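/- **Setup.** Let $\mathfrak g$ be a simple Lie algebra with Dynkin vertex set $I$, Cartan matrix $(c_{ij})$ and symmetrizers $d_i\in\{1,2,3\}$ (equal to $1$ for short roots), $d_ic_{ij}=d_jc_{ji}$; put $q_i=q^{d_i}\in\mathbb C(q)$. Write $i-j$ if $i\ne j$ and $c_{ij}\neq 0$, and fix an orientation $j\to i$ of each edge $i-j$. Fix $a_i\in\mathbb N$ $(i\in I)$, a sequence $(\omega_{i_1},\dots,\omega_{i_N})$ of fundamental coweights with sum $\lambda$, parameters $\mathsf z_1,\dots,\mathsf z_N\in\mathbb C^\times$, and let $\mu$ be the coweight with $\lambda-\mu=\sum_i a_i\alpha_i$ ($\alpha_i$ the simple coroots); its coordinates are $b_i=\#\{s: i_s=i\}-\sum_j c_{ji}a_j$. *Quantum algebras.* $U_q^\mu$ is the $\mathbb C(q)$-algebra generated by $e_{i,r},f_{i,r}$ $(r\in\mathbb Z)$, $\psi^+_{i,s}$ $(s\ge 0)$, $\psi^-_{i,-s}$ $(s\ge -b_i)$ and inverses of $\psi^+_{i,0},\psi^-_{i,b_i}$, with the following relations for the series $e_i(z)=\sum_r e_{i,r}z^{-r}$,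 $f_i(z)=\sum_r f_{i,r}z^{-r}$, $\psi_i^\pm(z)=\sum_r\psi^\pm_{i,\pm r}z^{\mp r}$: all $\psi$'s commute; $(z-q_i^{c_{ij}}w)x_i(z)e_j(w)=(q_i^{c_{ij}}z-w)e_j(w)x_i(z)$ for $x_i=e_i,\psi_i^\pm$; $(q_i^{c_{ij}}z-w)x_i(z)f_j(w)=(z-q_i^{c_{ij}}w)f_j(w)x_i(z)$ for $x_i=f_i,\psi_i^\pm$; $[e_i(z),f_j(w)]=\frac{\delta_{ij}}{q_i-q_i^{-1}}\delta(z/w)(\psi_i^+(z)-\psi_i^-(z))$ with $\delta(z)=\sum_{r\in\mathbb Z} z^r$; and the Serre relations $\mathrm{Sym}_{z_1,\dots,z_n}\sum_{r=0}^{n}(-1)^r\binom{n}{r}_{q_i}x_i(z_1)\cdots x_i(z_r)x_j(w)x_i(z_{r+1})\cdots x_i(z_n)=0$ with $n=1-c_{ij}$, for $i\neq j$ and $x=e,f$. Let $U_q^{\mu,>}$, $U_q^{\mu,<}$ be the subalgebras generated by the $e_{i,r}$, resp. the $f_{i,r}$, and let $U_q^>(L\mathfrak g)$, $U_q^<(L\mathfrak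 g)$ be the algebras with generators $e_{i,r}$, resp. $f_{i,r}$, and the quadratic and Serre relations among them. *Shuffle algebras.* For $k\in\mathbb N^I$ let $\mathbb S_k$ be the space of rational functions $f/\prod_{i-j}\prod_{r\le k_i,\,s\le k_j}(x_{i,r}-x_{j,s})$ (one factor for each unordered edge $i-j$ and each $r,s$), with $f$ a Laurent polynomial over $\mathbb C(q)$ in $\{x_{i,r}\}_{i\in I,\,1\le r\le k_i}$, symmetric in each group of variables. With $\zeta_{ij}(z/w)=\frac{z-q_i^{-c_{ij}}w}{z-w}$, the shuffle product of $F\in\mathbb S_k$, $G\in\mathbb S_l$ is $$F\star G=\prod_i\frac1{k_i!\,l_i!}\,\mathrm{Sym}\Big(F(\{x_{i,r}\}_{r\le k_i})\,G(\{x_{i,r}\}_{k_i<r\le k_i+l_i})\prod_{i,i'\in I}\prod_{r\le k_i,\ k_{i'}<r'\le k_{i'}+l_{i'}}\zeta_{ii'}(x_{i,r}/x_{i',r'})\Big),$$ $\mathrm{Sym}$ being the sum over $\prod_i S(k_i+l_i)$. Put $\mathbb S^{(\mathfrak g)}=\bigoplus_k\mathbb S_k$, and let $S^{(\mathfrak g)}\subset\mathbb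 S^{(\mathfrak g)}$ be the graded subspace of those elements whose numerators $f$ vanish at $(x_{i,1},\dots,x_{i,1-c_{ij}})=(w,wq_i^2,\dots,wq_i^{-2c_{ij}})$, $x_{j,1}=wq_i^{-c_{ij}}$, for all edges $i-j$ (in both orders). *Difference operators.* Let $\hat{\mathcal A}^q$ be the $\mathbb C(q)$-algebra generated by $D_{i,r}^{\pm1},\mathsf w_{i,r}^{\pm1/2}$ $(i\in I,\ 1\le r\le a_i)$, where the $D$'s commute, the $\mathsf w^{1/2}$'s commute, and $D_{i,r}\mathsf w_{j,s}^{1/2}=q_i^{\delta_{ij}\delta_{rs}}\mathsf w_{j,s}^{1/2}D_{i,r}$. Let $\tilde{\mathcal A}^q\subset\tilde{\mathcal A}^{q,\prime}$ be its localizations at all $\mathsf w_{i,r}-q_i^m\mathsf w_{i,s}$ ($r\ne s$, $m\in\mathbb Z$), respectively at all $\mathsf w_{i,r}-q_i^m\mathsf w_{j,s}$ ($(i,r)\ne(j,s)$, $m\in\mathbb Z$). Put $\mathsf Z_i(z)=\prod_{s:\,i_s=i}(1-q_i\mathsf z_s/z)$, $W_i(z)=\prod_{r}(1-\mathsf w_{i,r}/z)$,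 $W_{i,r}(z)=\prod_{s\ne r}(1-\mathsf w_{i,s}/z)$, $$Y_{i,r}(z)=\frac{1}{q_i-q_i^{-1}}\prod_{t}\mathsf w_{i,t}\prod_{j\to i}\prod_t\mathsf w_{j,t}^{c_{ji}/2}\cdot\frac{\mathsf Z_i(z)\prod_{j\to i}\prod_{p=1}^{-c_{ji}}W_j(zq_j^{-c_{ji}-2p})}{W_{i,r}(z)},$$ $$Y'_{i,r}(z)=\frac{1}{1-q_i^2}\prod_{j\leftarrow i}\prod_t\mathsf w_{j,t}^{c_{ji}/2}\cdot\frac{\prod_{j\leftarrow i}\prod_{p=1}^{-c_{ji}}W_j(zq_j^{-c_{ji}-2p})}{W_{i,r}(zq_i^{-2})}.$$ *GKLO homomorphism.* There is a (necessarily unique) algebra homomorphism $\tilde\Phi:U_q^\mu\to\tilde{\mathcal A}^q$ with $$e_i(z)\mapsto\frac{-q_i}{1-q_i^2}\prod_t\mathsf w_{i,t}\prod_{j\to i}\prod_t\mathsf w_{j,t}^{c_{ji}/2}\sum_{r=1}^{a_i}\delta\Big(\frac{\mathsf w_{i,r}}z\Big)\frac{\mathsf Z_i(\mathsf w_{i,r})}{W_{i,r}(\mathsf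 w_{i,r})}\prod_{j\to i}\prod_{p=1}^{-c_{ji}}W_j(q_j^{-c_{ji}-2p}z)D_{i,r}^{-1},$$ $$f_i(z)\mapsto\frac{1}{1-q_i^2}\prod_{j\leftarrow i}\prod_t\mathsf w_{j,t}^{c_{ji}/2}\sum_{r=1}^{a_i}\delta\Big(\frac{q_i^2\mathsf w_{i,r}}z\Big)\frac{1}{W_{i,r}(\mathsf w_{i,r})}\prod_{j\leftarrow i}\prod_{p=1}^{-c_{ji}}W_j(q_j^{-c_{ji}-2p}z)D_{i,r},$$ $$\psi_i^\pm(z)\mapsto\prod_t\mathsf w_{i,t}\prod_{j-i}\prod_t\mathsf w_{j,t}^{c_{ji}/2}\Big(\frac{\mathsf Z_i(z)}{W_i(z)W_i(q_i^{-2}z)}\prod_{j-i}\prod_{p=1}^{-c_{ji}}W_j(q_j^{-c_{ji}-2p}z)\Big)^{\pm},$$ where $(\cdot)^\pm$ denotes the expansion in $z^{\mp1}$. **Theorem.** $\mathbb S^{(\mathfrak g)}$ and $S^{(\mathfrak g)}$ are associative unital algebras under $\star$, and the following holds. (a) The assignment sending $E\in\mathbb S_k$ to $$\prod_{i}q_i^{k_i-k_i^2}\sum_{\substack{m^{(i)}_r\in\mathbb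 N\\ \sum_{r=1}^{a_i}m^{(i)}_r=k_i\ \forall i}}\Big\{\prod_{i,r}\prod_{p\le m^{(i)}_r}Y_{i,r}(x_{i,r,p})\cdot E\big(\{x_{i,r,p}\}_{p\le m^{(i)}_r}\big)\prod_{i,r}\prod_{p_1<p_2\le m^{(i)}_r}\zeta_{ii}^{-1}\Big(\frac{x_{i,r,p_1}}{x_{i,r,p_2}}\Big)$$ $$\times\prod_i\prod_{r_1\ne r_2}\prod_{p_1\le m^{(i)}_{r_1},\,p_2\le m^{(i)}_{r_2}}\zeta_{ii}^{-1}\Big(\frac{x_{i,r_1,p_1}}{x_{i,r_2,p_2}}\Big)\prod_{j\to i}\prod_{r_1\le a_i,\,r_2\le a_j}\prod_{p_1\le m^{(i)}_{r_1},\,p_2\le m^{(j)}_{r_2}}\zeta_{ij}^{-1}\Big(\frac{x_{i,r_1,p_1}}{x_{j,r_2,p_2}}\Big)\cdot\prod_{i,r}D_{i,r}^{-m^{(i)}_r}\Big\},$$ where $x_{i,r,p}=\mathsf w_{i,r}q_i^{-2(p-1)}$, defines an algebra homomorphism $\hat\Phi:\mathbb S^{(\mathfrak g)}\to\tilde{\mathcal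 A}^{q,\prime}$, and $\hat\Phi(S^{(\mathfrak g)})\subset\tilde{\mathcal A}^q$. There is an algebra homomorphism $\Upsilon:U_q^>(L\mathfrak g)\to S^{(\mathfrak g)}$, $e_{i,r}\mapsto x_{i,1}^r$; it factors through the canonical surjection $U_q^>(L\mathfrak g)\to U_q^{\mu,>}$, $e_{i,r}\mapsto e_{i,r}$, and the composition $U_q^{\mu,>}\to S^{(\mathfrak g)}\xrightarrow{\hat\Phi}\tilde{\mathcal A}^q$ coincides with the restriction of $\tilde\Phi$ to $U_q^{\mu,>}$. (b) The assignment sending $F\in\mathbb S_k$ to $$\sum_{\substack{m^{(i)}_r\in\mathbb N\\ \sum_{r=1}^{a_i}m^{(i)}_r=k_i\ \forall i}}\Big\{\prod_{i,r}\prod_{p\le m^{(i)}_r}Y'_{i,r}(y_{i,r,p})\cdot F\big(\{y_{i,r,p}\}_{p\le m^{(i)}_r}\big)\prod_{i,r}\prod_{p_1<p_2\le m^{(i)}_r}\zeta_{ii}^{-1}\Big(\frac{y_{i,r,p_2}}{y_{i,r,p_1}}\Big)$$ $$\times\prod_i\prod_{r_1\ne r_2}\prod_{p_1\le m^{(i)}_{r_1},\,p_2\le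 m^{(i)}_{r_2}}q_i^{-1}\zeta_{ii}^{-1}\Big(\frac{y_{i,r_2,p_2}}{y_{i,r_1,p_1}}\Big)\prod_{j\leftarrow i}\prod_{r_1\le a_i,\,r_2\le a_j}\prod_{p_1\le m^{(i)}_{r_1},\,p_2\le m^{(j)}_{r_2}}\zeta_{ji}^{-1}\Big(\frac{y_{j,r_2,p_2}}{y_{i,r_1,p_1}}\Big)\cdot\prod_{i,r}D_{i,r}^{m^{(i)}_r}\Big\},$$ where $y_{i,r,p}=\mathsf w_{i,r}q_i^{2p}$, defines an algebra homomorphism $\hat\Phi:\mathbb S^{(\mathfrak g),\mathrm{op}}\to\tilde{\mathcal A}^{q,\prime}$, and $\hat\Phi(S^{(\mathfrak g),\mathrm{op}})\subset\tilde{\mathcal A}^q$. There is an algebra homomorphism $\Upsilon:U_q^<(L\mathfrak g)\to S^{(\mathfrak g),\mathrm{op}}$, $f_{i,r}\mapsto x_{i,1}^r$; it factors through the canonical surjection $U_q^<(L\mathfrak g)\to U_q^{\mu,<}$, and the composition $U_q^{\mu,<}\to S^{(\mathfrak g),\mathrm{op}}\xrightarrow{\hat\Phi}\tilde{\mathcal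 A}^q$ coincides with the restriction of $\tilde\Phi$ to $U_q^{\mu,<}$. -/

import Mathlib

open scoped DirectSum

namespace ShuffleGKLO

noncomputable section

/-! ### The ground field and the Cartan datum -/

/-- The ground field `ℂ(q)`. -/
abbrev Fq : Type := RatFunc ℂ

/-- The indeterminate `q ∈ ℂ(q)`. -/
def q : Fq := RatFunc.X

/-- The Cartan matrix `c` of a simple Lie algebra (an indecomposable Cartan matrix of finite type),
together with the symmetrizing integers `d i = (αᵢ^∨, αᵢ^∨) / 2`, normalized so that the short
ones have `d i = 1`; automatically `d i ∈ {1, 2, 3}`. The set `I` is the set of vertices of the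
Dynkin diagram. -/
structure CartanDatum (I : Type*) [Fintype I] where
  c : I → I → ℤ
  d : I → ℕ
  c_diag : ∀ i, c i i = 2
  c_offDiag : ∀ i j, i ≠ j → c i j ≤ 0
  d_pos : ∀ i, 0 < d i
  symm : ∀ i j, (d i : ℤ) * c i j = (d j : ℤ) * c j i
  posDef : ∀ x : I → ℝ, x ≠ 0 → 0 < ∑ i, ∑ j, ((d i : ℝ) * (c i j : ℝ)) * x i * x j
  connected : (SimpleGraph.fromRel fun i j => c i j ≠ 0).Connected
  exists_short : ∃ i, d i = 1

/-- An orientation of the graph `Dyn(𝔤)` (the Dynkin diagram with multiple edges replaced by simple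
ones): `O.arr j i` means `j → i`. -/
structure DynOrientation {I : Type*} [Fintype I] (C : CartanDatum I) where
  arr : I → I → Prop
  adj_iff : ∀ i j, i ≠ j → (C.c i j ≠ 0 ↔ arr i j ∨ arr j i)
  asymm : ∀ i j, arr i j → ¬ arr j i

/-- `q_i = q ^ d_i`. -/
def qi {I : Type*} [Fintype I] (C : CartanDatum I) (i : I) : Fq := q ^ C.d i

/-- `[m]_v = (v ^ m - v ^ (-m)) / (v - v⁻¹)`. -/
def qnum (v : Fq) (m : ℕ) : Fq := (v ^ m - v⁻¹ ^ m) / (v - v⁻¹)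

/-- The `v`-binomial coefficient `[a-b+1]_v ⋯ [a]_v / ([1]_v ⋯ [b]_v)`, used for `b ≤ a` only. -/
def qbinom (v : Fq) (a b : ℕ) : Fq :=
  (∏ t ∈ Finset.range b, qnum v (a - b + 1 + t)) / ∏ t ∈ Finset.range b, qnum v (1 + t)

/-! ### Mode expansions of the defining relations

A generating series is `x(z) = ∑ x_r z^{-r}`; every relation below is the coefficient of
`z^{-r} w^{-s}` of the corresponding relation between series. -/

section Relations

variable {A : Type*} [Ring A] [Algebra Fq A]

/-- The coefficient of `z^{-r} w^{-s}` in
`(z - κ w) x(z) y(w) - (κ z - w) y(w) x(z)`. -/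
def posQuad (κ : Fq) (x y : ℤ → A) (r s : ℤ) : A :=
  (x (r + 1) * y s - κ • (x r * y (s + 1))) - (κ • (y s * x (r + 1)) - y (s + 1) * x r)

/-- The coefficient of `z^{-r} w^{-s}` in
`(κ z - w) x(z) y(w) - (z - κ w) y(w) x(z)`. -/
def negQuad (κ : Fq) (x y : ℤ → A) (r s : ℤ) : A :=
  (κ • (x (r + 1) * y s) - x r * y (s + 1)) - (y s * x (r + 1) - κ • (y (s + 1) * x r))

/-- The coefficient of `z_1^{-r_1} ⋯ z_n^{-r_n} w^{-s}` in
`Sym ∑_k (-1)^k [n choose k]_v x(z_1) ⋯ x(z_k) y(w) x(z_{k+1}) ⋯ x(z_n)`. -/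
def serre (v : Fq) (n : ℕ) (x y : ℤ → A) (r : Fin n → ℤ) (s : ℤ) : A :=
  ∑ σ : Equiv.Perm (Fin n), ∑ k ∈ Finset.range (n + 1),
    ((-1) ^ k * qbinom v n k) •
      (((List.ofFn fun t => x (r (σ t))).take k).prod * y s *
        ((List.ofFn fun t => x (r (σ t))).drop k).prod)

end Relations

section QuantumAlgebras

variable {I : Type*} [Fintype I]

/-! ### The shifted quantum affine algebra -/

/-- Generators of `U_q^μ`. With `b i = αᵢ^∨(μ)`: `psi true i n` is `ψ⁺_{i,n}`, `psi false i n` is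
`ψ⁻_{i, b i - n}`, and `psiInv true i`, `psiInv false i` are the inverses of
`ψ⁺_{i,0}` and `ψ⁻_{i, b i}`. -/
inductive UGen (I : Type*)
  | e (i : I) (r : ℤ)
  | f (i : I) (r : ℤ)
  | psi (ε : Bool) (i : I) (n : ℕ)
  | psiInv (ε : Bool) (i : I)

/-- The coefficient of `z^{-t}` of `ψ^ε_i(z)`, for all integers `t`:
`ψ⁺_i(z) = ∑_{t ≥ 0} ψ⁺_{i,t} z^{-t}` and `ψ⁻_i(z) = ∑_{t ≤ b_i} ψ⁻_{i,t} z^{-t}`. -/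
def psiMode {A : Type*} [Zero A] (b : I → ℤ) (ψ : Bool → I → ℕ → A) (ε : Bool) (i : I) (t : ℤ) : A :=
  match ε with
  | true => if 0 ≤ t then ψ true i t.toNat else 0
  | false => if t ≤ b i then ψ false i (b i - t).toNat else 0

/-- The free generators `e_{i,r}`. -/
def fe (i : I) (r : ℤ) : FreeAlgebra Fq (UGen I) := FreeAlgebra.ι Fq (.e i r)
/-- The free generators `f_{i,r}`. -/
def ff (i : I) (r : ℤ) : FreeAlgebra Fq (UGen I) := FreeAlgebra.ι Fq (.f i r)
/-- The free generators of type `ψ`. -/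
def fpsi (ε : Bool) (i : I) (n : ℕ) : FreeAlgebra Fq (UGen I) :=
  FreeAlgebra.ι Fq (.psi ε i n)
/-- The free inverses of the leading `ψ`'s. -/
def fpsiInv (ε : Bool) (i : I) : FreeAlgebra Fq (UGen I) :=
  FreeAlgebra.ι Fq (.psiInv ε i)

/-- The defining relations of `U_q^μ = U^{sc}_{0,μ}`, with `b i = αᵢ^∨(μ)`. -/
inductive URel (C : CartanDatum I) (b : I → ℤ) :
    FreeAlgebra Fq (UGen I) → FreeAlgebra Fq (UGen I) → Prop
  | psi_comm (ε ε' : Bool) (i j : I) (m n : ℕ) :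
      URel C b (fpsi ε i m * fpsi ε' j n) (fpsi ε' j n * fpsi ε i m)
  | psi_mul_inv (ε : Bool) (i : I) : URel C b (fpsi ε i 0 * fpsiInv ε i) 1
  | inv_mul_psi (ε : Bool) (i : I) : URel C b (fpsiInv ε i * fpsi ε i 0) 1
  | ee (i j : I) (r s : ℤ) : URel C b (posQuad (qi C i ^ C.c i j) (fe i) (fe j) r s) 0
  | ff (i j : I) (r s : ℤ) : URel C b (negQuad (qi C i ^ C.c i j) (ff i) (ff j) r s) 0
  | psi_e (ε : Bool) (i j : I) (r s : ℤ) :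
      URel C b (posQuad (qi C i ^ C.c i j) (psiMode b fpsi ε i) (fe j) r s) 0
  | psi_f (ε : Bool) (i j : I) (r s : ℤ) :
      URel C b (negQuad (qi C i ^ C.c i j) (psiMode b fpsi ε i) (ff j) r s) 0
  | ef_same (i : I) (r s : ℤ) :
      URel C b (fe i r * ShuffleGKLO.ff i s - ShuffleGKLO.ff i s * fe i r)
        ((qi C i - (qi C i)⁻¹)⁻¹ •
          (psiMode b fpsi true i (r + s) - psiMode b fpsi false i (r + s)))
  | ef_diff (i j : I) (h : i ≠ j) (r s : ℤ) :
      URel C b (fe i r * ShuffleGKLO.ff j s - ShuffleGKLO.ff j s * fe i r) 0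
  | serre_e (i j : I) (h : i ≠ j) (r : Fin (1 - C.c i j).toNat → ℤ) (s : ℤ) :
      URel C b (serre (qi C i) (1 - C.c i j).toNat (fe i) (fe j) r s) 0
  | serre_f (i j : I) (h : i ≠ j) (r : Fin (1 - C.c i j).toNat → ℤ) (s : ℤ) :
      URel C b (serre (qi C i) (1 - C.c i j).toNat (ShuffleGKLO.ff i) (ShuffleGKLO.ff j) r s) 0

/-- The (simply-connected) shifted quantum affine algebra `U_q^μ`, with `b i = αᵢ^∨(μ)`. -/
abbrev U (C : CartanDatum I) (b : I → ℤ) := RingQuot (URel C b)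

/-- The image in `U_q^μ` of an element of the free algebra. -/
abbrev toU (C : CartanDatum I) (b : I → ℤ) : FreeAlgebra Fq (UGen I) →ₐ[Fq] U C b :=
  RingQuot.mkAlgHom Fq (URel C b)

/-- The element `e_{i,r}` of `U_q^μ`. -/
def Ue (C : CartanDatum I) (b : I → ℤ) (i : I) (r : ℤ) : U C b := toU C b (fe i r)
/-- The element `f_{i,r}` of `U_q^μ`. -/
def Uf (C : CartanDatum I) (b : I → ℤ) (i : I) (r : ℤ) : U C b := toU C b (ff i r)
/-- The element `ψ^ε_{i,t}` of `U_q^μ` (zero when the mode `t` does not occur in `ψ^ε_i(z)`). -/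
def Upsi (C : CartanDatum I) (b : I → ℤ) (ε : Bool) (i : I) (t : ℤ) : U C b :=
  toU C b (psiMode b fpsi ε i t)

/-- The subalgebra `U_q^{μ,>}` of `U_q^μ` generated by the `e_{i,r}`. -/
def UposSub (C : CartanDatum I) (b : I → ℤ) : Subalgebra Fq (U C b) :=
  Algebra.adjoin Fq (Set.range fun p : I × ℤ => Ue C b p.1 p.2)

/-- The subalgebra `U_q^{μ,<}` of `U_q^μ` generated by the `f_{i,r}`. -/
def UnegSub (C : CartanDatum I) (b : I → ℤ) : Subalgebra Fq (U C b) :=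
  Algebra.adjoin Fq (Set.range fun p : I × ℤ => Uf C b p.1 p.2)

/-! ### The positive and negative halves of the quantum loop algebra -/

/-- The free generators of the halves `U_q^>(L𝔤)` and `U_q^<(L𝔤)`. -/
def hgen (i : I) (r : ℤ) : FreeAlgebra Fq (I × ℤ) := FreeAlgebra.ι Fq (i, r)

/-- The defining relations of `U_q^>(L𝔤)`. -/
inductive PosRel (C : CartanDatum I) : FreeAlgebra Fq (I × ℤ) → FreeAlgebra Fq (I × ℤ) → Prop
  | ee (i j : I) (r s : ℤ) : PosRel C (posQuad (qi C i ^ C.c i j) (hgen i) (hgen j) r s) 0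
  | serre_e (i j : I) (h : i ≠ j) (r : Fin (1 - C.c i j).toNat → ℤ) (s : ℤ) :
      PosRel C (serre (qi C i) (1 - C.c i j).toNat (hgen i) (hgen j) r s) 0

/-- The defining relations of `U_q^<(L𝔤)`. -/
inductive NegRel (C : CartanDatum I) : FreeAlgebra Fq (I × ℤ) → FreeAlgebra Fq (I × ℤ) → Prop
  | ff (i j : I) (r s : ℤ) : NegRel C (negQuad (qi C i ^ C.c i j) (hgen i) (hgen j) r s) 0
  | serre_f (i j : I) (h : i ≠ j) (r : Fin (1 - C.c i j).toNat → ℤ) (s : ℤ) :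
      NegRel C (serre (qi C i) (1 - C.c i j).toNat (hgen i) (hgen j) r s) 0

/-- The positive half `U_q^>(L𝔤)`. -/
abbrev Upos (C : CartanDatum I) := RingQuot (PosRel C)
/-- The negative half `U_q^<(L𝔤)`. -/
abbrev Uneg (C : CartanDatum I) := RingQuot (NegRel C)

/-- The generator `e_{i,r}` of `U_q^>(L𝔤)`. -/
def pe (C : CartanDatum I) (i : I) (r : ℤ) : Upos C := RingQuot.mkAlgHom Fq (PosRel C) (hgen i r)
/-- The generator `f_{i,r}` of `U_q^<(L𝔤)`. -/
def nf (C : CartanDatum I) (i : I) (r : ℤ) : Uneg C := RingQuot.mkAlgHom Fq (NegRel C) (hgen i r)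

theorem map_posQuad {A B : Type*} [Ring A] [Algebra Fq A] [Ring B] [Algebra Fq B]
    (φ : A →ₐ[Fq] B) (κ : Fq) (x y : ℤ → A) (r s : ℤ) :
    φ (posQuad κ x y r s) = posQuad κ (fun t => φ (x t)) (fun t => φ (y t)) r s := by
  simp [posQuad]

theorem map_negQuad {A B : Type*} [Ring A] [Algebra Fq A] [Ring B] [Algebra Fq B]
    (φ : A →ₐ[Fq] B) (κ : Fq) (x y : ℤ → A) (r s : ℤ) :
    φ (negQuad κ x y r s) = negQuad κ (fun t => φ (x t)) (fun t => φ (y t)) r s := by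
  simp [negQuad]

theorem map_serre {A B : Type*} [Ring A] [Algebra Fq A] [Ring B] [Algebra Fq B]
    (φ : A →ₐ[Fq] B) (v : Fq) (n : ℕ) (x y : ℤ → A) (r : Fin n → ℤ) (s : ℤ) :
    φ (serre v n x y r s) = serre v n (fun t => φ (x t)) (fun t => φ (y t)) r s := by
  simp only [serre, map_sum, map_smul, map_mul, map_list_prod, List.map_take, List.map_drop,
    List.map_ofFn, Function.comp_def]

/-- The element `e_{i,r}` of `U_q^{μ,>}`. -/
def UposSub.gen (C : CartanDatum I) (b : I → ℤ) (i : I) (r : ℤ) : UposSub C b :=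
  ⟨Ue C b i r, Algebra.subset_adjoin ⟨(i, r), rfl⟩⟩

/-- The canonical homomorphism `U_q^>(L𝔤) → U_q^{μ,>}`, `e_{i,r} ↦ e_{i,r}`. -/
def posToU (C : CartanDatum I) (b : I → ℤ) : Upos C →ₐ[Fq] UposSub C b :=
  RingQuot.liftAlgHom Fq ⟨FreeAlgebra.lift Fq fun p : I × ℤ => UposSub.gen C b p.1 p.2, by
    intro x y h
    cases h with
    | ee i j r s =>
      have := RingQuot.mkAlgHom_rel Fq (URel.ee (C := C) (b := b) i j r s)
      rw [map_posQuad, map_zero] at this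
      refine (map_posQuad (B := UposSub C b) _ _ _ _ _ _).trans (Eq.trans ?_ (map_zero _).symm)
      apply Subtype.ext
      refine (map_posQuad (A := UposSub C b) (B := U C b) (UposSub C b).val (qi C i ^ C.c i j)
        (fun t => FreeAlgebra.lift Fq (fun p : I × ℤ => UposSub.gen C b p.1 p.2) (hgen i t))
        (fun t => FreeAlgebra.lift Fq (fun p : I × ℤ => UposSub.gen C b p.1 p.2) (hgen j t)) r s).trans ?_
      simpa [hgen, UposSub.gen, Ue] using this
    | serre_e i j h r s =>
      have := RingQuot.mkAlgHom_rel Fq (URel.serre_e (C := C) (b := b) i j h r s)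
      rw [map_serre, map_zero] at this
      refine (map_serre (B := UposSub C b) _ _ _ _ _ _ _).trans (Eq.trans ?_ (map_zero _).symm)
      apply Subtype.ext
      refine (map_serre (A := UposSub C b) (B := U C b) (UposSub C b).val _ _ _ _ _ _).trans ?_
      simpa [hgen, UposSub.gen, Ue] using this⟩

/-- The element `f_{i,r}` of `U_q^{μ,<}`. -/
def UnegSub.gen (C : CartanDatum I) (b : I → ℤ) (i : I) (r : ℤ) : UnegSub C b :=
  ⟨Uf C b i r, Algebra.subset_adjoin ⟨(i, r), rfl⟩⟩

/-- The canonical homomorphism `U_q^<(L𝔤) → U_q^{μ,<}`, `f_{i,r} ↦ f_{i,r}`. -/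
def negToU (C : CartanDatum I) (b : I → ℤ) : Uneg C →ₐ[Fq] UnegSub C b :=
  RingQuot.liftAlgHom Fq ⟨FreeAlgebra.lift Fq fun p : I × ℤ => UnegSub.gen C b p.1 p.2, by
    intro x y h
    cases h with
    | ff i j r s =>
      have := RingQuot.mkAlgHom_rel Fq (URel.ff (C := C) (b := b) i j r s)
      rw [map_negQuad, map_zero] at this
      refine (map_negQuad (B := UnegSub C b) _ _ _ _ _ _).trans (Eq.trans ?_ (map_zero _).symm)
      apply Subtype.ext
      refine (map_negQuad (A := UnegSub C b) (B := U C b) (UnegSub C b).val (qi C i ^ C.c i j)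
        (fun t => FreeAlgebra.lift Fq (fun p : I × ℤ => UnegSub.gen C b p.1 p.2) (hgen i t))
        (fun t => FreeAlgebra.lift Fq (fun p : I × ℤ => UnegSub.gen C b p.1 p.2) (hgen j t)) r s).trans ?_
      simpa [hgen, UnegSub.gen, Uf] using this
    | serre_f i j h r s =>
      have := RingQuot.mkAlgHom_rel Fq (URel.serre_f (C := C) (b := b) i j h r s)
      rw [map_serre, map_zero] at this
      refine (map_serre (B := UnegSub C b) _ _ _ _ _ _ _).trans (Eq.trans ?_ (map_zero _).symm)
      apply Subtype.ext
      refine (map_serre (A := UnegSub C b) (B := U C b) (UnegSub C b).val _ _ _ _ _ _).trans ?_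
      simpa [hgen, UnegSub.gen, Uf] using this⟩

end QuantumAlgebras

/-! ### Rational functions in coloured variables -/

section RationalFunctions

/-- Indices `(i, r)` of variables `x_{i,r}`, `1 ≤ r ≤ k_i` (with `r` counted from `0`). -/
abbrev V {I : Type*} (k : I → ℕ) := Σ i, Fin (k i)

/-- The field of rational functions over `ℂ(q)` in the variables indexed by `σ`. -/
def Rat (σ : Type*) : Type _ := FractionRing (MvPolynomial σ Fq)

instance (σ : Type*) : Field (Rat σ) := inferInstanceAs (Field (FractionRing (MvPolynomial σ Fq)))
instance (σ : Type*) : Algebra (MvPolynomial σ Fq) (Rat σ) :=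
  inferInstanceAs (Algebra (MvPolynomial σ Fq) (FractionRing (MvPolynomial σ Fq)))
instance (σ : Type*) : IsFractionRing (MvPolynomial σ Fq) (Rat σ) :=
  inferInstanceAs (IsFractionRing (MvPolynomial σ Fq) (FractionRing (MvPolynomial σ Fq)))
instance (σ : Type*) : Algebra Fq (Rat σ) :=
  ((algebraMap (MvPolynomial σ Fq) (Rat σ)).comp MvPolynomial.C).toAlgebra
instance (σ : Type*) : IsScalarTower Fq (MvPolynomial σ Fq) (Rat σ) :=
  IsScalarTower.of_algebraMap_eq fun _ => rfl

/-- Rational functions over `ℂ(q)` in the variables `x_{i,r}`, `1 ≤ r ≤ k_i`. -/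
abbrev K {I : Type*} (k : I → ℕ) := Rat (V k)

/-- The variable `x_{i,r}`. -/
def x {I : Type*} {k : I → ℕ} (v : V k) : K k := algebraMap (MvPolynomial (V k) Fq) (K k) (.X v)

section Evaluation

variable {σ E : Type*} [Field E] [Algebra Fq E]

/-- The value of a rational function `F` at a point `p`, computed from the reduced fraction of `F`
(and `0` when `F` has a pole at `p`). -/
def evalRat (p : σ → E) (F : Rat σ) : E :=
  MvPolynomial.aeval p (IsFractionRing.num (MvPolynomial σ Fq) F) /
    MvPolynomial.aeval p (IsFractionRing.den (MvPolynomial σ Fq) F : MvPolynomial σ Fq)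

/-- Any fraction with denominator not vanishing at `p` computes the value at `p`. -/
theorem evalRat_eq (p : σ → E) (F : Rat σ) (n d : MvPolynomial σ Fq)
    (hd : MvPolynomial.aeval p d ≠ 0)
    (h : F * algebraMap _ (Rat σ) d = algebraMap _ _ n) :
    MvPolynomial.aeval p (IsFractionRing.den (MvPolynomial σ Fq) F : MvPolynomial σ Fq) ≠ 0 ∧
      evalRat p F = MvPolynomial.aeval p n / MvPolynomial.aeval p d := by
  set N := IsFractionRing.num (MvPolynomial σ Fq) F with hN
  set D : MvPolynomial σ Fq := (IsFractionRing.den (MvPolynomial σ Fq) F : MvPolynomial σ Fq) with hD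
  have hD0 : algebraMap (MvPolynomial σ Fq) (Rat σ) D ≠ 0 :=
    IsFractionRing.to_map_ne_zero_of_mem_nonZeroDivisors (IsFractionRing.den (MvPolynomial σ Fq) F).2
  have hF : algebraMap (MvPolynomial σ Fq) (Rat σ) N /
      algebraMap (MvPolynomial σ Fq) (Rat σ) D = F :=
    IsFractionRing.mk'_num_den' (MvPolynomial σ Fq) F
  have key : N * d = n * D := by
    apply IsFractionRing.injective (MvPolynomial σ Fq) (Rat σ)
    rw [map_mul, map_mul, ← h, ← hF]
    field_simp
  have hdvd : D ∣ d := by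
    have h1 : D ∣ N * d := ⟨n, by rw [key, mul_comm]⟩
    exact (IsFractionRing.num_den_reduced (MvPolynomial σ Fq) F).symm.dvd_of_dvd_mul_left h1
  have hDne : MvPolynomial.aeval p D ≠ 0 := by
    obtain ⟨t, rfl⟩ := hdvd
    intro h0
    exact hd (by rw [map_mul, h0, zero_mul])
  refine ⟨hDne, ?_⟩
  rw [evalRat, ← hN, ← hD, div_eq_div_iff hDne hd, ← map_mul, ← map_mul, key]

/-- The rational functions without pole at `p`. -/
def regularAt (p : σ → E) : Subalgebra Fq (Rat σ) where
  carrier := {F | MvPolynomial.aeval p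
    (IsFractionRing.den (MvPolynomial σ Fq) F : MvPolynomial σ Fq) ≠ 0}
  mul_mem' {F G} hF hG := by
    refine (evalRat_eq p _ (IsFractionRing.num (MvPolynomial σ Fq) F *
      IsFractionRing.num (MvPolynomial σ Fq) G) (IsFractionRing.den (MvPolynomial σ Fq) F *
      IsFractionRing.den (MvPolynomial σ Fq) G) ?_ ?_).1
    · rw [map_mul]; exact mul_ne_zero hF hG
    · rw [map_mul, map_mul, ← (IsFractionRing.num_mul_den_eq_num_iff_eq (x := F) (y := F)).2 rfl,
        ← (IsFractionRing.num_mul_den_eq_num_iff_eq (x := G) (y := G)).2 rfl]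
      ring
  add_mem' {F G} hF hG := by
    refine (evalRat_eq p _ (IsFractionRing.num (MvPolynomial σ Fq) F *
      IsFractionRing.den (MvPolynomial σ Fq) G + IsFractionRing.num (MvPolynomial σ Fq) G *
      IsFractionRing.den (MvPolynomial σ Fq) F) (IsFractionRing.den (MvPolynomial σ Fq) F *
      IsFractionRing.den (MvPolynomial σ Fq) G) ?_ ?_).1
    · rw [map_mul]; exact mul_ne_zero hF hG
    · rw [map_add, map_mul, map_mul, map_mul,
        ← (IsFractionRing.num_mul_den_eq_num_iff_eq (x := F) (y := F)).2 rfl,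
        ← (IsFractionRing.num_mul_den_eq_num_iff_eq (x := G) (y := G)).2 rfl]
      ring
  algebraMap_mem' c := by
    refine (evalRat_eq p _ (MvPolynomial.C c) 1 (by simp) ?_).1
    rw [map_one, mul_one, ← MvPolynomial.algebraMap_eq, ← IsScalarTower.algebraMap_apply]

theorem evalRat_add (p : σ → E) {F G : Rat σ}
    (hF : F ∈ regularAt p) (hG : G ∈ regularAt p) :
    evalRat p (F + G) = evalRat p F + evalRat p G := by
  have hF' : MvPolynomial.aeval p
    (IsFractionRing.den (MvPolynomial σ Fq) F : MvPolynomial σ Fq) ≠ 0 := hF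
  have hG' : MvPolynomial.aeval p
    (IsFractionRing.den (MvPolynomial σ Fq) G : MvPolynomial σ Fq) ≠ 0 := hG
  rw [(evalRat_eq p (F + G) (IsFractionRing.num (MvPolynomial σ Fq) F *
      IsFractionRing.den (MvPolynomial σ Fq) G + IsFractionRing.num (MvPolynomial σ Fq) G *
      IsFractionRing.den (MvPolynomial σ Fq) F) (IsFractionRing.den (MvPolynomial σ Fq) F *
      IsFractionRing.den (MvPolynomial σ Fq) G) ?_ ?_).2]
  · simp only [map_add, map_mul, evalRat]
    field_simp
  · rw [map_mul]; exact mul_ne_zero hF hG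
  · rw [map_add, map_mul, map_mul, map_mul,
      ← (IsFractionRing.num_mul_den_eq_num_iff_eq (x := F) (y := F)).2 rfl,
      ← (IsFractionRing.num_mul_den_eq_num_iff_eq (x := G) (y := G)).2 rfl]
    ring

theorem evalRat_smul (p : σ → E) (c : Fq) {F : Rat σ}
    (hF : F ∈ regularAt p) : evalRat p (c • F) = c • evalRat p F := by
  have hF' : MvPolynomial.aeval p
    (IsFractionRing.den (MvPolynomial σ Fq) F : MvPolynomial σ Fq) ≠ 0 := hF
  rw [(evalRat_eq p (c • F) (c • IsFractionRing.num (MvPolynomial σ Fq) F)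
      (IsFractionRing.den (MvPolynomial σ Fq) F) hF' ?_).2]
  · simp only [map_smul, evalRat, smul_div_assoc]
  · rw [smul_mul_assoc, (IsFractionRing.num_mul_den_eq_num_iff_eq (x := F) (y := F)).2 rfl]
    simp only [Algebra.smul_def, map_mul]
    rw [← IsScalarTower.algebraMap_apply]

end Evaluation

variable {I : Type*}

/-- The substitution `x_v ↦ x_{g v}` for an injective map `g` of indices. -/
def relabel {k l : I → ℕ} (g : V k ↪ V l) : K k →ₐ[Fq] K l :=
  IsFractionRing.liftAlgHom
    (g := (IsScalarTower.toAlgHom Fq (MvPolynomial (V l) Fq) (K l)).comp (MvPolynomial.rename g))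
    ((IsFractionRing.injective (MvPolynomial (V l) Fq) (K l)).comp
      (MvPolynomial.rename_injective g g.injective))

/-- The permutation of indices given by an element of `S_k = ∏ S(k_i)`. -/
def permV {k : I → ℕ} (σ : ∀ i, Equiv.Perm (Fin (k i))) : V k ↪ V k :=
  (Equiv.sigmaCongrRight σ).toEmbedding

/-- The indices `(i, r)` with `r ≤ k_i`, among those with `r ≤ k_i + l_i`. -/
def leftV (k l : I → ℕ) : V k ↪ V (k + l) where
  toFun v := ⟨v.1, Fin.castAdd (l v.1) v.2⟩
  inj' := by
    rintro ⟨i, r⟩ ⟨j, s⟩ h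
    obtain rfl : i = j := congrArg Sigma.fst h
    simpa using h

/-- The indices `(i, r)` with `k_i < r ≤ k_i + l_i`. -/
def rightV (k l : I → ℕ) : V l ↪ V (k + l) where
  toFun v := ⟨v.1, Fin.natAdd (k v.1) v.2⟩
  inj' := by
    rintro ⟨i, r⟩ ⟨j, s⟩ h
    obtain rfl : i = j := congrArg Sigma.fst h
    simpa using h

/-- Laurent polynomials in the `x_{i,r}`. -/
def laurent (k : I → ℕ) : Subalgebra Fq (K k) :=
  Algebra.adjoin Fq (Set.range (x (k := k)) ∪ Set.range fun v : V k => (x v)⁻¹)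

/-- Laurent polynomials invariant under `S_k`. -/
def symLaurent (k : I → ℕ) : Submodule Fq (K k) where
  carrier := {f | f ∈ laurent k ∧ ∀ σ, relabel (permV σ) f = f}
  add_mem' hf hg := ⟨add_mem hf.1 hg.1, fun σ => by rw [map_add, hf.2, hg.2]⟩
  zero_mem' := ⟨zero_mem _, fun σ => map_zero _⟩
  smul_mem' c _ hf := ⟨Subalgebra.smul_mem _ hf.1 c, fun σ => by rw [map_smul, hf.2]⟩

theorem x_ne_zero {k : I → ℕ} (v : V k) : (x v : K k) ≠ 0 := by
  rw [x, Ne, map_eq_zero_iff _ (IsFractionRing.injective (MvPolynomial (V k) Fq) (K k))]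
  exact MvPolynomial.X_ne_zero v

theorem laurent_le_regularAt {k : I → ℕ} {E : Type*} [Field E] [Algebra Fq E] (p : V k → E)
    (hp : ∀ v, p v ≠ 0) : laurent k ≤ regularAt p := by
  refine Algebra.adjoin_le ?_
  rintro _ (⟨v, rfl⟩ | ⟨v, rfl⟩)
  · exact (evalRat_eq p _ (.X v) 1 (by simp) (by simp [x])).1
  · refine (evalRat_eq p _ 1 (.X v) (by simpa using hp v) ?_).1
    rw [map_one]
    exact inv_mul_cancel₀ (x_ne_zero v)

end RationalFunctions

/-! ### The shuffle algebras -/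

section Shuffle

variable {I : Type*} [Fintype I]

/-- `ζ_{ij}(z/w) = (z - q_i^{-c_{ij}} w) / (z - w)`. -/
def zeta (C : CartanDatum I) {E : Type*} [Field E] [Algebra Fq E] (i j : I) (z w : E) : E :=
  (z - algebraMap Fq E (qi C i ^ (-C.c i j)) * w) / (z - w)

open Classical in
/-- The product of `x_{i,r} - x_{j,s}` over the edges of the Dynkin diagram, each edge being taken
once (the orientation affects this product by a sign only). -/
def poleDen {C : CartanDatum I} (O : DynOrientation C) (k : I → ℕ) : K k :=
  ∏ i, ∏ j ∈ Finset.univ.filter (fun j => O.arr j i), ∏ r : Fin (k i), ∏ s : Fin (k j),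
    (x ⟨i, r⟩ - x ⟨j, s⟩)

/-- The component `𝕊_k` of the big shuffle algebra: all `f / poleDen` with `f` a multisymmetric
Laurent polynomial. -/
def bigComp {C : CartanDatum I} (O : DynOrientation C) (k : I → ℕ) : Submodule Fq (K k) :=
  (symLaurent k).comap (LinearMap.mulRight Fq (poleDen O k))

open Classical in
/-- The specialization `(x_{i,1}, x_{i,2}, …, x_{i,1-c_{ij}}) ↦ (w, w q_i^2, …, w q_i^{-2 c_{ij}})`,
`x_{j,1} ↦ w q_i^{-c_{ij}}`, the other variables being left alone. -/
def wheelPt (C : CartanDatum I) {k : I → ℕ} (i j : I) (w : K k) : V k → K k := fun v =>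
  if v.1 = i ∧ (v.2 : ℤ) ≤ -C.c i j then w * algebraMap Fq (K k) (qi C i ^ (2 * (v.2 : ℕ)))
  else if v.1 = j ∧ (v.2 : ℕ) = 0 then w * algebraMap Fq (K k) (qi C i ^ (-C.c i j))
  else x v

theorem qi_ne_zero (C : CartanDatum I) (i : I) : qi C i ≠ 0 := pow_ne_zero _ RatFunc.X_ne_zero

theorem wheelPt_ne_zero (C : CartanDatum I) {k : I → ℕ} (i j : I) {w : K k} (hw : w ≠ 0) (v : V k) :
    wheelPt C i j w v ≠ 0 := by
  unfold wheelPt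
  split_ifs
  · exact mul_ne_zero hw ((map_ne_zero _).2 (pow_ne_zero _ (qi_ne_zero C i)))
  · exact mul_ne_zero hw ((map_ne_zero _).2 (zpow_ne_zero _ (qi_ne_zero C i)))
  · exact x_ne_zero v

/-- The component `S_k` of the shuffle algebra: the elements `f / poleDen` of `𝕊_k` whose numerator
`f` satisfies the wheel conditions. The free parameter `w` is the variable `x_{i,1}` itself. -/
def wheelComp {C : CartanDatum I} (O : DynOrientation C) (k : I → ℕ) : Submodule Fq (K k) where
  carrier := {F | F ∈ bigComp O k ∧ ∀ i j, i ≠ j → C.c i j ≠ 0 → 1 - C.c i j ≤ (k i : ℤ) → 0 < k j →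
    ∀ h : 0 < k i, evalRat (wheelPt C i j (x ⟨i, ⟨0, h⟩⟩)) (F * poleDen O k) = 0}
  add_mem' {F G} hF hG := by
    refine ⟨add_mem hF.1 hG.1, fun i j hij hc hk hj h => ?_⟩
    have hp := laurent_le_regularAt _ (wheelPt_ne_zero C (k := k) i j (x_ne_zero ⟨i, ⟨0, h⟩⟩))
    have h1 : F * poleDen O k ∈ laurent k := hF.1.1
    have h2 : G * poleDen O k ∈ laurent k := hG.1.1
    rw [add_mul, evalRat_add _ (hp h1) (hp h2), hF.2 i j hij hc hk hj h,
      hG.2 i j hij hc hk hj h, add_zero]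
  zero_mem' := by
    refine ⟨zero_mem _, fun i j hij hc hk hj h => ?_⟩
    rw [zero_mul, evalRat, IsFractionRing.num_zero, map_zero, zero_div]
  smul_mem' c F hF := by
    refine ⟨Submodule.smul_mem _ c hF.1, fun i j hij hc hk hj h => ?_⟩
    have hp := laurent_le_regularAt _ (wheelPt_ne_zero C (k := k) i j (x_ne_zero ⟨i, ⟨0, h⟩⟩))
    have h1 : F * poleDen O k ∈ laurent k := hF.1.1
    rw [smul_mul_assoc, evalRat_smul _ c (hp h1), hF.2 i j hij hc hk hj h, smul_zero]

/-- Finite formal sums of rational functions of all degrees `k ∈ ℕ^I`. -/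
abbrev T (I : Type*) := ⨁ k : I → ℕ, K k

/-- `𝕊^{(𝔤)} = ⨁ 𝕊_k`, as a subspace of the space of all rational functions. -/
def bigS {C : CartanDatum I} (O : DynOrientation C) : Submodule Fq (T I) where
  carrier := {F | ∀ k, F k ∈ bigComp O k}
  add_mem' hF hG k := add_mem (hF k) (hG k)
  zero_mem' _ := zero_mem _
  smul_mem' c _ hF k := Submodule.smul_mem _ c (hF k)

/-- `S^{(𝔤)} = ⨁ S_k`. -/
def wheelS {C : CartanDatum I} (O : DynOrientation C) : Submodule Fq (T I) where
  carrier := {F | ∀ k, F k ∈ wheelComp O k}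
  add_mem' hF hG k := add_mem (hF k) (hG k)
  zero_mem' _ := zero_mem _
  smul_mem' c _ hF k := Submodule.smul_mem _ c (hF k)

theorem wheelS_le_bigS {C : CartanDatum I} (O : DynOrientation C) : wheelS O ≤ bigS O :=
  fun _ h k => (h k).1

theorem of_mem_bigS {C : CartanDatum I} (O : DynOrientation C) {k : I → ℕ} {F : K k}
    (hF : F ∈ bigComp O k) : DirectSum.of (fun k : I → ℕ => K k) k F ∈ bigS O := by
  intro l
  by_cases h : k = l
  · subst h
    rwa [DirectSum.of_eq_same]
  · rw [DirectSum.of_eq_of_ne _ _ _ (Ne.symm h)]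
    exact zero_mem _

variable [DecidableEq I]

/-- The shuffle product of homogeneous elements:
`F ⋆ G = (k! l!)⁻¹ Sym (F(x_{i,r})_{r ≤ k_i} G(x_{i,r})_{r > k_i} ∏ ζ_{ii'}(x_{i,r} / x_{i',r'}))`,
the last product being over all `i, i'`, `r ≤ k_i`, `r' > k_{i'}`. -/
def shMulComp (C : CartanDatum I) (k l : I → ℕ) (F : K k) (G : K l) : K (k + l) :=
  ((∏ i, ((k i).factorial * (l i).factorial : ℕ) : ℕ) : Fq)⁻¹ •
    ∑ σ : (∀ i, Equiv.Perm (Fin ((k + l) i))), relabel (permV σ)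
      (relabel (leftV k l) F * relabel (rightV k l) G *
        ∏ i, ∏ i', ∏ r : Fin (k i), ∏ r' : Fin (l i'),
          zeta C i i' (x (leftV k l ⟨i, r⟩)) (x (rightV k l ⟨i', r'⟩)))

/-- The shuffle product of homogeneous elements as a bilinear map. -/
def shMulBilin (C : CartanDatum I) (k l : I → ℕ) : K k →ₗ[Fq] K l →ₗ[Fq] K (k + l) :=
  LinearMap.mk₂ Fq (shMulComp C k l)
    (fun F F' G => by
      simp only [shMulComp, map_add, add_mul, Finset.sum_add_distrib, smul_add])
    (fun c F G => by
      simp only [shMulComp, map_smul, smul_mul_assoc, ← Finset.smul_sum, smul_comm c])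
    (fun F G G' => by
      simp only [shMulComp, map_add, add_mul, mul_add, Finset.sum_add_distrib, smul_add])
    (fun c F G => by
      simp only [shMulComp, map_smul, smul_mul_assoc, mul_smul_comm, ← Finset.smul_sum, smul_comm c])

/-- The shuffle product. -/
def shMul (C : CartanDatum I) : T I →ₗ[Fq] T I →ₗ[Fq] T I :=
  DirectSum.toModule Fq (I → ℕ) (T I →ₗ[Fq] T I) fun k =>
    (DirectSum.toModule Fq (I → ℕ) (K k →ₗ[Fq] T I) fun l =>
      ((shMulBilin C k l).compr₂ (DirectSum.lof Fq (I → ℕ) (fun k => K k) (k + l))).flip).flip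

/-- The function `1` of degree `0`. -/
def shOne (I : Type*) [Fintype I] [DecidableEq I] : T I := DirectSum.of (fun k : I → ℕ => K k) 0 1

/-- The element `x_{i,1}^r` of degree `1_i`. -/
def xPow (i : I) (r : ℤ) : T I :=
  DirectSum.of (fun k : I → ℕ => K k) (Pi.single i 1) (x ⟨i, ⟨0, by simp⟩⟩ ^ r)

/-- `B` is an associative unital algebra under the shuffle product, with unit the constant `1`. -/
structure IsShuffleAlgebra (C : CartanDatum I) (B : Submodule Fq (T I)) : Prop where
  one_mem : shOne I ∈ B
  mul_mem : ∀ F ∈ B, ∀ G ∈ B, shMul C F G ∈ B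
  one_mul : ∀ F ∈ B, shMul C (shOne I) F = F
  mul_one : ∀ F ∈ B, shMul C F (shOne I) = F
  mul_assoc : ∀ F ∈ B, ∀ G ∈ B, ∀ H ∈ B, shMul C (shMul C F G) H = shMul C F (shMul C G H)

/-- The algebra whose underlying space is `B` and whose multiplication is the shuffle product. -/
def ShAlg {C : CartanDatum I} {B : Submodule Fq (T I)} (_ : IsShuffleAlgebra C B) : Type _ := B

section ShAlg

variable {C : CartanDatum I} {B : Submodule Fq (T I)} (h : IsShuffleAlgebra C B)

instance : AddCommGroup (ShAlg h) := inferInstanceAs (AddCommGroup B)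
instance : Module Fq (ShAlg h) := inferInstanceAs (Module Fq B)

instance : Ring (ShAlg h) where
  __ := (inferInstance : AddCommGroup (ShAlg h))
  mul F G := ⟨shMul C F.1 G.1, h.mul_mem _ F.2 _ G.2⟩
  one := ⟨shOne I, h.one_mem⟩
  one_mul F := Subtype.ext (h.one_mul _ F.2)
  mul_one F := Subtype.ext (h.mul_one _ F.2)
  mul_assoc F G H := Subtype.ext (h.mul_assoc _ F.2 _ G.2 _ H.2)
  zero_mul F := Subtype.ext (LinearMap.map_zero₂ (shMul C) F.1)
  mul_zero F := Subtype.ext (map_zero (shMul C F.1))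
  left_distrib F G H := Subtype.ext (map_add (shMul C F.1) G.1 H.1)
  right_distrib F G H := Subtype.ext (LinearMap.map_add₂ (shMul C) F.1 G.1 H.1)

instance : Algebra Fq (ShAlg h) :=
  Algebra.ofModule
    (fun c F G => Subtype.ext (LinearMap.map_smul₂ (shMul C) c F.1 G.1))
    (fun c F G => Subtype.ext (map_smul (shMul C F.1) c G.1))

/-- An element of `B` as an element of the algebra. -/
def ShAlg.mk (F : T I) (hF : F ∈ B) : ShAlg h := (⟨F, hF⟩ : B)

/-- An element of the algebra as an element of `B`. -/
def ShAlg.val {h : IsShuffleAlgebra C B} (F : ShAlg h) : T I := Subtype.val (p := (· ∈ B)) F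

/-- The inclusion of shuffle algebras. -/
def ShAlg.incl {B' : Submodule Fq (T I)} (h' : IsShuffleAlgebra C B') (hle : B ≤ B') :
    ShAlg h →ₐ[Fq] ShAlg h' :=
  AlgHom.ofLinearMap (Submodule.inclusion hle : B →ₗ[Fq] B') rfl fun _ _ => rfl

end ShAlg

end Shuffle

/-! ### The algebras of `q`-difference operators -/

section Difference

variable {I : Type*} [Fintype I]

/-- The group `ℤ^{(i,r)}` of exponents of the shift operators `D_{i,r}`, `1 ≤ r ≤ a_i`, in
multiplicative notation. -/
def Shift (_ : CartanDatum I) (a : I → ℕ) : Type _ := Multiplicative (V a → ℤ)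

instance (C : CartanDatum I) (a : I → ℕ) : CommGroup (Shift C a) :=
  inferInstanceAs (CommGroup (Multiplicative (V a → ℤ)))

/-- The element `∏ D_{i,r}^{n_{i,r}}` of the group of shifts. -/
def Shift.mk (C : CartanDatum I) {a : I → ℕ} (n : V a → ℤ) : Shift C a := Multiplicative.ofAdd n

/-- The exponents of an element of the group of shifts. -/
def Shift.exp {C : CartanDatum I} {a : I → ℕ} (γ : Shift C a) : V a → ℤ := Multiplicative.toAdd γ

/-- The automorphism `X_{i,r} ↦ q_i^{n_{i,r}} X_{i,r}` of the polynomial ring. -/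
def scale (C : CartanDatum I) {a : I → ℕ} (n : V a → ℤ) :
    MvPolynomial (V a) Fq →ₐ[Fq] MvPolynomial (V a) Fq :=
  MvPolynomial.aeval fun v => MvPolynomial.C (qi C v.1 ^ n v) * MvPolynomial.X v

theorem scale_scale (C : CartanDatum I) {a : I → ℕ} (m n : V a → ℤ) :
    (scale C m).comp (scale C n) = scale C (m + n) := by
  ext v : 1
  simp only [scale, AlgHom.comp_apply, MvPolynomial.aeval_X, map_mul, MvPolynomial.algHom_C,
    MvPolynomial.algebraMap_eq, Pi.add_apply, zpow_add₀ (qi_ne_zero C v.1)]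
  ring

theorem scale_zero (C : CartanDatum I) {a : I → ℕ} :
    scale C (0 : V a → ℤ) = AlgHom.id Fq (MvPolynomial (V a) Fq) := by
  ext v : 1
  simp [scale]

/-- The group of shifts acts on polynomials in the `X_{i,r}`. -/
def scaleHom (C : CartanDatum I) (a : I → ℕ) :
    Shift C a →* (MvPolynomial (V a) Fq ≃ₐ[Fq] MvPolynomial (V a) Fq) where
  toFun γ := AlgEquiv.ofAlgHom (scale C γ.exp) (scale C (-γ.exp))
    (by rw [scale_scale, add_neg_cancel, scale_zero]) (by rw [scale_scale, neg_add_cancel, scale_zero])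
  map_one' := AlgEquiv.ext fun p => DFunLike.congr_fun (scale_zero C) p
  map_mul' γ δ := AlgEquiv.ext fun p => DFunLike.congr_fun (scale_scale C γ.exp δ.exp).symm p

/-- The group of shifts acts on the field `ℂ(q)(w_{i,r}^{1/2})`; the variable of index `(i,r)` is
`w_{i,r}^{1/2}` and the generator `D_{i,r}` acts by `w_{i,r}^{1/2} ↦ q_i w_{i,r}^{1/2}`. -/
instance (C : CartanDatum I) (a : I → ℕ) : MulSemiringAction (Shift C a) (K a) :=
  MulSemiringAction.compHom (K a)
    ((IsFractionRing.fieldEquivOfAlgEquivHom Fq (K a)).comp (scaleHom C a))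

instance (C : CartanDatum I) (a : I → ℕ) : SMulCommClass (Shift C a) Fq (K a) where
  smul_comm γ c F :=
    map_smul (IsFractionRing.fieldEquivOfAlgEquivHom Fq (K a) (scaleHom C a γ)) c F

/-- The algebra of all `q`-difference operators `∑ F_n ∏ D_{i,r}^{n_{i,r}}` with rational
coefficients `F_n ∈ ℂ(q)(w_{i,r}^{1/2})`, subject to `D F = D(F) D`: the skew group algebra. It
contains the algebra with generators `D_{i,r}^{±1}`, `w_{i,r}^{±1/2}` and the relations
`D_{i,r} w_{j,s}^{1/2} = q_i^{δ_{ij} δ_{rs}} w_{j,s}^{1/2} D_{i,r}` (all other pairs of generators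
commuting), as well as its Ore localizations at sets of nonzero polynomials in the `w_{i,r}`. -/
abbrev Diff (C : CartanDatum I) (a : I → ℕ) := SkewMonoidAlgebra (K a) (Shift C a)

/-- Multiplication by a rational function, as a difference operator. -/
def mulOp (C : CartanDatum I) {a : I → ℕ} (F : K a) : Diff C a := SkewMonoidAlgebra.single 1 F

/-- `∏ D_{i,r}^{n_{i,r}}`, as a difference operator. -/
def shiftOp (C : CartanDatum I) {a : I → ℕ} (n : V a → ℤ) : Diff C a :=
  SkewMonoidAlgebra.single (Shift.mk C n) 1

/-- `w_{i,r}`. -/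
def w {a : I → ℕ} (v : V a) : K a := x v ^ 2

/-- `w_v - q_i^m w_u`, with `i` the colour of `v`. -/
def wDiff (C : CartanDatum I) {a : I → ℕ} (v u : V a) (m : ℤ) : K a :=
  w v - algebraMap Fq (K a) (qi C v.1 ^ m) * w u

open Classical in
/-- The generators `w_{i,r}^{±1/2}`, `D_{i,r}^{±1}`. -/
def diffGens (C : CartanDatum I) (a : I → ℕ) : Set (Diff C a) :=
  (Set.range fun v : V a => mulOp C (x v)) ∪ (Set.range fun v : V a => mulOp C (x v)⁻¹) ∪
    (Set.range fun v : V a => shiftOp C (Pi.single v 1)) ∪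
    (Set.range fun v : V a => shiftOp C (Pi.single v (-1)))

/-- The algebra `𝒜̃^q`: the localization of the algebra generated by `D_{i,r}^{±1}`,
`w_{i,r}^{±1/2}` at all `w_{i,r} - q_i^m w_{i,s}` with `r ≠ s`, `m ∈ ℤ`. -/
def Atilde (C : CartanDatum I) (a : I → ℕ) : Subalgebra Fq (Diff C a) :=
  Algebra.adjoin Fq (diffGens C a ∪
    {P | ∃ (v u : V a) (m : ℤ), v ≠ u ∧ v.1 = u.1 ∧ P = mulOp C (wDiff C v u m)⁻¹})

/-- The larger localization `𝒜̃^{q,'}` at all `w_{i,r} - q_i^m w_{j,s}` with `(i,r) ≠ (j,s)`,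
`m ∈ ℤ`. -/
def AtildePrime (C : CartanDatum I) (a : I → ℕ) : Subalgebra Fq (Diff C a) :=
  Algebra.adjoin Fq (diffGens C a ∪
    {P | ∃ (v u : V a) (m : ℤ), v ≠ u ∧ P = mulOp C (wDiff C v u m)⁻¹})

/-! ### The homomorphisms -/

section Formulas

variable [DecidableEq I] {C : CartanDatum I} (O : DynOrientation C) {a : I → ℕ} {N : ℕ}
  (col : Fin N → I) (z : Fin N → ℂ)

/-- A constant of `ℂ(q)` as an element of a field containing `ℂ(q)(w_{i,r}^{1/2})`. -/
def cst (a : I → ℕ) {E : Type*} [Field E] [Algebra (K a) E] (c : Fq) : E :=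
  algebraMap (K a) E (algebraMap Fq (K a) c)

/-- `Z_i(y) = ∏_{s : i_s = i} (1 - q_i z_s / y)`. -/
def Z (C : CartanDatum I) (a : I → ℕ) {E : Type*} [Field E] [Algebra (K a) E] (i : I) (y : E) : E :=
  ∏ s ∈ Finset.univ.filter (fun s => col s = i), (1 - cst a (qi C i * RatFunc.C (z s)) / y)

/-- `W_i(y) = ∏_r (1 - w_{i,r} / y)`. -/
def W {E : Type*} [Field E] [Algebra (K a) E] (i : I) (y : E) : E :=
  ∏ r : Fin (a i), (1 - algebraMap (K a) E (w ⟨i, r⟩) / y)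

/-- `W_{i,r}(y) = ∏_{s ≠ r} (1 - w_{i,s} / y)`. -/
def W' (i : I) (r : Fin (a i)) (y : K a) : K a :=
  ∏ s ∈ Finset.univ.filter (fun s => s ≠ r), (1 - w ⟨i, s⟩ / y)

/-- `∏_{p=1}^{-c_{ji}} W_j(q_j^{-c_{ji}-2p} y)`. -/
def Wprod (C : CartanDatum I) {E : Type*} [Field E] [Algebra (K a) E] (i j : I) (y : E) : E :=
  ∏ p ∈ Finset.Icc 1 (-C.c j i).toNat, W (a := a) j (cst a (qi C j ^ (-C.c j i - 2 * (p : ℤ))) * y)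

/-- `∏_t w_{j,t}^{c_{ji}/2}`. -/
def wHalf (C : CartanDatum I) (a : I → ℕ) (i j : I) : K a := ∏ t : Fin (a j), x ⟨j, t⟩ ^ C.c j i

/-- `∏_t w_{i,t}`. -/
def wAll (a : I → ℕ) (i : I) : K a := ∏ t : Fin (a i), w ⟨i, t⟩

open Classical in
/-- The image of `e_{i,r}` under the GKLO homomorphism. -/
def gkloE (i : I) (r : ℤ) : Diff C a :=
  ∑ t : Fin (a i),
    mulOp C (algebraMap Fq (K a) (-qi C i / (1 - qi C i ^ 2)) * wAll a i *
        (∏ j ∈ Finset.univ.filter (fun j => O.arr j i), wHalf C a i j) *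
        w ⟨i, t⟩ ^ r * (Z col z C a i (w ⟨i, t⟩) / W' i t (w ⟨i, t⟩)) *
        ∏ j ∈ Finset.univ.filter (fun j => O.arr j i), Wprod (a := a) C i j (w ⟨i, t⟩)) *
      shiftOp C (Pi.single ⟨i, t⟩ (-1))

open Classical in
/-- The image of `f_{i,r}` under the GKLO homomorphism. -/
def gkloF (i : I) (r : ℤ) : Diff C a :=
  ∑ t : Fin (a i),
    mulOp C (algebraMap Fq (K a) (1 / (1 - qi C i ^ 2)) *
        (∏ j ∈ Finset.univ.filter (fun j => O.arr i j), wHalf C a i j) *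
        (algebraMap Fq (K a) (qi C i ^ 2) * w ⟨i, t⟩) ^ r * (1 / W' i t (w ⟨i, t⟩)) *
        ∏ j ∈ Finset.univ.filter (fun j => O.arr i j),
          Wprod (a := a) C i j (algebraMap Fq (K a) (qi C i ^ 2) * w ⟨i, t⟩)) *
      shiftOp C (Pi.single ⟨i, t⟩ 1)

open Classical in
/-- The rational function whose expansions are the images of `ψ^±_i(y)`. -/
def gkloPsi {E : Type*} [Field E] [Algebra (K a) E] (i : I) (y : E) : E :=
  algebraMap (K a) E (wAll a i *
      ∏ j ∈ Finset.univ.filter (fun j => O.arr j i ∨ O.arr i j), wHalf C a i j) *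
    (Z col z C a i y / (W (a := a) i y * W (a := a) i (cst a (qi C i ^ (-2 : ℤ)) * y)) *
      ∏ j ∈ Finset.univ.filter (fun j => O.arr j i ∨ O.arr i j), Wprod (a := a) C i j y)

/-- The homomorphism `Φ` is the GKLO homomorphism: it has the prescribed values on the coefficients
of `e_i(y)`, `f_i(y)`, `ψ^±_i(y)`. The expansion of a rational function of `y` in `y^{∓1}` is its
value at `y = u^{∓1}` in the field of Laurent series in `u`. -/
def IsGKLO {μ : I → ℤ} (Φ : U C μ →ₐ[Fq] Atilde C a) : Prop :=
  (∀ i r, (Φ (Ue C μ i r) : Diff C a) = gkloE O col z i r) ∧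
  (∀ i r, (Φ (Uf C μ i r) : Diff C a) = gkloF O i r) ∧
  (∀ i t, (Φ (Upsi C μ true i t) : Diff C a) =
    mulOp C (HahnSeries.coeff
      (gkloPsi (a := a) O col z i (HahnSeries.single (-1) 1 : LaurentSeries (K a))) t)) ∧
  (∀ i t, (Φ (Upsi C μ false i t) : Diff C a) =
    mulOp C (HahnSeries.coeff
      (gkloPsi (a := a) O col z i (HahnSeries.single 1 1 : LaurentSeries (K a))) (-t)))

open Classical in
/-- `Y_{i,r}(y)`. -/
def Y (i : I) (r : Fin (a i)) (y : K a) : K a :=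
  algebraMap Fq (K a) (1 / (qi C i - (qi C i)⁻¹)) * wAll a i *
    (∏ j ∈ Finset.univ.filter (fun j => O.arr j i), wHalf C a i j) *
    ((Z col z C a i y * ∏ j ∈ Finset.univ.filter (fun j => O.arr j i), Wprod (a := a) C i j y) /
      W' i r y)

open Classical in
/-- `Y'_{i,r}(y)`. -/
def Y' (i : I) (r : Fin (a i)) (y : K a) : K a :=
  algebraMap Fq (K a) (1 / (1 - qi C i ^ 2)) *
    (∏ j ∈ Finset.univ.filter (fun j => O.arr i j), wHalf C a i j) *
    ((∏ j ∈ Finset.univ.filter (fun j => O.arr i j), Wprod (a := a) C i j y) /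
      W' i r (y * algebraMap Fq (K a) (qi C i ^ (-2 : ℤ))))

/-- Collections of `m^{(i)}_r ∈ ℕ`, `1 ≤ r ≤ a_i`, with `∑_r m^{(i)}_r = k_i` for all `i`. -/
def Comp (a k : I → ℕ) : Type _ := {m : ∀ i, Fin (a i) → ℕ // ∀ i, ∑ r, m i r = k i}

instance (a k : I → ℕ) : Fintype (Comp a k) :=
  Fintype.subtype (Fintype.piFinset fun i => Finset.piAntidiag Finset.univ (k i))
    (by intro m; simp)

/-- Given points `y i r p` (`p` counted from `0`), the assignment to the variables
`(x_{i,1}, …, x_{i,k_i})` of the `k_i` points `y i r p` with `p < m^{(i)}_r`. -/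
def specPt {k : I → ℕ} (m : Comp a k) (y : ∀ i, Fin (a i) → ℕ → K a) : V k → K a := fun v =>
  let t := finSigmaFinEquiv.symm (Fin.cast (m.2 v.1).symm v.2)
  y v.1 t.1 t.2

/-- `w_{i,r} q_i^{-2(p-1)}` where `p - 1` is counted from `0`. -/
def ptPlus (C : CartanDatum I) (a : I → ℕ) (i : I) (r : Fin (a i)) (p : ℕ) : K a :=
  w ⟨i, r⟩ * algebraMap Fq (K a) (qi C i ^ (-2 * (p : ℤ)))

/-- `w_{i,r} q_i^{2p}` where `p - 1` is counted from `0`. -/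
def ptMinus (C : CartanDatum I) (a : I → ℕ) (i : I) (r : Fin (a i)) (p : ℕ) : K a :=
  w ⟨i, r⟩ * algebraMap Fq (K a) (qi C i ^ (2 * ((p : ℤ) + 1)))

open Classical in
/-- The summand of index `m` in the image of `E ∈ 𝕊_k`, without the shift operators. -/
def termPlus {k : I → ℕ} (m : Comp a k) (E : K k) : K a :=
  (∏ i, ∏ r : Fin (a i), ∏ p ∈ Finset.range (m.1 i r), Y O col z i r (ptPlus C a i r p)) *
  evalRat (specPt m (ptPlus C a)) E *
  (∏ i, ∏ r : Fin (a i), ∏ p₂ ∈ Finset.range (m.1 i r), ∏ p₁ ∈ Finset.range p₂,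
    (zeta C i i (ptPlus C a i r p₁) (ptPlus C a i r p₂))⁻¹) *
  (∏ i, ∏ r₁ : Fin (a i), ∏ r₂ ∈ Finset.univ.filter (fun r₂ => r₁ ≠ r₂),
    ∏ p₁ ∈ Finset.range (m.1 i r₁), ∏ p₂ ∈ Finset.range (m.1 i r₂),
      (zeta C i i (ptPlus C a i r₁ p₁) (ptPlus C a i r₂ p₂))⁻¹) *
  (∏ i, ∏ j ∈ Finset.univ.filter (fun j => O.arr j i), ∏ r₁ : Fin (a i), ∏ r₂ : Fin (a j),
    ∏ p₁ ∈ Finset.range (m.1 i r₁), ∏ p₂ ∈ Finset.range (m.1 j r₂),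
      (zeta C i j (ptPlus C a i r₁ p₁) (ptPlus C a j r₂ p₂))⁻¹)

/-- The image of `E ∈ 𝕊_k`. -/
def phiPlus (k : I → ℕ) (E : K k) : Diff C a :=
  (∏ i, qi C i ^ ((k i : ℤ) - (k i : ℤ) ^ 2)) •
    ∑ m : Comp a k, mulOp C (termPlus O col z m E) * shiftOp C (fun v => -(m.1 v.1 v.2 : ℤ))

open Classical in
/-- The summand of index `m` in the image of `F ∈ 𝕊_k^{op}`, without the shift operators. -/
def termMinus {k : I → ℕ} (m : Comp a k) (F : K k) : K a :=
  (∏ i, ∏ r : Fin (a i), ∏ p ∈ Finset.range (m.1 i r), Y' O i r (ptMinus C a i r p)) *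
  evalRat (specPt m (ptMinus C a)) F *
  (∏ i, ∏ r : Fin (a i), ∏ p₂ ∈ Finset.range (m.1 i r), ∏ p₁ ∈ Finset.range p₂,
    (zeta C i i (ptMinus C a i r p₂) (ptMinus C a i r p₁))⁻¹) *
  (∏ i, ∏ r₁ : Fin (a i), ∏ r₂ ∈ Finset.univ.filter (fun r₂ => r₁ ≠ r₂),
    ∏ p₁ ∈ Finset.range (m.1 i r₁), ∏ p₂ ∈ Finset.range (m.1 i r₂),
      (algebraMap Fq (K a) (qi C i)⁻¹ *
        (zeta C i i (ptMinus C a i r₂ p₂) (ptMinus C a i r₁ p₁))⁻¹)) *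
  (∏ i, ∏ j ∈ Finset.univ.filter (fun j => O.arr i j), ∏ r₁ : Fin (a i), ∏ r₂ : Fin (a j),
    ∏ p₁ ∈ Finset.range (m.1 i r₁), ∏ p₂ ∈ Finset.range (m.1 j r₂),
      (zeta C j i (ptMinus C a j r₂ p₂) (ptMinus C a i r₁ p₁))⁻¹)

/-- The image of `F ∈ 𝕊_k^{op}`. -/
def phiMinus (k : I → ℕ) (F : K k) : Diff C a :=
  ∑ m : Comp a k, mulOp C (termMinus O m F) * shiftOp C (fun v => (m.1 v.1 v.2 : ℤ))

end Formulas

end Difference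

end

end ShuffleGKLO

open ShuffleGKLO

namespace ShuffleGKLO

noncomputable section

set_option linter.unusedSectionVars false

set_option linter.unusedSimpArgs false

section

/-! ### Values of rational functions -/

section HasVal

variable {σ τ E : Type*} [Field E] [Algebra Fq E]

/-- The rational function `F` is regular at `p`, with value `y`. -/
def HasVal (p : σ → E) (F : Rat σ) (y : E) : Prop :=
  ∃ n d : MvPolynomial σ Fq, MvPolynomial.aeval p d ≠ 0 ∧
    F * algebraMap _ (Rat σ) d = algebraMap _ _ n ∧
    y = MvPolynomial.aeval p n / MvPolynomial.aeval p d

variable {p : σ → E} {F G : Rat σ} {y y' : E}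

theorem HasVal.evalRat_eq (h : HasVal p F y) : evalRat p F = y := by
  obtain ⟨n, d, hd, hF, rfl⟩ := h
  exact (ShuffleGKLO.evalRat_eq p F n d hd hF).2

theorem hasVal_of_mem_regularAt (h : F ∈ regularAt p) : HasVal p F (evalRat p F) :=
  ⟨_, _, h, (IsFractionRing.num_mul_den_eq_num_iff_eq (x := F) (y := F)).2 rfl, rfl⟩

theorem HasVal.unique (h : HasVal p F y) (h' : HasVal p F y') : y = y' :=
  h.evalRat_eq.symm.trans h'.evalRat_eq

theorem HasVal.congr (h : HasVal p F y) (e : y = y') : HasVal p F y' := e ▸ h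

theorem hasVal_poly (p : σ → E) (n : MvPolynomial σ Fq) :
    HasVal p (algebraMap _ (Rat σ) n) (MvPolynomial.aeval p n) :=
  ⟨n, 1, by simp, by simp, by simp⟩

theorem hasVal_const (p : σ → E) (c : Fq) :
    HasVal p (algebraMap Fq (Rat σ) c) (algebraMap Fq E c) := by
  have := hasVal_poly p (MvPolynomial.C c)
  rwa [MvPolynomial.aeval_C, ← MvPolynomial.algebraMap_eq, ← IsScalarTower.algebraMap_apply] at this

theorem hasVal_one (p : σ → E) : HasVal p (1 : Rat σ) 1 := by
  simpa using hasVal_const p 1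

theorem hasVal_zero (p : σ → E) : HasVal p (0 : Rat σ) 0 := by
  simpa using hasVal_const p 0

theorem HasVal.mul (hF : HasVal p F y) (hG : HasVal p G y') : HasVal p (F * G) (y * y') := by
  obtain ⟨n, d, hd, hF, rfl⟩ := hF
  obtain ⟨n', d', hd', hG, rfl⟩ := hG
  refine ⟨n * n', d * d', by rw [map_mul]; exact mul_ne_zero hd hd', ?_, ?_⟩
  · rw [map_mul, map_mul, ← hF, ← hG]; ring
  · rw [map_mul, map_mul]; field_simp

theorem HasVal.add (hF : HasVal p F y) (hG : HasVal p G y') : HasVal p (F + G) (y + y') := by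
  obtain ⟨n, d, hd, hF, rfl⟩ := hF
  obtain ⟨n', d', hd', hG, rfl⟩ := hG
  refine ⟨n * d' + n' * d, d * d', by rw [map_mul]; exact mul_ne_zero hd hd', ?_, ?_⟩
  · rw [map_mul, map_add, map_mul, map_mul, ← hF, ← hG]; ring
  · simp only [map_mul, map_add]; field_simp

theorem HasVal.smul (c : Fq) (hF : HasVal p F y) : HasVal p (c • F) (c • y) := by
  rw [Algebra.smul_def, Algebra.smul_def]
  exact (hasVal_const p c).mul hF

theorem HasVal.neg (hF : HasVal p F y) : HasVal p (-F) (-y) := by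
  simpa using hF.smul (-1)

theorem HasVal.sub (hF : HasVal p F y) (hG : HasVal p G y') : HasVal p (F - G) (y - y') := by
  simpa [sub_eq_add_neg] using hF.add hG.neg

theorem HasVal.inv (hF : HasVal p F y) (hy : y ≠ 0) : HasVal p F⁻¹ y⁻¹ := by
  obtain ⟨n, d, hd, hF, rfl⟩ := hF
  have hn : MvPolynomial.aeval p n ≠ 0 := fun h => hy (by rw [h, zero_div])
  refine ⟨d, n, hn, ?_, by rw [inv_div]⟩
  have h0 : F ≠ 0 := by
    rintro rfl
    rw [zero_mul] at hF
    have : n = 0 := (map_eq_zero_iff _ (IsFractionRing.injective (MvPolynomial σ Fq) (Rat σ))).1 hF.symm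
    exact hn (by rw [this, map_zero])
  rw [← hF]
  field_simp

theorem HasVal.div (hF : HasVal p F y) (hG : HasVal p G y') (hy : y' ≠ 0) :
    HasVal p (F / G) (y / y') := by
  rw [div_eq_mul_inv, div_eq_mul_inv]
  exact hF.mul (hG.inv hy)

theorem HasVal.pow (hF : HasVal p F y) (n : ℕ) : HasVal p (F ^ n) (y ^ n) := by
  induction n with
  | zero => simpa using hasVal_one p
  | succ n ih => rw [pow_succ, pow_succ]; exact ih.mul hF

theorem HasVal.zpow (hF : HasVal p F y) (hy : y ≠ 0) (n : ℤ) : HasVal p (F ^ n) (y ^ n) := by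
  cases n with
  | ofNat n => simpa using hF.pow n
  | negSucc n =>
    rw [zpow_negSucc, zpow_negSucc]
    exact (hF.pow _).inv (pow_ne_zero _ hy)

theorem HasVal.prod {ι : Type*} (s : Finset ι) {f : ι → Rat σ} {g : ι → E}
    (h : ∀ i ∈ s, HasVal p (f i) (g i)) : HasVal p (∏ i ∈ s, f i) (∏ i ∈ s, g i) := by
  classical
  induction s using Finset.induction_on with
  | empty => simpa using hasVal_one p
  | insert a s ha ih =>
    rw [Finset.prod_insert ha, Finset.prod_insert ha]
    exact (h a (by simp)).mul (ih fun i hi => h i (by simp [hi]))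

theorem HasVal.sum {ι : Type*} (s : Finset ι) {f : ι → Rat σ} {g : ι → E}
    (h : ∀ i ∈ s, HasVal p (f i) (g i)) : HasVal p (∑ i ∈ s, f i) (∑ i ∈ s, g i) := by
  classical
  induction s using Finset.induction_on with
  | empty => simpa using hasVal_zero p
  | insert a s ha ih =>
    rw [Finset.sum_insert ha, Finset.sum_insert ha]
    exact (h a (by simp)).add (ih fun i hi => h i (by simp [hi]))

theorem HasVal.aeval {s : τ → Rat σ} {p' : τ → E} (h : ∀ v, HasVal p (s v) (p' v))
    (n : MvPolynomial τ Fq) :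
    HasVal p (MvPolynomial.aeval s n) (MvPolynomial.aeval p' n) := by
  induction n using MvPolynomial.induction_on with
  | C c => simpa using hasVal_const p c
  | add f g hf hg => rw [map_add, map_add]; exact hf.add hg
  | mul_X f v hf =>
    rw [map_mul, map_mul, MvPolynomial.aeval_X, MvPolynomial.aeval_X]
    exact hf.mul (h v)

/-- Specialization in two steps. -/
theorem HasVal.comp {s : τ → Rat σ} {p' : τ → E} (h : ∀ v, HasVal p (s v) (p' v)) {F : Rat τ}
    (hF : HasVal p' F y) : HasVal s F (evalRat s F) ∧ HasVal p (evalRat s F) y := by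
  obtain ⟨n, d, hd, hF, rfl⟩ := hF
  have hn := HasVal.aeval h n
  have hd' := HasVal.aeval h d
  have hne : MvPolynomial.aeval s d ≠ 0 := fun h0 => hd <| by
    rw [h0] at hd'
    exact hd'.unique (hasVal_zero p)
  have hs : HasVal s F (MvPolynomial.aeval s n / MvPolynomial.aeval s d) := ⟨n, d, hne, hF, rfl⟩
  rw [hs.evalRat_eq]
  exact ⟨hs, hn.div hd' hd⟩

/-- The value of an embedded rational function under an embedding of fields. -/
theorem HasVal.map {E' : Type*} [Field E'] [Algebra Fq E'] (φ : E →ₐ[Fq] E') (h : HasVal p F y) :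
    HasVal (fun v => φ (p v)) F (φ y) := by
  obtain ⟨n, d, hd, hF, rfl⟩ := h
  have key : ∀ n : MvPolynomial σ Fq,
      MvPolynomial.aeval (fun v => φ (p v)) n = φ (MvPolynomial.aeval p n) := fun n => by
    induction n using MvPolynomial.induction_on with
    | C c => simp
    | add f g hf hg => rw [map_add, map_add, map_add, hf, hg]
    | mul_X f v hf => simp only [map_mul, MvPolynomial.aeval_X, hf]
  refine ⟨n, d, ?_, hF, ?_⟩
  · rw [key]; exact (map_ne_zero φ).2 hd
  · rw [key, key, map_div₀]

end HasVal

section Coloured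

variable {I : Type*} {E : Type*} [Field E] [Algebra Fq E]

theorem hasVal_x {k : I → ℕ} (p : V k → E) (v : V k) : HasVal p (x v) (p v) := by
  simpa [x] using hasVal_poly p (MvPolynomial.X v)

theorem hasVal_self {k : I → ℕ} (F : K k) : HasVal x F F := by
  have key : ∀ n : MvPolynomial (V k) Fq, MvPolynomial.aeval x n = algebraMap _ (K k) n := fun n => by
    induction n using MvPolynomial.induction_on with
    | C c =>
      rw [MvPolynomial.aeval_C, ← MvPolynomial.algebraMap_eq, ← IsScalarTower.algebraMap_apply]
    | add f g hf hg => rw [map_add, map_add, hf, hg]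
    | mul_X f v hf => rw [map_mul, map_mul, MvPolynomial.aeval_X, hf, x]
  obtain ⟨n, d, hd, h⟩ := IsFractionRing.div_surjective (A := MvPolynomial (V k) Fq) F
  have hd' : algebraMap _ (K k) d ≠ 0 := IsFractionRing.to_map_ne_zero_of_mem_nonZeroDivisors hd
  refine ⟨n, d, by rwa [key], ?_, ?_⟩
  · rw [← h]; field_simp
  · rw [key, key, h]

theorem relabel_algebraMap {k l : I → ℕ} (g : V k ↪ V l) (n : MvPolynomial (V k) Fq) :
    relabel g (algebraMap _ (K k) n) = algebraMap _ (K l) (MvPolynomial.rename g n) := by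
  exact IsFractionRing.lift_algebraMap (g := ((IsScalarTower.toAlgHom Fq (MvPolynomial (V l) Fq)
    (K l)).comp (MvPolynomial.rename g)).toRingHom) ((IsFractionRing.injective (MvPolynomial (V l) Fq)
      (K l)).comp (MvPolynomial.rename_injective g g.injective)) n

@[simp] theorem relabel_x {k l : I → ℕ} (g : V k ↪ V l) (v : V k) : relabel g (x v) = x (g v) := by
  rw [x, relabel_algebraMap, MvPolynomial.rename_X, x]

theorem HasVal.relabel {k l : I → ℕ} (g : V k ↪ V l) {p : V l → E} {F : K k} {y : E}
    (h : HasVal (fun v => p (g v)) F y) : HasVal p (relabel g F) y := by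
  obtain ⟨n, d, hd, hF, rfl⟩ := h
  refine ⟨MvPolynomial.rename g n, MvPolynomial.rename g d, ?_, ?_, ?_⟩
  · rw [MvPolynomial.aeval_rename]; exact hd
  · rw [← relabel_algebraMap, ← map_mul, hF, relabel_algebraMap]
  · rw [MvPolynomial.aeval_rename, MvPolynomial.aeval_rename]; rfl

theorem relabel_eq_evalRat {k l : I → ℕ} (g : V k ↪ V l) (F : K k) :
    HasVal (fun v => x (g v)) F (relabel g F) := by
  have := (hasVal_self F).map (relabel g)
  simpa using this

theorem relabel_relabel {k l m : I → ℕ} (g : V k ↪ V l) (g' : V l ↪ V m) (F : K k) :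
    relabel g' (relabel g F) = relabel (g.trans g') F := by
  have := (relabel_eq_evalRat g F).map (relabel g')
  simp only [relabel_x] at this
  exact this.unique (relabel_eq_evalRat (g.trans g') F)

theorem relabel_refl {k : I → ℕ} (g : V k ↪ V k) (h : ∀ v, g v = v) (F : K k) :
    relabel g F = F := by
  have := relabel_eq_evalRat g F
  simp only [h] at this
  exact this.unique (hasVal_self F)

theorem hasVal_laurent {k : I → ℕ} {p : V k → E} (hp : ∀ v, p v ≠ 0) {f : K k}
    (hf : f ∈ laurent k) : HasVal p f (evalRat p f) :=
  hasVal_of_mem_regularAt (laurent_le_regularAt p hp hf)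

theorem x_mem_laurent {k : I → ℕ} (v : V k) : (x v : K k) ∈ laurent k :=
  Algebra.subset_adjoin (Or.inl ⟨v, rfl⟩)

theorem x_inv_mem_laurent {k : I → ℕ} (v : V k) : (x v : K k)⁻¹ ∈ laurent k :=
  Algebra.subset_adjoin (Or.inr ⟨v, rfl⟩)

theorem x_zpow_mem_laurent {k : I → ℕ} (v : V k) (n : ℤ) : (x v : K k) ^ n ∈ laurent k := by
  cases n with
  | ofNat n => simpa using pow_mem (x_mem_laurent v) n
  | negSucc n =>
    rw [zpow_negSucc, ← inv_pow]
    exact pow_mem (x_inv_mem_laurent v) _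

theorem relabel_mem_laurent {k l : I → ℕ} (g : V k ↪ V l) {f : K k} (hf : f ∈ laurent k) :
    relabel g f ∈ laurent l := by
  have : laurent k ≤ (laurent l).comap (relabel g) := by
    refine Algebra.adjoin_le ?_
    rintro _ (⟨v, rfl⟩ | ⟨v, rfl⟩)
    · simpa using x_mem_laurent (g v)
    · simpa using x_inv_mem_laurent (g v)
  exact this hf

theorem poly_mem_laurent {k : I → ℕ} (n : MvPolynomial (V k) Fq) :
    algebraMap _ (K k) n ∈ laurent k := by
  induction n using MvPolynomial.induction_on with
  | C c =>
    rw [← MvPolynomial.algebraMap_eq, ← IsScalarTower.algebraMap_apply]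
    exact Subalgebra.algebraMap_mem _ c
  | add f g hf hg => rw [map_add]; exact add_mem hf hg
  | mul_X f v hf => rw [map_mul]; exact mul_mem hf (x_mem_laurent v)

/-- A Laurent polynomial is a polynomial divided by a monomial. -/
theorem exists_monomial_mul {k : I → ℕ} {f : K k} (hf : f ∈ laurent k) :
    ∃ (n : MvPolynomial (V k) Fq) (s : V k →₀ ℕ),
      f * algebraMap (MvPolynomial (V k) Fq) (K k) (MvPolynomial.monomial s 1) = algebraMap _ _ n := by
  induction hf using Algebra.adjoin_induction with
  | mem f hf =>
    rcases hf with ⟨v, rfl⟩ | ⟨v, rfl⟩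
    · exact ⟨.X v, 0, by simp [x]⟩
    · exact ⟨1, Finsupp.single v 1, by
        rw [map_one (algebraMap (MvPolynomial (V k) Fq) (K k))]; exact inv_mul_cancel₀ (x_ne_zero v)⟩
  | algebraMap c => exact ⟨.C c, 0, by
      rw [← MvPolynomial.algebraMap_eq, ← IsScalarTower.algebraMap_apply]; simp⟩
  | add f g _ _ hf hg =>
    obtain ⟨n, s, h⟩ := hf
    obtain ⟨n', s', h'⟩ := hg
    refine ⟨n * .monomial s' 1 + n' * .monomial s 1, s + s', ?_⟩
    have e : MvPolynomial.monomial (s + s') (1 : Fq) = .monomial s 1 * .monomial s' 1 := by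
      rw [MvPolynomial.monomial_mul, one_mul]
    rw [e]
    simp only [map_mul, map_add, ← h, ← h']
    ring
  | mul f g _ _ hf hg =>
    obtain ⟨n, s, h⟩ := hf
    obtain ⟨n', s', h'⟩ := hg
    refine ⟨n * n', s + s', ?_⟩
    have e : MvPolynomial.monomial (s + s') (1 : Fq) = .monomial s 1 * .monomial s' 1 := by
      rw [MvPolynomial.monomial_mul, one_mul]
    rw [e]
    simp only [map_mul, ← h, ← h']
    ring

theorem aeval_monomial_ne_zero {τ : Type*} {p : τ → E} (hp : ∀ v, p v ≠ 0) (s : τ →₀ ℕ) :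
    MvPolynomial.aeval p (MvPolynomial.monomial s (1 : Fq)) ≠ 0 := by
  rw [MvPolynomial.aeval_monomial, map_one, one_mul]
  exact Finset.prod_ne_zero_iff.2 fun v _ => pow_ne_zero _ (hp v)

end Coloured

end

section

/-! ### Counting permutations with a prescribed image of an initial segment -/

theorem card_perm_image_castAdd (n m : ℕ) (B : Finset (Fin (n + m))) (hB : B.card = n) :
    (Finset.univ.filter fun σ : Equiv.Perm (Fin (n + m)) =>
      Finset.univ.image (fun r : Fin n => σ (Fin.castAdd m r)) = B).card
      = n.factorial * m.factorial := by
  classical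
  have hmem : ∀ (σ : Equiv.Perm (Fin (n + m))),
      Finset.univ.image (fun r : Fin n => σ (Fin.castAdd m r)) = B ↔
        ∀ t, σ t ∈ B ↔ (t : ℕ) < n := by
    intro σ
    have hc : (Finset.univ.image (fun r : Fin n => σ (Fin.castAdd m r))).card = n := by
      refine (Finset.card_image_of_injective _ (σ.injective.comp (Fin.castAdd_injective n m))).trans ?_
      simp
    constructor
    · rintro rfl t
      simp only [Finset.mem_image, Finset.mem_univ, true_and, EmbeddingLike.apply_eq_iff_eq]
      exact ⟨by rintro ⟨r, rfl⟩; simp, fun h => ⟨⟨t, h⟩, by ext; simp⟩⟩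
    · intro h
      refine Finset.eq_of_subset_of_card_le ?_ (by rw [hc, hB])
      intro t ht
      obtain ⟨r, -, rfl⟩ := Finset.mem_image.1 ht
      exact (h _).2 (by simp)
  simp only [hmem]
  obtain ⟨σ₀, h₀⟩ : ∃ σ₀ : Equiv.Perm (Fin (n + m)), ∀ t, σ₀ t ∈ B ↔ (t : ℕ) < n := by
    have hcard : Fintype.card {t : Fin (n + m) // (t : ℕ) < n} = Fintype.card {t // t ∈ B} := by
      rw [Fintype.card_coe, hB, Fintype.card_subtype]
      have : (Finset.univ.filter fun t : Fin (n + m) => (t : ℕ) < n)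
          = Finset.univ.image (Fin.castAdd m : Fin n → Fin (n + m)) := by
        ext t
        simp only [Finset.mem_filter, Finset.mem_univ, true_and, Finset.mem_image]
        exact ⟨fun h => ⟨⟨t, h⟩, by ext; simp⟩, by rintro ⟨r, rfl⟩; simp⟩
      rw [this, Finset.card_image_of_injective _ (Fin.castAdd_injective n m)]
      simp
    let e := Fintype.equivOfCardEq hcard
    exact ⟨e.extendSubtype, fun t => by
      by_cases h : (t : ℕ) < n
      · simp only [h, iff_true]
        exact e.extendSubtype_mem t h
      · simp only [h, iff_false]
        exact e.extendSubtype_not_mem t h⟩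
  have hs := DomMulAct.stabilizer_card (fun t : Fin (n + m) => decide ((t : ℕ) < n))
  rw [Fintype.prod_bool] at hs
  have h1 : Fintype.card {t : Fin (n + m) // decide ((t : ℕ) < n) = true} = n := by
    rw [Fintype.card_congr (Equiv.subtypeEquivRight (q := fun t => t ∈ B.image σ₀.symm) ?_),
      Fintype.card_coe, Finset.card_image_of_injective _ σ₀.symm.injective, hB]
    intro t
    rw [decide_eq_true_iff, ← h₀]
    simp only [Finset.mem_image]
    exact ⟨fun h => ⟨_, h, by simp⟩, by rintro ⟨s, hs, rfl⟩; simpa using hs⟩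
  have h2 : Fintype.card {t : Fin (n + m) // decide ((t : ℕ) < n) = false} = m := by
    have h3 : Fintype.card {t : Fin (n + m) // ¬ (decide ((t : ℕ) < n) = true)} = m := by
      rw [Fintype.card_subtype_compl, h1, Fintype.card_fin, Nat.add_sub_cancel_left]
    refine Eq.trans ?_ h3
    refine Fintype.card_congr (Equiv.subtypeEquivRight ?_)
    intro t
    cases decide ((t : ℕ) < n) <;> decide
  rw [h1, h2] at hs
  rw [← hs, Fintype.card_subtype]
  refine Finset.card_bij' (fun σ _ => σ₀⁻¹ * σ) (fun τ _ => σ₀ * τ) ?_ ?_ ?_ ?_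
  · intro σ hσ
    simp only [Finset.mem_filter, Finset.mem_univ, true_and] at hσ ⊢
    funext t
    have e : σ₀ (σ₀⁻¹ (σ t)) = σ t := σ₀.apply_symm_apply _
    have e' : (((σ₀⁻¹ * σ) t : Fin (n + m)) : ℕ) < n ↔ (t : ℕ) < n := by
      rw [← h₀, Equiv.Perm.mul_apply, e, hσ]
    simp only [Function.comp_apply, e']
  · intro τ hτ
    simp only [Finset.mem_filter, Finset.mem_univ, true_and] at hτ ⊢
    intro t
    have := congrFun hτ t
    simp only [Function.comp_apply, decide_eq_decide] at this
    rw [Equiv.Perm.mul_apply, h₀, this]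
  · intro σ _; simp
  · intro σ _; simp

/-! ### Enumerations of coloured finite sets -/

section Enum

variable {I : Type*} [DecidableEq I] {ι : Type*} (cl : ι → I)

/-- The number of points of each colour. -/
def cnt (A : Finset ι) : I → ℕ := fun i => (A.filter fun u => cl u = i).card

/-- A colour preserving enumeration of `A`. -/
structure IsEnum {k : I → ℕ} (e : V k → ι) (A : Finset ι) : Prop where
  inj : Function.Injective e
  colour : ∀ v, cl (e v) = v.1
  mem : ∀ u, u ∈ A ↔ ∃ v, e v = u

variable {cl} {A : Finset ι}

theorem IsEnum.cnt_eq {k : I → ℕ} {e : V k → ι} (h : IsEnum cl e A) : cnt cl A = k := by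
  classical
  funext i
  have : A.filter (fun u => cl u = i) = Finset.univ.image fun r : Fin (k i) => e ⟨i, r⟩ := by
    ext u
    simp only [Finset.mem_filter, Finset.mem_image, Finset.mem_univ, true_and]
    constructor
    · rintro ⟨hu, hc⟩
      obtain ⟨⟨j, r⟩, rfl⟩ := (h.mem u).1 hu
      rw [h.colour] at hc
      subst hc
      exact ⟨r, rfl⟩
    · rintro ⟨r, rfl⟩
      exact ⟨(h.mem _).2 ⟨_, rfl⟩, h.colour _⟩
  rw [cnt, this, Finset.card_image_of_injective]
  · simp
  · intro r s hrs
    simpa using h.inj hrs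

variable (cl) in
theorem exists_enum (A : Finset ι) : ∃ e : V (cnt cl A) → ι, IsEnum cl e A := by
  refine ⟨fun v => ((A.filter fun u => cl u = v.1).equivFin.symm v.2 : ι), ?_, ?_, ?_⟩
  · rintro ⟨i, r⟩ ⟨j, s⟩ h
    dsimp only at h
    have hi := (Finset.mem_filter.1 ((A.filter fun u => cl u = i).equivFin.symm r).2).2
    have hj := (Finset.mem_filter.1 ((A.filter fun u => cl u = j).equivFin.symm s).2).2
    rw [h] at hi
    have hij : i = j := hi.symm.trans hj
    subst hij
    have := (A.filter fun u => cl u = i).equivFin.symm.injective (Subtype.ext h)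
    rw [this]
  · intro v
    exact (Finset.mem_filter.1 ((A.filter fun u => cl u = v.1).equivFin.symm v.2).2).2
  · intro u
    constructor
    · intro hu
      exact ⟨⟨cl u, (A.filter fun u' => cl u' = cl u).equivFin ⟨u, by simp [hu]⟩⟩, by simp⟩
    · rintro ⟨v, rfl⟩
      exact (Finset.mem_filter.1 ((A.filter fun u => cl u = v.1).equivFin.symm v.2).2).1

variable (cl) in
/-- A chosen enumeration of `A`. -/
def enum (A : Finset ι) : V (cnt cl A) → ι := (exists_enum cl A).choose

variable (cl) in
theorem isEnum_enum (A : Finset ι) : IsEnum cl (enum cl A) A := (exists_enum cl A).choose_spec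

theorem IsEnum.exists_perm {k : I → ℕ} {e e' : V k → ι} (h : IsEnum cl e A) (h' : IsEnum cl e' A) :
    ∃ σ : ∀ i, Equiv.Perm (Fin (k i)), ∀ v, e' v = e (permV σ v) := by
  have key : ∀ i (r : Fin (k i)), ∃ s : Fin (k i), e ⟨i, s⟩ = e' ⟨i, r⟩ := by
    intro i r
    obtain ⟨⟨j, s⟩, hs⟩ := (h.mem _).1 ((h'.mem _).2 ⟨⟨i, r⟩, rfl⟩)
    have : j = i := (h.colour ⟨j, s⟩).symm.trans ((congrArg cl hs).trans (h'.colour _))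
    subst this
    exact ⟨s, hs⟩
  choose s hs using key
  have hinj : ∀ i, Function.Injective (s i) := by
    intro i r r' hrr
    have := hs i r
    rw [hrr, hs] at this
    simpa using (h'.inj this).symm
  refine ⟨fun i => Equiv.ofBijective (s i) (Finite.injective_iff_bijective.1 (hinj i)), ?_⟩
  rintro ⟨i, r⟩
  exact (hs i r).symm

theorem IsEnum.comp_permV {k : I → ℕ} {e : V k → ι} (h : IsEnum cl e A)
    (σ : ∀ i, Equiv.Perm (Fin (k i))) : IsEnum cl (fun v => e (permV σ v)) A where
  inj := h.inj.comp (permV σ).injective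
  colour v := h.colour _
  mem u := by
    rw [h.mem]
    constructor
    · rintro ⟨v, rfl⟩
      refine ⟨(Equiv.sigmaCongrRight σ).symm v, ?_⟩
      rw [permV, Equiv.toEmbedding_apply, Equiv.apply_symm_apply]
    · rintro ⟨v, rfl⟩
      exact ⟨_, rfl⟩

section Halves

variable [Fintype I] [DecidableEq ι] {k l : I → ℕ} {e : V (k + l) → ι}

/-- The set of points enumerated by the first `k_i` variables of each colour. -/
def leftSet (k l : I → ℕ) (e : V (k + l) → ι) : Finset ι :=
  Finset.univ.image fun v : V k => e (leftV k l v)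

theorem leftV_or_rightV (v : V (k + l)) : (∃ u, leftV k l u = v) ∨ ∃ u, rightV k l u = v := by
  obtain ⟨i, r⟩ := v
  induction r using Fin.addCases (m := k i) (n := l i) with
  | left r => exact Or.inl ⟨⟨i, r⟩, rfl⟩
  | right r => exact Or.inr ⟨⟨i, r⟩, rfl⟩

theorem leftV_ne_rightV (u : V k) (v : V l) : leftV k l u ≠ rightV k l v := by
  obtain ⟨i, r⟩ := u
  obtain ⟨j, s⟩ := v
  intro h
  obtain rfl : i = j := congrArg Sigma.fst h
  have h0 : (⟨i, Fin.castAdd (l i) r⟩ : Σ i, Fin (k i + l i)) = ⟨i, Fin.natAdd (k i) s⟩ := h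
  rw [Sigma.mk.injEq] at h0
  have h1 := congrArg Fin.val (eq_of_heq h0.2)
  simp only [Fin.val_castAdd, Fin.val_natAdd] at h1
  omega

theorem IsEnum.left (h : IsEnum cl e A) :
    IsEnum cl (fun v => e (leftV k l v)) (leftSet k l e) where
  inj := h.inj.comp (leftV k l).injective
  colour v := h.colour _
  mem u := by simp [leftSet]

theorem IsEnum.right (h : IsEnum cl e A) :
    IsEnum cl (fun v => e (rightV k l v)) (A \ leftSet k l e) where
  inj := h.inj.comp (rightV k l).injective
  colour v := h.colour _
  mem u := by
    rw [Finset.mem_sdiff, h.mem, leftSet]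
    simp only [Finset.mem_image, Finset.mem_univ, true_and]
    constructor
    · rintro ⟨⟨v, rfl⟩, hv⟩
      rcases leftV_or_rightV v with ⟨w, rfl⟩ | ⟨w, rfl⟩
      · exact absurd ⟨w, rfl⟩ hv
      · exact ⟨w, rfl⟩
    · rintro ⟨w, rfl⟩
      exact ⟨⟨_, rfl⟩, by rintro ⟨v, hv⟩; exact leftV_ne_rightV _ _ (h.inj hv)⟩

theorem IsEnum.leftSet_subset (h : IsEnum cl e A) : leftSet k l e ⊆ A := by
  intro u hu
  obtain ⟨v, -, rfl⟩ := Finset.mem_image.1 hu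
  exact (h.mem _).2 ⟨_, rfl⟩

theorem IsEnum.card_leftSet_eq (h : IsEnum cl e A) {B : Finset ι} (hB : B ⊆ A)
    (hc : cnt cl B = k) :
    (Finset.univ.filter fun σ : ∀ i, Equiv.Perm (Fin ((k + l) i)) =>
      leftSet k l (fun v => e (permV σ v)) = B).card
      = ∏ i, ((k i).factorial * (l i).factorial) := by
  let Bi : ∀ i, Finset (Fin ((k + l) i)) := fun i => Finset.univ.filter fun r => e ⟨i, r⟩ ∈ B
  have hBi : ∀ i, (Bi i).card = k i := by
    intro i
    refine Eq.trans ?_ (congrFun hc i)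
    refine Finset.card_bij (fun r _ => e ⟨i, r⟩) ?_ ?_ ?_
    · intro r hr
      simp only [Bi, Finset.mem_filter, Finset.mem_univ, true_and] at hr ⊢
      exact ⟨hr, h.colour _⟩
    · intro r _ s _ hrs
      simpa using h.inj hrs
    · intro u hu
      obtain ⟨huB, hcu⟩ := Finset.mem_filter.1 hu
      obtain ⟨⟨j, r⟩, rfl⟩ := (h.mem u).1 (hB huB)
      obtain rfl : j = i := (h.colour ⟨j, r⟩).symm.trans hcu
      exact ⟨r, by simpa [Bi] using huB, rfl⟩
  have hset : (Finset.univ.filter fun σ : ∀ i, Equiv.Perm (Fin ((k + l) i)) =>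
      leftSet k l (fun v => e (permV σ v)) = B) = Fintype.piFinset fun i =>
        Finset.univ.filter fun τ : Equiv.Perm (Fin (k i + l i)) =>
          Finset.univ.image (fun r : Fin (k i) => τ (Fin.castAdd (l i) r)) = Bi i := by
    ext σ
    simp only [Finset.mem_filter, Finset.mem_univ, true_and, Fintype.mem_piFinset]
    have hp : ∀ i (r : Fin (k i)), permV σ (leftV k l ⟨i, r⟩) = ⟨i, σ i (Fin.castAdd (l i) r)⟩ :=
      fun _ _ => rfl
    constructor
    · rintro rfl i
      ext t
      simp only [Bi, leftSet, Finset.mem_image, Finset.mem_univ, true_and, Finset.mem_filter]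
      constructor
      · rintro ⟨r, rfl⟩
        exact ⟨⟨i, r⟩, rfl⟩
      · rintro ⟨⟨j, r⟩, hr⟩
        have := h.inj hr
        rw [hp] at this
        obtain rfl : j = i := congrArg Sigma.fst this
        exact ⟨r, by simpa using this⟩
    · intro hσ
      ext u
      simp only [leftSet, Finset.mem_image, Finset.mem_univ, true_and]
      constructor
      · rintro ⟨⟨i, r⟩, rfl⟩
        have : σ i (Fin.castAdd (l i) r) ∈ Bi i := by
          rw [← hσ]
          exact Finset.mem_image_of_mem _ (Finset.mem_univ _)
        rw [hp]
        exact (Finset.mem_filter.1 this).2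
      · intro hu
        obtain ⟨⟨i, t⟩, rfl⟩ := (h.mem u).1 (hB hu)
        have : t ∈ Bi i := by simpa [Bi] using hu
        rw [← hσ] at this
        obtain ⟨r, -, rfl⟩ := Finset.mem_image.1 this
        exact ⟨⟨i, r⟩, rfl⟩
  rw [hset, Fintype.card_piFinset]
  exact Finset.prod_congr rfl fun i _ => card_perm_image_castAdd _ _ _ (hBi i)

/-- Summation over permutations of a quantity depending only on the set of points enumerated by the
first variables. -/
theorem IsEnum.sum_leftSet {R : Type*} [CommRing R] (h : IsEnum cl e A) (H : Finset ι → R) :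
    ∑ σ : (∀ i, Equiv.Perm (Fin ((k + l) i))), H (leftSet k l fun v => e (permV σ v)) =
      ((∏ i, ((k i).factorial * (l i).factorial) : ℕ) : R) *
        ∑ B ∈ A.powerset.filter (fun B => cnt cl B = k), H B := by
  rw [← Finset.sum_fiberwise_of_maps_to (t := A.powerset.filter (fun B => cnt cl B = k))
    (g := fun σ : (∀ i, Equiv.Perm (Fin ((k + l) i))) => leftSet k l fun v => e (permV σ v)),
    Finset.mul_sum]
  · refine Finset.sum_congr rfl fun B hB => ?_
    obtain ⟨hB, hc⟩ := Finset.mem_filter.1 hB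
    rw [Finset.sum_congr rfl (g := fun _ => H B), Finset.sum_const,
      h.card_leftSet_eq (Finset.mem_powerset.1 hB) hc, nsmul_eq_mul]
    intro σ hσ
    rw [(Finset.mem_filter.1 hσ).2]
  · intro σ _
    have h' := h.comp_permV σ
    exact Finset.mem_filter.2 ⟨Finset.mem_powerset.2 h'.leftSet_subset, h'.left.cnt_eq⟩

end Halves

end Enum

end

section

/-! ### Numerators of shuffle products -/

section Numerator

variable {I : Type*} [Fintype I] {C : CartanDatum I} (O : DynOrientation C)

theorem CartanDatum.c_ne_zero_symm (C : CartanDatum I) {i j : I} (h : C.c i j ≠ 0) : C.c j i ≠ 0 := by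
  intro h0
  have := C.symm i j
  rw [h0, mul_zero] at this
  rcases mul_eq_zero.1 this with h1 | h1
  · exact (C.d_pos i).ne' (by exact_mod_cast h1)
  · exact h h1

theorem qi_zpow_c_symm (C : CartanDatum I) (i j : I) : qi C i ^ C.c i j = qi C j ^ C.c j i := by
  rw [qi, qi, ← zpow_natCast, ← zpow_natCast, ← zpow_mul, ← zpow_mul, C.symm]

theorem qi_zpow_neg_c_symm (C : CartanDatum I) (i j : I) :
    qi C i ^ (-C.c i j) = qi C j ^ (-C.c j i) := by
  rw [zpow_neg, zpow_neg, qi_zpow_c_symm]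

theorem DynOrientation.ne_of_arr {i j : I} (h : O.arr i j) : i ≠ j := by
  rintro rfl
  exact O.asymm i i h h

variable [DecidableEq I]

open Classical in
/-- The factor `ζ_{ij}(z/w)`, with its pole cleared for `i ≠ j`. -/
def kap {E : Type*} [Field E] [Algebra Fq E] (i j : I) (z w : E) : E :=
  if i = j then zeta C i i z w
  else if O.arr j i then z - algebraMap Fq E (qi C i ^ (-C.c i j)) * w
  else if O.arr i j then -(z - algebraMap Fq E (qi C i ^ (-C.c i j)) * w)
  else 1

variable {E : Type*} [Field E] [Algebra Fq E]

theorem kap_self (i : I) (z w : E) : kap O i i z w = zeta C i i z w := by simp [kap]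

theorem kap_of_arr_right {i j : I} (h : O.arr j i) (z w : E) :
    kap O i j z w = z - algebraMap Fq E (qi C i ^ (-C.c i j)) * w := by
  rw [kap, if_neg (O.ne_of_arr h).symm, if_pos h]

theorem kap_of_arr_left {i j : I} (h : O.arr i j) (z w : E) :
    kap O i j z w = -(z - algebraMap Fq E (qi C i ^ (-C.c i j)) * w) := by
  rw [kap, if_neg (O.ne_of_arr h), if_neg (O.asymm i j h), if_pos h]

theorem kap_of_not_arr {i j : I} (hij : i ≠ j) (h : ¬ O.arr i j) (h' : ¬ O.arr j i) (z w : E) :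
    kap O i j z w = 1 := by
  rw [kap, if_neg hij, if_neg h', if_neg h]

theorem HasVal.zeta {σ : Type*} {p : σ → E} {X X' : Rat σ} {y y' : E} (i j : I) (h : HasVal p X y)
    (h' : HasVal p X' y') (hne : y ≠ y') :
    HasVal p (zeta C i j X X') (ShuffleGKLO.zeta C i j y y') :=
  (h.sub ((hasVal_const p _).mul h')).div (h.sub h') (sub_ne_zero.2 hne)

theorem HasVal.kap {σ : Type*} {p : σ → E} {X X' : Rat σ} {y y' : E} (i j : I) (h : HasVal p X y)
    (h' : HasVal p X' y') (hne : i = j → y ≠ y') :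
    HasVal p (kap O i j X X') (ShuffleGKLO.kap O i j y y') := by
  unfold ShuffleGKLO.kap
  split_ifs with h1
  · exact h.zeta i i h' (hne h1)
  · exact h.sub ((hasVal_const p _).mul h')
  · exact (h.sub ((hasVal_const p _).mul h')).neg
  · exact hasVal_one p

open Classical in
theorem zeta_mul_eq_kap (i j : I) {z w : E} (h : z ≠ w) :
    zeta C i j z w * ((if O.arr j i then z - w else 1) * (if O.arr i j then w - z else 1))
      = kap O i j z w := by
  have h0 : z - w ≠ 0 := sub_ne_zero.2 h
  by_cases hij : i = j
  · subst hij
    have : ¬ O.arr i i := fun h => O.asymm i i h h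
    simp only [kap_self, if_neg this, mul_one]
  by_cases h1 : O.arr j i
  · rw [if_pos h1, if_neg (O.asymm _ _ h1), kap_of_arr_right O h1, zeta, mul_one,
      div_mul_cancel₀ _ h0]
  by_cases h2 : O.arr i j
  · rw [if_neg h1, if_pos h2, kap_of_arr_left O h2, zeta, one_mul]
    field_simp
    ring
  · rw [if_neg h1, if_neg h2, kap_of_not_arr O hij h2 h1, zeta]
    have : C.c i j = 0 := by
      by_contra hc
      rcases (O.adj_iff i j hij).1 hc with h | h
      · exact h2 h
      · exact h1 h
    rw [this, neg_zero, zpow_zero, map_one, one_mul, mul_one, mul_one, div_self h0]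

theorem relabel_poleDen {k : I → ℕ} (σ : ∀ i, Equiv.Perm (Fin (k i))) :
    relabel (permV σ) (poleDen O k) = poleDen O k := by
  classical
  simp only [poleDen, map_prod, map_sub, relabel_x]
  refine Finset.prod_congr rfl fun i _ => Finset.prod_congr rfl fun j _ => ?_
  refine (Equiv.prod_comp (σ i) fun r : Fin (k i) => ∏ s : Fin (k j),
    (x ⟨i, r⟩ - x (permV σ ⟨j, s⟩) : K k)).trans ?_
  refine Finset.prod_congr rfl fun r _ => ?_
  exact Equiv.prod_comp (σ j) fun s : Fin (k j) => (x ⟨i, r⟩ - x ⟨j, s⟩ : K k)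

theorem x_injective {k : I → ℕ} : Function.Injective (x : V k → K k) := fun _ _ h =>
  MvPolynomial.X_injective (IsFractionRing.injective (MvPolynomial (V k) Fq) (K k) h)

theorem poleDen_ne_zero (k : I → ℕ) : poleDen O k ≠ 0 := by
  classical
  simp only [poleDen, Finset.prod_ne_zero_iff]
  intro i _ j hj r _ s _ h
  have := x_injective (sub_eq_zero.1 h)
  exact O.ne_of_arr (Finset.mem_filter.1 hj).2 (congrArg Sigma.fst this).symm

open Classical in
theorem poleDen_eq (k : I → ℕ) : poleDen O k =
    ∏ i, ∏ j, ∏ r : Fin (k i), ∏ s : Fin (k j),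
      (if O.arr j i then (x ⟨i, r⟩ - x ⟨j, s⟩ : K k) else 1) := by
  rw [poleDen]
  refine Finset.prod_congr rfl fun i _ => ?_
  rw [Finset.prod_filter]
  refine Finset.prod_congr rfl fun j _ => ?_
  split_ifs <;> simp

theorem prod_V {k : I → ℕ} {R : Type*} [CommMonoid R] (f : V k → R) :
    ∏ v, f v = ∏ i, ∏ r : Fin (k i), f ⟨i, r⟩ := by
  rw [← Finset.univ_sigma_univ, Finset.prod_sigma]

theorem prod_V_add {k l : I → ℕ} {R : Type*} [CommMonoid R] (f : V (k + l) → R) :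
    ∏ v, f v = (∏ u, f (leftV k l u)) * ∏ v, f (rightV k l v) := by
  rw [prod_V, prod_V, prod_V, ← Finset.prod_mul_distrib]
  refine Finset.prod_congr rfl fun i _ => ?_
  exact Fin.prod_univ_add (fun r : Fin (k i + l i) => f ⟨i, r⟩)

open Classical in
theorem poleDen_eq' (k : I → ℕ) : poleDen O k =
    ∏ u : V k, ∏ v : V k, (if O.arr v.1 u.1 then (x u - x v : K k) else 1) := by
  rw [poleDen_eq, prod_V]
  refine Finset.prod_congr rfl fun i _ => ?_
  rw [Finset.prod_comm]
  refine Finset.prod_congr rfl fun r _ => ?_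
  rw [prod_V]

/-- The numerator of the summand of a shuffle product before symmetrization. -/
def shNum (k l : I → ℕ) (f : K k) (g : K l) : K (k + l) :=
  relabel (leftV k l) f * relabel (rightV k l) g *
    ∏ u : V k, ∏ v : V l, kap O u.1 v.1 (x (leftV k l u)) (x (rightV k l v))

theorem shMulComp_mul_poleDen (k l : I → ℕ) (F : K k) (G : K l) :
    shMulComp C k l F G * poleDen O (k + l) =
      ((∏ i, ((k i).factorial * (l i).factorial : ℕ) : ℕ) : Fq)⁻¹ •
        ∑ σ : (∀ i, Equiv.Perm (Fin ((k + l) i))), relabel (permV σ)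
          (shNum O k l (F * poleDen O k) (G * poleDen O l)) := by
  classical
  rw [shMulComp, smul_mul_assoc, Finset.sum_mul]
  congr 1
  refine Finset.sum_congr rfl fun σ _ => ?_
  conv_lhs => rw [← relabel_poleDen O σ, ← map_mul]
  congr 1
  have hz : (∏ i, ∏ i', ∏ r : Fin (k i), ∏ r' : Fin (l i'),
      zeta C i i' (x (leftV k l ⟨i, r⟩)) (x (rightV k l ⟨i', r'⟩))) =
      ∏ u : V k, ∏ v : V l, zeta C u.1 v.1 (x (leftV k l u) : K (k + l)) (x (rightV k l v)) := by
    rw [prod_V]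
    refine Finset.prod_congr rfl fun i _ => ?_
    rw [Finset.prod_comm]
    refine Finset.prod_congr rfl fun r _ => ?_
    rw [prod_V]
  have hk : (∏ u : V k, ∏ v : V l, kap O u.1 v.1 (x (leftV k l u) : K (k + l)) (x (rightV k l v))) =
      (∏ u : V k, ∏ v : V l, zeta C u.1 v.1 (x (leftV k l u)) (x (rightV k l v))) *
      ((∏ u : V k, ∏ v : V l, (if O.arr v.1 u.1 then x (leftV k l u) - x (rightV k l v) else 1)) *
      ∏ v : V l, ∏ u : V k, (if O.arr u.1 v.1 then x (rightV k l v) - x (leftV k l u) else 1)) := by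
    rw [Finset.prod_comm (s := (Finset.univ : Finset (V l)))]
    simp only [← Finset.prod_mul_distrib]
    refine Finset.prod_congr rfl fun u _ => Finset.prod_congr rfl fun v _ => ?_
    rw [zeta_mul_eq_kap]
    exact fun h => leftV_ne_rightV u v (x_injective h)
  have hp : poleDen O (k + l) = relabel (leftV k l) (poleDen O k) * relabel (rightV k l) (poleDen O l) *
      ((∏ u : V k, ∏ v : V l, (if O.arr v.1 u.1 then x (leftV k l u) - x (rightV k l v) else 1)) *
      ∏ v : V l, ∏ u : V k, (if O.arr u.1 v.1 then x (rightV k l v) - x (leftV k l u) else 1)) := by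
    rw [poleDen_eq', poleDen_eq', poleDen_eq', prod_V_add]
    simp only [prod_V_add (k := k) (l := l), Finset.prod_mul_distrib, map_prod]
    have hL : ∀ u v : V k, relabel (leftV k l) (if O.arr v.1 u.1 then (x u - x v : K k) else 1) =
        if O.arr (leftV k l v).1 (leftV k l u).1 then x (leftV k l u) - x (leftV k l v) else 1 := by
      intro u v
      split_ifs with h1 h2 h2
      · simp
      · exact absurd h1 h2
      · exact absurd h2 h1
      · simp
    have hR : ∀ u v : V l, relabel (rightV k l) (if O.arr v.1 u.1 then (x u - x v : K l) else 1) =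
        if O.arr (rightV k l v).1 (rightV k l u).1 then x (rightV k l u) - x (rightV k l v)
          else 1 := by
      intro u v
      split_ifs with h1 h2 h2
      · simp
      · exact absurd h1 h2
      · exact absurd h2 h1
      · simp
    simp only [hL, hR]
    rw [show ∀ a b c d : K (k + l), a * b * (c * d) = a * d * (b * c) from fun a b c d => by ring]
    rfl
  rw [shNum, hz, hk, hp, map_mul, map_mul]
  ring

end Numerator

end

section

/-! ### Evaluation at coloured finite sets of points -/

section Ev

variable {I : Type*} [Fintype I] [DecidableEq I] {C : CartanDatum I} (O : DynOrientation C)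
variable {ι : Type*} {cl : ι → I} {E : Type*} [Field E] [Algebra Fq E] {p : ι → E}

variable (cl p) in
/-- The value of the numerator of `F` at the points of `A`. -/
def ev (F : T I) (A : Finset ι) : E :=
  evalRat (fun v => p (enum cl A v)) (F (cnt cl A) * poleDen O (cnt cl A))

theorem evalRat_comp_permV {k : I → ℕ} {f : K k} (hf : f ∈ symLaurent k) {p : V k → E}
    (hp : ∀ v, p v ≠ 0) (σ : ∀ i, Equiv.Perm (Fin (k i))) :
    evalRat (fun v => p (permV σ v)) f = evalRat p f := by
  have := (hasVal_laurent (p := fun v => p (permV σ v)) (fun v => hp _) hf.1).relabel (permV σ)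
  rw [hf.2] at this
  exact this.evalRat_eq.symm

theorem ev_of (hp : ∀ u, p u ≠ 0) {k : I → ℕ} {F : K k} (hF : F ∈ bigComp O k) {A : Finset ι}
    {e : V k → ι} (he : IsEnum cl e A) :
    ev O cl p (DirectSum.of (fun k : I → ℕ => K k) k F) A
      = evalRat (fun v => p (e v)) (F * poleDen O k) := by
  obtain rfl := he.cnt_eq
  rw [ev, DirectSum.of_eq_same]
  obtain ⟨σ, hσ⟩ := (isEnum_enum cl A).exists_perm he
  simp only [hσ]
  exact (evalRat_comp_permV hF (p := fun v => p (enum cl A v)) (fun v => hp _) σ).symm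

theorem evalRat_zero {σ : Type*} (p : σ → E) : evalRat p (0 : Rat σ) = 0 :=
  (hasVal_zero p).evalRat_eq

theorem ev_of_ne {k : I → ℕ} (F : K k) {A : Finset ι} (h : cnt cl A ≠ k) :
    ev O cl p (DirectSum.of (fun k : I → ℕ => K k) k F) A = 0 := by
  rw [ev, DirectSum.of_eq_of_ne _ _ _ h, zero_mul, evalRat_zero]

theorem hasVal_ev (hp : ∀ u, p u ≠ 0) {F : T I} (hF : F ∈ bigS O) (A : Finset ι) :
    HasVal (fun v => p (enum cl A v)) (F (cnt cl A) * poleDen O (cnt cl A)) (ev O cl p F A) :=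
  hasVal_laurent (fun _ => hp _) (hF (cnt cl A)).1

theorem ev_add (hp : ∀ u, p u ≠ 0) {F G : T I} (hF : F ∈ bigS O) (hG : G ∈ bigS O) (A : Finset ι) :
    ev O cl p (F + G) A = ev O cl p F A + ev O cl p G A := by
  rw [← ((hasVal_ev O hp hF A).add (hasVal_ev O hp hG A)).evalRat_eq, ev, DirectSum.add_apply, add_mul]

theorem ev_smul (hp : ∀ u, p u ≠ 0) (c : Fq) {F : T I} (hF : F ∈ bigS O) (A : Finset ι) :
    ev O cl p (c • F) A = c • ev O cl p F A := by
  rw [← ((hasVal_ev O hp hF A).smul c).evalRat_eq, ev, DirectSum.smul_apply, smul_mul_assoc]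

theorem ev_zero (A : Finset ι) : ev O cl p 0 A = 0 := by
  rw [ev, DirectSum.zero_apply, zero_mul, evalRat_zero]

theorem ev_eq_ev_of {k : I → ℕ} (F : T I) {A : Finset ι} (h : cnt cl A = k) :
    ev O cl p F A = ev O cl p (DirectSum.of (fun k : I → ℕ => K k) k (F k)) A := by
  subst h
  rw [ev, ev, DirectSum.of_eq_same]

/-- Points whose coordinates are nonzero, and distinct within each colour. -/
structure Admissible (cl : ι → I) (p : ι → E) : Prop where
  ne_zero : ∀ u, p u ≠ 0
  ne : ∀ u v, u ≠ v → cl u = cl v → p u ≠ p v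

variable [DecidableEq ι]

variable (cl p) in
/-- The product of the factors `kap` over all pairs of points. -/
def kapProd (A B : Finset ι) : E := ∏ u ∈ A, ∏ v ∈ B, kap O (cl u) (cl v) (p u) (p v)

theorem IsEnum.prod_eq {k : I → ℕ} {e : V k → ι} {A : Finset ι} (he : IsEnum cl e A)
    {R : Type*} [CommMonoid R] (f : ι → R) : ∏ u ∈ A, f u = ∏ v, f (e v) := by
  rw [← Finset.prod_image (s := (Finset.univ : Finset (V k))) (g := e) fun _ _ _ _ h => he.inj h]
  congr 1
  ext u
  simp [he.mem]

theorem hasVal_shMulComp_mul_poleDen (hp : Admissible cl p) {k l : I → ℕ} {F : K k} {G : K l}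
    (hF : F ∈ bigComp O k) (hG : G ∈ bigComp O l) {e : V (k + l) → ι} {S : Finset ι}
    (he : IsEnum cl e S) :
    HasVal (fun v => p (e v)) (shMulComp C k l F G * poleDen O (k + l))
      (∑ A ∈ S.powerset, ev O cl p (DirectSum.of (fun k : I → ℕ => K k) k F) A *
        ev O cl p (DirectSum.of (fun k : I → ℕ => K k) l G) (S \ A) * kapProd O cl p A (S \ A)) := by
  set H : Finset ι → E := fun A => ev O cl p (DirectSum.of (fun k : I → ℕ => K k) k F) A *
        ev O cl p (DirectSum.of (fun k : I → ℕ => K k) l G) (S \ A) * kapProd O cl p A (S \ A) with hH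
  have hsum : ∑ A ∈ S.powerset, H A = ∑ A ∈ S.powerset.filter (fun B => cnt cl B = k), H A := by
    rw [Finset.sum_filter]
    refine Finset.sum_congr rfl fun A _ => ?_
    split_ifs with h
    · rfl
    · simp only [hH, ev_of_ne O F h, zero_mul]
  set N : ℕ := ∏ i, ((k i).factorial * (l i).factorial) with hN
  have hN0 : (N : Fq) ≠ 0 := by
    rw [Nat.cast_ne_zero, hN]
    exact Finset.prod_ne_zero_iff.2 fun i _ =>
      mul_ne_zero (Nat.factorial_ne_zero _) (Nat.factorial_ne_zero _)
  have hval : ∑ A ∈ S.powerset, H A = (N : Fq)⁻¹ •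
      ∑ σ : (∀ i, Equiv.Perm (Fin ((k + l) i))), H (leftSet k l fun v => e (permV σ v)) := by
    rw [he.sum_leftSet, hsum, Algebra.smul_def, map_inv₀, map_natCast, ← mul_assoc,
      inv_mul_cancel₀, one_mul]
    rw [← map_natCast (algebraMap Fq E), Ne, map_eq_zero]
    exact hN0
  rw [shMulComp_mul_poleDen, hval]
  refine HasVal.smul _ (HasVal.sum _ fun σ _ => HasVal.relabel _ ?_)
  have heσ := he.comp_permV σ
  refine HasVal.mul (HasVal.mul ?_ ?_) ?_
  · refine HasVal.relabel _ ?_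
    rw [ev_of O hp.ne_zero hF heσ.left]
    exact hasVal_laurent (fun _ => hp.ne_zero _) hF.1
  · refine HasVal.relabel _ ?_
    rw [ev_of O hp.ne_zero hG heσ.right]
    exact hasVal_laurent (fun _ => hp.ne_zero _) hG.1
  · rw [kapProd, heσ.left.prod_eq]
    refine HasVal.prod _ fun u _ => ?_
    rw [heσ.right.prod_eq]
    refine HasVal.prod _ fun v _ => ?_
    refine (HasVal.kap O u.1 v.1 (hasVal_x _ _) (hasVal_x _ _) ?_).congr ?_
    · intro huv
      refine hp.ne _ _ (fun h => leftV_ne_rightV u v (heσ.inj h)) ?_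
      rw [heσ.colour, heσ.colour]
      exact huv
    · rw [heσ.colour, heσ.colour]
      rfl

theorem cnt_sdiff_add {A S : Finset ι} (h : A ⊆ S) :
    cnt cl A + cnt cl (S \ A) = cnt cl S := by
  funext i
  simp only [cnt, Pi.add_apply]
  rw [← Finset.card_union_of_disjoint, ← Finset.filter_union, Finset.union_sdiff_of_subset h]
  exact Finset.disjoint_filter_filter Finset.disjoint_sdiff

theorem shMul_of_of {k l : I → ℕ} (F : K k) (G : K l) :
    shMul C (DirectSum.of (fun k : I → ℕ => K k) k F) (DirectSum.of (fun k : I → ℕ => K k) l G)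
      = DirectSum.of (fun k : I → ℕ => K k) (k + l) (shMulComp C k l F G) := by
  simp only [← DirectSum.lof_eq_of Fq, shMul, DirectSum.toModule_lof, LinearMap.flip_apply,
    LinearMap.compr₂_apply]
  rfl

theorem ev_shMul_of (hp : Admissible cl p) {k l : I → ℕ} {F : K k} {G : K l}
    (hF : F ∈ bigComp O k) (hG : G ∈ bigComp O l) (S : Finset ι) :
    ev O cl p (shMul C (DirectSum.of (fun k : I → ℕ => K k) k F)
        (DirectSum.of (fun k : I → ℕ => K k) l G)) S
      = ∑ A ∈ S.powerset, ev O cl p (DirectSum.of (fun k : I → ℕ => K k) k F) A *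
        ev O cl p (DirectSum.of (fun k : I → ℕ => K k) l G) (S \ A) * kapProd O cl p A (S \ A) := by
  rw [shMul_of_of]
  by_cases h : cnt cl S = k + l
  · obtain ⟨e, he⟩ := exists_enum cl S
    have key : ∀ m (e : V m → ι), IsEnum cl e S → m = k + l → ∃ e : V (k + l) → ι, IsEnum cl e S := by
      rintro m e he rfl
      exact ⟨e, he⟩
    obtain ⟨e, he⟩ := key _ e he h
    rw [← (hasVal_shMulComp_mul_poleDen O hp hF hG he).evalRat_eq, ev]
    have key : ∀ m (e' : V m → ι), IsEnum cl e' S → m = k + l →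
      evalRat (fun v => p (e' v)) ((DirectSum.of (fun k : I → ℕ => K k) (k + l)
        (shMulComp C k l F G)) m * poleDen O m) =
      evalRat (fun v => p (e v)) (shMulComp C k l F G * poleDen O (k + l)) := by
      rintro m e' he' rfl
      rw [DirectSum.of_eq_same]
      obtain ⟨σ, hσ⟩ := he'.exists_perm he
      have h1 := hasVal_shMulComp_mul_poleDen O hp hF hG he
      have h2 := hasVal_shMulComp_mul_poleDen O hp hF hG he'
      rw [h1.evalRat_eq, h2.evalRat_eq]
    exact key _ _ (isEnum_enum cl S) h
  · rw [ev_of_ne O _ h]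
    refine (Finset.sum_eq_zero fun A hA => ?_).symm
    by_cases h1 : cnt cl A = k
    · by_cases h2 : cnt cl (S \ A) = l
      · exact absurd (by rw [← cnt_sdiff_add (Finset.mem_powerset.1 hA), h1, h2]) h
      · rw [ev_of_ne O G h2, mul_zero, zero_mul]
    · rw [ev_of_ne O F h1, zero_mul, zero_mul]

theorem sum_of_mem_bigS {F : T I} (hF : F ∈ bigS O) (s : Finset (I → ℕ)) :
    ∑ k ∈ s, DirectSum.of (fun k : I → ℕ => K k) k (F k) ∈ bigS O :=
  sum_mem fun k _ => of_mem_bigS O (hF k)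

theorem eq_sum_of (F : T I) : ∃ s : Finset (I → ℕ),
    F = ∑ k ∈ s, DirectSum.of (fun k : I → ℕ => K k) k (F k) := by
  classical
  exact ⟨DFinsupp.support F, (DirectSum.sum_support_of F).symm⟩

/-- Induction on elements of the big shuffle algebra. -/
theorem bigS_induction {P : T I → Prop} (h0 : P 0)
    (hof : ∀ k (F : K k), F ∈ bigComp O k → P (DirectSum.of (fun k : I → ℕ => K k) k F))
    (hadd : ∀ F ∈ bigS O, ∀ G ∈ bigS O, P F → P G → P (F + G)) {F : T I} (hF : F ∈ bigS O) : P F := by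
  classical
  obtain ⟨s, hs⟩ := eq_sum_of F
  have key : ∀ s : Finset (I → ℕ),
      P (∑ k ∈ s, DirectSum.of (fun k : I → ℕ => K k) k (F k)) := fun s => by
    induction s using Finset.induction_on with
    | empty => simpa using h0
    | insert k s hk ih =>
      rw [Finset.sum_insert hk]
      exact hadd _ (of_mem_bigS O (hF k)) _ (sum_of_mem_bigS O hF s) (hof k _ (hF k)) ih
  rw [hs]
  exact key s

end Ev

end

section

/-! ### Divisibility by differences of variables -/

section Linear

variable {σ R : Type*} [Field R] [DecidableEq σ]

/-- The substitution `X_v ↦ c X_u`. -/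
def substVar (v u : σ) (c : R) : MvPolynomial σ R →ₐ[R] MvPolynomial σ R :=
  MvPolynomial.aeval fun t => if t = v then MvPolynomial.C c * MvPolynomial.X u else MvPolynomial.X t

theorem substVar_X (v u t : σ) (c : R) : substVar v u c (MvPolynomial.X t) =
    if t = v then MvPolynomial.C c * MvPolynomial.X u else MvPolynomial.X t := by
  rw [substVar, MvPolynomial.aeval_X]

theorem substVar_linear {v u : σ} (h : v ≠ u) (c : R) :
    substVar v u c (MvPolynomial.X v - MvPolynomial.C c * MvPolynomial.X u) = 0 := by
  rw [map_sub, map_mul, substVar_X, substVar_X, if_pos rfl, if_neg h.symm, ← MvPolynomial.algebraMap_eq,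
    AlgHom.commutes, sub_self]

theorem linear_dvd_iff {v u : σ} (h : v ≠ u) (c : R) (n : MvPolynomial σ R) :
    MvPolynomial.X v - MvPolynomial.C c * MvPolynomial.X u ∣ n ↔ substVar v u c n = 0 := by
  constructor
  · rintro ⟨m, rfl⟩
    rw [map_mul, substVar_linear h, zero_mul]
  · intro hn
    have key : ∀ n : MvPolynomial σ R,
        MvPolynomial.X v - MvPolynomial.C c * MvPolynomial.X u ∣ n - substVar v u c n := fun n => by
      induction n using MvPolynomial.induction_on with
      | C a => rw [← MvPolynomial.algebraMap_eq, AlgHom.commutes, sub_self]; exact dvd_zero _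
      | add f g hf hg => rw [map_add, add_sub_add_comm]; exact dvd_add hf hg
      | mul_X f t hf =>
        rw [map_mul, substVar_X]
        split_ifs with ht
        · subst ht
          rw [show f * MvPolynomial.X t - substVar t u c f * (MvPolynomial.C c * MvPolynomial.X u) =
            (f - substVar t u c f) * (MvPolynomial.C c * MvPolynomial.X u) +
              f * (MvPolynomial.X t - MvPolynomial.C c * MvPolynomial.X u) by ring]
          exact dvd_add (hf.mul_right _) (dvd_mul_left _ _)
        · rw [← sub_mul]
          exact hf.mul_right _
    have := key n
    rwa [hn, sub_zero] at this

theorem prime_linear {v u : σ} (h : v ≠ u) (c : R) :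
    Prime (MvPolynomial.X v - MvPolynomial.C c * MvPolynomial.X u) := by
  refine ⟨?_, ?_, ?_⟩
  · intro h0
    have h1 := congrArg (MvPolynomial.aeval fun t => if t = v then (1 : R) else 0) h0
    simp [h.symm] at h1
  · intro hu
    have := hu.map (substVar v u c)
    rw [substVar_linear h] at this
    exact not_isUnit_zero this
  · intro f g hfg
    rw [linear_dvd_iff h, map_mul, mul_eq_zero] at hfg
    rw [linear_dvd_iff h, linear_dvd_iff h]
    exact hfg

theorem C_mul_X_sub_ne_zero {s t : σ} {a b : R} (ha : a ≠ 0) (h : s = t → a ≠ b) :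
    (MvPolynomial.C a * MvPolynomial.X s - MvPolynomial.C b * MvPolynomial.X t : MvPolynomial σ R) ≠ 0 := by
  intro h0
  have h1 := congrArg (MvPolynomial.aeval fun r => if r = s then (1 : R) else 0) h0
  by_cases hst : s = t
  · subst hst
    simp at h1
    exact h rfl (sub_eq_zero.1 h1)
  · simp [Ne.symm hst] at h1
    exact ha h1

theorem substVar_linear_ne_zero {v u v' u' : σ} (h' : v' ≠ u') {c c' : R} (hc : c ≠ 0)
    (h1 : ¬ (v' = v ∧ u' = u ∧ c' = c)) (h2 : ¬ (v' = u ∧ u' = v)) :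
    substVar v u c (MvPolynomial.X v' - MvPolynomial.C c' * MvPolynomial.X u') ≠ 0 := by
  have hC : substVar v u c (MvPolynomial.C c') = MvPolynomial.C c' := by
    rw [← MvPolynomial.algebraMap_eq, AlgHom.commutes]
  rw [map_sub, map_mul, substVar_X, substVar_X, hC]
  split_ifs with hv hu hu
  · exact absurd (hv.trans hu.symm) h'
  · refine C_mul_X_sub_ne_zero hc fun h3 h4 => h1 ⟨hv, h3.symm, h4.symm⟩
  · rw [← mul_assoc, ← map_mul, ← one_mul (MvPolynomial.X v'), ← map_one MvPolynomial.C]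
    exact C_mul_X_sub_ne_zero one_ne_zero fun h3 => absurd ⟨h3, hu⟩ h2
  · rw [← one_mul (MvPolynomial.X v'), ← map_one MvPolynomial.C]
    exact C_mul_X_sub_ne_zero one_ne_zero fun h3 => absurd h3 h'

theorem isRelPrime_linear {v u v' u' : σ} (h : v ≠ u) (h' : v' ≠ u') {c c' : R} (hc : c ≠ 0)
    (h1 : ¬ (v' = v ∧ u' = u ∧ c' = c)) (h2 : ¬ (v' = u ∧ u' = v)) :
    IsRelPrime (MvPolynomial.X v - MvPolynomial.C c * MvPolynomial.X u)
      (MvPolynomial.X v' - MvPolynomial.C c' * MvPolynomial.X u' : MvPolynomial σ R) := by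
  rw [(prime_linear h c).irreducible.isRelPrime_iff_not_dvd, linear_dvd_iff h]
  exact substVar_linear_ne_zero h' hc h1 h2

theorem aeval_substVar {E : Type*} [CommRing E] [Algebra R E] (v u : σ) (c : R) (p : σ → E)
    (n : MvPolynomial σ R) : MvPolynomial.aeval p (substVar v u c n) =
      MvPolynomial.aeval (fun t => if t = v then algebraMap R E c * p u else p t) n := by
  rw [substVar, ← AlgHom.comp_apply]
  congr 1
  ext t
  rw [AlgHom.comp_apply, MvPolynomial.aeval_X, MvPolynomial.aeval_X]
  split_ifs <;> simp

end Linear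

/-! ### The big shuffle space is closed under the shuffle product -/

section Closed

variable {I : Type*} [Fintype I]

/-- The product of Vandermonde determinants, one for each colour. -/
def vand (k : I → ℕ) : K k := ∏ i, (Matrix.vandermonde fun r : Fin (k i) => (x ⟨i, r⟩ : K k)).det

theorem relabel_vand {k : I → ℕ} (σ : ∀ i, Equiv.Perm (Fin (k i))) :
    relabel (permV σ) (vand k) = ((∏ i, (Equiv.Perm.sign (σ i) : ℤ) : ℤ) : K k) * vand k := by
  rw [vand, map_prod, Int.cast_prod, ← Finset.prod_mul_distrib]
  refine Finset.prod_congr rfl fun i _ => ?_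
  rw [AlgHom.map_det, ← Matrix.det_permute]
  congr 1
  ext r s
  simp only [AlgHom.mapMatrix_apply, Matrix.map_apply, Matrix.vandermonde_apply, map_pow, relabel_x,
    Matrix.submatrix_apply, id]
  rfl

open Classical in
/-- The pairs of variables of equal colour, in increasing order. -/
def pairs (k : I → ℕ) : Finset (V k × V k) :=
  Finset.univ.filter fun z => z.1.1 = z.2.1 ∧ (z.1.2 : ℕ) < z.2.2

theorem vand_eq (k : I → ℕ) : vand k = ∏ z ∈ pairs k, (x z.2 - x z.1) := by
  classical
  rw [vand, pairs, Finset.prod_filter, ← Finset.univ_product_univ, Finset.prod_product, prod_V]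
  refine Finset.prod_congr rfl fun i _ => ?_
  rw [Matrix.det_vandermonde]
  refine Finset.prod_congr rfl fun r _ => ?_
  rw [prod_V, Finset.prod_eq_single i]
  · rw [show Finset.Ioi r = Finset.univ.filter fun s => r < s by ext; simp, Finset.prod_filter]
    simp
  · intro j _ hj
    exact Finset.prod_eq_one fun s _ => if_neg fun h => hj h.1.symm
  · simp

theorem vand_ne_zero (k : I → ℕ) : vand k ≠ 0 := by
  rw [vand_eq, Finset.prod_ne_zero_iff]
  rintro ⟨u, v⟩ h h0
  simp only [pairs, Finset.mem_filter, Finset.mem_univ, true_and] at h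
  have := MvPolynomial.X_injective
    (IsFractionRing.injective (MvPolynomial (V k) Fq) (K k) (sub_eq_zero.1 h0))
  simp only at this
  subst this
  exact lt_irrefl _ h.2

theorem div_vand_mem_laurent {k : I → ℕ} {N : K k} (hN : N ∈ laurent k)
    (hanti : ∀ σ : ∀ i, Equiv.Perm (Fin (k i)), (∏ i, (Equiv.Perm.sign (σ i) : ℤ)) = -1 →
      relabel (permV σ) N = -N) : N * (vand k)⁻¹ ∈ laurent k := by
  classical
  obtain ⟨n, s, hn⟩ := exists_monomial_mul hN
  have hdvd : (∏ z ∈ pairs k, (MvPolynomial.X z.2 - MvPolynomial.C (1 : Fq) * MvPolynomial.X z.1)) ∣ n := by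
    refine Finset.prod_dvd_of_isRelPrime ?_ ?_
    · rintro ⟨u, v⟩ hz ⟨u', v'⟩ hz' hne
      simp only [pairs, Finset.coe_filter, Finset.mem_univ, true_and, Set.mem_ofPred_eq] at hz hz'
      have h1 : v ≠ u := by rintro rfl; exact lt_irrefl _ hz.2
      have h2 : v' ≠ u' := by rintro rfl; exact lt_irrefl _ hz'.2
      refine isRelPrime_linear h1 h2 one_ne_zero ?_ ?_
      · rintro ⟨rfl, rfl, -⟩
        exact hne rfl
      · rintro ⟨rfl, rfl⟩
        exact lt_asymm hz.2 hz'.2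
    · rintro ⟨⟨i, r⟩, ⟨j, r'⟩⟩ hz
      simp only [pairs, Finset.mem_filter, Finset.mem_univ, true_and] at hz
      obtain ⟨rfl, hlt⟩ := hz
      have hrr : r ≠ r' := by rintro rfl; exact lt_irrefl _ hlt
      have h1 : (⟨i, r'⟩ : V k) ≠ ⟨i, r⟩ := by
        intro h
        simp only [Sigma.mk.injEq, heq_eq_eq, true_and] at h
        exact hrr h.symm
      simp only
      rw [linear_dvd_iff h1]
      let τ : ∀ i, Equiv.Perm (Fin (k i)) := Pi.mulSingle i (Equiv.swap r r')
      let p : V k → K k := fun t => if t = ⟨i, r'⟩ then algebraMap Fq (K k) 1 * x ⟨i, r⟩ else x t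
      have hp0 : ∀ t, p t ≠ 0 := by
        intro t
        simp only [p, map_one, one_mul]
        split_ifs <;> exact x_ne_zero _
      have hτ : ∀ t, p (permV τ t) = p t := by
        rintro ⟨j, t⟩
        change p ⟨j, τ j t⟩ = _
        by_cases hj : j = i
        · subst hj
          simp only [τ, Pi.mulSingle_eq_same, p, map_one, one_mul, Sigma.mk.injEq, heq_eq_eq, true_and]
          rcases eq_or_ne t r with rfl | h3
          · rw [Equiv.swap_apply_left, if_pos rfl, if_neg hrr]
          rcases eq_or_ne t r' with rfl | h4
          · rw [Equiv.swap_apply_right, if_neg hrr, if_pos rfl]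
          · rw [Equiv.swap_apply_of_ne_of_ne h3 h4]
        · simp only [τ, Pi.mulSingle_eq_of_ne hj, Equiv.Perm.coe_one, id]
      have hs : (∏ i, (Equiv.Perm.sign (τ i) : ℤ)) = -1 := by
        rw [Finset.prod_eq_single i]
        · simp [τ, Equiv.Perm.sign_swap hrr]
        · intro j _ hj
          simp [τ, Pi.mulSingle_eq_of_ne hj]
        · simp
      have hv := hasVal_laurent hp0 hN
      have hv' : HasVal p (relabel (permV τ) N) (evalRat p N) := by
        refine HasVal.relabel _ ?_
        simp only [hτ]
        exact hv
      rw [hanti τ hs] at hv'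
      have h0 : evalRat p N = 0 := by
        have := hv'.unique hv.neg
        have h2 : (2 : K k) * evalRat p N = 0 := by linear_combination this
        rcases mul_eq_zero.1 h2 with h | h
        · have : (algebraMap Fq (K k) 2) = 0 := by rw [map_ofNat]; exact h
          rw [map_eq_zero] at this
          exact absurd this two_ne_zero
        · exact h
      have hv2 := hv.mul (hasVal_poly p (MvPolynomial.monomial s 1))
      rw [hn, h0, zero_mul] at hv2
      have hn0 := hv2.unique (hasVal_poly p n)
      have key := aeval_substVar (⟨i, r'⟩ : V k) ⟨i, r⟩ (1 : Fq) (x : V k → K k) n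
      have h5 := (hasVal_poly (x : V k → K k) (substVar (⟨i, r'⟩ : V k) ⟨i, r⟩ (1 : Fq) n)).unique
        (hasVal_self _)
      rw [key] at h5
      refine IsFractionRing.injective (MvPolynomial (V k) Fq) (K k) ?_
      rw [← h5, map_zero]
      exact hn0.symm
  obtain ⟨m, hm⟩ := hdvd
  have hmon : algebraMap (MvPolynomial (V k) Fq) (K k) (MvPolynomial.monomial s 1) ≠ 0 := by
    have := aeval_monomial_ne_zero (fun v => x_ne_zero (k := k) v) s
    rwa [(hasVal_poly (x : V k → K k) (MvPolynomial.monomial s 1)).unique (hasVal_self _)] at this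
  have hmi : (algebraMap (MvPolynomial (V k) Fq) (K k) (MvPolynomial.monomial s 1))⁻¹ ∈ laurent k := by
    have : (algebraMap (MvPolynomial (V k) Fq) (K k) (MvPolynomial.monomial s 1)) =
        ∏ v ∈ s.support, (x v) ^ s v := by
      rw [MvPolynomial.monomial_eq, map_one, one_mul, Finsupp.prod, map_prod]
      simp only [map_pow]
      rfl
    rw [this, ← Finset.prod_inv_distrib]
    refine prod_mem fun v _ => ?_
    rw [← inv_pow]
    exact pow_mem (x_inv_mem_laurent v) _
  have hvd : algebraMap (MvPolynomial (V k) Fq) (K k)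
      (∏ z ∈ pairs k, (MvPolynomial.X z.2 - MvPolynomial.C (1 : Fq) * MvPolynomial.X z.1)) = vand k := by
    rw [vand_eq, map_prod]
    refine Finset.prod_congr rfl fun z _ => ?_
    rw [map_sub, map_one, one_mul, x, x]
  have : N * (vand k)⁻¹ = algebraMap (MvPolynomial (V k) Fq) (K k) m *
      (algebraMap (MvPolynomial (V k) Fq) (K k) (MvPolynomial.monomial s 1))⁻¹ := by
    rw [hm, map_mul, hvd] at hn
    have := vand_ne_zero k
    field_simp
    linear_combination hn
  rw [this]
  exact mul_mem (poly_mem_laurent m) hmi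

variable [DecidableEq I] {C : CartanDatum I} (O : DynOrientation C)

theorem kap_of_ne_mem_laurent {k : I → ℕ} (u v : V k) (h : u.1 ≠ v.1) :
    kap O u.1 v.1 (x u) (x v) ∈ laurent k := by
  have h1 : (x u - algebraMap Fq (K k) (qi C u.1 ^ (-C.c u.1 v.1)) * x v : K k) ∈ laurent k :=
    sub_mem (x_mem_laurent u) (mul_mem (Subalgebra.algebraMap_mem _ _) (x_mem_laurent v))
  rw [kap, if_neg h]
  split_ifs
  · exact h1
  · exact neg_mem h1
  · exact one_mem _

theorem kapProd_mul_vand_mem_laurent (k l : I → ℕ) :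
    (∏ u : V k, ∏ v : V l, kap O u.1 v.1 (x (leftV k l u)) (x (rightV k l v))) * vand (k + l)
      ∈ laurent (k + l) := by
  classical
  set P : Finset (V k × V l) := Finset.univ.filter fun z => z.1.1 = z.2.1 with hP
  let g : V k × V l → V (k + l) × V (k + l) := fun z => (leftV k l z.1, rightV k l z.2)
  have hg : Function.Injective g := fun z z' h =>
    Prod.ext ((leftV k l).injective (congrArg Prod.fst h)) ((rightV k l).injective (congrArg Prod.snd h))
  have hsub : P.image g ⊆ pairs (k + l) := by
    intro z hz
    obtain ⟨⟨⟨i, r⟩, ⟨j, s⟩⟩, hzP, rfl⟩ := Finset.mem_image.1 hz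
    have hij : i = j := (Finset.mem_filter.1 hzP).2
    subst hij
    simp only [pairs, Finset.mem_filter, Finset.mem_univ, true_and, g]
    refine ⟨rfl, ?_⟩
    change r.1 < k i + s.1
    omega
  rw [vand_eq, ← Finset.prod_sdiff hsub, Finset.prod_image hg.injOn,
    ← Finset.prod_product', Finset.univ_product_univ, hP, Finset.prod_filter]
  rw [mul_left_comm, ← Finset.prod_mul_distrib]
  refine mul_mem (prod_mem fun z _ => sub_mem (x_mem_laurent _) (x_mem_laurent _)) (prod_mem ?_)
  rintro ⟨u, v⟩ -
  split_ifs with h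
  · simp only at h
    simp only [g]
    rw [← h, kap_self, zeta, h]
    have hne : (x (leftV k l u) - x (rightV k l v) : K (k + l)) ≠ 0 :=
      sub_ne_zero.2 fun h => leftV_ne_rightV u v (MvPolynomial.X_injective
        (IsFractionRing.injective (MvPolynomial (V (k + l)) Fq) (K (k + l)) h))
    rw [show ∀ a b c : K (k + l), a / (b - c) * (c - b) = -(a * ((b - c) / (b - c))) from
      fun a b c => by rw [show c - b = -(b - c) by ring]; ring, div_self hne, mul_one]
    exact neg_mem (sub_mem (x_mem_laurent _)
      (mul_mem (Subalgebra.algebraMap_mem _ _) (x_mem_laurent _)))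
  · rw [mul_one]
    exact kap_of_ne_mem_laurent O (leftV k l u) (rightV k l v) h

theorem shMulComp_mem_bigComp {k l : I → ℕ} {F : K k} {G : K l} (hF : F ∈ bigComp O k)
    (hG : G ∈ bigComp O l) : shMulComp C k l F G ∈ bigComp O (k + l) := by
  set h := shNum O k l (F * poleDen O k) (G * poleDen O l) with hh
  set N := ∑ σ : (∀ i, Equiv.Perm (Fin ((k + l) i))), relabel (permV σ) h with hN
  have hsym : ∀ τ, relabel (permV τ) N = N := by
    intro τ
    rw [hN, map_sum]
    simp only [relabel_relabel]
    exact Fintype.sum_equiv (Equiv.mulLeft τ) _ _ fun σ => rfl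
  have hlau : h * vand (k + l) ∈ laurent (k + l) := by
    rw [hh, shNum, mul_assoc]
    exact mul_mem (mul_mem (relabel_mem_laurent _ hF.1) (relabel_mem_laurent _ hG.1))
      (kapProd_mul_vand_mem_laurent O k l)
  have hNv : N * vand (k + l) ∈ laurent (k + l) := by
    rw [hN, Finset.sum_mul]
    refine sum_mem fun σ _ => ?_
    have h1 := relabel_mem_laurent (permV σ) hlau
    rw [map_mul, relabel_vand, mul_left_comm] at h1
    have h2 : (((∏ i, (Equiv.Perm.sign (σ i) : ℤ) : ℤ) : K (k + l)) *
        ((∏ i, (Equiv.Perm.sign (σ i) : ℤ) : ℤ) : K (k + l))) = 1 := by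
      rw [← Int.cast_mul, ← Finset.prod_mul_distrib]
      simp [← Units.val_mul]
    have h3 : ((∏ i, (Equiv.Perm.sign (σ i) : ℤ) : ℤ) : K (k + l)) ∈ laurent (k + l) :=
      intCast_mem _ _
    have h4 := mul_mem h3 h1
    rwa [← mul_assoc, h2, one_mul] at h4
  have hNl : N ∈ laurent (k + l) := by
    have := div_vand_mem_laurent hNv fun σ hσ => by
      rw [map_mul, hsym, relabel_vand, hσ]
      push_cast
      ring
    rwa [mul_assoc, mul_inv_cancel₀ (vand_ne_zero _), mul_one] at this
  change shMulComp C k l F G * poleDen O (k + l) ∈ symLaurent (k + l)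
  rw [shMulComp_mul_poleDen]
  exact Submodule.smul_mem _ _ ⟨hNl, hsym⟩

theorem shMul_mem_bigS {F G : T I} (hF : F ∈ bigS O) (hG : G ∈ bigS O) : shMul C F G ∈ bigS O := by
  refine bigS_induction O (P := fun F => shMul C F G ∈ bigS O) ?_ ?_ ?_ hF
  · simp
  · intro k F hF
    refine bigS_induction O (P := fun G => shMul C _ G ∈ bigS O) ?_ ?_ ?_ hG
    · simp
    · intro l G hG
      rw [shMul_of_of]
      exact of_mem_bigS O (shMulComp_mem_bigComp O hF hG)
    · intro G _ G' _ h h'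
      rw [map_add]
      exact add_mem h h'
  · intro F _ F' _ h h'
    rw [map_add, LinearMap.add_apply]
    exact add_mem h h'

variable {ι : Type*} [DecidableEq ι] {cl : ι → I} {E : Type*} [Field E] [Algebra Fq E] {p : ι → E}

theorem ev_shMul (hp : Admissible cl p) {F G : T I} (hF : F ∈ bigS O) (hG : G ∈ bigS O)
    (S : Finset ι) : ev O cl p (shMul C F G) S =
      ∑ A ∈ S.powerset, ev O cl p F A * ev O cl p G (S \ A) * kapProd O cl p A (S \ A) := by
  have h0 := hp.ne_zero
  refine bigS_induction O (P := fun F => ev O cl p (shMul C F G) S =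
      ∑ A ∈ S.powerset, ev O cl p F A * ev O cl p G (S \ A) * kapProd O cl p A (S \ A)) ?_ ?_ ?_ hF
  · simp [ev_zero]
  · intro k F hF
    have hF' := of_mem_bigS O hF
    refine bigS_induction O (P := fun G => ev O cl p (shMul C _ G) S =
      ∑ A ∈ S.powerset, ev O cl p _ A * ev O cl p G (S \ A) * kapProd O cl p A (S \ A)) ?_ ?_ ?_ hG
    · simp [ev_zero]
    · intro l G hG
      exact ev_shMul_of O hp hF hG S
    · intro G hG G' hG' h h'
      rw [map_add, ev_add O h0 (shMul_mem_bigS O hF' hG) (shMul_mem_bigS O hF' hG'), h, h',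
        ← Finset.sum_add_distrib]
      refine Finset.sum_congr rfl fun A _ => ?_
      rw [ev_add O h0 hG hG']
      ring
  · intro F hF F' hF' h h'
    rw [map_add, LinearMap.add_apply, ev_add O h0 (shMul_mem_bigS O hF hG) (shMul_mem_bigS O hF' hG),
      h, h', ← Finset.sum_add_distrib]
    refine Finset.sum_congr rfl fun A _ => ?_
    rw [ev_add O h0 hF hF']
    ring

/-- Elements of the big shuffle algebra are determined by their values at generic points. -/
theorem eq_of_ev_eq {F G : T I} (hF : F ∈ bigS O) (hG : G ∈ bigS O)
    (h : ∀ k : I → ℕ, ev O (fun v : V k => v.1) (x : V k → K k) F Finset.univ =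
      ev O (fun v : V k => v.1) (x : V k → K k) G Finset.univ) : F = G := by
  have key : ∀ (k : I → ℕ) (F : T I), F ∈ bigS O →
      ev O (fun v : V k => v.1) (x : V k → K k) F Finset.univ = F k * poleDen O k := by
    intro k F hF
    have he : IsEnum (fun v : V k => v.1) (id : V k → V k) Finset.univ :=
      ⟨Function.injective_id, fun _ => rfl, fun u => by simp⟩
    have h1 := ev_of O (cl := fun v : V k => v.1) (x_ne_zero (k := k)) (hF k) he
    simp only [id] at h1
    rw [(hasVal_self _).evalRat_eq] at h1
    rw [← h1, ev_eq_ev_of O F he.cnt_eq]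
  refine DFinsupp.ext fun k => ?_
  have := h k
  rw [key k F hF, key k G hG] at this
  exact mul_right_cancel₀ (poleDen_ne_zero O k) this

theorem admissible_x (k : I → ℕ) : Admissible (fun v : V k => v.1) (x : V k → K k) :=
  ⟨x_ne_zero, fun _ _ h _ h' => h (x_injective h')⟩

end Closed

end

section

/-! ### The convolution algebra of functions on finite sets -/

/-- Functions on finite subsets of `ι`, with convolution twisted by `κ`. -/
def Conv {ι E : Type*} (_ : ι → ι → E) : Type _ := Finset ι → E

namespace Conv

variable {ι E : Type*} [DecidableEq ι] [Field E] (κ : ι → ι → E)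

instance : AddCommGroup (Conv κ) := inferInstanceAs (AddCommGroup (Finset ι → E))
instance {R : Type*} [Semiring R] [Module R E] : Module R (Conv κ) :=
  inferInstanceAs (Module R (Finset ι → E))

/-- The product of `κ` over pairs of points. -/
def kk (A B : Finset ι) : E := ∏ u ∈ A, ∏ v ∈ B, κ u v

variable {κ} in
theorem kk_union_left {A B D : Finset ι} (h : Disjoint A B) :
    kk κ (A ∪ B) D = kk κ A D * kk κ B D := Finset.prod_union h

variable {κ} in
theorem kk_union_right {A B D : Finset ι} (h : Disjoint A B) :
    kk κ D (A ∪ B) = kk κ D A * kk κ D B := by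
  rw [kk, kk, kk, ← Finset.prod_mul_distrib]
  exact Finset.prod_congr rfl fun u _ => Finset.prod_union h

@[simp] theorem kk_empty_left (A : Finset ι) : kk κ ∅ A = 1 := Finset.prod_empty
@[simp] theorem kk_empty_right (A : Finset ι) : kk κ A ∅ = 1 := by simp [kk]

instance : Mul (Conv κ) :=
  ⟨fun f g S => ∑ A ∈ S.powerset, f A * g (S \ A) * kk κ A (S \ A)⟩

instance : One (Conv κ) := ⟨fun S => if S = ∅ then 1 else 0⟩

variable {κ}

theorem mul_apply (f g : Conv κ) (S : Finset ι) :
    (f * g) S = ∑ A ∈ S.powerset, f A * g (S \ A) * kk κ A (S \ A) := rfl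

theorem one_apply (S : Finset ι) : (1 : Conv κ) S = if S = ∅ then 1 else 0 := rfl

theorem add_apply (f g : Conv κ) (S : Finset ι) : (f + g) S = f S + g S := rfl
theorem sub_apply (f g : Conv κ) (S : Finset ι) : (f - g) S = f S - g S := rfl
theorem zero_apply (S : Finset ι) : (0 : Conv κ) S = 0 := rfl
theorem smul_apply {R : Type*} [Semiring R] [Module R E] (c : R) (f : Conv κ) (S : Finset ι) :
    (c • f) S = c • f S := rfl
theorem sum_apply {α : Type*} (s : Finset α) (f : α → Conv κ) (S : Finset ι) :
    (∑ a ∈ s, f a) S = ∑ a ∈ s, f a S := Finset.sum_apply S s f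

@[ext] theorem ext {f g : Conv κ} (h : ∀ S, f S = g S) : f = g := funext h

protected theorem mul_assoc (f g h : Conv κ) : f * g * h = f * (g * h) := by
  ext S
  simp only [mul_apply, Finset.sum_mul, Finset.mul_sum]
  rw [Finset.sum_sigma', Finset.sum_sigma']
  refine Finset.sum_bij' (fun z _ => ⟨z.2, z.1 \ z.2⟩) (fun z _ => ⟨z.1 ∪ z.2, z.1⟩) ?_ ?_ ?_ ?_ ?_
  · rintro ⟨A, B⟩ hz
    simp only [Finset.mem_sigma, Finset.mem_powerset] at hz ⊢
    exact ⟨hz.2.trans hz.1, Finset.sdiff_subset_sdiff hz.1 subset_rfl⟩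
  · rintro ⟨A, B⟩ hz
    simp only [Finset.mem_sigma, Finset.mem_powerset] at hz ⊢
    exact ⟨Finset.union_subset hz.1 (hz.2.trans Finset.sdiff_subset), Finset.subset_union_left⟩
  · rintro ⟨A, B⟩ hz
    simp only [Finset.mem_sigma, Finset.mem_powerset] at hz
    simp [Finset.union_sdiff_of_subset hz.2]
  · rintro ⟨A, B⟩ hz
    simp only [Finset.mem_sigma, Finset.mem_powerset] at hz
    have : (A ∪ B) \ A = B := by
      rw [Finset.union_sdiff_left]
      exact Finset.sdiff_eq_self_of_disjoint (Finset.disjoint_of_subset_left hz.2 Finset.sdiff_disjoint)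
    simp [this]
  · rintro ⟨A, B⟩ hz
    simp only [Finset.mem_sigma, Finset.mem_powerset] at hz
    simp only
    have h1 : (S \ B) \ (A \ B) = S \ A := by
      ext u
      simp only [Finset.mem_sdiff]
      have := @hz.2 u
      tauto
    have h2 : kk κ A (S \ A) = kk κ B (S \ A) * kk κ (A \ B) (S \ A) := by
      rw [← kk_union_left Finset.disjoint_sdiff, Finset.union_sdiff_of_subset hz.2]
    have h3 : kk κ B (S \ B) = kk κ B (A \ B) * kk κ B (S \ A) := by
      rw [← kk_union_right]
      · congr 1
        ext u
        simp only [Finset.mem_sdiff, Finset.mem_union]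
        have := @hz.2 u
        have := @hz.1 u
        tauto
      · exact Finset.disjoint_of_subset_left Finset.sdiff_subset Finset.disjoint_sdiff
    rw [h1, h2, h3]
    ring

instance : Ring (Conv κ) where
  __ := (inferInstance : AddCommGroup (Conv κ))
  mul := (· * ·)
  one := 1
  mul_assoc := Conv.mul_assoc
  one_mul f := by
    ext S
    rw [mul_apply, Finset.sum_eq_single ∅]
    · simp [one_apply]
    · intro A _ hA
      rw [one_apply, if_neg hA, zero_mul, zero_mul]
    · simp
  mul_one f := by
    ext S
    rw [mul_apply, Finset.sum_eq_single S]
    · simp [one_apply]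
    · intro A hA hne
      rw [one_apply, if_neg, mul_zero, zero_mul]
      intro h
      exact hne (Finset.Subset.antisymm (Finset.mem_powerset.1 hA) (Finset.sdiff_eq_empty_iff_subset.1 h))
    · simp
  zero_mul f := by ext S; simp [mul_apply, zero_apply]
  mul_zero f := by ext S; simp [mul_apply, zero_apply]
  left_distrib f g h := by
    ext S
    simp only [mul_apply, add_apply, ← Finset.sum_add_distrib]
    exact Finset.sum_congr rfl fun A _ => by ring
  right_distrib f g h := by
    ext S
    simp only [mul_apply, add_apply, ← Finset.sum_add_distrib]
    exact Finset.sum_congr rfl fun A _ => by ring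

instance [Algebra Fq E] : Algebra Fq (Conv κ) :=
  Algebra.ofModule
    (fun c f g => by
      ext S
      simp only [mul_apply, smul_apply, Finset.smul_sum, smul_mul_assoc])
    (fun c f g => by
      ext S
      simp only [mul_apply, smul_apply, Finset.smul_sum, smul_mul_assoc, mul_smul_comm])

end Conv

/-! ### The big shuffle algebra -/

section BigAlgebra

variable {I : Type*} [Fintype I] [DecidableEq I] {C : CartanDatum I} (O : DynOrientation C)

theorem one_mem_bigComp : (1 : K (0 : I → ℕ)) ∈ bigComp O 0 := by
  change 1 * poleDen O 0 ∈ symLaurent 0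
  rw [one_mul]
  refine ⟨?_, fun σ => relabel_poleDen O σ⟩
  classical
  rw [poleDen]
  exact prod_mem fun i _ => prod_mem fun j _ => prod_mem fun r _ => r.elim0

theorem shOne_mem_bigS : shOne I ∈ bigS O := of_mem_bigS O (one_mem_bigComp O)

variable {ι : Type*} [DecidableEq ι] {cl : ι → I} {E : Type*} [Field E] [Algebra Fq E] {p : ι → E}

variable (cl p) in
/-- The kernel `kap` at given points. -/
def kapAt (u v : ι) : E := kap O (cl u) (cl v) (p u) (p v)

variable (cl p) in
/-- The values of an element of the shuffle algebra, as an element of the convolution algebra. -/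
def evC (F : T I) : Conv (kapAt O cl p) := ev O cl p F

theorem evC_mul (hp : Admissible cl p) {F G : T I} (hF : F ∈ bigS O) (hG : G ∈ bigS O) :
    evC O cl p (shMul C F G) = evC O cl p F * evC O cl p G :=
  funext fun S => ev_shMul O hp hF hG S

theorem isEnum_empty (e : V (0 : I → ℕ) → ι) : IsEnum cl e ∅ where
  inj := fun v => v.2.elim0
  colour := fun v => v.2.elim0
  mem u := by
    simp only [Finset.notMem_empty, false_iff, not_exists]
    exact fun v => v.2.elim0

theorem poleDen_zero : poleDen O (0 : I → ℕ) = 1 := by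
  classical
  rw [poleDen_eq']
  exact Finset.prod_eq_one fun v _ => v.2.elim0

theorem cnt_eq_zero {A : Finset ι} (h : cnt cl A = 0) : A = ∅ := by
  by_contra hA
  obtain ⟨u, hu⟩ := Finset.nonempty_iff_ne_empty.2 hA
  have h1 := congrFun h (cl u)
  simp only [cnt, Pi.zero_apply, Finset.card_eq_zero, Finset.filter_eq_empty_iff] at h1
  exact h1 hu rfl

theorem evC_one (hp : Admissible cl p) : evC O cl p (shOne I) = 1 := by
  ext S
  rw [Conv.one_apply]
  split_ifs with h
  · subst h
    rw [evC, shOne, ev_of O hp.ne_zero (one_mem_bigComp O) (isEnum_empty fun v => v.2.elim0),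
      poleDen_zero, one_mul, (hasVal_one _).evalRat_eq]
  · rw [evC, shOne, ev_of_ne]
    exact fun h' => h (cnt_eq_zero h')

theorem isShuffleAlgebra_bigS : IsShuffleAlgebra C (bigS O) where
  one_mem := shOne_mem_bigS O
  mul_mem _ hF _ hG := shMul_mem_bigS O hF hG
  one_mul F hF := eq_of_ev_eq O (shMul_mem_bigS O (shOne_mem_bigS O) hF) hF fun k =>
    congrFun (show evC O _ _ _ = evC O _ _ _ by
      rw [evC_mul O (admissible_x k) (shOne_mem_bigS O) hF, evC_one O (admissible_x k), one_mul]) _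
  mul_one F hF := eq_of_ev_eq O (shMul_mem_bigS O hF (shOne_mem_bigS O)) hF fun k =>
    congrFun (show evC O _ _ _ = evC O _ _ _ by
      rw [evC_mul O (admissible_x k) hF (shOne_mem_bigS O), evC_one O (admissible_x k), mul_one]) _
  mul_assoc F hF G hG H hH := by
    have hFG := shMul_mem_bigS O hF hG
    have hGH := shMul_mem_bigS O hG hH
    exact eq_of_ev_eq O (shMul_mem_bigS O hFG hH) (shMul_mem_bigS O hF hGH) fun k =>
      congrFun (show evC O _ _ _ = evC O _ _ _ by
        rw [evC_mul O (admissible_x k) hFG hH, evC_mul O (admissible_x k) hF hGH,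
          evC_mul O (admissible_x k) hF hG, evC_mul O (admissible_x k) hG hH, mul_assoc]) _

/-- Evaluation as a homomorphism of algebras. -/
def evHom (hp : Admissible cl p) (h : IsShuffleAlgebra C (bigS O)) :
    ShAlg h →ₐ[Fq] Conv (kapAt O cl p) :=
  AlgHom.ofLinearMap
    { toFun := fun F => evC O cl p F.val
      map_add' := fun F G => funext fun A => ev_add O hp.ne_zero F.2 G.2 A
      map_smul' := fun c F => funext fun A => ev_smul O hp.ne_zero c F.2 A }
    (evC_one O hp) fun F G => evC_mul O hp F.2 G.2

end BigAlgebra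

end

section

section Wheel

theorem q_ne_zero : q ≠ 0 := RatFunc.X_ne_zero

theorem q_pow_eq_one {n : ℕ} (h : q ^ n = 1) : n = 0 := by
  have key : ∀ n : ℕ, RatFunc.intDegree (q ^ n) = n := fun n => by
    induction n with
    | zero => simp
    | succ n ih =>
      rw [pow_succ, RatFunc.intDegree_mul (pow_ne_zero _ q_ne_zero) q_ne_zero, ih, q,
        RatFunc.intDegree_X]
      push_cast
      ring
  have := key n
  rw [h, RatFunc.intDegree_one] at this
  exact_mod_cast this.symm

theorem q_zpow_eq_one {n : ℤ} (h : q ^ n = 1) : n = 0 := by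
  obtain ⟨m, rfl | rfl⟩ := n.eq_nat_or_neg
  · rw [zpow_natCast] at h
    rw [q_pow_eq_one h]; rfl
  · rw [zpow_neg, inv_eq_one, zpow_natCast] at h
    rw [q_pow_eq_one h]; rfl

theorem q_zpow_injective {m n : ℤ} (h : q ^ m = q ^ n) : m = n := by
  have : q ^ (m - n) = 1 := by
    rw [zpow_sub₀ q_ne_zero, h, div_self (zpow_ne_zero _ q_ne_zero)]
  linarith [q_zpow_eq_one this]

variable {I : Type*} [Fintype I]

theorem qi_zpow (C : CartanDatum I) (i : I) (n : ℤ) : qi C i ^ n = q ^ ((C.d i : ℤ) * n) := by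
  rw [qi, ← zpow_natCast, ← zpow_mul]

theorem qi_zpow_injective (C : CartanDatum I) (i : I) {m n : ℤ} (h : qi C i ^ m = qi C i ^ n) :
    m = n := by
  rw [qi_zpow, qi_zpow] at h
  have := q_zpow_injective h
  exact mul_left_cancel₀ (by exact_mod_cast (C.d_pos i).ne') this

theorem qi_pow_injective (C : CartanDatum I) (i : I) {m n : ℕ} (h : qi C i ^ m = qi C i ^ n) :
    m = n := by
  have := qi_zpow_injective C i (m := m) (n := n) (by exact_mod_cast h)
  exact_mod_cast this

theorem mul_x_eq {k : I → ℕ} {a b : Fq} (ha : a ≠ 0) {u v : V k}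
    (h : algebraMap Fq (K k) a * x u = algebraMap Fq (K k) b * x v) : u = v ∧ a = b := by
  classical
  have h' : algebraMap (MvPolynomial (V k) Fq) (K k)
      (MvPolynomial.C a * MvPolynomial.X u - MvPolynomial.C b * MvPolynomial.X v) = 0 := by
    rw [map_sub, map_mul, map_mul, ← MvPolynomial.algebraMap_eq, ← IsScalarTower.algebraMap_apply,
      ← IsScalarTower.algebraMap_apply]
    exact sub_eq_zero.2 h
  rw [map_eq_zero_iff _ (IsFractionRing.injective (MvPolynomial (V k) Fq) (K k))] at h'
  by_contra hne
  exact C_mul_X_sub_ne_zero ha (fun h1 h2 => hne ⟨h1, h2⟩) h'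

theorem exists_perm_extend {m n : ℕ} (h : m ≤ n) (r : Fin m → Fin n) (hr : Function.Injective r) :
    ∃ σ : Equiv.Perm (Fin n), ∀ a, σ (Fin.castLE h a) = r a := by
  classical
  let e : {t // t ∈ Set.range (Fin.castLE h)} ≃ {t // t ∈ Set.range r} :=
    (Equiv.ofInjective _ (Fin.castLE_injective h)).symm.trans (Equiv.ofInjective r hr)
  refine ⟨e.extendSubtype, fun a => ?_⟩
  rw [e.extendSubtype_apply_of_mem _ ⟨a, rfl⟩]
  have : (⟨Fin.castLE h a, ⟨a, rfl⟩⟩ : {t // t ∈ Set.range (Fin.castLE h)}) =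
    Equiv.ofInjective _ (Fin.castLE_injective h) a := rfl
  simp only [e, Equiv.trans_apply, this, Equiv.symm_apply_apply]
  rfl

variable {C : CartanDatum I} (O : DynOrientation C) {E : Type*} [Field E] [Algebra Fq E]

/-- The wheel condition at points in arbitrary position. -/
theorem evalRat_eq_zero_of_wheel {k : I → ℕ} {F : K k} (hF : F ∈ wheelComp O k) {p : V k → E}
    (hp : ∀ v, p v ≠ 0) {i j : I} (hij : i ≠ j) (hc : C.c i j ≠ 0)
    (r : Fin ((-C.c i j).toNat + 1) → Fin (k i)) (s : Fin (k j)) (hr : Function.Injective r) {W : E}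
    (hr' : ∀ t, p ⟨i, r t⟩ = W * algebraMap Fq E (qi C i ^ (2 * (t : ℕ))))
    (hs : p ⟨j, s⟩ = W * algebraMap Fq E (qi C i ^ (-C.c i j))) :
    evalRat p (F * poleDen O k) = 0 := by
  classical
  have hneg := C.c_offDiag i j hij
  have hle : (-C.c i j).toNat + 1 ≤ k i := by
    simpa using Fintype.card_le_of_injective r hr
  have hj : 1 ≤ k j := by have := s.2; omega
  obtain ⟨σi, hσi⟩ := exists_perm_extend hle r hr
  obtain ⟨σj, hσj⟩ := exists_perm_extend hj (fun _ => s) (fun _ _ _ => Subsingleton.elim _ _)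
  let σ : ∀ i, Equiv.Perm (Fin (k i)) := Function.update (Pi.mulSingle i σi) j σj
  have h1 : ∀ t : Fin (k i), permV σ ⟨i, t⟩ = ⟨i, σi t⟩ := fun t => by
    change (⟨i, σ i t⟩ : V k) = _
    simp only [σ, Function.update_of_ne hij, Pi.mulSingle_eq_same]
  have h2 : ∀ t : Fin (k j), permV σ ⟨j, t⟩ = ⟨j, σj t⟩ := fun t => by
    change (⟨j, σ j t⟩ : V k) = _
    simp only [σ, Function.update_self]
  have hsym : F * poleDen O k ∈ symLaurent k := hF.1
  rw [← evalRat_comp_permV hsym hp σ]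
  have h0 : 0 < k i := by omega
  have hW : p (permV σ ⟨i, ⟨0, h0⟩⟩) = W := by
    rw [h1, show (⟨0, h0⟩ : Fin (k i)) = Fin.castLE hle 0 from rfl, hσi, hr']
    simp
  have hval : ∀ v, HasVal (fun v => p (permV σ v)) (wheelPt C i j (x ⟨i, ⟨0, h0⟩⟩) v)
      (p (permV σ v)) := by
    rintro ⟨i', t⟩
    unfold wheelPt
    split_ifs with h3 h4
    · obtain ⟨rfl, ht⟩ := h3
      simp only at ht
      refine ((hasVal_x _ _).mul (hasVal_const _ _)).congr ?_
      have ht' : (t : ℕ) < (-C.c i' j).toNat + 1 := by omega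
      rw [hW, h1, show t = Fin.castLE hle ⟨t, ht'⟩ from rfl, hσi, hr']
      rfl
    · obtain ⟨rfl, ht⟩ := h4
      simp only at ht
      refine ((hasVal_x _ _).mul (hasVal_const _ _)).congr ?_
      rw [hW, h2, show t = Fin.castLE hj 0 from Fin.ext ht, hσj, hs]
    · exact hasVal_x _ _
  have hf := hasVal_laurent (p := fun v => p (permV σ v)) (fun v => hp _) hsym.1
  have := (HasVal.comp hval hf).2
  have hz := hF.2 i j hij hc (by omega) (by omega) h0
  rw [hz] at this
  exact this.unique (hasVal_zero _)

variable [DecidableEq I] {ι : Type*} {cl : ι → I} {p : ι → E}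

theorem ev_eq_zero_of_wheel (hp : ∀ u, p u ≠ 0) {F : T I} (hF : F ∈ wheelS O) {A : Finset ι} {i j : I}
    (hij : i ≠ j) (hc : C.c i j ≠ 0) (U : ℕ → ι) (J : ι) {W : E}
    (hU : ∀ t : ℕ, (t : ℤ) ≤ -C.c i j → U t ∈ A ∧ cl (U t) = i ∧
      p (U t) = W * algebraMap Fq E (qi C i ^ (2 * t)))
    (hJ : J ∈ A) (hJc : cl J = j) (hJp : p J = W * algebraMap Fq E (qi C i ^ (-C.c i j))) :
    ev O cl p F A = 0 := by
  have hneg := C.c_offDiag i j hij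
  have hW : W ≠ 0 := by
    rintro rfl
    exact hp J (by rw [hJp, zero_mul])
  have he := isEnum_enum cl A
  have hidx : ∀ t : Fin ((-C.c i j).toNat + 1), ∃ r : Fin (cnt cl A i), enum cl A ⟨i, r⟩ = U t := by
    intro t
    obtain ⟨h1, h2, -⟩ := hU t (by have := t.2; omega)
    obtain ⟨⟨i', r⟩, hr⟩ := (he.mem _).1 h1
    have : i' = i := (he.colour ⟨i', r⟩).symm.trans ((congrArg cl hr).trans h2)
    subst this
    exact ⟨r, hr⟩
  choose r hr using hidx
  obtain ⟨⟨j', s⟩, hs⟩ := (he.mem _).1 hJ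
  have : j' = j := (he.colour ⟨j', s⟩).symm.trans ((congrArg cl hs).trans hJc)
  subst this
  refine evalRat_eq_zero_of_wheel O (hF (cnt cl A)) (fun v => hp _) hij hc r s ?_ (W := W) ?_ ?_
  · intro t t' htt
    have h1 := hr t
    rw [htt, hr] at h1
    have h2 := congrArg p h1
    rw [(hU t (by have := t.2; omega)).2.2, (hU t' (by have := t'.2; omega)).2.2] at h2
    have h3 := (algebraMap Fq E).injective (mul_left_cancel₀ hW h2)
    have := qi_pow_injective C i h3
    ext
    omega
  · intro t
    simp only [hr]
    exact (hU t (by have := t.2; omega)).2.2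
  · simp only [hs]
    exact hJp

variable [DecidableEq ι]

theorem ev_shMul_eq_zero_of_wheel (hp : Admissible cl p) {F G : T I} (hF : F ∈ wheelS O)
    (hG : G ∈ wheelS O) {A : Finset ι} {i j : I}
    (hij : i ≠ j) (hc : C.c i j ≠ 0) (U : ℕ → ι) (J : ι) {W : E}
    (hU : ∀ t : ℕ, (t : ℤ) ≤ -C.c i j → U t ∈ A ∧ cl (U t) = i ∧
      p (U t) = W * algebraMap Fq E (qi C i ^ (2 * t)))
    (hJ : J ∈ A) (hJc : cl J = j) (hJp : p J = W * algebraMap Fq E (qi C i ^ (-C.c i j))) :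
    ev O cl p (shMul C F G) A = 0 := by
  have hneg := C.c_offDiag i j hij
  obtain ⟨m, hm⟩ : ∃ m : ℕ, -C.c i j = m := ⟨(-C.c i j).toNat, by omega⟩
  rw [hm] at hU hJp
  have hqi := qi_ne_zero C i
  rw [ev_shMul O hp (wheelS_le_bigS O hF) (wheelS_le_bigS O hG)]
  refine Finset.sum_eq_zero fun B hB => ?_
  have hB := Finset.mem_powerset.1 hB
  by_contra hne
  have hkap : ∀ u ∈ B, ∀ v ∈ A \ B, kap O (cl u) (cl v) (p u) (p v) ≠ 0 := by
    intro u hu v hv h0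
    apply hne
    rw [kapProd, Finset.prod_eq_zero hu (Finset.prod_eq_zero hv h0), mul_zero]
  have hedge : ∀ {i j : I} (z w : E), i ≠ j → C.c i j ≠ 0 →
      z = algebraMap Fq E (qi C i ^ (-C.c i j)) * w → kap O i j z w = 0 := by
    intro i j z w hij hc h
    rcases (O.adj_iff i j hij).1 hc with h1 | h1
    · rw [kap_of_arr_left O h1, ← h, sub_self, neg_zero]
    · rw [kap_of_arr_right O h1, ← h, sub_self]
  have hstep : ∀ t : ℕ, t + 1 ≤ m → U t ∈ B → U (t + 1) ∈ B := by
    intro t ht hUt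
    by_contra hn
    obtain ⟨h1, h2, h3⟩ := hU (t + 1) (by exact_mod_cast ht)
    obtain ⟨-, h5, h6⟩ := hU t (by exact_mod_cast (Nat.le_of_succ_le ht))
    refine hkap _ hUt _ (Finset.mem_sdiff.2 ⟨h1, hn⟩) ?_
    rw [h2, h5, h3, h6, kap_self, zeta, C.c_diag]
    have : algebraMap Fq E (qi C i ^ (-2 : ℤ)) * (W * algebraMap Fq E (qi C i ^ (2 * (t + 1)))) =
        W * algebraMap Fq E (qi C i ^ (2 * t)) := by
      rw [mul_left_comm, ← map_mul, ← zpow_natCast, ← zpow_natCast, ← zpow_add₀ hqi]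
      congr 3
      push_cast
      ring
    rw [this, sub_self, zero_div]
  by_cases hJB : J ∈ B
  · have h0 : U 0 ∈ B := by
      by_contra hn
      obtain ⟨h1, h2, h3⟩ := hU 0 (by simp)
      refine hkap _ hJB _ (Finset.mem_sdiff.2 ⟨h1, hn⟩) ?_
      rw [hJc, h2]
      refine hedge _ _ hij.symm (C.c_ne_zero_symm hc) ?_
      rw [← qi_zpow_neg_c_symm, hJp, h3, hm]
      simp [mul_comm]
    have hall : ∀ t : ℕ, t ≤ m → U t ∈ B := fun t => by
      induction t with
      | zero => exact fun _ => h0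
      | succ t ih => exact fun ht => hstep t ht (ih (by omega))
    apply hne
    rw [ev_eq_zero_of_wheel O hp.ne_zero hF hij hc U J (W := W) _ hJB hJc (by rw [hJp, hm]), zero_mul,
      zero_mul]
    intro t ht
    rw [hm] at ht
    exact ⟨hall t (by exact_mod_cast ht), (hU t ht).2⟩
  · have h0 : U m ∉ B := by
      intro hn
      obtain ⟨h1, h2, h3⟩ := hU m le_rfl
      refine hkap _ hn _ (Finset.mem_sdiff.2 ⟨hJ, hJB⟩) ?_
      rw [hJc, h2]
      refine hedge _ _ hij hc ?_
      rw [h3, hJp, hm, mul_left_comm, ← map_mul, ← zpow_natCast, ← zpow_add₀ hqi]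
      congr 3
      push_cast
      ring
    have hall : ∀ t : ℕ, t ≤ m → U t ∉ B := by
      intro t ht htB
      have : ∀ s : ℕ, t ≤ s → s ≤ m → U s ∈ B := fun s hs => by
        induction s, hs using Nat.le_induction with
        | base => exact fun _ => htB
        | succ s hs ih => exact fun h => hstep s h (ih (by omega))
      exact h0 (this m ht le_rfl)
    apply hne
    rw [ev_eq_zero_of_wheel O hp.ne_zero hG hij hc U J (W := W) _ (Finset.mem_sdiff.2 ⟨hJ, hJB⟩) hJc
      (by rw [hJp, hm]), mul_zero, zero_mul]
    intro t ht
    rw [hm] at ht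
    exact ⟨Finset.mem_sdiff.2 ⟨(hU t ht).1, hall t (by exact_mod_cast ht)⟩, (hU t ht).2⟩

theorem wheelPt_eq (C : CartanDatum I) {k : I → ℕ} {i j : I} (h : 0 < k i) (v : V k) :
    ∃ (a : Fq) (u : V k), a ≠ 0 ∧
      wheelPt C i j (x ⟨i, ⟨0, h⟩⟩) v = algebraMap Fq (K k) a * x u ∧
      ((v.1 = i ∧ (v.2 : ℤ) ≤ -C.c i j ∧ u = ⟨i, ⟨0, h⟩⟩ ∧ a = qi C i ^ (2 * (v.2 : ℕ))) ∨
        (v.1 = j ∧ (v.2 : ℕ) = 0 ∧ u = ⟨i, ⟨0, h⟩⟩) ∨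
        (¬ (v.1 = i ∧ (v.2 : ℤ) ≤ -C.c i j) ∧ u = v ∧ a = 1)) := by
  unfold wheelPt
  split_ifs with h1 h2
  · exact ⟨_, _, pow_ne_zero _ (qi_ne_zero C i), mul_comm _ _, Or.inl ⟨h1.1, h1.2, rfl, rfl⟩⟩
  · exact ⟨_, _, zpow_ne_zero _ (qi_ne_zero C i), mul_comm _ _, Or.inr (Or.inl ⟨h2.1, h2.2, rfl⟩)⟩
  · exact ⟨1, v, one_ne_zero, by simp, Or.inr (Or.inr ⟨h1, rfl, rfl⟩)⟩

theorem admissible_wheelPt (C : CartanDatum I) {k : I → ℕ} {i j : I} (hij : i ≠ j) (h : 0 < k i) :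
    Admissible (fun v : V k => v.1) (wheelPt C i j (x ⟨i, ⟨0, h⟩⟩) : V k → K k) := by
  refine ⟨fun v => wheelPt_ne_zero C i j (x_ne_zero _) v, ?_⟩
  rintro ⟨i₁, r₁⟩ ⟨i₂, r₂⟩ hne hcol heq
  simp only at hcol
  subst hcol
  have hr : r₁ ≠ r₂ := by rintro rfl; exact hne rfl
  obtain ⟨a, u, ha, hau, h1⟩ := wheelPt_eq C h ⟨i₁, r₁⟩
  obtain ⟨b, v, hb, hbv, h2⟩ := wheelPt_eq C h ⟨i₁, r₂⟩
  rw [hau, hbv] at heq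
  obtain ⟨rfl, rfl⟩ := mul_x_eq ha heq
  simp only at h1 h2
  rcases h1 with ⟨e1, l1, u1, a1⟩ | ⟨e1, l1, u1⟩ | ⟨n1, u1, a1⟩ <;>
    rcases h2 with ⟨e2, l2, u2, a2⟩ | ⟨e2, l2, u2⟩ | ⟨n2, u2, a2⟩
  · rw [a1] at a2
    have := qi_pow_injective C i a2
    exact hr (Fin.ext (by omega))
  · exact hij (e1.symm.trans e2)
  · rw [u1] at u2
    simp only [Sigma.mk.injEq] at u2
    obtain ⟨rfl, h3⟩ := u2
    rw [← eq_of_heq h3] at n2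
    simp at n2
    have := C.c_offDiag i j hij
    omega
  · exact hij (e2.symm.trans e1)
  · exact hr (Fin.ext (by omega))
  · rw [u1] at u2
    exact hij ((congrArg Sigma.fst u2).trans e1)
  · rw [u2] at u1
    simp only [Sigma.mk.injEq] at u1
    obtain ⟨rfl, h3⟩ := u1
    rw [← eq_of_heq h3] at n1
    simp at n1
    have := C.c_offDiag i j hij
    omega
  · rw [u2] at u1
    exact hij ((congrArg Sigma.fst u1).trans e2)
  · rw [u1] at u2
    exact hne u2

theorem isEnum_id (k : I → ℕ) : IsEnum (fun v : V k => v.1) (id : V k → V k) Finset.univ :=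
  ⟨Function.injective_id, fun _ => rfl, fun u => by simp⟩

theorem shMul_mem_wheelS {F G : T I} (hF : F ∈ wheelS O) (hG : G ∈ wheelS O) :
    shMul C F G ∈ wheelS O := by
  have hFG := shMul_mem_bigS O (wheelS_le_bigS O hF) (wheelS_le_bigS O hG)
  refine fun k => ⟨hFG k, fun i j hij hc hk hj h => ?_⟩
  have hp := admissible_wheelPt C (j := j) hij h
  have h1 := ev_eq_ev_of O (p := wheelPt C i j (x ⟨i, ⟨0, h⟩⟩)) (shMul C F G) (isEnum_id k).cnt_eq
  rw [ev_of O hp.ne_zero (hFG k) (isEnum_id k)] at h1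
  refine h1.symm.trans ?_
  refine ev_shMul_eq_zero_of_wheel O hp hF hG hij hc
    (fun t => if ht : t < k i then ⟨i, ⟨t, ht⟩⟩ else ⟨i, ⟨0, h⟩⟩) ⟨j, ⟨0, hj⟩⟩ (W := x ⟨i, ⟨0, h⟩⟩)
    ?_ (Finset.mem_univ _) rfl ?_
  · intro t ht
    have hlt : t < k i := by omega
    refine ⟨Finset.mem_univ _, ?_, ?_⟩
    · split_ifs; rfl
    · rw [dif_pos hlt, wheelPt, if_pos ⟨rfl, ht⟩]
  · rw [wheelPt, if_neg (fun h => hij h.1.symm), if_pos ⟨rfl, rfl⟩]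

theorem of_mem_wheelS {k : I → ℕ} {F : K k} (hF : F ∈ wheelComp O k) :
    DirectSum.of (fun k : I → ℕ => K k) k F ∈ wheelS O := by
  intro l
  by_cases h : k = l
  · subst h
    rwa [DirectSum.of_eq_same]
  · rw [DirectSum.of_eq_of_ne _ _ _ (Ne.symm h)]
    exact zero_mem _

theorem shOne_mem_wheelS : shOne I ∈ wheelS O :=
  of_mem_wheelS O ⟨one_mem_bigComp O, fun _ _ _ _ _ _ h => absurd h (lt_irrefl 0)⟩

theorem isShuffleAlgebra_wheelS : IsShuffleAlgebra C (wheelS O) where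
  one_mem := shOne_mem_wheelS O
  mul_mem _ hF _ hG := shMul_mem_wheelS O hF hG
  one_mul F hF := (isShuffleAlgebra_bigS O).one_mul F (wheelS_le_bigS O hF)
  mul_one F hF := (isShuffleAlgebra_bigS O).mul_one F (wheelS_le_bigS O hF)
  mul_assoc F hF G hG H hH := (isShuffleAlgebra_bigS O).mul_assoc F (wheelS_le_bigS O hF) G
    (wheelS_le_bigS O hG) H (wheelS_le_bigS O hH)

end Wheel

end

section

/-! ### Symmetrization of products of affine functions -/

section Symmetrization

variable {E : Type*} [Field E] {n : ℕ} (t : E)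

/-- The increasing pairs of indices. -/
def incPairs (n : ℕ) : Finset (Fin n × Fin n) := Finset.univ.filter fun z => z.1 < z.2

/-- The product of `(z_a - t z_b) / (z_a - z_b)` over `a < b`. -/
def hlKernel (z : Fin n → E) : E :=
  ∏ y ∈ incPairs n, (z y.1 - t * z y.2) / (z y.1 - z y.2)

/-- The symmetrization of `∏_{a ∈ A} z_a` times the kernel. -/
def symMon (z : Fin n → E) (A : Finset (Fin n)) : E :=
  ∑ σ : Equiv.Perm (Fin n), hlKernel t (z ∘ σ) * ∏ a ∈ A, z (σ a)

variable {t} {z : Fin n → E}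

theorem symMon_move [CharZero E] (hz : Function.Injective z) (A : Finset (Fin n)) (a b : Fin n)
    (hab : (b : ℕ) = a + 1) (ha : a ∉ A) (hb : b ∉ A) :
    symMon t z (insert b A) = t * symMon t z (insert a A) := by
  have hlt : a < b := by rw [Fin.lt_def]; omega
  have hmem : (a, b) ∈ incPairs n := by simp [incPairs, hlt]
  set P := (incPairs n).erase (a, b) with hP
  let s : Equiv.Perm (Fin n) := Equiv.swap a b
  have hs : ∀ y ∈ P, (s y.1, s y.2) ∈ P := by
    rintro ⟨c, d⟩ hy
    simp only [hP, incPairs, Finset.mem_erase, Finset.mem_filter, Finset.mem_univ, true_and, ne_eq,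
      Prod.mk.injEq, Fin.lt_def, Fin.ext_iff] at hy ⊢
    simp only [s, Equiv.swap_apply_def, Fin.ext_iff]
    split_ifs <;> constructor <;> omega
  have hker : ∀ y : Fin n → E, ∏ w ∈ P, (y (s w.1) - t * y (s w.2)) / (y (s w.1) - y (s w.2)) =
      ∏ w ∈ P, (y w.1 - t * y w.2) / (y w.1 - y w.2) := fun y => by
    refine Finset.prod_bij' (fun w _ => (s w.1, s w.2)) (fun w _ => (s w.1, s w.2))
      hs hs ?_ ?_ ?_
    · intro w _; simp [s]
    · intro w _; simp [s]
    · intro w _; rfl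
  set R : (Fin n → E) → E := fun y => ∏ w ∈ P, (y w.1 - t * y w.2) / (y w.1 - y w.2) with hR
  have hK : ∀ y : Fin n → E, hlKernel t y = (y a - t * y b) / (y a - y b) * R y := fun y =>
    (Finset.mul_prod_erase _ _ hmem).symm
  have hG : ∀ σ : Equiv.Perm (Fin n), ∏ c ∈ A, z ((σ * s) c) = ∏ c ∈ A, z (σ c) := by
    intro σ
    refine Finset.prod_congr rfl fun c hc => ?_
    rw [Equiv.Perm.mul_apply, Equiv.swap_apply_of_ne_of_ne]
    · rintro rfl; exact ha hc
    · rintro rfl; exact hb hc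
  have hdouble : ∀ c, c ∉ A → 2 * symMon t z (insert c A) =
      ∑ σ : Equiv.Perm (Fin n), (R (z ∘ σ) * ∏ c ∈ A, z (σ c)) *
        ((z (σ a) - t * z (σ b)) / (z (σ a) - z (σ b)) * z (σ c) +
          (z (σ b) - t * z (σ a)) / (z (σ b) - z (σ a)) * z (σ (s c))) := by
    intro c hc
    have h1 : symMon t z (insert c A) = ∑ σ : Equiv.Perm (Fin n),
        hlKernel t (z ∘ (σ * s : Equiv.Perm (Fin n))) * ∏ d ∈ insert c A, z ((σ * s) d) :=
      (Fintype.sum_equiv (Equiv.mulRight s) _ _ fun σ => rfl).symm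
    rw [two_mul]
    nth_rw 2 [h1]
    rw [symMon, ← Finset.sum_add_distrib]
    refine Finset.sum_congr rfl fun σ _ => ?_
    rw [Finset.prod_insert hc, Finset.prod_insert hc, hG, hK, hK]
    have h2 : R (z ∘ (σ * s : Equiv.Perm (Fin n))) = R (z ∘ σ) := hker (z ∘ σ)
    rw [h2]
    simp only [Function.comp_apply, Equiv.Perm.mul_apply, s, Equiv.swap_apply_left,
      Equiv.swap_apply_right]
    ring
  have h2 : (2 : E) ≠ 0 := two_ne_zero
  refine mul_left_cancel₀ h2 ?_
  rw [mul_left_comm, hdouble b hb, hdouble a ha, Finset.mul_sum]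
  refine Finset.sum_congr rfl fun σ _ => ?_
  have hne : z (σ a) - z (σ b) ≠ 0 := sub_ne_zero.2 fun h => hlt.ne (σ.injective (hz h))
  have hne' : z (σ b) - z (σ a) ≠ 0 := sub_ne_zero.2 fun h => hlt.ne' (σ.injective (hz h))
  rw [mul_left_comm]
  congr 1
  simp only [s, Equiv.swap_apply_left, Equiv.swap_apply_right]
  rw [show z (σ b) - z (σ a) = -(z (σ a) - z (σ b)) by ring]
  field_simp
  ring

/-- The symmetrized monomials depend on the set of indices in a simple way. -/
theorem exists_symMon_eq [CharZero E] (ht : t ≠ 0) (hz : Function.Injective z) :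
    ∃ N : ℕ → E, ∀ A : Finset (Fin n), symMon t z A = t ^ (∑ a ∈ A, (a : ℕ)) * N A.card := by
  classical
  let I : ℕ → Finset (Fin n) := fun j => Finset.univ.filter fun a => (a : ℕ) < j
  let N : ℕ → E := fun j => (t ^ (∑ a ∈ I j, (a : ℕ)))⁻¹ * symMon t z (I j)
  refine ⟨N, fun A => ?_⟩
  induction hs : ∑ a ∈ A, (a : ℕ) using Nat.strong_induction_on generalizing A with
  | _ s ih =>
    by_cases hA : ∃ a b : Fin n, (b : ℕ) = a + 1 ∧ a ∉ A ∧ b ∈ A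
    · obtain ⟨a, b, hab, ha, hb⟩ := hA
      set B := A.erase b with hB
      have hbB : b ∉ B := Finset.notMem_erase b A
      have haB : a ∉ B := fun h => ha (Finset.mem_of_mem_erase h)
      have hAB : A = insert b B := (Finset.insert_erase hb).symm
      have hsB : s = b + ∑ c ∈ B, (c : ℕ) := by rw [← hs, hAB, Finset.sum_insert hbB]
      have hsum : ∑ c ∈ insert a B, (c : ℕ) = a + ∑ c ∈ B, (c : ℕ) := Finset.sum_insert haB
      have := ih _ (by omega) (insert a B) hsum
      rw [hAB, symMon_move hz B a b hab haB hbB, this, Finset.card_insert_of_notMem hbB,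
        Finset.card_insert_of_notMem haB, hsB, hab, ← mul_assoc, ← pow_succ']
      congr 2
      omega
    · have hdown : ∀ b ∈ A, ∀ a : Fin n, a ≤ b → a ∈ A := by
        intro b hb a hab
        by_contra ha
        have key : ∀ c : ℕ, (a : ℕ) ≤ c → ∀ hc : c < n, (⟨c, hc⟩ : Fin n) ∉ A := fun c hac => by
          induction c, hac using Nat.le_induction with
          | base => exact fun _ => ha
          | succ c hac ih =>
            intro hc hcA
            exact hA ⟨⟨c, by omega⟩, ⟨c + 1, hc⟩, rfl, ih (by omega), hcA⟩
        exact key b hab b.2 hb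
      have hI : A = I A.card := by
        have hsub : ∀ j : ℕ, (∀ a : Fin n, (a : ℕ) < j → a ∈ A) → j ≤ n → j ≤ A.card := by
          intro j hj hjn
          have : (Finset.univ : Finset (Fin j)).image (Fin.castLE hjn) ⊆ A := by
            intro a ha
            obtain ⟨c, -, rfl⟩ := Finset.mem_image.1 ha
            exact hj _ (by simp)
          have := Finset.card_le_card this
          rwa [Finset.card_image_of_injective _ (Fin.castLE_injective _), Finset.card_univ,
            Fintype.card_fin] at this
        refine Finset.eq_of_subset_of_card_le ?_ ?_
        · intro a ha
          simp only [I, Finset.mem_filter, Finset.mem_univ, true_and]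
          have := hsub (a + 1) (fun c hc => hdown a ha c (by rw [Fin.le_def]; omega)) (by omega)
          omega
        · refine le_of_le_of_eq (Finset.card_le_card_of_injOn (t := Finset.range A.card)
            (fun a => (a : ℕ)) ?_ ?_) (Finset.card_range _)
          · intro a ha
            simpa [I] using ha
          · intro a _ b _ h
            exact Fin.ext h
      simp only [N]
      rw [← hI, hs, mul_inv_cancel_left₀ (pow_ne_zero _ ht)]

theorem sum_hlKernel_mul_eq_zero [CharZero E] (ht : t ≠ 0) (hz : Function.Injective z) {m : ℕ}
    (c : ℕ → E) (α β : ℕ → Fin n → E)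
    (h : ∀ X : E, ∑ k ∈ Finset.range m, c k * ∏ a : Fin n,
      (α k a + β k a * t ^ (a : ℕ) * X) = 0) :
    ∑ σ : Equiv.Perm (Fin n), ∑ k ∈ Finset.range m, c k * (hlKernel t (z ∘ σ) *
      ∏ a : Fin n, (α k a + β k a * z (σ a))) = 0 := by
  classical
  replace h : ∑ k ∈ Finset.range m, Polynomial.C (c k) * ∏ a : Fin n,
      (Polynomial.C (α k a) + Polynomial.C (β k a * t ^ (a : ℕ)) * Polynomial.X) = 0 := by
    refine Polynomial.funext fun X => ?_
    simpa [Polynomial.eval_finsetSum, Polynomial.eval_prod] using h X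
  obtain ⟨N, hN⟩ := exists_symMon_eq (t := t) ht hz
  have hexp : ∀ k (A : Finset (Fin n)) (y : Fin n → E),
      ∏ a : Fin n, (α k a + β k a * y a) = ∑ A ∈ Finset.univ.powerset,
        ((∏ a ∈ A, β k a) * (∏ a ∈ Finset.univ \ A, α k a)) * ∏ a ∈ A, y a := by
    intro k A y
    rw [Finset.prod_congr rfl fun a _ => add_comm (α k a) (β k a * y a), Finset.prod_add]
    refine Finset.sum_congr rfl fun A _ => ?_
    rw [Finset.prod_mul_distrib]
    ring
  set B : ℕ → Finset (Fin n) → E := fun k A => (∏ a ∈ A, β k a) * (∏ a ∈ Finset.univ \ A, α k a) with hB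
  have hL : ∑ σ : Equiv.Perm (Fin n), ∑ k ∈ Finset.range m, c k * (hlKernel t (z ∘ σ) *
      ∏ a : Fin n, (α k a + β k a * z (σ a))) =
      ∑ k ∈ Finset.range m, ∑ A ∈ (Finset.univ : Finset (Fin n)).powerset,
        c k * B k A * (t ^ (∑ a ∈ A, (a : ℕ)) * N A.card) := by
    rw [Finset.sum_comm]
    refine Finset.sum_congr rfl fun k _ => ?_
    simp only [← hN, symMon, Finset.mul_sum]
    rw [Finset.sum_comm]
    refine Finset.sum_congr rfl fun σ _ => ?_
    rw [hexp k ∅ (fun a => z (σ a)), Finset.mul_sum, Finset.mul_sum]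
    refine Finset.sum_congr rfl fun A _ => ?_
    simp only [hB]
    ring
  have hpoly : ∀ j, ∑ k ∈ Finset.range m, ∑ A ∈ (Finset.univ : Finset (Fin n)).powerset,
      (if A.card = j then c k * B k A * t ^ (∑ a ∈ A, (a : ℕ)) else 0) = 0 := by
    intro j
    have h1 := congrArg (fun P => Polynomial.coeff P j) h
    simp only [Polynomial.finsetSum_coeff, Polynomial.coeff_zero] at h1
    refine Eq.trans ?_ h1
    refine Finset.sum_congr rfl fun k _ => ?_
    rw [Finset.prod_congr rfl fun a _ => add_comm (Polynomial.C (α k a)) _, Finset.prod_add,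
      Polynomial.coeff_C_mul, Polynomial.finsetSum_coeff, Finset.mul_sum]
    refine Finset.sum_congr rfl fun A _ => ?_
    rw [Finset.prod_mul_distrib, Finset.prod_const, ← map_prod, ← map_prod, Polynomial.coeff_mul_C,
      Polynomial.coeff_C_mul, Polynomial.coeff_X_pow, Finset.prod_mul_distrib,
      Finset.prod_pow_eq_pow_sum]
    simp only [hB, eq_comm (a := j)]
    split_ifs <;> ring
  rw [hL]
  have hsplit : ∀ k, ∑ A ∈ (Finset.univ : Finset (Fin n)).powerset,
        c k * B k A * (t ^ (∑ a ∈ A, (a : ℕ)) * N A.card) =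
      ∑ j ∈ Finset.range (n + 1), N j * ∑ A ∈ (Finset.univ : Finset (Fin n)).powerset,
        (if A.card = j then c k * B k A * t ^ (∑ a ∈ A, (a : ℕ)) else 0) := by
    intro k
    simp only [Finset.mul_sum]
    rw [Finset.sum_comm]
    refine Finset.sum_congr rfl fun A _ => ?_
    rw [Finset.sum_eq_single A.card]
    · rw [if_pos rfl]; ring
    · intro j _ hj
      rw [if_neg hj.symm, mul_zero]
    · intro hA
      exact absurd (Finset.mem_range.2 (Nat.lt_succ_of_le (by simpa using Finset.card_le_univ A))) hA
  simp only [hsplit]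
  rw [Finset.sum_comm]
  refine Finset.sum_eq_zero fun j _ => ?_
  rw [← Finset.mul_sum, hpoly, mul_zero]

end Symmetrization

/-! ### The `q`-binomial identity behind the Serre relations -/

section QBinomial

theorem qnum_one {v : Fq} (h : v - v⁻¹ ≠ 0) : qnum v 1 = 1 := by
  rw [qnum, pow_one, pow_one, div_self h]

theorem qnum_two {v : Fq} (h : v - v⁻¹ ≠ 0) : qnum v 2 = v + v⁻¹ := by
  rw [qnum, div_eq_iff h]; ring

theorem qnum_three {v : Fq} (h0 : v ≠ 0) (h : v - v⁻¹ ≠ 0) : qnum v 3 = v ^ 2 + 1 + v⁻¹ ^ 2 := by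
  rw [qnum, div_eq_iff h]; field_simp; ring

theorem qnum_four {v : Fq} (h0 : v ≠ 0) (h : v - v⁻¹ ≠ 0) :
    qnum v 4 = (v ^ 2 + v⁻¹ ^ 2) * (v + v⁻¹) := by
  rw [qnum, div_eq_iff h]; field_simp; ring

theorem qbinom_zero (v : Fq) (n : ℕ) : qbinom v n 0 = 1 := by simp [qbinom]

theorem qnum_qi_ne_zero {I : Type*} [Fintype I] (C : CartanDatum I) (i : I) {n : ℕ} (hn : n ≠ 0) :
    qnum (qi C i) n ≠ 0 := by
  have key : ∀ n : ℕ, n ≠ 0 → qi C i ^ n - (qi C i)⁻¹ ^ n ≠ 0 := by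
    intro n hn h
    rw [sub_eq_zero, inv_pow, ← zpow_natCast, ← zpow_neg] at h
    have := qi_zpow_injective C i h
    omega
  exact div_ne_zero (key n hn) (by simpa using key 1 one_ne_zero)

theorem qbinom_eq {I : Type*} [Fintype I] (C : CartanDatum I) (i : I) {a b : ℕ} (h : b ≤ a) :
    qbinom (qi C i) a b = (∏ t ∈ Finset.range a, qnum (qi C i) (1 + t)) /
      ((∏ t ∈ Finset.range (a - b), qnum (qi C i) (1 + t)) *
        ∏ t ∈ Finset.range b, qnum (qi C i) (1 + t)) := by
  have h0 : ∏ t ∈ Finset.range (a - b), qnum (qi C i) (1 + t) ≠ 0 :=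
    Finset.prod_ne_zero_iff.2 fun t _ => qnum_qi_ne_zero C i (by omega)
  have h1 : ∏ t ∈ Finset.range a, qnum (qi C i) (1 + t) =
      (∏ t ∈ Finset.range (a - b), qnum (qi C i) (1 + t)) *
        ∏ t ∈ Finset.range b, qnum (qi C i) (a - b + 1 + t) := by
    conv_lhs => rw [← Nat.sub_add_cancel h, Finset.prod_range_add]
    congr 1
    refine Finset.prod_congr rfl fun t _ => ?_
    rw [← add_assoc, add_comm 1]
  rw [qbinom, h1, mul_div_mul_left _ _ h0]

theorem qbinom_symm {I : Type*} [Fintype I] (C : CartanDatum I) (i : I) {a b : ℕ} (h : b ≤ a) :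
    qbinom (qi C i) a (a - b) = qbinom (qi C i) a b := by
  rw [qbinom_eq C i h, qbinom_eq C i (Nat.sub_le a b), Nat.sub_sub_self h, mul_comm (∏ t ∈ _, _)]

theorem qbinom_self {I : Type*} [Fintype I] (C : CartanDatum I) (i : I) (n : ℕ) :
    qbinom (qi C i) n n = 1 := by
  simp only [qbinom, Nat.sub_self, Nat.zero_add]
  refine div_self (Finset.prod_ne_zero_iff.2 fun t _ => qnum_qi_ne_zero C i (by omega))

end QBinomial

end

section

/-! ### Words in the generators of the convolution algebra -/

namespace Conv

variable {ι E : Type*} [DecidableEq ι] [Field E] (κ : ι → ι → E)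

/-- The element supported on singletons with given values. -/
def gen (g : ι → E) : Conv κ := fun S => if S.card = 1 then ∑ u ∈ S, g u else 0

variable {κ}

theorem gen_singleton (g : ι → E) (u : ι) : gen κ g {u} = g u := by simp [gen]

theorem gen_mul (g : ι → E) (f : Conv κ) (S : Finset ι) :
    (gen κ g * f) S = ∑ u ∈ S, g u * f (S.erase u) * ∏ v ∈ S.erase u, κ u v := by
  have hinj : Set.InjOn (fun u : ι => ({u} : Finset ι)) S := fun a _ b _ h => Finset.singleton_injective h
  rw [mul_apply, ← Finset.sum_subset (s₁ := S.image fun u => ({u} : Finset ι)),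
    Finset.sum_image hinj]
  · refine Finset.sum_congr rfl fun u _ => ?_
    rw [gen_singleton, kk, Finset.prod_singleton, Finset.sdiff_singleton_eq_erase]
  · intro A hA
    obtain ⟨u, hu, rfl⟩ := Finset.mem_image.1 hA
    simpa using hu
  · intro A hA hA'
    have : A.card ≠ 1 := by
      intro h
      obtain ⟨u, rfl⟩ := Finset.card_eq_one.1 h
      exact hA' (Finset.mem_image.2 ⟨u, by simpa using hA, rfl⟩)
    rw [gen, if_neg this, zero_mul, zero_mul]

variable [Fintype ι]

/-- The enumerations of a set. -/
def enums (n : ℕ) (S : Finset ι) : Finset (Fin n → ι) :=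
  Finset.univ.filter fun β => Function.Injective β ∧ Finset.univ.image β = S

theorem mem_enums {n : ℕ} {S : Finset ι} {β : Fin n → ι} :
    β ∈ enums n S ↔ Function.Injective β ∧ Finset.univ.image β = S := by simp [enums]

theorem prod_of_mem_enums {n : ℕ} {S : Finset ι} {β : Fin n → ι} (h : β ∈ enums n S) (f : ι → E) :
    ∏ v ∈ S, f v = ∏ t, f (β t) := by
  rw [mem_enums] at h
  rw [← h.2, Finset.prod_image h.1.injOn]

theorem cons_mem_enums {n : ℕ} {S : Finset ι} {u : ι} {β : Fin n → ι} :
    (Fin.cons u β : Fin (n + 1) → ι) ∈ enums (n + 1) S ↔ u ∈ S ∧ β ∈ enums n (S.erase u) := by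
  have himg : Finset.univ.image (Fin.cons u β : Fin (n + 1) → ι) = insert u (Finset.univ.image β) := by
    ext v
    simp only [Finset.mem_image, Finset.mem_univ, true_and, Fin.exists_fin_succ, Fin.cons_zero,
      Fin.cons_succ, Finset.mem_insert, eq_comm (a := u)]
  rw [mem_enums, mem_enums, himg, Fin.cons_injective_iff]
  constructor
  · rintro ⟨⟨h1, h2⟩, rfl⟩
    refine ⟨Finset.mem_insert_self _ _, h2, ?_⟩
    rw [Finset.erase_insert]
    simpa using h1
  · rintro ⟨hu, h2, h3⟩
    refine ⟨⟨?_, h2⟩, by rw [h3, Finset.insert_erase hu]⟩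
    rintro ⟨t, rfl⟩
    have : β t ∈ S.erase (β t) := h3 ▸ Finset.mem_image_of_mem β (Finset.mem_univ t)
    exact Finset.notMem_erase _ _ this

theorem sum_enums_succ (n : ℕ) (S : Finset ι) (F : (Fin (n + 1) → ι) → E) :
    ∑ β ∈ enums (n + 1) S, F β = ∑ u ∈ S, ∑ β ∈ enums n (S.erase u), F (Fin.cons u β) := by
  rw [Finset.sum_sigma']
  refine Finset.sum_bij' (fun β _ => ⟨β 0, Fin.tail β⟩) (fun z _ => Fin.cons z.1 z.2) ?_ ?_ ?_ ?_ ?_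
  · intro β hβ
    rw [← Fin.cons_self_tail β, cons_mem_enums] at hβ
    simpa using hβ
  · intro z hz
    rw [cons_mem_enums]
    simpa using hz
  · intro β _
    exact Fin.cons_self_tail β
  · intro z _
    simp
  · intro β _
    rw [Fin.cons_self_tail]

/-- The product of `κ` over the ordered pairs of entries. -/
def pw (κ : ι → ι → E) {n : ℕ} (β : Fin n → ι) : E :=
  ∏ a, ∏ b, if a < b then κ (β a) (β b) else 1

theorem pw_cons {n : ℕ} (u : ι) (β : Fin n → ι) :
    pw κ (Fin.cons u β : Fin (n + 1) → ι) = (∏ t, κ u (β t)) * pw κ β := by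
  simp [pw, Fin.prod_univ_succ]

theorem word_apply {n : ℕ} (g : Fin n → ι → E) (S : Finset ι) :
    (List.ofFn fun t => gen κ (g t)).prod S = ∑ β ∈ enums n S, (∏ t, g t (β t)) * pw κ β := by
  induction n generalizing S with
  | zero =>
    rw [List.ofFn_zero, List.prod_nil, one_apply]
    split_ifs with h
    · have : enums 0 S = Finset.univ := by
        ext β
        simp [mem_enums, h, Function.injective_of_subsingleton, eq_iff_true_of_subsingleton]
      simp [this, pw]
    · have : enums 0 S = ∅ := by
        refine Finset.eq_empty_of_forall_notMem fun β hβ => h ?_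
        simpa using (mem_enums.1 hβ).2.symm
      simp [this]
  | succ n ih =>
    rw [List.ofFn_succ, List.prod_cons, gen_mul, sum_enums_succ]
    refine Finset.sum_congr rfl fun u _ => ?_
    rw [ih, Finset.mul_sum, Finset.sum_mul]
    refine Finset.sum_congr rfl fun β hβ => ?_
    rw [prod_of_mem_enums hβ, pw_cons, Fin.prod_univ_succ]
    simp only [Fin.cons_zero, Fin.cons_succ]
    ring

theorem word_insert_apply {n : ℕ} (g : Fin n → ι → E) (y : ι → E) (k : ℕ) (hk : k ≤ n)
    (S : Finset ι) :
    (((List.ofFn fun t => gen κ (g t)).take k).prod * gen κ y *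
        ((List.ofFn fun t => gen κ (g t)).drop k).prod) S =
      ∑ J ∈ S, ∑ β ∈ enums n (S.erase J), y J * ((∏ t, g t (β t)) * (pw κ β *
        ∏ t : Fin n, if (t : ℕ) < k then κ (β t) J else κ J (β t))) := by
  induction k generalizing n S with
  | zero =>
    rw [List.take_zero, List.drop_zero, List.prod_nil, one_mul, gen_mul]
    refine Finset.sum_congr rfl fun J _ => ?_
    rw [word_apply, Finset.mul_sum, Finset.sum_mul]
    refine Finset.sum_congr rfl fun β hβ => ?_
    rw [prod_of_mem_enums hβ]
    simp only [not_lt_zero, if_false]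
    ring
  | succ k ih =>
    obtain ⟨n, rfl⟩ : ∃ m, n = m + 1 := ⟨n - 1, by omega⟩
    rw [List.ofFn_succ, List.take_succ_cons, List.drop_succ_cons, List.prod_cons, mul_assoc,
      mul_assoc, gen_mul]
    simp only [sum_enums_succ]
    rw [Finset.sum_comm' (s' := fun u => S.erase u) (t' := S)
      (h := fun x y => by simp only [Finset.mem_erase]; tauto)]
    refine Finset.sum_congr rfl fun u hu => ?_
    rw [← mul_assoc, ih _ (by omega), Finset.mul_sum, Finset.sum_mul]
    refine Finset.sum_congr rfl fun J hJ => ?_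
    rw [Finset.erase_right_comm, Finset.mul_sum, Finset.sum_mul]
    refine Finset.sum_congr rfl fun β hβ => ?_
    rw [Finset.erase_right_comm] at hβ
    rw [← Finset.mul_prod_erase _ _ hJ, prod_of_mem_enums hβ, pw_cons, Fin.prod_univ_succ,
      Fin.prod_univ_succ]
    simp only [Fin.cons_zero, Fin.cons_succ, Fin.val_zero, Fin.val_succ, Nat.succ_pos, if_true,
      add_lt_add_iff_right, Nat.zero_lt_succ]
    ring

theorem sum_enums_comp {n : ℕ} {S : Finset ι} (σ : Equiv.Perm (Fin n)) (F : (Fin n → ι) → E) :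
    ∑ β ∈ enums n S, F (β ∘ σ) = ∑ β ∈ enums n S, F β := by
  have key : ∀ (τ : Equiv.Perm (Fin n)) β, β ∈ enums n S → β ∘ τ ∈ enums n S := by
    intro τ β hβ
    rw [mem_enums] at hβ ⊢
    refine ⟨hβ.1.comp τ.injective, ?_⟩
    rw [← hβ.2]
    ext v
    simp only [Finset.mem_image, Finset.mem_univ, true_and, Function.comp_apply]
    exact τ.exists_congr_left.trans (by simp)
  refine Finset.sum_bij' (fun β _ => β ∘ σ) (fun β _ => β ∘ (σ⁻¹ : Equiv.Perm (Fin n))) (fun β => key σ β)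
    (fun β => key σ⁻¹ β) ?_ ?_ ?_
  · intro β _; ext t; simp
  · intro β _; ext t; simp
  · intro β _; rfl

/-- The Serre relation holds as soon as the symmetrization of its kernel vanishes. -/
theorem serre_gen_eq_zero [Algebra Fq E] (v : Fq) (n : ℕ) (x y : ℤ → ι → E) (r : Fin n → ℤ) (s : ℤ)
    (h : ∀ (J : ι) (β : Fin n → ι), Function.Injective β → (∀ t, β t ≠ J) → y s J ≠ 0 →
      (∀ t, x (r t) (β t) ≠ 0) → ∑ σ : Equiv.Perm (Fin n), ∑ k ∈ Finset.range (n + 1),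
        algebraMap Fq E ((-1) ^ k * qbinom v n k) * (pw κ (β ∘ σ) *
          ∏ t : Fin n, if (t : ℕ) < k then κ (β (σ t)) J else κ J (β (σ t))) = 0) :
    serre v n (fun t => gen κ (x t)) (fun t => gen κ (y t)) r s = 0 := by
  funext S
  change _ = (0 : E)
  simp only [serre, sum_apply, smul_apply]
  have h1 : ∀ σ : Equiv.Perm (Fin n), ∀ k ∈ Finset.range (n + 1),
      ((-1) ^ k * qbinom v n k) • ((((List.ofFn fun t => gen κ (x (r (σ t)))).take k).prod *
        gen κ (y s) * ((List.ofFn fun t => gen κ (x (r (σ t)))).drop k).prod) S : E) =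
      ∑ J ∈ S, ∑ β ∈ enums n (S.erase J), y s J * ((∏ t, x (r t) (β t)) *
        (algebraMap Fq E ((-1) ^ k * qbinom v n k) * (pw κ (β ∘ σ) *
          ∏ t : Fin n, if (t : ℕ) < k then κ (β (σ t)) J else κ J (β (σ t))))) := by
    intro σ k hk
    rw [word_insert_apply (fun t => x (r (σ t))) (y s) k (by simpa [Nat.lt_succ_iff] using hk),
      Algebra.smul_def, Finset.mul_sum]
    refine Finset.sum_congr rfl fun J _ => ?_
    rw [← sum_enums_comp σ, Finset.mul_sum]
    refine Finset.sum_congr rfl fun β _ => ?_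
    simp only [Function.comp_apply]
    rw [Equiv.prod_comp σ fun t => x (r t) (β t)]
    ring
  rw [Finset.sum_congr rfl fun σ _ => Finset.sum_congr rfl (h1 σ)]
  have h2 : ∀ σ : Equiv.Perm (Fin n), ∑ k ∈ Finset.range (n + 1), ∑ J ∈ S,
      ∑ β ∈ enums n (S.erase J), y s J * ((∏ t, x (r t) (β t)) *
        (algebraMap Fq E ((-1) ^ k * qbinom v n k) * (pw κ (β ∘ σ) *
          ∏ t : Fin n, if (t : ℕ) < k then κ (β (σ t)) J else κ J (β (σ t))))) =
      ∑ J ∈ S, ∑ β ∈ enums n (S.erase J), y s J * ((∏ t, x (r t) (β t)) *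
        ∑ k ∈ Finset.range (n + 1), (algebraMap Fq E ((-1) ^ k * qbinom v n k) * (pw κ (β ∘ σ) *
          ∏ t : Fin n, if (t : ℕ) < k then κ (β (σ t)) J else κ J (β (σ t))))) := by
    intro σ
    rw [Finset.sum_comm]
    refine Finset.sum_congr rfl fun J _ => ?_
    rw [Finset.sum_comm]
    simp only [Finset.mul_sum]
  rw [Finset.sum_congr rfl fun σ _ => h2 σ, Finset.sum_comm]
  refine Finset.sum_eq_zero fun J _ => ?_
  rw [Finset.sum_comm]
  refine Finset.sum_eq_zero fun β hβ => ?_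
  rw [← Finset.mul_sum, ← Finset.mul_sum]
  rw [mem_enums] at hβ
  by_cases hy : y s J = 0
  · rw [hy, zero_mul]
  by_cases hx : ∀ t, x (r t) (β t) ≠ 0
  · rw [h J β hβ.1 ?_ hy hx, mul_zero, mul_zero]
    intro t ht
    have : β t ∈ S.erase J := hβ.2 ▸ Finset.mem_image_of_mem β (Finset.mem_univ t)
    exact (Finset.ne_of_mem_erase this) ht
  · push Not at hx
    obtain ⟨t, ht⟩ := hx
    rw [Finset.prod_eq_zero (Finset.mem_univ t) ht, zero_mul, mul_zero]

theorem posQuad_gen_eq_zero [Algebra Fq E] (c : Fq) (x y : ℤ → ι → E) (r s : ℤ)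
    (h : ∀ u v, u ≠ v → κ u v * (x (r + 1) u * y s v - algebraMap Fq E c * (x r u * y (s + 1) v)) =
      κ v u * (algebraMap Fq E c * (x (r + 1) u * y s v) - x r u * y (s + 1) v)) :
    posQuad c (fun t => gen κ (x t)) (fun t => gen κ (y t)) r s = 0 := by
  have hmul : ∀ (g g' : ι → E) (S : Finset ι), S.card ≠ 2 → (gen κ g * gen κ g') S = 0 := by
    intro g g' S hS
    rw [gen_mul]
    refine Finset.sum_eq_zero fun u hu => ?_
    rw [gen, if_neg, mul_zero, zero_mul]
    rw [Finset.card_erase_of_mem hu]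
    have := Finset.card_pos.2 ⟨u, hu⟩
    omega
  have hpair : ∀ (g g' : ι → E) (u v : ι), u ≠ v → (gen κ g * gen κ g') {u, v} =
      g u * g' v * κ u v + g v * g' u * κ v u := by
    intro g g' u v huv
    have h1 : ({u, v} : Finset ι).erase u = {v} := by
      ext a; simp only [Finset.mem_erase, Finset.mem_insert, Finset.mem_singleton]; grind
    have h2 : ({u, v} : Finset ι).erase v = {u} := by
      ext a; simp only [Finset.mem_erase, Finset.mem_insert, Finset.mem_singleton]; grind
    rw [gen_mul, Finset.sum_pair huv, h1, h2, gen_singleton, gen_singleton, Finset.prod_singleton,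
      Finset.prod_singleton]
  funext S
  change _ = (0 : E)
  simp only [posQuad, sub_apply, smul_apply]
  by_cases hS : S.card = 2
  · obtain ⟨u, v, huv, rfl⟩ := Finset.card_eq_two.1 hS
    simp only [hpair _ _ u v huv, Algebra.smul_def]
    linear_combination h u v huv + h v u huv.symm
  · simp [hmul _ _ S hS]

end Conv

end

section

/-! ### The defining relations in the shuffle algebras -/

section Cartan

variable {I : Type*} [Fintype I]

theorem CartanDatum.c_mul_c_lt_four (C : CartanDatum I) {i j : I} (h : i ≠ j) :
    C.c i j * C.c j i < 4 := by
  classical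
  let x : I → ℝ := fun l => if l = i then -(C.d i * C.c i j : ℝ) else if l = j then 2 * C.d i else 0
  have hdi : (0 : ℝ) < C.d i := by exact_mod_cast C.d_pos i
  have hdj : (0 : ℝ) < C.d j := by exact_mod_cast C.d_pos j
  have hxi : x i = -(C.d i * C.c i j : ℝ) := if_pos rfl
  have hxj : x j = 2 * C.d i := by simp [x, h.symm]
  have hx0 : ∀ l, l ≠ i ∧ l ≠ j → x l = 0 := fun l hl => by simp [x, hl.1, hl.2]
  have hx : x ≠ 0 := fun h0 => by
    have := congrFun h0 j
    rw [hxj, Pi.zero_apply] at this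
    linarith
  have hpos := C.posDef x hx
  have hrow : ∀ l, ∑ m, ((C.d l : ℝ) * (C.c l m : ℝ)) * x l * x m =
      ((C.d l : ℝ) * (C.c l i : ℝ)) * x l * x i + ((C.d l : ℝ) * (C.c l j : ℝ)) * x l * x j :=
    fun l => Fintype.sum_eq_add i j h fun m hm => by rw [hx0 m hm, mul_zero]
  simp only [hrow] at hpos
  rw [Fintype.sum_eq_add i j h fun m hm => by rw [hx0 m hm]; ring, hxi, hxj, C.c_diag, C.c_diag] at hpos
  have hs : (C.d i : ℝ) * C.c i j = C.d j * C.c j i := by exact_mod_cast C.symm i j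
  rw [← hs] at hpos
  push_cast at hpos
  have h2 : 0 < (C.d i : ℝ) ^ 2 * C.d j * (8 - 2 * (C.c i j * C.c j i)) := by
    have e : (C.d i : ℝ) ^ 2 * C.d j * (2 * (C.c i j * C.c j i)) =
      (C.d i : ℝ) ^ 2 * C.c i j * (2 * (C.d j * C.c j i)) := by ring
    rw [mul_sub, e, ← hs]
    linarith
  have h3 := (mul_pos_iff_of_pos_left (by positivity)).1 h2
  have h4 : (C.c i j * C.c j i : ℝ) < 4 := by linarith
  exact_mod_cast h4

theorem CartanDatum.c_cases (C : CartanDatum I) {i j : I} (h : i ≠ j) :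
    C.c i j = 0 ∨ C.c i j = -1 ∨ C.c i j = -2 ∨ C.c i j = -3 := by
  have h1 := C.c_mul_c_lt_four h
  have h2 := C.c_offDiag i j h
  have h3 := C.c_offDiag j i h.symm
  by_cases h0 : C.c i j = 0
  · exact Or.inl h0
  · have h4 := C.c_ne_zero_symm h0
    have : C.c j i ≤ -1 := by omega
    have : -4 < C.c i j := by nlinarith
    omega

/-- Of the two entries of the Cartan matrix for an edge, at least one is `-1`. -/
theorem CartanDatum.c_eq_neg_one (C : CartanDatum I) {i j : I} (h : i ≠ j) (hc : C.c i j ≠ 0) :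
    C.c i j = -1 ∨ C.c j i = -1 := by
  have h1 := C.c_mul_c_lt_four h
  have h0 := C.c_ne_zero_symm hc
  rcases C.c_cases h with h2 | h2 | h2 | h2 <;> rcases C.c_cases h.symm with h3 | h3 | h3 | h3 <;>
    first | omega | (rw [h2, h3] at h1; omega)

end Cartan

section SerreIdentity

variable {I : Type*} [Fintype I] {E : Type*} [Field E] [Algebra Fq E]

theorem serre_identity (C : CartanDatum I) {i j : I} (h : i ≠ j) (w X : E) :
    ∑ k ∈ Finset.range ((1 - C.c i j).toNat + 1),
      algebraMap Fq E ((-1) ^ k * qbinom (qi C i) (1 - C.c i j).toNat k) *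
        ∏ a : Fin (1 - C.c i j).toNat,
          ((if (a : ℕ) < k then -(algebraMap Fq E (qi C i ^ (-C.c i j)) * w) else -w) +
            (if (a : ℕ) < k then 1 else algebraMap Fq E (qi C i ^ (-C.c i j))) *
              algebraMap Fq E (qi C i ^ (-2 : ℤ)) ^ (a : ℕ) * X) = 0 := by
  have hv : qi C i - (qi C i)⁻¹ ≠ 0 := by
    intro h0
    rw [sub_eq_zero, ← zpow_one (qi C i), ← zpow_neg] at h0
    exact absurd (qi_zpow_injective C i h0) (by norm_num)
  have h0 := qi_ne_zero C i
  have hv0 : algebraMap Fq E (qi C i) ≠ 0 := (map_ne_zero _).2 h0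
  have hn2 := qnum_qi_ne_zero C i (n := 2) two_ne_zero
  have hn3 := qnum_qi_ne_zero C i (n := 3) three_ne_zero
  rcases C.c_cases h with hc | hc | hc | hc
  · rw [hc]
    have e : (1 - 0 : ℤ).toNat = 1 := rfl
    rw [e]
    simp [Finset.sum_range_succ, qbinom_zero, qbinom_self]
  · rw [hc]
    have e : (1 - (-1) : ℤ).toNat = 2 := rfl
    rw [e]
    have hb1 : qbinom (qi C i) 2 1 = qnum (qi C i) 2 := by
      simp [qbinom, Finset.prod_range_succ, qnum_one hv]
    simp only [Finset.sum_range_succ, Finset.sum_range_zero, qbinom_zero, qbinom_self, hb1,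
      Fin.prod_univ_two, qnum_two hv]
    simp
    field_simp
    ring
  · rw [hc]
    have e : (1 - (-2) : ℤ).toNat = 3 := rfl
    rw [e]
    have hb1 : qbinom (qi C i) 3 1 = qnum (qi C i) 3 := by
      simp [qbinom, Finset.prod_range_succ, qnum_one hv]
    have hb2 : qbinom (qi C i) 3 2 = qnum (qi C i) 3 := by
      rw [← hb1, ← qbinom_symm C i (by norm_num : 1 ≤ 3)]
    simp only [Finset.sum_range_succ, Finset.sum_range_zero, qbinom_zero, qbinom_self, hb1, hb2,
      Fin.prod_univ_three, qnum_three h0 hv]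
    simp
    field_simp
    ring
  · rw [hc]
    have e : (1 - (-3) : ℤ).toNat = 4 := rfl
    rw [e]
    have hb1 : qbinom (qi C i) 4 1 = qnum (qi C i) 4 := by
      simp [qbinom, Finset.prod_range_succ, qnum_one hv]
    have hb3 : qbinom (qi C i) 4 3 = qnum (qi C i) 4 := by
      rw [← hb1, ← qbinom_symm C i (by norm_num : 1 ≤ 4)]
    have hb2 : qbinom (qi C i) 4 2 = qnum (qi C i) 3 * (qi C i ^ 2 + (qi C i)⁻¹ ^ 2) := by
      simp only [qbinom, Finset.prod_range_succ, Finset.prod_range_zero, qnum_one hv, one_mul]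
      norm_num
      rw [qnum_four h0 hv, ← qnum_two hv]
      field_simp
    simp only [Finset.sum_range_succ, Finset.sum_range_zero, qbinom_zero, qbinom_self, hb1, hb2, hb3,
      Fin.prod_univ_four, qnum_three h0 hv, qnum_four h0 hv]
    simp
    field_simp
    ring

end SerreIdentity

section Generators

variable {I : Type*} [Fintype I] [DecidableEq I] {C : CartanDatum I} (O : DynOrientation C)

theorem fst_eq_of_single {i : I} (v : V (Pi.single i 1 : I → ℕ)) : v.1 = i := by
  by_contra h
  have h1 := v.2.2
  have h2 : (Pi.single i 1 : I → ℕ) v.1 = 0 := Pi.single_eq_of_ne h 1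
  omega

instance (i : I) : Subsingleton (V (Pi.single i 1 : I → ℕ)) :=
  ⟨fun u v => by
    obtain ⟨a, r⟩ := u
    obtain ⟨b, s⟩ := v
    obtain rfl : a = i := fst_eq_of_single ⟨a, r⟩
    obtain rfl : b = a := fst_eq_of_single ⟨b, s⟩
    have hr := r.2
    have hs := s.2
    have h1 : (Pi.single b 1 : I → ℕ) b = 1 := Pi.single_eq_same b 1
    congr 1
    exact Fin.ext (by omega)⟩

theorem poleDen_single (i : I) : poleDen O (Pi.single i 1 : I → ℕ) = 1 := by
  rw [poleDen_eq']
  refine Finset.prod_eq_one fun u _ => Finset.prod_eq_one fun v _ => if_neg fun h => ?_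
  rw [Subsingleton.elim v u] at h
  exact O.ne_of_arr h rfl

theorem xPow_mem_wheelComp (i : I) (r : ℤ) :
    (x ⟨i, ⟨0, by simp⟩⟩ ^ r : K (Pi.single i 1 : I → ℕ)) ∈ wheelComp O (Pi.single i 1) := by
  refine ⟨⟨?_, fun σ => ?_⟩, fun a b hab _ ha hb => ?_⟩
  · rw [LinearMap.mulRight_apply, poleDen_single, mul_one]
    exact x_zpow_mem_laurent _ r
  · exact relabel_refl _ (fun v => Subsingleton.elim _ _) _
  · have ha' : a = i := by
      by_contra h
      rw [Pi.single_eq_of_ne h] at ha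
      have := C.c_offDiag a b hab
      push_cast at ha
      omega
    have hb' : b = i := by
      by_contra h
      rw [Pi.single_eq_of_ne h] at hb
      omega
    exact absurd (ha'.trans hb'.symm) hab

theorem xPow_mem_wheelS (i : I) (r : ℤ) : xPow i r ∈ wheelS O :=
  of_mem_wheelS O (xPow_mem_wheelComp O i r)

variable {ι : Type*} [DecidableEq ι] {cl : ι → I} {E : Type*} [Field E] [Algebra Fq E] {p : ι → E}

theorem sum_cnt (A : Finset ι) : ∑ i, cnt cl A i = A.card :=
  (Finset.card_eq_sum_card_fiberwise fun u _ => Finset.mem_univ (cl u)).symm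

theorem evC_xPow (hp : ∀ u, p u ≠ 0) (i : I) (r : ℤ) :
    evC O cl p (xPow i r) = Conv.gen _ fun u => if cl u = i then p u ^ r else 0 := by
  funext S
  simp only [Conv.gen, evC]
  split_ifs with h
  · obtain ⟨u, rfl⟩ := Finset.card_eq_one.1 h
    rw [Finset.sum_singleton]
    split_ifs with hu
    · have he : IsEnum cl (fun _ : V (Pi.single i 1 : I → ℕ) => u) {u} :=
        ⟨fun _ _ _ => Subsingleton.elim _ _, fun v => hu.trans (fst_eq_of_single v).symm, fun a => by
          simp only [Finset.mem_singleton]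
          exact ⟨fun h => ⟨⟨i, ⟨0, by simp⟩⟩, h.symm⟩, fun ⟨_, h⟩ => h.symm⟩⟩
      rw [xPow, ev_of O hp (xPow_mem_wheelComp O i r).1 he, poleDen_single, mul_one]
      exact ((hasVal_x _ _).zpow (hp _) r).evalRat_eq
    · refine ev_of_ne O _ fun h1 => ?_
      have := congrFun h1 i
      rw [Pi.single_eq_same, cnt, Finset.filter_singleton, if_neg hu, Finset.card_empty] at this
      omega
  · refine ev_of_ne O _ fun h1 => h ?_
    rw [← sum_cnt (cl := cl), h1, Finset.sum_pi_single']
    simp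

theorem kap_exchange (i j : I) (z w : E) (hzw : i = j → z ≠ w) :
    kap O i j z w * (z - algebraMap Fq E (qi C i ^ C.c i j) * w) =
      kap O j i w z * (algebraMap Fq E (qi C i ^ C.c i j) * z - w) := by
  have hQ : algebraMap Fq E (qi C i ^ C.c i j) ≠ 0 := (map_ne_zero _).2 (zpow_ne_zero _ (qi_ne_zero C i))
  by_cases hij : i = j
  · subst hij
    have h1 : z - w ≠ 0 := sub_ne_zero.2 (hzw rfl)
    have h2 : w - z ≠ 0 := sub_ne_zero.2 (hzw rfl).symm
    rw [kap_self, kap_self, zeta, zeta, zpow_neg, map_inv₀, show w - z = -(z - w) by ring]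
    field_simp
    ring
  · by_cases h1 : O.arr j i
    · rw [kap_of_arr_right O h1, kap_of_arr_left O h1, ← qi_zpow_neg_c_symm C i j, zpow_neg, map_inv₀]
      field_simp
      ring
    · by_cases h2 : O.arr i j
      · rw [kap_of_arr_left O h2, kap_of_arr_right O h2, ← qi_zpow_neg_c_symm C i j, zpow_neg, map_inv₀]
        field_simp
        ring
      · have hc : C.c i j = 0 := by
          by_contra hc
          exact ((O.adj_iff i j hij).1 hc).elim h2 h1
        rw [kap_of_not_arr O hij h2 h1, kap_of_not_arr O (Ne.symm hij) h1 h2, hc]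
        simp

theorem posQuad_evC [Fintype ι] (hp : Admissible cl p) (i j : I) (r s : ℤ) :
    posQuad (qi C i ^ C.c i j) (fun t => evC O cl p (xPow i t)) (fun t => evC O cl p (xPow j t)) r s
      = 0 := by
  simp only [evC_xPow O hp.ne_zero]
  refine Conv.posQuad_gen_eq_zero _ _ _ r s fun u v huv => ?_
  by_cases hu : cl u = i
  · by_cases hv : cl v = j
    · simp only [hu, hv, if_true, kapAt]
      have := kap_exchange O i j (p u) (p v) fun h => hp.ne u v huv (by rw [hu, hv, h])
      rw [zpow_add_one₀ (hp.ne_zero u), zpow_add_one₀ (hp.ne_zero v)]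
      linear_combination (p u ^ r * p v ^ s) * this
    · simp [hv]
  · simp [hu]

theorem pw_eq_hlKernel [Fintype ι] {n : ℕ} {i : I} (β : Fin n → ι) (h : ∀ t, cl (β t) = i) :
    Conv.pw (kapAt O cl p) β = hlKernel (algebraMap Fq E (qi C i ^ (-2 : ℤ))) (p ∘ β) := by
  rw [hlKernel, incPairs, Finset.prod_filter, Conv.pw, ← Finset.univ_product_univ, Finset.prod_product]
  refine Finset.prod_congr rfl fun a _ => Finset.prod_congr rfl fun b _ => ?_
  split_ifs
  · rw [kapAt, h, h, kap_self, zeta, C.c_diag]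
    rfl
  · rfl

theorem serre_evC [Fintype ι] [CharZero E] (hp : Admissible cl p) {i j : I} (hij : i ≠ j)
    (r : Fin (1 - C.c i j).toNat → ℤ) (s : ℤ) :
    serre (qi C i) (1 - C.c i j).toNat (fun t => evC O cl p (xPow i t))
      (fun t => evC O cl p (xPow j t)) r s = 0 := by
  simp only [evC_xPow O hp.ne_zero]
  refine Conv.serre_gen_eq_zero _ _ _ _ r s fun J β hβ hβJ hJ hx => ?_
  have hcJ : cl J = j := by
    by_contra h
    simp [h] at hJ
  have hcβ : ∀ t, cl (β t) = i := fun t => by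
    by_contra h
    exact hx t (by simp [h])
  by_cases hc : C.c i j = 0
  · have hn : (1 - C.c i j).toNat = 1 := by rw [hc]; rfl
    have h1 : ∀ z w : E, kap O i j z w = 1 ∧ kap O j i z w = 1 := fun z w => by
      have ha : ¬ O.arr i j := fun h => (O.adj_iff i j hij).2 (Or.inl h) hc
      have hb : ¬ O.arr j i := fun h => (O.adj_iff i j hij).2 (Or.inr h) hc
      exact ⟨kap_of_not_arr O hij ha hb z w, kap_of_not_arr O hij.symm hb ha z w⟩
    have h2 : ∀ σ : Equiv.Perm (Fin (1 - C.c i j).toNat), Conv.pw (kapAt O cl p) (β ∘ σ) = 1 := fun σ =>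
      Finset.prod_eq_one fun a _ => Finset.prod_eq_one fun b _ => if_neg fun h => by
        rw [Fin.lt_def] at h
        omega
    have h3 : ∑ k ∈ Finset.range ((1 - C.c i j).toNat + 1),
        algebraMap Fq E ((-1) ^ k * qbinom (qi C i) (1 - C.c i j).toNat k) = 0 := by
      rw [hn]
      simp [Finset.sum_range_succ, qbinom_zero, qbinom_self]
    refine Finset.sum_eq_zero fun σ _ => Eq.trans (Finset.sum_congr rfl fun k _ => ?_) h3
    rw [h2, one_mul, Finset.prod_eq_one, mul_one]
    intro t _
    simp only [kapAt, hcβ, hcJ, h1, ite_self]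
  have hz : Function.Injective (p ∘ β) := fun a b hab => by
    by_contra h
    exact hp.ne (β a) (β b) (fun h' => h (hβ h')) (by rw [hcβ, hcβ]) hab
  have ht : algebraMap Fq E (qi C i ^ (-2 : ℤ)) ≠ 0 :=
    (map_ne_zero _).2 (zpow_ne_zero _ (qi_ne_zero C i))
  have key := sum_hlKernel_mul_eq_zero ht hz (m := (1 - C.c i j).toNat + 1)
    (fun k => algebraMap Fq E ((-1) ^ k * qbinom (qi C i) (1 - C.c i j).toNat k)) _ _
    (serre_identity C hij (p J))
  obtain ⟨e, he⟩ : ∃ e : E, ∀ (k : ℕ) (z : Fin (1 - C.c i j).toNat → ι), (∀ t, cl (z t) = i) →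
      (∏ t : Fin (1 - C.c i j).toNat, if (t : ℕ) < k then kapAt O cl p (z t) J
        else kapAt O cl p J (z t)) = e * ∏ t : Fin (1 - C.c i j).toNat,
          ((if (t : ℕ) < k then -(algebraMap Fq E (qi C i ^ (-C.c i j)) * p J) else -p J) +
            (if (t : ℕ) < k then 1 else algebraMap Fq E (qi C i ^ (-C.c i j))) * p (z t)) := by
    by_cases h1 : O.arr j i
    · refine ⟨1, fun k z hz => ?_⟩
      rw [one_mul]
      refine Finset.prod_congr rfl fun t _ => ?_
      simp only [kapAt, hz, hcJ, kap_of_arr_right O h1, kap_of_arr_left O h1, ← qi_zpow_neg_c_symm C i j]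
      split_ifs <;> ring
    · by_cases h2 : O.arr i j
      · refine ⟨(-1) ^ (1 - C.c i j).toNat, fun k z hz => ?_⟩
        rw [← Fin.prod_const, ← Finset.prod_mul_distrib]
        refine Finset.prod_congr rfl fun t _ => ?_
        simp only [kapAt, hz, hcJ, kap_of_arr_right O h2, kap_of_arr_left O h2,
          ← qi_zpow_neg_c_symm C i j]
        split_ifs <;> ring
      · exact absurd ((O.adj_iff i j hij).1 hc) (not_or.2 ⟨h2, h1⟩)
  refine Eq.trans ?_ ((congrArg (e * ·) key).trans (mul_zero e))
  simp only [Finset.mul_sum]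
  refine Finset.sum_congr rfl fun σ _ => Finset.sum_congr rfl fun k _ => ?_
  rw [he k (fun t => β (σ t)) fun t => hcβ _, pw_eq_hlKernel O (β ∘ σ) fun t => hcβ _,
    ← Function.comp_assoc]
  simp only [Function.comp_apply]
  ring

end Generators

section Opposite

variable {A : Type*} [Ring A] [Algebra Fq A]

theorem negQuad_op (c : Fq) (x y : ℤ → A) (r s : ℤ) :
    negQuad c (fun t => MulOpposite.op (x t)) (fun t => MulOpposite.op (y t)) r s =
      -MulOpposite.op (posQuad c x y r s) := by
  simp only [negQuad, posQuad, ← MulOpposite.op_mul, ← MulOpposite.op_smul, ← MulOpposite.op_sub,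
    ← MulOpposite.op_neg]
  congr 1
  abel

theorem serre_op {v : Fq} {n : ℕ} (hv : ∀ k ≤ n, qbinom v n (n - k) = qbinom v n k) (x y : ℤ → A)
    (r : Fin n → ℤ) (s : ℤ) :
    serre v n (fun t => MulOpposite.op (x t)) (fun t => MulOpposite.op (y t)) r s =
      (-1 : Fq) ^ n • MulOpposite.op (serre v n x y r s) := by
  apply MulOpposite.unop_injective
  simp only [serre, MulOpposite.unop_smul, MulOpposite.unop_op, Finset.unop_sum,
    Finset.smul_sum]
  rw [← Equiv.sum_comp (Equiv.mulRight Fin.revPerm)]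
  refine Finset.sum_congr rfl fun σ _ => ?_
  rw [← Finset.sum_flip]
  refine Finset.sum_congr rfl fun k hk => ?_
  have hk : k ≤ n := Nat.lt_succ_iff.1 (Finset.mem_range.1 hk)
  have hL : (List.map MulOpposite.unop (List.ofFn fun t => MulOpposite.op
      (x (r ((Equiv.mulRight Fin.revPerm σ : Equiv.Perm (Fin n)) t))))) =
      (List.ofFn fun t => x (r (σ t))).reverse := by
    rw [List.map_ofFn]
    apply List.ext_getElem
    · simp
    · intro m h1 h2
      simp only [List.getElem_ofFn, List.getElem_reverse, Function.comp_apply, MulOpposite.unop_op,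
        Equiv.coe_mulRight, Equiv.Perm.mul_apply, Fin.revPerm_apply]
      congr 3
      ext
      simp only [List.length_ofFn, Fin.val_rev]
      omega
  rw [MulOpposite.unop_mul, MulOpposite.unop_mul, MulOpposite.unop_list_prod,
    MulOpposite.unop_list_prod, List.map_take, List.map_drop, hL, List.drop_reverse,
    List.take_reverse, List.reverse_reverse, List.reverse_reverse, MulOpposite.unop_op,
    List.length_ofFn, Nat.sub_sub_self hk, hv k hk, ← mul_assoc, smul_smul]
  congr 1
  have h2 : ((-1 : Fq) ^ k) ^ 2 = 1 := by rw [← pow_mul, mul_comm, pow_mul]; norm_num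
  have h3 : (-1 : Fq) ^ n = (-1) ^ (n - k) * (-1) ^ k := by rw [← pow_add, Nat.sub_add_cancel hk]
  rw [h3]
  linear_combination (-((-1 : Fq) ^ (n - k)) * qbinom v n k) * h2

end Opposite

section Upsilon

variable {I : Type*} [Fintype I] [DecidableEq I] {C : CartanDatum I} (O : DynOrientation C)

theorem ShAlg.eq_of_evC_eq (h : IsShuffleAlgebra C (bigS O)) {F G : ShAlg h}
    (hFG : ∀ k : I → ℕ, evHom O (admissible_x k) h F = evHom O (admissible_x k) h G) : F = G :=
  Subtype.ext (eq_of_ev_eq O F.2 G.2 fun k => congrFun (hFG k) Finset.univ)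

theorem ShAlg.incl_injective {B B' : Submodule Fq (T I)} (h : IsShuffleAlgebra C B)
    (h' : IsShuffleAlgebra C B') (hle : B ≤ B') : Function.Injective (ShAlg.incl h h' hle) :=
  Submodule.inclusion_injective hle

instance (k : I → ℕ) : CharZero (K k) := charZero_of_injective_algebraMap (algebraMap Fq (K k)).injective

variable (hB : IsShuffleAlgebra C (bigS O)) (hS : IsShuffleAlgebra C (wheelS O))

/-- The generators of the shuffle algebra. -/
def shGen (i : I) (r : ℤ) : ShAlg hS := ShAlg.mk hS (xPow i r) (xPow_mem_wheelS O i r)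

theorem posQuad_shGen (i j : I) (r s : ℤ) :
    posQuad (qi C i ^ C.c i j) (shGen O hS i) (shGen O hS j) r s = 0 := by
  apply ShAlg.incl_injective hS (isShuffleAlgebra_bigS O) (wheelS_le_bigS O)
  refine ShAlg.eq_of_evC_eq O _ fun k => ?_
  rw [map_zero, map_zero, map_posQuad, map_posQuad]
  exact posQuad_evC O (admissible_x k) i j r s

theorem serre_shGen {i j : I} (hij : i ≠ j) (r : Fin (1 - C.c i j).toNat → ℤ) (s : ℤ) :
    serre (qi C i) (1 - C.c i j).toNat (shGen O hS i) (shGen O hS j) r s = 0 := by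
  apply ShAlg.incl_injective hS (isShuffleAlgebra_bigS O) (wheelS_le_bigS O)
  refine ShAlg.eq_of_evC_eq O _ fun k => ?_
  rw [map_zero, map_zero, map_serre, map_serre]
  exact serre_evC O (admissible_x k) hij r s

/-- The homomorphism from the positive half to the shuffle algebra. -/
def upsPos : Upos C →ₐ[Fq] ShAlg hS :=
  RingQuot.liftAlgHom Fq ⟨FreeAlgebra.lift Fq fun p : I × ℤ => shGen O hS p.1 p.2, by
    intro x y h
    cases h with
    | ee i j r s =>
      rw [map_posQuad, map_zero]
      simpa [hgen] using posQuad_shGen O hS i j r s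
    | serre_e i j h r s =>
      rw [map_serre, map_zero]
      simpa [hgen] using serre_shGen O hS h r s⟩

theorem upsPos_pe (i : I) (r : ℤ) : upsPos O hS (pe C i r) = shGen O hS i r := by
  simp [upsPos, pe, hgen]

/-- The homomorphism from the negative half to the opposite shuffle algebra. -/
def upsNeg : Uneg C →ₐ[Fq] (ShAlg hS)ᵐᵒᵖ :=
  RingQuot.liftAlgHom Fq ⟨FreeAlgebra.lift Fq fun p : I × ℤ => MulOpposite.op (shGen O hS p.1 p.2), by
    intro x y h
    cases h with
    | ff i j r s =>
      rw [map_negQuad, map_zero]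
      have := negQuad_op (qi C i ^ C.c i j) (shGen O hS i) (shGen O hS j) r s
      rw [posQuad_shGen, MulOpposite.op_zero, neg_zero] at this
      simpa [hgen] using this
    | serre_f i j h r s =>
      rw [map_serre, map_zero]
      have := serre_op (fun k hk => qbinom_symm C i hk) (shGen O hS i) (shGen O hS j) r s
      rw [serre_shGen O hS h, MulOpposite.op_zero, smul_zero] at this
      simpa [hgen] using this⟩

theorem upsNeg_nf (i : I) (r : ℤ) : upsNeg O hS (nf C i r) = MulOpposite.op (shGen O hS i r) := by
  simp [upsNeg, nf, hgen]

end Upsilon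

end

section

/-! ### Difference operators -/

section Operators

variable {I : Type*} [Fintype I] {C : CartanDatum I} {a : I → ℕ}

/-- A shift as an automorphism of the field of coefficients. -/
def shiftHom (γ : Shift C a) : K a →ₐ[Fq] K a := MulSemiringAction.toAlgHom Fq (K a) γ

theorem shiftHom_apply (γ : Shift C a) (F : K a) : shiftHom γ F = γ • F := rfl

theorem shiftHom_x (n : V a → ℤ) (v : V a) :
    shiftHom (Shift.mk C n) (x v) = algebraMap Fq (K a) (qi C v.1 ^ n v) * x v := by
  change IsFractionRing.fieldEquivOfAlgEquivHom Fq (K a) (scaleHom C a (Shift.mk C n)) (x v) = _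
  rw [IsFractionRing.fieldEquivOfAlgEquivHom_apply, x, IsFractionRing.fieldEquivOfAlgEquiv_algebraMap]
  change algebraMap _ (K a) (scale C n (MvPolynomial.X v)) = _
  rw [scale, MvPolynomial.aeval_X, map_mul]
  rfl

theorem shiftHom_w (n : V a → ℤ) (v : V a) :
    shiftHom (Shift.mk C n) (w v) = algebraMap Fq (K a) (qi C v.1 ^ (2 * n v)) * w v := by
  rw [w, map_pow, shiftHom_x, mul_pow, ← map_pow, ← zpow_natCast, ← zpow_mul, mul_comm (n v)]
  rfl

theorem mulOp_mul_shiftOp (F : K a) (n : V a → ℤ) :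
    mulOp C F * shiftOp C n = SkewMonoidAlgebra.single (Shift.mk C n) F := by
  rw [mulOp, shiftOp, SkewMonoidAlgebra.single_mul_single, one_mul, one_smul, mul_one]

theorem single_mul_single' (m n : V a → ℤ) (F G : K a) :
    (SkewMonoidAlgebra.single (Shift.mk C m) F : Diff C a) * SkewMonoidAlgebra.single (Shift.mk C n) G =
      SkewMonoidAlgebra.single (Shift.mk C (m + n)) (F * shiftHom (Shift.mk C m) G) := by
  rw [SkewMonoidAlgebra.single_mul_single]
  rfl

/-- Multiplication operators. -/
def mulHom (C : CartanDatum I) (a : I → ℕ) : K a →ₐ[Fq] Diff C a where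
  toFun := mulOp C
  map_one' := rfl
  map_mul' F G := by
    rw [mulOp, mulOp, mulOp, SkewMonoidAlgebra.single_mul_single, one_mul, one_smul]
  map_zero' := SkewMonoidAlgebra.single_zero _
  map_add' F G := SkewMonoidAlgebra.single_add _ _ _
  commutes' _ := rfl

theorem mulHom_apply (F : K a) : mulHom C a F = mulOp C F := rfl

theorem shiftOp_add (m n : V a → ℤ) : shiftOp C (m + n) = shiftOp C m * shiftOp C n := by
  rw [shiftOp, shiftOp, shiftOp, single_mul_single', map_one, mul_one]

theorem shiftOp_zero : shiftOp C (0 : V a → ℤ) = 1 := rfl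

theorem smul_single_Fq (c : Fq) (γ : Shift C a) (F : K a) :
    c • (SkewMonoidAlgebra.single γ F : Diff C a) = SkewMonoidAlgebra.single γ (c • F) :=
  SkewMonoidAlgebra.smul_single _ _ _

theorem shiftOp_mem {S : Subalgebra Fq (Diff C a)} (hS : diffGens C a ⊆ S) (n : V a → ℤ) :
    shiftOp C n ∈ S := by
  classical
  have h1 : ∀ v (m : ℤ), shiftOp C (Pi.single v m) ∈ S := by
    intro v m
    induction m using Int.induction_on with
    | zero => rw [Pi.single_zero, shiftOp_zero]; exact one_mem S
    | succ m ih =>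
      rw [Pi.single_add, shiftOp_add]
      refine mul_mem ih (hS (Or.inl (Or.inr ⟨v, ?_⟩)))
      congr!
    | pred m ih =>
      rw [sub_eq_add_neg, Pi.single_add, shiftOp_add]
      refine mul_mem ih (hS (Or.inr ⟨v, ?_⟩))
      congr!
  rw [← Finset.univ_sum_single n]
  induction (Finset.univ : Finset (V a)) using Finset.induction_on with
  | empty => rw [Finset.sum_empty, shiftOp_zero]; exact one_mem S
  | insert v s hv ih => rw [Finset.sum_insert hv, shiftOp_add]; exact mul_mem (h1 _ _) ih

theorem mulOp_laurent_mem {S : Subalgebra Fq (Diff C a)} (hS : diffGens C a ⊆ S) {F : K a}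
    (hF : F ∈ laurent a) : mulOp C F ∈ S := by
  have : laurent a ≤ S.comap (mulHom C a) := by
    refine Algebra.adjoin_le ?_
    rintro _ (⟨v, rfl⟩ | ⟨v, rfl⟩)
    · exact hS (Or.inl (Or.inl (Or.inl ⟨v, rfl⟩)))
    · exact hS (Or.inl (Or.inl (Or.inr ⟨v, rfl⟩)))
  exact this hF

end Operators

/-! ### Slots -/

section Slots

variable {I : Type*} [Fintype I] [DecidableEq I] {a : I → ℕ}

/-- The points at which the shuffle elements are evaluated are indexed by these pairs. -/
abbrev Slot (a : I → ℕ) := Σ _ : V a, ℕ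

/-- The colour of a slot. -/
def slotCl (u : Slot a) : I := u.1.1

/-- The first `m v` slots over every `v`. -/
def slots (m : V a → ℕ) : Finset (Slot a) := Finset.univ.sigma fun v => Finset.range (m v)

theorem mem_slots {m : V a → ℕ} {u : Slot a} : u ∈ slots m ↔ u.2 < m u.1 := by
  simp [slots]

theorem slots_injective : Function.Injective (slots (a := a)) := by
  intro m n h
  funext v
  refine le_antisymm ?_ ?_ <;> by_contra hlt
  · have : (⟨v, n v⟩ : Slot a) ∈ slots m := mem_slots.2 (not_le.1 hlt)
    rw [h, mem_slots] at this
    exact lt_irrefl _ this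
  · have : (⟨v, m v⟩ : Slot a) ∈ slots n := mem_slots.2 (not_le.1 hlt)
    rw [← h, mem_slots] at this
    exact lt_irrefl _ this

/-- The translation of the slots over `v` by `m v`. -/
def slotShift (m : V a → ℕ) : Slot a ↪ Slot a where
  toFun u := ⟨u.1, u.2 + m u.1⟩
  inj' := by
    rintro ⟨v, p⟩ ⟨v', p'⟩ h
    obtain rfl : v = v' := congrArg Sigma.fst h
    simpa using h

theorem slotShift_apply (m : V a → ℕ) (u : Slot a) : slotShift m u = ⟨u.1, u.2 + m u.1⟩ := rfl

theorem slots_add_sdiff (m n : V a → ℕ) : slots (m + n) \ slots m = (slots n).map (slotShift m) := by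
  ext ⟨v, p⟩
  simp only [Finset.mem_sdiff, mem_slots, Finset.mem_map, Pi.add_apply, not_lt, slotShift_apply]
  constructor
  · rintro ⟨h1, h2⟩
    exact ⟨⟨v, p - m v⟩, show p - m v < n v by omega, by
      simp only [Sigma.mk.injEq, heq_eq_eq, true_and]; omega⟩
  · rintro ⟨⟨v', p'⟩, h1, h2⟩
    change p' < n v' at h1
    simp only [Sigma.mk.injEq, heq_eq_eq] at h2
    obtain ⟨rfl, rfl⟩ := h2
    omega

theorem slots_subset_iff {m n : V a → ℕ} : slots m ⊆ slots n ↔ m ≤ n := by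
  constructor
  · intro h v
    by_contra hlt
    have := h (mem_slots.2 (not_le.1 hlt : (⟨v, n v⟩ : Slot a).2 < m v))
    rw [mem_slots] at this
    exact lt_irrefl _ this
  · intro h u hu
    rw [mem_slots] at hu ⊢
    exact hu.trans_le (h _)

theorem exists_slots_eq {A : Finset (Slot a)} (h : ∀ v p, (⟨v, p + 1⟩ : Slot a) ∈ A → (⟨v, p⟩ : Slot a) ∈ A) :
    ∃ m, slots m = A := by
  classical
  have hex : ∀ v, ∃ p, (⟨v, p⟩ : Slot a) ∉ A := by
    intro v
    by_contra hall
    push Not at hall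
    exact Set.infinite_of_injective_forall_mem (s := (A : Set (Slot a))) (f := fun p : ℕ => ⟨v, p⟩)
      (fun p p' hpp => by simpa using hpp) hall A.finite_toSet
  refine ⟨fun v => Nat.find (hex v), ?_⟩
  ext ⟨v, p⟩
  rw [mem_slots]
  constructor
  · intro hp
    by_contra hA
    exact Nat.find_min (hex v) hp hA
  · intro hA
    by_contra hp
    have : ∀ n, (⟨v, Nat.find (hex v) + n⟩ : Slot a) ∉ A := by
      intro n
      induction n with
      | zero => exact Nat.find_spec (hex v)
      | succ n ih => exact fun h' => ih (h _ _ h')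
    refine this (p - Nat.find (hex v)) ?_
    rwa [Nat.add_sub_cancel' (not_lt.1 hp)]

/-- The total number of slots of every colour. -/
def slotDeg (m : V a → ℕ) : I → ℕ := fun i => ∑ r : Fin (a i), m ⟨i, r⟩

theorem slotDeg_add (m n : V a → ℕ) : slotDeg (m + n) = slotDeg m + slotDeg n := by
  funext i
  simp [slotDeg, Finset.sum_add_distrib]

/-- The enumeration of the slots used by `specPt`. -/
def slotEnum {k : I → ℕ} (m : Comp a k) : V k → Slot a := fun v =>
  let t := finSigmaFinEquiv.symm (Fin.cast (m.2 v.1).symm v.2)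
  ⟨⟨v.1, t.1⟩, t.2⟩

/-- The exponents as a function on pairs. -/
def Comp.fn {k : I → ℕ} (m : Comp a k) : V a → ℕ := fun v => m.1 v.1 v.2

theorem isEnum_slotEnum {k : I → ℕ} (m : Comp a k) : IsEnum slotCl (slotEnum m) (slots m.fn) := by
  refine ⟨?_, fun v => rfl, fun u => ?_⟩
  · rintro ⟨i, r⟩ ⟨j, s⟩ h
    obtain rfl : i = j := congrArg (fun u : Slot a => u.1.1) h
    simp only [slotEnum, Sigma.mk.injEq, heq_eq_eq, true_and] at h
    have : finSigmaFinEquiv.symm (Fin.cast (m.2 i).symm r) =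
        finSigmaFinEquiv.symm (Fin.cast (m.2 i).symm s) :=
      Sigma.ext h.1 ((Fin.heq_ext_iff (by rw [h.1])).2 h.2)
    simpa using this
  · rw [mem_slots]
    constructor
    · intro hu
      let t : Σ r : Fin (a u.1.1), Fin (m.1 u.1.1 r) := ⟨u.1.2, ⟨u.2, hu⟩⟩
      refine ⟨⟨u.1.1, Fin.cast (m.2 _) (finSigmaFinEquiv t)⟩, ?_⟩
      have e : finSigmaFinEquiv.symm (Fin.cast (m.2 u.1.1).symm
          (Fin.cast (m.2 u.1.1) (finSigmaFinEquiv t))) = t := by simp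
      have key : ∀ s : Σ r : Fin (a u.1.1), Fin (m.1 u.1.1 r), s = t →
          (⟨⟨u.1.1, s.1⟩, (s.2 : ℕ)⟩ : Slot a) = u := by
        rintro _ rfl
        rfl
      exact key _ e
    · rintro ⟨v, rfl⟩
      exact (finSigmaFinEquiv.symm (Fin.cast (m.2 v.1).symm v.2)).2.2

theorem cnt_slots (m : V a → ℕ) : cnt slotCl (slots m) = slotDeg m := by
  have := (isEnum_slotEnum (⟨fun i r => m ⟨i, r⟩, fun i => rfl⟩ : Comp a (slotDeg m))).cnt_eq
  exact this

/-- The exponents of given degree. -/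
def comps (a k : I → ℕ) : Finset (V a → ℕ) := Finset.univ.image (Comp.fn (a := a) (k := k))

theorem mem_comps {k : I → ℕ} {m : V a → ℕ} : m ∈ comps a k ↔ slotDeg m = k := by
  simp only [comps, Finset.mem_image, Finset.mem_univ, true_and]
  constructor
  · rintro ⟨m, rfl⟩
    exact funext m.2
  · intro h
    exact ⟨⟨fun i r => m ⟨i, r⟩, fun i => congrFun h i⟩, rfl⟩

theorem sum_comps {k : I → ℕ} {M : Type*} [AddCommMonoid M] (f : (V a → ℕ) → M) :
    ∑ m ∈ comps a k, f m = ∑ m : Comp a k, f m.fn := by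
  rw [comps, Finset.sum_image]
  intro m _ n _ h
  refine Subtype.ext ?_
  funext i r
  exact congrFun h ⟨i, r⟩

end Slots

end

section

/-! ### The two families of coefficients -/

section Coefficients

variable {I : Type*} [Fintype I] [DecidableEq I] {C : CartanDatum I} (O : DynOrientation C)
  {a : I → ℕ} {N : ℕ} (col : Fin N → I) (z : Fin N → ℂ) (ε : Bool)

/-- The sign distinguishing the positive and the negative half. -/
def sg (ε : Bool) : ℤ := if ε then 1 else -1

theorem sg_mul_sg : sg ε * sg ε = 1 := by cases ε <;> rfl

/-- The orientation, reversed in the negative case. -/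
def arrE (j i : I) : Prop := if ε then O.arr j i else O.arr i j

variable (C) in
/-- The evaluation points. -/
def pt (u : Slot a) : K a := if ε then ptPlus C a u.1.1 u.1.2 u.2 else ptMinus C a u.1.1 u.1.2 u.2

variable (C) in
theorem pt_eq (u : Slot a) :
    pt C ε u = algebraMap Fq (K a) (qi C u.1.1 ^ (1 - sg ε - 2 * sg ε * u.2)) * w u.1 := by
  cases ε
  · rw [pt, ptMinus, mul_comm]
    simp only [sg, Bool.false_eq_true, if_false]
    congr 3
    ring
  · rw [pt, ptPlus, mul_comm]
    simp only [sg, if_true]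
    congr 3
    ring

theorem w_ne_zero (v : V a) : (w v : K a) ≠ 0 := pow_ne_zero _ (x_ne_zero v)

theorem algebraMap_qi_zpow_ne_zero {E : Type*} [Field E] [Algebra Fq E] (i : I) (n : ℤ) :
    algebraMap Fq E (qi C i ^ n) ≠ 0 := (map_ne_zero _).2 (zpow_ne_zero _ (qi_ne_zero C i))

theorem mul_w_eq {b c : Fq} (hb : b ≠ 0) {u v : V a}
    (h : algebraMap Fq (K a) b * w u = algebraMap Fq (K a) c * w v) : u = v ∧ b = c := by
  have hinj := IsFractionRing.injective (MvPolynomial (V a) Fq) (K a)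
  have h' : MvPolynomial.C b * MvPolynomial.X u ^ 2 = MvPolynomial.C c * MvPolynomial.X v ^ 2 := by
    apply hinj
    rw [map_mul, map_mul, map_pow, map_pow]
    exact h
  rw [MvPolynomial.C_mul_X_pow_eq_monomial, MvPolynomial.C_mul_X_pow_eq_monomial,
    MvPolynomial.monomial_eq_monomial_iff] at h'
  rcases h' with ⟨h1, h2⟩ | ⟨h1, _⟩
  · exact ⟨Finsupp.single_left_injective two_ne_zero h1, h2⟩
  · exact absurd h1 hb

variable (C) in
theorem pt_ne_zero (u : Slot a) : pt C ε u ≠ 0 := by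
  rw [pt_eq]
  exact mul_ne_zero (algebraMap_qi_zpow_ne_zero _ _) (w_ne_zero _)

theorem pt_eq_mul_pt {u u' : Slot a} {c : Fq} (h : pt C ε u = algebraMap Fq (K a) c * pt C ε u') :
    u.1 = u'.1 ∧ c = qi C u.1.1 ^ (2 * sg ε * ((u'.2 : ℤ) - u.2)) := by
  rw [pt_eq, pt_eq, ← mul_assoc, ← map_mul] at h
  obtain ⟨h1, h2⟩ := mul_w_eq (zpow_ne_zero _ (qi_ne_zero C _)) h
  refine ⟨h1, ?_⟩
  rw [← h1] at h2
  rw [← mul_inv_eq_iff_eq_mul₀ (zpow_ne_zero _ (qi_ne_zero C _)), ← zpow_neg,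
    ← zpow_add₀ (qi_ne_zero C _)] at h2
  rw [← h2]
  congr 1
  ring

variable (C a) in
theorem admissible_pt : Admissible (slotCl (a := a)) (pt C ε) where
  ne_zero := pt_ne_zero C ε
  ne u v huv _ h := by
    obtain ⟨h1, h2⟩ := pt_eq_mul_pt (c := 1) ε (h.trans (by rw [map_one, one_mul]))
    have h3 := qi_zpow_injective C _ ((zpow_zero _).trans h2)
    refine huv (Sigma.ext h1 (heq_of_eq ?_))
    have : (v.2 : ℤ) - u.2 = 0 := by
      cases ε <;> simp only [sg, Bool.false_eq_true, if_false, if_true] at h3 <;> linarith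
    omega

variable (C) in
/-- The shift attached to exponents `m`. -/
def shiftE (m : V a → ℕ) : Shift C a := Shift.mk C fun v => -sg ε * m v

theorem shiftHom_pt (m : V a → ℕ) (u : Slot a) :
    shiftHom (shiftE C ε m) (pt C ε u) = pt C ε (slotShift m u) := by
  rw [pt_eq, pt_eq, map_mul, AlgHom.commutes, shiftE, shiftHom_w, ← mul_assoc, ← map_mul,
    ← zpow_add₀ (qi_ne_zero C _), slotShift_apply]
  congr 3
  push_cast
  ring

/-- The kernel of the shuffle product, transposed in the negative case. -/
def kapE (u u' : Slot a) : K a :=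
  if ε then kapAt O slotCl (pt C ε) u u' else kapAt O slotCl (pt C ε) u' u

open Classical in
/-- The factor of the coefficients attached to a pair of slots. -/
def pairE (u u' : Slot a) : K a :=
  if u.1 = u'.1 then
    if u.2 < u'.2 then algebraMap Fq (K a) (qi C u.1.1 ^ (-(1 + sg ε))) * (kapE O ε u u')⁻¹ else 1
  else if u.1.1 = u'.1.1 then algebraMap Fq (K a) (qi C u.1.1 ^ (-1 : ℤ)) * (kapE O ε u u')⁻¹
  else if arrE O ε u'.1.1 u.1.1 then (kapE O ε u u')⁻¹ else 1

/-- The factor of the coefficients attached to a slot. -/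
def ptE (v : V a) (y : K a) : K a := if ε then Y O col z v.1 v.2 y else Y' O v.1 v.2 y

/-- The coefficients. -/
def coefE (m : V a → ℕ) : K a :=
  (∏ u ∈ slots m, ptE O col z ε u.1 (pt C ε u)) * ∏ u ∈ slots m, ∏ u' ∈ slots m, pairE O ε u u'

theorem map_kap {E E' : Type*} [Field E] [Algebra Fq E] [Field E'] [Algebra Fq E'] (φ : E →ₐ[Fq] E')
    (i j : I) (y y' : E) : φ (kap O i j y y') = kap O i j (φ y) (φ y') := by
  unfold kap zeta
  split_ifs <;> simp

theorem shiftHom_kapE (m : V a → ℕ) (u u' : Slot a) :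
    shiftHom (shiftE C ε m) (kapE O ε u u') = kapE O ε (slotShift m u) (slotShift m u') := by
  cases ε
  all_goals
    simp only [kapE, kapAt, Bool.false_eq_true, if_false, if_true, map_kap, shiftHom_pt]
    rfl

theorem shiftHom_pairE (m : V a → ℕ) (u u' : Slot a) :
    shiftHom (shiftE C ε m) (pairE O ε u u') = pairE O ε (slotShift m u) (slotShift m u') := by
  classical
  have h2 : u.1 = u'.1 → ((slotShift m u).2 < (slotShift m u').2 ↔ u.2 < u'.2) := fun e => by
    simp only [slotShift_apply, e, add_lt_add_iff_right]
  have h : pairE O ε (slotShift m u) (slotShift m u') =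
      if u.1 = u'.1 then
        if (slotShift m u).2 < (slotShift m u').2 then algebraMap Fq (K a) (qi C u.1.1 ^ (-(1 + sg ε))) *
          (kapE O ε (slotShift m u) (slotShift m u'))⁻¹ else 1
      else if u.1.1 = u'.1.1 then algebraMap Fq (K a) (qi C u.1.1 ^ (-1 : ℤ)) *
        (kapE O ε (slotShift m u) (slotShift m u'))⁻¹
      else if arrE O ε u'.1.1 u.1.1 then (kapE O ε (slotShift m u) (slotShift m u'))⁻¹ else 1 := by
    rfl
  rw [h]
  unfold pairE
  by_cases h3 : u.1 = u'.1
  · rw [if_pos h3, if_pos h3]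
    simp only [h2 h3]
    split_ifs <;> simp [shiftHom_kapE]
  · rw [if_neg h3, if_neg h3]
    split_ifs <;> simp [shiftHom_kapE]

/-- The contribution of a pair of slots to the comparison of coefficients. -/
def hE (u u' : Slot a) : K a := pairE O ε u u' * kapE O ε u u' * pairE O ε u' u

theorem kap_ne_zero {E : Type*} [Field E] [Algebra Fq E] {i j : I} {y y' : E}
    (h : i = j → y ≠ y') (h' : y ≠ algebraMap Fq E (qi C i ^ (-C.c i j)) * y') :
    kap O i j y y' ≠ 0 := by
  have h1 := sub_ne_zero.2 h'
  by_cases hij : i = j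
  · subst hij
    rw [kap_self]
    exact div_ne_zero h1 (sub_ne_zero.2 (h rfl))
  · by_cases ha : O.arr j i
    · rw [kap_of_arr_right O ha]
      exact h1
    · by_cases hb : O.arr i j
      · rw [kap_of_arr_left O hb]
        exact neg_ne_zero.2 h1
      · rw [kap_of_not_arr O hij hb ha]
        exact one_ne_zero

theorem kapAt_pt_ne_zero {u u' : Slot a} (h : u.1 ≠ u'.1) : kapAt O slotCl (pt C ε) u u' ≠ 0 :=
  kap_ne_zero O (fun e => (admissible_pt C a ε).ne u u' (fun h' => h (congrArg Sigma.fst h')) e)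
    fun e => h (pt_eq_mul_pt ε e).1

theorem kapE_ne_zero {u u' : Slot a} (h : u.1 ≠ u'.1) : kapE O ε u u' ≠ 0 := by
  cases ε
  · exact kapAt_pt_ne_zero O false (Ne.symm h)
  · exact kapAt_pt_ne_zero O true h

theorem kapE_self_ne_zero {u u' : Slot a} (h : u.1 = u'.1) (h' : u.2 < u'.2) : kapE O ε u u' ≠ 0 := by
  have hne : u ≠ u' := fun e => by rw [e] at h'; exact lt_irrefl _ h'
  have hcl : slotCl u = slotCl u' := congrArg Sigma.fst h
  cases ε
  · refine kap_ne_zero O (fun e => (admissible_pt C a false).ne _ _ hne.symm e) fun e => ?_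
    have h1 := qi_zpow_injective C _ (hcl ▸ (pt_eq_mul_pt false e).2 :)
    rw [C.c_diag] at h1
    simp only [sg, Bool.false_eq_true, if_false] at h1
    omega
  · refine kap_ne_zero O (fun e => (admissible_pt C a true).ne _ _ hne e) fun e => ?_
    have h1 := qi_zpow_injective C _ (pt_eq_mul_pt true e).2
    rw [hcl, C.c_diag] at h1
    simp only [sg, if_true] at h1
    omega

theorem kapE_succ (v : V a) (p : ℕ) : kapE O ε (⟨v, p + 1⟩ : Slot a) ⟨v, p⟩ = 0 := by
  cases ε
  all_goals
    simp only [kapE, kapAt, slotCl, Bool.false_eq_true, if_false, if_true, kap_self, zeta, pt_eq,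
      C.c_diag, sg]
    rw [← mul_assoc, ← map_mul, ← zpow_add₀ (qi_ne_zero C _)]
    refine div_eq_zero_iff.2 (Or.inl (sub_eq_zero.2 ?_))
    congr 3
    push_cast
    ring

/-- `Q_i = q_i^{±1}`, as an element of the field of coefficients. -/
def qE (ε : Bool) (C : CartanDatum I) (a : I → ℕ) (i : I) (n : ℤ) : K a :=
  algebraMap Fq (K a) (qi C i ^ (sg ε * n))

theorem hE_of_eq {u u' : Slot a} (h : u.1 = u'.1) (h' : u.2 < u'.2) :
    hE O ε u u' = algebraMap Fq (K a) (qi C u.1.1 ^ (-(1 + sg ε))) := by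
  rw [hE, pairE, if_pos h, if_pos h', pairE, if_pos h.symm, if_neg (by omega), mul_one,
    inv_mul_cancel_right₀ (kapE_self_ne_zero O ε h h')]

theorem hE_of_colour_eq {u u' : Slot a} (h : u.1 ≠ u'.1) (h' : u.1.1 = u'.1.1) :
    hE O ε u u' = algebraMap Fq (K a) (qi C u.1.1 ^ (-(1 + sg ε))) * ((pt C ε u' - pt C ε u) /
      (pt C ε u' - qE ε C a u.1.1 (-2) * pt C ε u)) := by
  rw [hE, pairE, if_neg h, if_pos h', pairE, if_neg (Ne.symm h), if_pos h'.symm,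
    inv_mul_cancel_right₀ (kapE_ne_zero O ε h), ← h']
  have hq := algebraMap_qi_zpow_ne_zero (C := C) (E := K a) u.1.1 1
  have h1 : pt C ε u - pt C ε u' ≠ 0 := sub_ne_zero.2 fun e => by
    exact h (pt_eq_mul_pt (c := 1) ε (e.trans (by rw [map_one, one_mul]))).1
  have h2 : pt C ε u' - pt C ε u ≠ 0 := by rwa [← neg_sub, neg_ne_zero]
  cases ε
  · simp only [kapE, kapAt, slotCl, Bool.false_eq_true, if_false, kap_self, zeta, C.c_diag, sg, ← h',
      qE, map_zpow₀]
    have h3 : pt C false u - algebraMap Fq (K a) (qi C u.1.1 ^ (-2 : ℤ)) * pt C false u' ≠ 0 :=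
      sub_ne_zero.2 fun e => h (pt_eq_mul_pt false e).1
    have h4 : pt C false u' - algebraMap Fq (K a) (qi C u.1.1 ^ (2 : ℤ)) * pt C false u ≠ 0 :=
      sub_ne_zero.2 fun e => h (pt_eq_mul_pt false e).1.symm
    generalize pt C false u = y at *
    generalize pt C false u' = y' at *
    simp only [map_zpow₀, zpow_one] at h3 h4 hq ⊢
    generalize algebraMap Fq (K a) (qi C u.1.1) = A at *
    have hA2 : A ^ (-2 : ℤ) = (A ^ 2)⁻¹ := by rw [zpow_neg]; norm_cast
    rw [hA2] at h3
    rw [inv_div, hA2]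
    norm_num
    rw [← mul_assoc, ← mul_inv, ← mul_div_assoc, div_eq_div_iff h3 (by exact_mod_cast h4)]
    have hA : (A ^ 2)⁻¹ * A ^ 2 = 1 := inv_mul_cancel₀ (pow_ne_zero _ hq)
    rw [← pow_two]
    linear_combination (y' - y) * y * hA
  · simp only [kapE, kapAt, slotCl, if_true, kap_self, zeta, C.c_diag, sg, ← h', qE, map_zpow₀]
    rw [inv_div, ← mul_assoc, ← zpow_add₀ (by simpa using hq)]
    norm_num

theorem hE_of_arr {u u' : Slot a} (h : arrE O ε u'.1.1 u.1.1) : hE O ε u u' = 1 := by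
  have hne : u.1.1 ≠ u'.1.1 := fun e => by
    cases ε
    · exact O.ne_of_arr (show O.arr u.1.1 u'.1.1 from h) e
    · exact O.ne_of_arr (show O.arr u'.1.1 u.1.1 from h) e.symm
  have hne' : u.1 ≠ u'.1 := fun e => hne (congrArg Sigma.fst e)
  have h' : ¬ arrE O ε u.1.1 u'.1.1 := fun h' => by
    cases ε <;> exact O.asymm _ _ h h'
  rw [hE, pairE, if_neg hne', if_neg hne, if_pos h, pairE, if_neg hne'.symm, if_neg hne.symm,
    if_neg h', mul_one, inv_mul_cancel₀ (kapE_ne_zero O ε hne')]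

theorem hE_of_not_arr {u u' : Slot a} (hne : u.1.1 ≠ u'.1.1) (h : ¬ arrE O ε u'.1.1 u.1.1)
    (h' : ¬ arrE O ε u.1.1 u'.1.1) : hE O ε u u' = 1 := by
  have hne' : u.1 ≠ u'.1 := fun e => hne (congrArg Sigma.fst e)
  rw [hE, pairE, if_neg hne', if_neg hne, if_neg h, pairE, if_neg hne'.symm, if_neg hne.symm,
    if_neg h', one_mul, mul_one]
  cases ε
  · exact kap_of_not_arr O hne.symm h' h _ _
  · exact kap_of_not_arr O hne h' h _ _

theorem hE_of_arr' {u u' : Slot a} (h : arrE O ε u.1.1 u'.1.1) :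
    hE O ε u u' = (qE ε C a u.1.1 (-C.c u.1.1 u'.1.1) * pt C ε u' - pt C ε u) /
      (pt C ε u' - qE ε C a u.1.1 (-C.c u.1.1 u'.1.1) * pt C ε u) := by
  have hne : u.1.1 ≠ u'.1.1 := fun e => by
    cases ε
    · exact O.ne_of_arr (show O.arr u'.1.1 u.1.1 from h) e.symm
    · exact O.ne_of_arr (show O.arr u.1.1 u'.1.1 from h) e
  have hne' : u.1 ≠ u'.1 := fun e => hne (congrArg Sigma.fst e)
  have h' : ¬ arrE O ε u'.1.1 u.1.1 := fun h' => by
    cases ε <;> exact O.asymm _ _ h h'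
  rw [hE, pairE, if_neg hne', if_neg hne, if_neg h', pairE, if_neg hne'.symm, if_neg hne.symm,
    if_pos h, one_mul]
  cases ε
  · have e1 : kapE O false u u' = -(pt C false u' -
        algebraMap Fq (K a) (qi C u.1.1 ^ (-C.c u.1.1 u'.1.1)) * pt C false u) := by
      rw [qi_zpow_neg_c_symm]
      exact kap_of_arr_left O h _ _
    have e2 : kapE O false u' u = pt C false u -
        algebraMap Fq (K a) (qi C u.1.1 ^ (-C.c u.1.1 u'.1.1)) * pt C false u' :=
      kap_of_arr_right O h _ _
    have h3 := kapE_ne_zero O false hne'.symm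
    have hA := algebraMap_qi_zpow_ne_zero (C := C) (E := K a) u.1.1 (-C.c u.1.1 u'.1.1)
    have e3 : qE false C a u.1.1 (-C.c u.1.1 u'.1.1) =
        (algebraMap Fq (K a) (qi C u.1.1 ^ (-C.c u.1.1 u'.1.1)))⁻¹ := by
      rw [qE, ← map_inv₀, ← zpow_neg]
      congr 2
      simp [sg]
    rw [e2] at h3
    rw [e1, e2, e3]
    generalize algebraMap Fq (K a) (qi C u.1.1 ^ (-C.c u.1.1 u'.1.1)) = A at *
    have h4 : pt C false u' - A⁻¹ * pt C false u ≠ 0 := fun e => h3 (by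
      have := congrArg (A * ·) e
      simp only [mul_sub, mul_inv_cancel_left₀ hA, mul_zero] at this
      linear_combination -this)
    rw [← div_eq_mul_inv, div_eq_div_iff h3 h4]
    field_simp
    ring
  · have e1 : kapE O true u u' = -(pt C true u - algebraMap Fq (K a) (qi C u.1.1 ^ (-C.c u.1.1 u'.1.1)) *
        pt C true u') := kap_of_arr_left O h _ _
    have e2 : kapE O true u' u = pt C true u' - algebraMap Fq (K a) (qi C u.1.1 ^ (-C.c u.1.1 u'.1.1)) *
        pt C true u := by
      rw [qi_zpow_neg_c_symm]
      exact kap_of_arr_right O h _ _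
    have e3 : qE true C a u.1.1 (-C.c u.1.1 u'.1.1) =
        algebraMap Fq (K a) (qi C u.1.1 ^ (-C.c u.1.1 u'.1.1)) := by
      rw [qE]
      congr 2
      simp [sg]
    rw [e1, e2, e3, neg_sub, div_eq_mul_inv]

end Coefficients

end

section

/-! ### The cocycle property of the coefficients -/

section Telescoping

variable {E : Type*} [Field E]

theorem prod_telescope_colour (y b θ : E) (m : ℕ) (h : ∀ p : ℕ, y - θ ^ p * b ≠ 0) :
    ∏ p ∈ Finset.range m, (y - θ ^ p * b) / (y - θ * (θ ^ p * b)) = (y - b) / (y - θ ^ m * b) := by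
  induction m with
  | zero => simp [div_self (by simpa using h 0)]
  | succ m ih =>
    rw [Finset.prod_range_succ, ih, ← mul_assoc θ, ← pow_succ', div_mul_div_cancel₀ (h m)]

theorem prod_telescope_edge {y Q : E} (hy : y ≠ 0) (hQ : Q ≠ 0) (b : E) (n m : ℕ)
    (h : ∀ p : ℕ, y - Q ^ (n : ℤ) * (Q ^ (-2 * (p : ℤ)) * b) ≠ 0) :
    (∏ r ∈ Finset.range n, (1 - b * Q ^ (2 * ((r : ℤ) + 1) - n) / y)) *
      ∏ p ∈ Finset.range m, (Q ^ (n : ℤ) * y - Q ^ (-2 * (p : ℤ)) * b) /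
        (y - Q ^ (n : ℤ) * (Q ^ (-2 * (p : ℤ)) * b)) =
      Q ^ ((n : ℤ) * m) * ∏ r ∈ Finset.range n,
        (1 - (Q ^ (-2 * (m : ℤ)) * b) * Q ^ (2 * ((r : ℤ) + 1) - n) / y) := by
  induction m with
  | zero => simp
  | succ m ih =>
    rw [Finset.prod_range_succ, ← mul_assoc, ih]
    let f : ℕ → E := fun r => 1 - (Q ^ (-2 * (m : ℤ)) * b) * Q ^ (2 * (r : ℤ) - n) / y
    have h1 : ∏ r ∈ Finset.range n, (1 - (Q ^ (-2 * ((m + 1 : ℕ) : ℤ)) * b) *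
        Q ^ (2 * ((r : ℤ) + 1) - n) / y) = ∏ r ∈ Finset.range n, f r := by
      refine Finset.prod_congr rfl fun r _ => ?_
      simp only [f]
      rw [mul_right_comm, mul_right_comm _ b, ← zpow_add₀ hQ, ← zpow_add₀ hQ]
      congr 4
      push_cast
      ring
    have h2 : ∏ r ∈ Finset.range n, (1 - (Q ^ (-2 * (m : ℤ)) * b) *
        Q ^ (2 * ((r : ℤ) + 1) - n) / y) = ∏ r ∈ Finset.range n, f (r + 1) := by
      refine Finset.prod_congr rfl fun r _ => ?_
      simp only [f]
      push_cast
      rfl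
    have h3 : (∏ r ∈ Finset.range n, f r) * f n = (∏ r ∈ Finset.range n, f (r + 1)) * f 0 := by
      rw [← Finset.prod_range_succ, ← Finset.prod_range_succ']
    have hn : y * f n = y - Q ^ (n : ℤ) * (Q ^ (-2 * (m : ℤ)) * b) := by
      simp only [f]
      rw [mul_sub, mul_one, mul_div_cancel₀ _ hy, two_mul, add_sub_cancel_right, mul_comm]
    have h0 : Q ^ (n : ℤ) * (y * f 0) = Q ^ (n : ℤ) * y - Q ^ (-2 * (m : ℤ)) * b := by
      simp only [f]
      rw [mul_sub, mul_one, mul_div_cancel₀ _ hy, Nat.cast_zero, mul_zero, zero_sub, mul_sub,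
        mul_comm _ (Q ^ (-(n : ℤ))), ← mul_assoc, ← zpow_add₀ hQ, add_neg_cancel, zpow_zero, one_mul]
    have hfn : f n ≠ 0 := fun e => h m (by rw [← hn, e, mul_zero])
    rw [h1, h2, ← hn, ← h0, eq_div_of_mul_eq hfn h3]
    have e : Q ^ ((n : ℤ) * (m + 1 : ℕ)) = Q ^ ((n : ℤ) * m) * Q ^ (n : ℤ) := by
      rw [← zpow_add₀ hQ]
      congr 1
    rw [e]
    field_simp

end Telescoping

section Cocycle

variable {I : Type*} [Fintype I] [DecidableEq I] {C : CartanDatum I} (O : DynOrientation C)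
  {a : I → ℕ} {N : ℕ} (col : Fin N → I) (z : Fin N → ℂ) (ε : Bool)

open Classical in
/-- The factor of `ptE` contributed by one variable. -/
def facE (v t : V a) (y : K a) : K a :=
  if t.1 = v.1 then
    x t ^ (1 + sg ε) * (if t = v then 1 else (1 - pt C ε ⟨t, 0⟩ / y)⁻¹)
  else if arrE O ε t.1 v.1 then
    x t ^ C.c t.1 v.1 * ∏ p ∈ Finset.Icc 1 (-C.c t.1 v.1).toNat,
      (1 - w t / (algebraMap Fq (K a) (qi C t.1 ^ (-C.c t.1 v.1 - 2 * (p : ℤ))) * y))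
  else 1

/-- The constant factor of `ptE`. -/
def conE (C : CartanDatum I) (ε : Bool) (i : I) : Fq :=
  if ε then 1 / (qi C i - (qi C i)⁻¹) else 1 / (1 - qi C i ^ 2)

open Classical in
theorem prod_colours {M : Type*} [CommMonoid M] (i : I) (P : M) (Q : I → M) :
    ∏ j, (if j = i then P else if arrE O ε j i then Q j else 1) =
      P * ∏ j ∈ Finset.univ.filter (fun j => arrE O ε j i), Q j := by
  have hi : ¬ arrE O ε i i := fun h => by
    cases ε <;> exact O.ne_of_arr h rfl
  have h : ∀ j, (if j = i then P else if arrE O ε j i then Q j else 1) =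
      (if j = i then P else 1) * (if arrE O ε j i then Q j else 1) := by
    intro j
    by_cases hj : j = i
    · subst hj
      simp [hi]
    · simp [hj]
  simp only [h]
  rw [Finset.prod_mul_distrib, Finset.prod_ite_eq', if_pos (Finset.mem_univ _), Finset.prod_filter]

open Classical in
theorem prod_facE (v : V a) (y : K a) : ∏ t, facE O ε v t y =
    ((∏ r : Fin (a v.1), x ⟨v.1, r⟩ ^ (1 + sg ε)) *
      (∏ r ∈ Finset.univ.filter (fun r => r ≠ v.2), (1 - pt C ε ⟨⟨v.1, r⟩, 0⟩ / y))⁻¹) *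
    ∏ j ∈ Finset.univ.filter (fun j => arrE O ε j v.1), wHalf C a v.1 j * Wprod (a := a) C v.1 j y := by
  rw [prod_V, ← prod_colours O ε v.1]
  refine Finset.prod_congr rfl fun j _ => ?_
  by_cases hj : j = v.1
  · rw [if_pos hj]
    subst hj
    obtain ⟨j, s⟩ := v
    simp only [facE, if_true]
    rw [Finset.prod_mul_distrib, ← Finset.prod_inv_distrib, Finset.prod_filter]
    congr 1
    refine Finset.prod_congr rfl fun r _ => ?_
    by_cases hr : r = s
    · subst hr; simp
    · rw [if_neg, if_pos hr]
      simpa using hr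
  · rw [if_neg hj]
    split_ifs with h
    · rw [wHalf, Wprod]
      simp only [W]
      rw [Finset.prod_comm, ← Finset.prod_mul_distrib]
      refine Finset.prod_congr rfl fun r _ => ?_
      rw [facE, if_neg hj, if_pos h]
      rfl
    · refine Finset.prod_eq_one fun r _ => ?_
      rw [facE, if_neg hj, if_neg h]

theorem ptE_eq (v : V a) (y : K a) : ptE O col z ε v y =
    algebraMap Fq (K a) (conE C ε v.1) * (if ε then Z col z C a v.1 y else 1) *
      ∏ t, facE O ε v t y := by
  classical
  rw [prod_facE, Finset.prod_mul_distrib]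
  cases ε
  · simp only [ptE, Y', conE, W', Bool.false_eq_true, if_false, arrE, sg, pt_eq]
    simp only [add_neg_cancel, zpow_zero, Finset.prod_const_one, one_mul, mul_one]
    have h : ∀ r : Fin (a v.1), algebraMap Fq (K a) (qi C v.1 ^ (1 - -1 - 2 * -1 * ((0 : ℕ) : ℤ))) *
        w ⟨v.1, r⟩ / y = w ⟨v.1, r⟩ / (y * algebraMap Fq (K a) (qi C v.1 ^ (-2 : ℤ))) := by
      intro r
      have : (1 - -1 - 2 * -1 * ((0 : ℕ) : ℤ)) = (-(-2 : ℤ)) := by norm_num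
      rw [this, zpow_neg _ (-2), map_inv₀, ← div_eq_inv_mul, div_div, mul_comm]
    simp only [h]
    rw [div_eq_mul_inv]
    have hd : ∀ (s : Fin (a v.1)) (f : Fin (a v.1) → K a) (d : DecidablePred fun r => r ≠ s),
        @Finset.prod _ _ _ (@Finset.filter _ (fun r => r ≠ s) d Finset.univ) f =
        ∏ r ∈ Finset.univ.filter (fun r => r ≠ s), f r := fun s f d => by congr!
    rw [hd]
    ring
  · simp only [ptE, Y, conE, W', if_true, arrE, sg, pt_eq, wAll, w]
    have h : ∀ r : Fin (a v.1), algebraMap Fq (K a) (qi C v.1 ^ (1 - 1 - 2 * 1 * ((0 : ℕ) : ℤ))) *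
        x ⟨v.1, r⟩ ^ 2 / y = x ⟨v.1, r⟩ ^ 2 / y := by
      intro r
      simp
    have h2 : ∀ r : Fin (a v.1), (x ⟨v.1, r⟩ : K a) ^ (1 + 1 : ℤ) = x ⟨v.1, r⟩ ^ 2 := fun r => by
      norm_cast
    simp only [h, h2]
    rw [div_eq_mul_inv]
    ring

theorem edge_prod (t : V a) (n : ℕ) (y : K a) :
    ∏ p ∈ Finset.Icc 1 n,
      (1 - w t / (algebraMap Fq (K a) (qi C t.1 ^ ((n : ℤ) - 2 * (p : ℤ))) * y)) =
    ∏ r ∈ Finset.range n, (1 - pt C ε ⟨t, 0⟩ * qE ε C a t.1 1 ^ (2 * ((r : ℤ) + 1) - n) / y) := by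
  have h : Finset.Icc 1 n = Finset.Ico 1 (n + 1) := by ext; simp
  rw [h, Finset.prod_Ico_eq_prod_range, Nat.add_sub_cancel]
  have hq : ∀ n : ℤ, algebraMap Fq (K a) (qi C t.1 ^ n) = algebraMap Fq (K a) (qi C t.1) ^ n :=
    fun n => map_zpow₀ _ _ _
  have hq0 : algebraMap Fq (K a) (qi C t.1) ≠ 0 := (map_ne_zero _).2 (qi_ne_zero C _)
  cases ε
  · rw [← Finset.prod_range_reflect]
    refine Finset.prod_congr rfl fun r hr => ?_
    have hr := Finset.mem_range.1 hr
    simp only [pt_eq, qE, sg, Bool.false_eq_true, if_false, hq]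
    rw [← zpow_mul, mul_comm (algebraMap Fq (K a) (qi C t.1) ^ _) (w t), mul_assoc,
      ← zpow_add₀ hq0, ← div_div, div_eq_mul_inv (w t), ← zpow_neg]
    congr 4
    have : ((n - 1 - r : ℕ) : ℤ) = n - 1 - r := by omega
    push_cast [this]
    ring
  · refine Finset.prod_congr rfl fun r _ => ?_
    simp only [pt_eq, qE, sg, if_true, hq]
    rw [← zpow_mul, mul_comm (algebraMap Fq (K a) (qi C t.1) ^ _) (w t), mul_assoc,
      ← zpow_add₀ hq0, ← div_div, div_eq_mul_inv (w t), ← zpow_neg]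
    congr 4
    push_cast
    ring

theorem qE_zpow (i : I) (n : ℤ) : qE ε C a i n = qE ε C a i 1 ^ n := by
  rw [qE, qE, ← map_zpow₀, ← zpow_mul, mul_one]

theorem qE_ne_zero (i : I) (n : ℤ) : qE ε C a i n ≠ 0 := algebraMap_qi_zpow_ne_zero _ _

theorem pt_eq_qE (t : V a) (p : ℕ) :
    pt C ε ⟨t, p⟩ = qE ε C a t.1 1 ^ (-2 * (p : ℤ)) * pt C ε ⟨t, 0⟩ := by
  rw [← qE_zpow, pt_eq, pt_eq, qE, ← mul_assoc, ← map_mul, ← zpow_add₀ (qi_ne_zero C _)]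
  congr 3
  push_cast
  ring

theorem shiftHom_x_shiftE (m : V a → ℕ) (t : V a) :
    shiftHom (shiftE C ε m) (x t) = qE ε C a t.1 1 ^ (-(m t : ℤ)) * x t := by
  rw [shiftE, shiftHom_x, ← qE_zpow, qE]
  congr 3
  ring

theorem pt_sub_ne_zero {u u' : Slot a} (h : u.1 ≠ u'.1) (c : Fq) :
    pt C ε u - algebraMap Fq (K a) c * pt C ε u' ≠ 0 :=
  sub_ne_zero.2 fun e => h (pt_eq_mul_pt ε e).1

theorem facE_shift (m : V a → ℕ) (u : Slot a) (t : V a) :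
    facE O ε u.1 t (pt C ε (slotShift m u)) *
        ∏ p ∈ Finset.range (m t), hE O ε ⟨t, p⟩ (slotShift m u) =
      shiftHom (shiftE C ε m) (facE O ε u.1 t (pt C ε u)) := by
  classical
  have hQ : qE ε C a t.1 1 ≠ 0 := qE_ne_zero ε _ _
  set Q := qE ε C a t.1 1 with hQdef
  have hconst : algebraMap Fq (K a) (qi C t.1 ^ (-(1 + sg ε))) = Q ^ (-(1 + sg ε)) := by
    rw [hQdef, ← qE_zpow, qE]
    congr 2
    linear_combination (sg_mul_sg ε)
  have hbase : shiftHom (shiftE C ε m) (pt C ε ⟨t, 0⟩) = Q ^ (-2 * (m t : ℤ)) * pt C ε ⟨t, 0⟩ := by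
    rw [shiftHom_pt, slotShift_apply]
    simp only [zero_add]
    exact pt_eq_qE ε t (m t)
  have hxp : ∀ n : ℤ, shiftHom (shiftE C ε m) (x t ^ n) = Q ^ (-(m t : ℤ) * n) * x t ^ n := by
    intro n
    rw [map_zpow₀, shiftHom_x_shiftE, mul_zpow, ← zpow_mul]
  obtain ⟨v, p⟩ := u
  set y := pt C ε (slotShift m ⟨v, p⟩) with hy
  have hy' : shiftHom (shiftE C ε m) (pt C ε ⟨v, p⟩) = y := shiftHom_pt ε m _
  have hy0 : y ≠ 0 := pt_ne_zero C ε _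
  by_cases htv : t = v
  · subst htv
    have hh : ∀ p' ∈ Finset.range (m t), hE O ε ⟨t, p'⟩ (slotShift m ⟨t, p⟩) = Q ^ (-(1 + sg ε)) := by
      intro p' hp'
      rw [Finset.mem_range] at hp'
      refine (hE_of_eq O ε (u := ⟨t, p'⟩) (u' := slotShift m ⟨t, p⟩) rfl ?_).trans hconst
      simp only [slotShift_apply]
      omega
    rw [Finset.prod_congr rfl hh, Finset.prod_const, Finset.card_range]
    simp only [facE, if_true, mul_one]
    rw [hxp, ← zpow_natCast, ← zpow_mul, mul_comm]
    congr 2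
    ring
  by_cases hc : t.1 = v.1
  · simp only [facE, if_pos hc, if_neg htv]
    have hh : ∀ p' ∈ Finset.range (m t), hE O ε ⟨t, p'⟩ (slotShift m ⟨v, p⟩) = Q ^ (-(1 + sg ε)) *
        ((y - (Q ^ (-2 : ℤ)) ^ p' * pt C ε ⟨t, 0⟩) /
          (y - Q ^ (-2 : ℤ) * ((Q ^ (-2 : ℤ)) ^ p' * pt C ε ⟨t, 0⟩))) := by
      intro p' _
      rw [hE_of_colour_eq O ε htv hc, hconst, pt_eq_qE ε t p', qE_zpow ε t.1 (-2), ← hQdef, ← hy,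
        zpow_mul, zpow_natCast]
    have hne : ∀ p : ℕ, y - (Q ^ (-2 : ℤ)) ^ p * pt C ε ⟨t, 0⟩ ≠ 0 := by
      intro p'
      have := pt_sub_ne_zero (C := C) ε (u := slotShift m ⟨v, p⟩) (u' := ⟨t, p'⟩) (Ne.symm htv) 1
      rwa [map_one, one_mul, pt_eq_qE ε t p', zpow_mul, zpow_natCast] at this
    rw [Finset.prod_congr rfl hh, Finset.prod_mul_distrib, prod_telescope_colour _ _ _ _ hne,
      Finset.prod_const, Finset.card_range, map_mul, hxp, map_inv₀, map_sub, map_one, map_div₀, hbase,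
      hy']
    have h1 := hne 0
    have h2 := hne (m t)
    rw [← zpow_natCast, ← zpow_mul] at h2 ⊢
    rw [pow_zero, one_mul] at h1
    rw [← zpow_natCast, ← zpow_mul, one_sub_div hy0, one_sub_div hy0, inv_div, inv_div,
      show -(1 + sg ε) * (m t : ℤ) = -(m t : ℤ) * (1 + sg ε) by ring]
    field_simp
  have htv' : ∀ p', (⟨t, p'⟩ : Slot a).1 ≠ (slotShift m ⟨v, p⟩).1 := fun _ => htv
  by_cases ha : arrE O ε t.1 v.1
  · simp only [facE, if_neg hc, if_pos ha]
    have hcn : C.c t.1 v.1 = -((-C.c t.1 v.1).toNat : ℤ) := by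
      have := C.c_offDiag _ _ hc
      omega
    set n := (-C.c t.1 v.1).toNat with hn
    have hh : ∀ p' ∈ Finset.range (m t), hE O ε ⟨t, p'⟩ (slotShift m ⟨v, p⟩) =
        (Q ^ (n : ℤ) * y - Q ^ (-2 * (p' : ℤ)) * pt C ε ⟨t, 0⟩) /
          (y - Q ^ (n : ℤ) * (Q ^ (-2 * (p' : ℤ)) * pt C ε ⟨t, 0⟩)) := by
      intro p' _
      rw [hE_of_arr' O ε (u := ⟨t, p'⟩) (u' := slotShift m ⟨v, p⟩) ha]
      simp only [← hy]
      rw [pt_eq_qE ε t p', qE_zpow ε t.1 (-_), ← hQdef,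
        show -C.c t.1 (slotShift m ⟨v, p⟩).1.1 = (n : ℤ) by rw [← neg_neg (n : ℤ), ← hcn]; rfl]
    have hne : ∀ p' : ℕ, y - Q ^ (n : ℤ) * (Q ^ (-2 * (p' : ℤ)) * pt C ε ⟨t, 0⟩) ≠ 0 := by
      intro p'
      have := pt_sub_ne_zero (C := C) ε (u := slotShift m ⟨v, p⟩) (u' := ⟨t, p'⟩) (Ne.symm htv)
        (qi C t.1 ^ (sg ε * n))
      rwa [pt_eq_qE ε t p', show algebraMap Fq (K a) (qi C t.1 ^ (sg ε * n)) = Q ^ (n : ℤ) from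
        qE_zpow ε t.1 n] at this
    rw [Finset.prod_congr rfl hh, hcn, neg_neg, edge_prod ε, edge_prod ε, mul_assoc, ← hQdef,
      prod_telescope_edge hy0 hQ _ _ _ hne, map_mul, hxp, map_prod]
    have : ∀ r : ℕ, shiftHom (shiftE C ε m) (1 - pt C ε ⟨t, 0⟩ * Q ^ (2 * ((r : ℤ) + 1) - n) / pt C ε ⟨v, p⟩) =
        1 - Q ^ (-2 * (m t : ℤ)) * pt C ε ⟨t, 0⟩ * Q ^ (2 * ((r : ℤ) + 1) - n) / y := by
      intro r
      rw [map_sub, map_one, map_div₀, map_mul, hbase, hy', map_zpow₀, hQdef, qE, AlgHom.commutes]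
    simp only [this]
    rw [show -(m t : ℤ) * -(n : ℤ) = n * m t by ring]
    ring
  · have hh : ∀ p' ∈ Finset.range (m t), hE O ε ⟨t, p'⟩ (slotShift m ⟨v, p⟩) = 1 := by
      intro p' _
      by_cases hb : arrE O ε v.1 t.1
      · exact hE_of_arr O ε hb
      · exact hE_of_not_arr O ε hc hb ha
    simp only [facE, if_neg hc, if_neg ha]
    rw [Finset.prod_congr rfl hh, Finset.prod_const_one, map_one, mul_one]

theorem map_Z (φ : K a →ₐ[Fq] K a) (i : I) (y : K a) :
    φ (Z col z C a i y) = Z col z C a i (φ y) := by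
  rw [Z, Z, map_prod]
  refine Finset.prod_congr rfl fun s _ => ?_
  rw [map_sub, map_one, map_div₀]
  congr 2
  exact AlgHom.commutes φ _

theorem ptE_shift (m : V a → ℕ) (u : Slot a) :
    ptE O col z ε u.1 (pt C ε (slotShift m u)) * ∏ u' ∈ slots m, hE O ε u' (slotShift m u) =
      shiftHom (shiftE C ε m) (ptE O col z ε u.1 (pt C ε u)) := by
  rw [ptE_eq, ptE_eq, map_mul, map_mul, AlgHom.commutes, map_prod, slots, Finset.prod_sigma, mul_assoc,
    ← Finset.prod_mul_distrib]
  simp only [facE_shift]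
  congr 2
  split_ifs
  · rw [map_Z, shiftHom_pt]
  · rw [map_one]

theorem coefE_add (m n : V a → ℕ) :
    coefE O col z ε (m + n) * ∏ u ∈ slots m, ∏ u' ∈ slots (m + n) \ slots m, kapE O ε u u' =
      coefE O col z ε m * shiftHom (shiftE C ε m) (coefE O col z ε n) := by
  have hsub : slots m ⊆ slots (m + n) := slots_subset_iff.2 le_self_add
  have hsplit : ∀ f : Slot a → K a, ∏ u ∈ slots (m + n), f u =
      (∏ u ∈ slots m, f u) * ∏ u ∈ slots n, f (slotShift m u) := by
    intro f
    rw [← Finset.prod_sdiff hsub, slots_add_sdiff, Finset.prod_map, mul_comm]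
  rw [slots_add_sdiff]
  simp only [Finset.prod_map, coefE]
  rw [map_mul, map_prod, map_prod]
  simp only [map_prod, shiftHom_pairE, ← ptE_shift, hsplit, Finset.prod_mul_distrib]
  have h1 : ∏ u ∈ slots n, ∏ u' ∈ slots m, hE O ε u' (slotShift m u) =
      (∏ u ∈ slots m, ∏ u' ∈ slots n, pairE O ε u (slotShift m u')) *
        (∏ u ∈ slots m, ∏ u' ∈ slots n, kapE O ε u (slotShift m u')) *
        ∏ u ∈ slots n, ∏ u' ∈ slots m, pairE O ε (slotShift m u) u' := by
    rw [Finset.prod_comm (s := slots m) (t := slots n) (f := fun u u' => pairE O ε u (slotShift m u')),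
      Finset.prod_comm (s := slots m) (t := slots n) (f := fun u u' => kapE O ε u (slotShift m u'))]
    simp only [hE, Finset.prod_mul_distrib]
  rw [h1]
  have h2 : ∀ u : Slot a, (slotShift m u).1 = u.1 := fun _ => rfl
  simp only [h2]
  ring

end Cocycle

end

section

/-! ### The homomorphisms to difference operators -/

section Phi

variable {I : Type*} [Fintype I] [DecidableEq I] {C : CartanDatum I} (O : DynOrientation C)
  {a : I → ℕ} {N : ℕ} (col : Fin N → I) (z : Fin N → ℂ) (ε : Bool)

variable (C) in
/-- The shuffle product, with the factors exchanged in the negative case. -/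
def mulE (F G : T I) : T I := if ε then shMul C F G else shMul C G F

theorem ev_mulE {F G : T I} (hF : F ∈ bigS O) (hG : G ∈ bigS O) (S : Finset (Slot a)) :
    ev O slotCl (pt C ε) (mulE C ε F G) S = ∑ A ∈ S.powerset, ev O slotCl (pt C ε) F A *
      ev O slotCl (pt C ε) G (S \ A) * ∏ u ∈ A, ∏ u' ∈ S \ A, kapE O ε u u' := by
  cases ε
  · rw [mulE, if_neg (by simp), ev_shMul O (admissible_pt C a false) hG hF]
    refine Finset.sum_bij' (fun A _ => S \ A) (fun A _ => S \ A) ?_ ?_ ?_ ?_ ?_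
    · intro A _; simp
    · intro A _; simp
    · intro A hA; simpa using Finset.inter_eq_right.2 (Finset.mem_powerset.1 hA)
    · intro A hA; simpa using Finset.inter_eq_right.2 (Finset.mem_powerset.1 hA)
    · intro A hA
      have e : S \ (S \ A) = A := by simpa using Finset.inter_eq_right.2 (Finset.mem_powerset.1 hA)
      rw [e, mul_comm (ev O slotCl (pt C false) G A), kapProd, Finset.prod_comm]
      rfl
  · rw [mulE, if_pos rfl, ev_shMul O (admissible_pt C a true) hF hG]
    rfl

theorem shiftHom_ev {G : T I} (hG : G ∈ bigS O) (m n : V a → ℕ) :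
    shiftHom (shiftE C ε m) (ev O slotCl (pt C ε) G (slots n)) =
      ev O slotCl (pt C ε) G ((slots n).map (slotShift m)) := by
  have h := (hasVal_ev O (cl := slotCl) (pt_ne_zero C ε) hG (slots n)).map (shiftHom (shiftE C ε m))
  have he := isEnum_enum slotCl (slots n)
  have he' : IsEnum slotCl (fun v => slotShift m (enum slotCl (slots n) v)) ((slots n).map (slotShift m)) :=
    ⟨(slotShift m).injective.comp he.inj, fun v => he.colour v, fun u => by
      rw [Finset.mem_map]
      constructor
      · rintro ⟨u', hu', rfl⟩
        obtain ⟨v, rfl⟩ := (he.mem u').1 hu'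
        exact ⟨v, rfl⟩
      · rintro ⟨v, rfl⟩
        exact ⟨_, (he.mem _).2 ⟨v, rfl⟩, rfl⟩⟩
  rw [ev_eq_ev_of O G he'.cnt_eq, ev_of O (pt_ne_zero C ε) (hG _) he']
  simp only [shiftHom_pt] at h
  exact h.evalRat_eq.symm

/-- The coefficient of a shift in the image of a shuffle element. -/
def phiC (F : T I) (m : V a → ℕ) : K a := coefE O col z ε m * ev O slotCl (pt C ε) F (slots m)

/-- The image of the part of degree `k` of a shuffle element. -/
def phiE (k : I → ℕ) (F : T I) : Diff C a :=
  ∑ m ∈ comps a k, SkewMonoidAlgebra.single (shiftE C ε m) (phiC O col z ε F m)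

theorem shiftE_mul (m n : V a → ℕ) : shiftE C ε m * shiftE C ε n = shiftE C ε (m + n) := by
  change Shift.mk C _ = Shift.mk C _
  congr 1
  funext v
  simp only [Pi.add_apply]
  push_cast
  exact (mul_add _ _ _).symm

theorem sum_powerset_slots {F : T I} (G : T I) {k : I → ℕ}
    (hF : ∀ A : Finset (Slot a), cnt slotCl A ≠ k → ev O slotCl (pt C ε) F A = 0) (M : V a → ℕ) :
    ∑ A ∈ (slots M).powerset, ev O slotCl (pt C ε) F A * ev O slotCl (pt C ε) G (slots M \ A) *
        ∏ u ∈ A, ∏ u' ∈ slots M \ A, kapE O ε u u' =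
      ∑ m ∈ (Finset.Iic M).filter (fun m => slotDeg m = k), ev O slotCl (pt C ε) F (slots m) *
        ev O slotCl (pt C ε) G (slots M \ slots m) *
        ∏ u ∈ slots m, ∏ u' ∈ slots M \ slots m, kapE O ε u u' := by
  rw [← Finset.sum_image (f := fun A => ev O slotCl (pt C ε) F A *
    ev O slotCl (pt C ε) G (slots M \ A) * ∏ u ∈ A, ∏ u' ∈ slots M \ A, kapE O ε u u')
    (slots_injective.injOn)]
  symm
  refine Finset.sum_subset ?_ fun A hA hA' => ?_
  · intro A hA
    obtain ⟨m, hm, rfl⟩ := Finset.mem_image.1 hA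
    rw [Finset.mem_powerset, slots_subset_iff]
    exact Finset.mem_Iic.1 (Finset.mem_filter.1 hm).1
  · rw [Finset.mem_powerset] at hA
    by_cases hex : ∃ m, slots m = A
    · obtain ⟨m, rfl⟩ := hex
      rw [hF, zero_mul, zero_mul]
      intro hk
      refine hA' (Finset.mem_image_of_mem _ (Finset.mem_filter.2 ⟨Finset.mem_Iic.2 (slots_subset_iff.1 hA), ?_⟩))
      rw [← cnt_slots, hk]
    · have : ∃ v p, (⟨v, p + 1⟩ : Slot a) ∈ A ∧ (⟨v, p⟩ : Slot a) ∉ A := by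
        by_contra h
        push Not at h
        exact hex (exists_slots_eq h)
      obtain ⟨v, p, h1, h2⟩ := this
      have h3 : (⟨v, p⟩ : Slot a) ∈ slots M \ A := by
        refine Finset.mem_sdiff.2 ⟨?_, h2⟩
        have := mem_slots.1 (hA h1)
        rw [mem_slots]
        exact (Nat.lt_succ_self p).trans this
      rw [Finset.prod_eq_zero h1 (Finset.prod_eq_zero h3 (kapE_succ O ε v p)), mul_zero]

theorem phiE_mulE {F G : T I} (hF : F ∈ bigS O) (hG : G ∈ bigS O) {k l : I → ℕ}
    (hFk : ∀ A : Finset (Slot a), cnt slotCl A ≠ k → ev O slotCl (pt C ε) F A = 0) :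
    phiE O col z ε (k + l) (mulE C ε F G) = phiE O col z ε (a := a) k F * phiE O col z ε l G := by
  let g : (V a → ℕ) → (V a → ℕ) → K a := fun M m => coefE O col z ε M *
    (ev O slotCl (pt C ε) F (slots m) * ev O slotCl (pt C ε) G (slots M \ slots m) *
      ∏ u ∈ slots m, ∏ u' ∈ slots M \ slots m, kapE O ε u u')
  have hprod : ∀ m n, phiC O col z ε F m * shiftHom (shiftE C ε m) (phiC O col z ε G n) = g (m + n) m := by
    intro m n
    simp only [g, phiC]
    rw [map_mul, shiftHom_ev O ε hG, ← slots_add_sdiff]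
    linear_combination (-(ev O slotCl (pt C ε) F (slots m) *
      ev O slotCl (pt C ε) G (slots (m + n) \ slots m))) * coefE_add O col z ε m n
  have hR : phiE O col z ε (a := a) k F * phiE O col z ε l G =
      ∑ m ∈ comps a k, ∑ n ∈ comps a l, SkewMonoidAlgebra.single (shiftE C ε (m + n)) (g (m + n) m) := by
    rw [phiE, phiE, Finset.sum_mul_sum]
    refine Finset.sum_congr rfl fun m _ => Finset.sum_congr rfl fun n _ => ?_
    rw [SkewMonoidAlgebra.single_mul_single, shiftE_mul, ← hprod]
    rfl
  have hL : phiE O col z ε (a := a) (k + l) (mulE C ε F G) = ∑ M ∈ comps a (k + l),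
      ∑ m ∈ (Finset.Iic M).filter (fun m => slotDeg m = k),
        SkewMonoidAlgebra.single (shiftE C ε M) (g M m) := by
    rw [phiE]
    refine Finset.sum_congr rfl fun M _ => ?_
    rw [phiC, ev_mulE O ε hF hG, sum_powerset_slots O ε G hFk, Finset.mul_sum]
    exact map_sum (AddMonoidHom.mk' (SkewMonoidAlgebra.single (shiftE C ε M))
      fun _ _ => SkewMonoidAlgebra.single_add _ _ _) _ _
  rw [hL, hR, Finset.sum_sigma', Finset.sum_sigma']
  refine Finset.sum_bij' (fun s _ => ⟨s.2, s.1 - s.2⟩) (fun s _ => ⟨s.1 + s.2, s.1⟩) ?_ ?_ ?_ ?_ ?_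
  · rintro ⟨M, m⟩ h
    simp only [Finset.mem_sigma, mem_comps, Finset.mem_filter, Finset.mem_Iic] at h ⊢
    refine ⟨h.2.2, ?_⟩
    have h1 := h.1
    rw [← add_tsub_cancel_of_le h.2.1, slotDeg_add, h.2.2] at h1
    exact add_left_cancel h1
  · rintro ⟨m, n⟩ h
    simp only [Finset.mem_sigma, mem_comps, Finset.mem_filter, Finset.mem_Iic] at h ⊢
    exact ⟨by rw [slotDeg_add, h.1, h.2], le_self_add, h.1⟩
  · rintro ⟨M, m⟩ h
    simp only [Finset.mem_sigma, mem_comps, Finset.mem_filter, Finset.mem_Iic] at h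
    simp [add_tsub_cancel_of_le h.2.1]
  · rintro ⟨m, n⟩ h
    simp
  · rintro ⟨M, m⟩ h
    simp only [Finset.mem_sigma, mem_comps, Finset.mem_filter, Finset.mem_Iic] at h
    simp [add_tsub_cancel_of_le h.2.1]

theorem phiE_add {F G : T I} (hF : F ∈ bigS O) (hG : G ∈ bigS O) (k : I → ℕ) :
    phiE O col z ε (a := a) k (F + G) = phiE O col z ε k F + phiE O col z ε k G := by
  simp only [phiE, phiC, ← Finset.sum_add_distrib, ev_add O (pt_ne_zero C ε) hF hG, mul_add,
    SkewMonoidAlgebra.single_add]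

theorem phiE_smul (c : Fq) {F : T I} (hF : F ∈ bigS O) (k : I → ℕ) :
    phiE O col z ε (a := a) k (c • F) = c • phiE O col z ε k F := by
  simp only [phiE, phiC, Finset.smul_sum, ev_smul O (pt_ne_zero C ε) c hF, mul_smul_comm,
    smul_single_Fq]

/-- The image of a homogeneous element. -/
def phiHomog (k : I → ℕ) : bigComp O k →ₗ[Fq] Diff C a where
  toFun F := phiE O col z ε k (DirectSum.of (fun k : I → ℕ => K k) k F)
  map_add' F G := by
    rw [Submodule.coe_add, map_add]
    exact phiE_add O col z ε (of_mem_bigS O F.2) (of_mem_bigS O G.2) k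
  map_smul' c F := by
    refine Eq.trans ?_ (phiE_smul O col z ε c (of_mem_bigS O F.2) k)
    exact congrArg _ (map_smul (DirectSum.lof Fq (I → ℕ) (fun k => K k) k) c F.1)

/-- A linear map on all rational functions restricting to `phiHomog`. -/
def phiExt (k : I → ℕ) : K k →ₗ[Fq] Diff C a := (phiHomog O col z ε k).exists_extend.choose

theorem phiExt_apply {k : I → ℕ} {F : K k} (hF : F ∈ bigComp O k) :
    phiExt O col z ε (a := a) k F = phiE O col z ε k (DirectSum.of (fun k : I → ℕ => K k) k F) :=
  LinearMap.congr_fun (phiHomog O col z ε k).exists_extend.choose_spec ⟨F, hF⟩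

/-- The linear map from the big shuffle algebra to difference operators. -/
def phiLin : T I →ₗ[Fq] Diff C a := DirectSum.toModule Fq (I → ℕ) _ (phiExt O col z ε)

theorem phiLin_of {k : I → ℕ} {F : K k} (hF : F ∈ bigComp O k) :
    phiLin O col z ε (a := a) (DirectSum.of (fun k : I → ℕ => K k) k F) =
      phiE O col z ε k (DirectSum.of (fun k : I → ℕ => K k) k F) :=
  (DirectSum.toModule_lof Fq k F).trans (phiExt_apply O col z ε hF)

theorem phiLin_shOne : phiLin O col z ε (a := a) (shOne I) = 1 := by
  rw [shOne, phiLin_of O col z ε (one_mem_bigComp O), phiE]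
  have h : comps a 0 = {0} := by
    ext m
    rw [mem_comps, Finset.mem_singleton]
    constructor
    · intro h
      funext v
      have := congrFun h v.1
      simp only [slotDeg, Pi.zero_apply, Finset.sum_eq_zero_iff] at this
      exact this v.2 (Finset.mem_univ _)
    · rintro rfl
      funext i
      simp [slotDeg]
  have h0 : slots (0 : V a → ℕ) = ∅ := by
    ext u
    simp [mem_slots]
  have h1 : phiC O col z ε (DirectSum.of (fun k : I → ℕ => K k) 0 1) (0 : V a → ℕ) = 1 := by
    have := congrFun (evC_one O (admissible_pt C a ε)) ∅
    rw [phiC, coefE, h0]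
    simp only [Finset.prod_empty, one_mul]
    exact this
  rw [h, Finset.sum_singleton, h1]
  have : shiftE C ε (0 : V a → ℕ) = 1 := by
    change Shift.mk C _ = Shift.mk C 0
    congr 1
    funext v
    simp
  rw [this]
  rfl

theorem phiLin_mulE {F G : T I} (hF : F ∈ bigS O) (hG : G ∈ bigS O) :
    phiLin O col z ε (a := a) (mulE C ε F G) = phiLin O col z ε F * phiLin O col z ε G := by
  have hzl : ∀ G, mulE C ε 0 G = 0 := fun G => by
    cases ε
    · exact map_zero _
    · exact LinearMap.map_zero₂ (shMul C) G
  have hzr : ∀ F, mulE C ε F 0 = 0 := fun F => by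
    cases ε
    · exact LinearMap.map_zero₂ (shMul C) F
    · exact map_zero _
  have hal : ∀ F F' G, mulE C ε (F + F') G = mulE C ε F G + mulE C ε F' G := fun F F' G => by
    cases ε
    · exact map_add _ _ _
    · exact LinearMap.map_add₂ (shMul C) F F' G
  have har : ∀ F G G', mulE C ε F (G + G') = mulE C ε F G + mulE C ε F G' := fun F G G' => by
    cases ε
    · exact LinearMap.map_add₂ (shMul C) G G' F
    · exact map_add _ _ _
  refine bigS_induction O (P := fun F => phiLin O col z ε (a := a) (mulE C ε F G) =
    phiLin O col z ε F * phiLin O col z ε G) ?_ ?_ ?_ hF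
  · rw [hzl, map_zero, zero_mul]
  · intro k F hF
    refine bigS_induction O (P := fun G => phiLin O col z ε (a := a)
      (mulE C ε (DirectSum.of (fun k : I → ℕ => K k) k F) G) =
      phiLin O col z ε (DirectSum.of (fun k : I → ℕ => K k) k F) * phiLin O col z ε G) ?_ ?_ ?_ hG
    · rw [hzr, map_zero, mul_zero]
    · intro l G hG
      rw [phiLin_of O col z ε hF, phiLin_of O col z ε hG, ← phiE_mulE O col z ε (of_mem_bigS O hF)
        (of_mem_bigS O hG) fun A hA => ev_of_ne O F hA]
      cases ε
      · rw [mulE, if_neg (by simp), shMul_of_of, phiLin_of O col z false (shMulComp_mem_bigComp O hG hF),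
          add_comm k l]
      · rw [mulE, if_pos rfl, shMul_of_of, phiLin_of O col z true (shMulComp_mem_bigComp O hF hG)]
    · intro G _ G' _ h h'
      rw [har, map_add, map_add, h, h', mul_add]
  · intro F _ F' _ h h'
    rw [hal, map_add, map_add, h, h', add_mul]

variable (h : IsShuffleAlgebra C (bigS O))

/-- The homomorphism from the big shuffle algebra. -/
def phiPos : ShAlg h →ₐ[Fq] Diff C a :=
  AlgHom.ofLinearMap ((phiLin O col z true).comp (bigS O).subtype : bigS O →ₗ[Fq] Diff C a)
    (phiLin_shOne O col z true) fun F G => phiLin_mulE O col z true F.2 G.2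

/-- The homomorphism from the opposite of the big shuffle algebra. -/
def phiNeg : (ShAlg h)ᵐᵒᵖ →ₐ[Fq] Diff C a :=
  AlgHom.ofLinearMap (((phiLin O col z false).comp (bigS O).subtype : bigS O →ₗ[Fq] Diff C a).comp
      ((MulOpposite.opLinearEquiv Fq (M := ShAlg h)).symm : (ShAlg h)ᵐᵒᵖ →ₗ[Fq] ShAlg h))
    (phiLin_shOne O col z false) fun F G => phiLin_mulE O col z false F.unop.2 G.unop.2

end Phi

end

section

/-! ### Comparison with the explicit formulas -/

section Explicit

variable {I : Type*} [Fintype I] [DecidableEq I] {C : CartanDatum I} (O : DynOrientation C)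
  {a : I → ℕ} {N : ℕ} (col : Fin N → I) (z : Fin N → ℂ) (ε : Bool)

section Products

variable {M : Type*} [CommMonoid M] (m : V a → ℕ)

theorem prod_slots (f : Slot a → M) :
    ∏ u ∈ slots m, f u = ∏ i, ∏ r : Fin (a i), ∏ p ∈ Finset.range (m ⟨i, r⟩), f ⟨⟨i, r⟩, p⟩ := by
  rw [slots, Finset.prod_sigma, prod_V]

theorem prod_slots_slots (P : V a → V a → Prop) [∀ v v', Decidable (P v v')] (f : Slot a → Slot a → M) :
    ∏ u ∈ slots m, ∏ u' ∈ slots m, (if P u.1 u'.1 then f u u' else 1) =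
      ∏ v, ∏ v', if P v v' then
        ∏ p ∈ Finset.range (m v), ∏ p' ∈ Finset.range (m v'), f ⟨v, p⟩ ⟨v', p'⟩ else 1 := by
  simp only [slots, Finset.prod_sigma]
  refine Finset.prod_congr rfl fun v _ => ?_
  rw [Finset.prod_comm]
  refine Finset.prod_congr rfl fun v' _ => ?_
  split_ifs <;> simp

theorem prod_slots_same (f : Slot a → Slot a → M) :
    ∏ u ∈ slots m, ∏ u' ∈ slots m, (if u.1 = u'.1 then (if u.2 < u'.2 then f u u' else 1) else 1) =
      ∏ i, ∏ r : Fin (a i), ∏ p₂ ∈ Finset.range (m ⟨i, r⟩), ∏ p₁ ∈ Finset.range p₂,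
        f ⟨⟨i, r⟩, p₁⟩ ⟨⟨i, r⟩, p₂⟩ := by
  rw [prod_slots_slots m (fun v v' => v = v') fun u u' => if u.2 < u'.2 then f u u' else 1]
  simp only [Finset.prod_ite_eq, Finset.mem_univ, if_true]
  rw [prod_V]
  refine Finset.prod_congr rfl fun i _ => Finset.prod_congr rfl fun r _ => ?_
  rw [Finset.prod_comm]
  refine Finset.prod_congr rfl fun p₂ hp₂ => ?_
  rw [← Finset.prod_filter]
  refine Finset.prod_congr ?_ fun _ _ => rfl
  ext p
  have := Finset.mem_range.1 hp₂
  simp only [Finset.mem_filter, Finset.mem_range]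
  omega

theorem prod_slots_colour (f : Slot a → Slot a → M) :
    ∏ u ∈ slots m, ∏ u' ∈ slots m, (if u.1 ≠ u'.1 ∧ u.1.1 = u'.1.1 then f u u' else 1) =
      ∏ i, ∏ r₁ : Fin (a i), ∏ r₂ ∈ Finset.univ.filter (fun r₂ => r₁ ≠ r₂),
        ∏ p₁ ∈ Finset.range (m ⟨i, r₁⟩), ∏ p₂ ∈ Finset.range (m ⟨i, r₂⟩),
          f ⟨⟨i, r₁⟩, p₁⟩ ⟨⟨i, r₂⟩, p₂⟩ := by
  rw [prod_slots_slots m (fun v v' => v ≠ v' ∧ v.1 = v'.1) f, prod_V]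
  refine Finset.prod_congr rfl fun i _ => Finset.prod_congr rfl fun r _ => ?_
  rw [prod_V, Finset.prod_eq_single i]
  · rw [Finset.prod_filter]
    refine Finset.prod_congr rfl fun s _ => ?_
    simp
  · intro j _ hj
    refine Finset.prod_eq_one fun s _ => if_neg ?_
    rintro ⟨-, h⟩
    exact hj h.symm
  · intro h
    exact absurd (Finset.mem_univ _) h

theorem prod_slots_arr (P : I → I → Prop) [∀ i j, Decidable (P i j)] (f : Slot a → Slot a → M) :
    ∏ u ∈ slots m, ∏ u' ∈ slots m, (if P u'.1.1 u.1.1 then f u u' else 1) =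
      ∏ i, ∏ j ∈ Finset.univ.filter (fun j => P j i), ∏ r₁ : Fin (a i), ∏ r₂ : Fin (a j),
        ∏ p₁ ∈ Finset.range (m ⟨i, r₁⟩), ∏ p₂ ∈ Finset.range (m ⟨j, r₂⟩),
          f ⟨⟨i, r₁⟩, p₁⟩ ⟨⟨j, r₂⟩, p₂⟩ := by
  rw [prod_slots_slots m (fun v v' => P v'.1 v.1) f, prod_V]
  refine Finset.prod_congr rfl fun i _ => ?_
  rw [Finset.prod_filter]
  simp only [prod_V]
  rw [Finset.prod_comm]
  refine Finset.prod_congr rfl fun j _ => ?_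
  split_ifs <;> simp

end Products

open Classical in
theorem prod_pairE (m : V a → ℕ) : ∏ u ∈ slots m, ∏ u' ∈ slots m, pairE O ε u u' =
    (∏ u ∈ slots m, ∏ u' ∈ slots m, if u.1 = u'.1 then (if u.2 < u'.2 then
      algebraMap Fq (K a) (qi C u.1.1 ^ (-(1 + sg ε))) * (kapE O ε u u')⁻¹ else 1) else 1) *
    (∏ u ∈ slots m, ∏ u' ∈ slots m, if u.1 ≠ u'.1 ∧ u.1.1 = u'.1.1 then
      algebraMap Fq (K a) (qi C u.1.1 ^ (-1 : ℤ)) * (kapE O ε u u')⁻¹ else 1) *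
    (∏ u ∈ slots m, ∏ u' ∈ slots m, if arrE O ε u'.1.1 u.1.1 then (kapE O ε u u')⁻¹ else 1) := by
  simp only [← Finset.prod_mul_distrib]
  refine Finset.prod_congr rfl fun u _ => Finset.prod_congr rfl fun u' _ => ?_
  have hne : arrE O ε u'.1.1 u.1.1 → u.1.1 ≠ u'.1.1 := fun h e => by
    cases ε
    · exact O.ne_of_arr (show O.arr u.1.1 u'.1.1 from h) e
    · exact O.ne_of_arr (show O.arr u'.1.1 u.1.1 from h) e.symm
  rw [pairE]
  by_cases h1 : u.1 = u'.1
  · have h2 : ¬ arrE O ε u'.1.1 u.1.1 := fun h => hne h (congrArg Sigma.fst h1)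
    rw [if_pos h1, if_pos h1, if_neg (show ¬(u.1 ≠ u'.1 ∧ u.1.1 = u'.1.1) from fun h => h.1 h1),
      if_neg h2, mul_one, mul_one]
  · by_cases h3 : u.1.1 = u'.1.1
    · have h2 : ¬ arrE O ε u'.1.1 u.1.1 := fun h => hne h h3
      rw [if_neg h1, if_pos h3, if_neg h1, if_pos ⟨h1, h3⟩, if_neg h2, one_mul, mul_one]
    · rw [if_neg h1, if_neg h3, if_neg h1,
        if_neg (show ¬(u.1 ≠ u'.1 ∧ u.1.1 = u'.1.1) from fun h => h3 h.2), one_mul, one_mul]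

open Classical in
theorem evalRat_specPt {k : I → ℕ} {F : K k} (hF : F ∈ bigComp O k) (m : Comp a k) :
    evalRat (fun v => pt C ε (slotEnum m v)) F *
      (∏ u ∈ slots m.fn, ∏ u' ∈ slots m.fn, if O.arr u'.1.1 u.1.1 then pt C ε u - pt C ε u' else 1) =
    ev O slotCl (pt C ε) (DirectSum.of (fun k : I → ℕ => K k) k F) (slots m.fn) := by
  have he := isEnum_slotEnum m
  rw [ev_of O (pt_ne_zero C ε) hF he]
  have hpole : HasVal (fun v => pt C ε (slotEnum m v)) (poleDen O k)
      (∏ u ∈ slots m.fn, ∏ u' ∈ slots m.fn, if O.arr u'.1.1 u.1.1 then pt C ε u - pt C ε u' else 1) := by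
    rw [poleDen_eq']
    simp only [he.prod_eq]
    refine HasVal.prod _ fun u _ => HasVal.prod _ fun v _ => ?_
    have h1 : (slotEnum m u).1.1 = u.1 := rfl
    have h2 : (slotEnum m v).1.1 = v.1 := rfl
    simp only [h1, h2]
    split_ifs
    · exact (hasVal_x _ _).sub (hasVal_x _ _)
    · exact hasVal_one _
  have hne : (∏ u ∈ slots m.fn, ∏ u' ∈ slots m.fn,
      if O.arr u'.1.1 u.1.1 then pt C ε u - pt C ε u' else 1) ≠ 0 := by
    refine Finset.prod_ne_zero_iff.2 fun u _ => Finset.prod_ne_zero_iff.2 fun u' _ => ?_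
    split_ifs with h
    · have := pt_sub_ne_zero (C := C) ε (u := u) (u' := u')
        (fun e => O.ne_of_arr h (congrArg Sigma.fst e).symm) 1
      rwa [map_one, one_mul] at this
    · exact one_ne_zero
  have hval : HasVal (fun v => pt C ε (slotEnum m v)) (F * poleDen O k)
      (evalRat (fun v => pt C ε (slotEnum m v)) (F * poleDen O k)) :=
    hasVal_laurent (fun v => pt_ne_zero C ε _) hF.1
  have h2 := hval.div hpole hne
  rw [mul_div_cancel_right₀ _ (poleDen_ne_zero O k)] at h2
  rw [h2.evalRat_eq, div_mul_cancel₀ _ hne]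

theorem prod_const_pairs {k : I → ℕ} (m : Comp a k) :
    (∏ u ∈ slots m.fn, ∏ u' ∈ slots m.fn, if u.1 = u'.1 then (if u.2 < u'.2 then
      algebraMap Fq (K a) (qi C u.1.1 ^ (-2 : ℤ)) else 1) else 1) *
    (∏ u ∈ slots m.fn, ∏ u' ∈ slots m.fn, if u.1 ≠ u'.1 ∧ u.1.1 = u'.1.1 then
      algebraMap Fq (K a) (qi C u.1.1 ^ (-1 : ℤ)) else 1) =
    algebraMap Fq (K a) (∏ i, qi C i ^ ((k i : ℤ) - (k i : ℤ) ^ 2)) := by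
  let g : Slot a → Slot a → K a := fun u u' => if u.1 = u'.1 then (if u.2 < u'.2 then
      algebraMap Fq (K a) (qi C u.1.1 ^ (-1 : ℤ)) else 1) else 1
  have h1 : (∏ u ∈ slots m.fn, ∏ u' ∈ slots m.fn, if u.1 = u'.1 then (if u.2 < u'.2 then
      algebraMap Fq (K a) (qi C u.1.1 ^ (-2 : ℤ)) else 1) else 1) =
      (∏ u ∈ slots m.fn, ∏ u' ∈ slots m.fn, g u u') * ∏ u ∈ slots m.fn, ∏ u' ∈ slots m.fn, g u' u := by
    rw [Finset.prod_comm (f := fun u u' => g u' u), ← Finset.prod_mul_distrib]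
    refine Finset.prod_congr rfl fun u _ => ?_
    rw [← Finset.prod_mul_distrib]
    refine Finset.prod_congr rfl fun u' _ => ?_
    simp only [g]
    split_ifs
    · rw [← map_mul, ← zpow_add₀ (qi_ne_zero C _)]
      rfl
    · rw [mul_one]
    · rw [mul_one]
  have he := isEnum_slotEnum m
  rw [h1]
  simp only [← Finset.prod_mul_distrib]
  have h2 : ∀ u u' : Slot a, g u u' * g u' u * (if u.1 ≠ u'.1 ∧ u.1.1 = u'.1.1 then
      algebraMap Fq (K a) (qi C u.1.1 ^ (-1 : ℤ)) else 1) =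
      if u.1.1 = u'.1.1 ∧ u ≠ u' then algebraMap Fq (K a) (qi C u.1.1 ^ (-1 : ℤ)) else 1 := by
    intro u u'
    simp only [g]
    by_cases h : u.1 = u'.1
    · have hc : u.1.1 = u'.1.1 := congrArg Sigma.fst h
      have hne : u ≠ u' ↔ u.2 ≠ u'.2 := by
        rw [Ne, Sigma.ext_iff]
        simp [h]
      simp only [if_pos h, if_pos h.symm, hne, hc, true_and, h, ne_eq, not_true_eq_false, false_and,
        if_false, mul_one]
      rcases lt_trichotomy u.2 u'.2 with h3 | h3 | h3
      · simp [h3, h3.not_gt, h3.ne]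
      · simp [h3]
      · simp [h3, h3.not_gt, h3.ne']
    · have hne : u ≠ u' := fun e => h (congrArg Sigma.fst e)
      simp [h, Ne.symm h, hne]
  simp only [h2, he.prod_eq]
  have h3 : ∀ v v' : V k, (if (slotEnum m v).1.1 = (slotEnum m v').1.1 ∧ slotEnum m v ≠ slotEnum m v' then
      algebraMap Fq (K a) (qi C (slotEnum m v).1.1 ^ (-1 : ℤ)) else 1) =
      if v.1 = v'.1 ∧ v ≠ v' then algebraMap Fq (K a) (qi C v.1 ^ (-1 : ℤ)) else 1 := by
    intro v v'
    simp only [he.inj.ne_iff]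
    rfl
  simp only [h3]
  rw [prod_V, map_prod]
  refine Finset.prod_congr rfl fun i _ => ?_
  have h4 : ∀ r : Fin (k i), (∏ v' : V k, if (⟨i, r⟩ : V k).1 = v'.1 ∧ (⟨i, r⟩ : V k) ≠ v' then
      algebraMap Fq (K a) (qi C (⟨i, r⟩ : V k).1 ^ (-1 : ℤ)) else 1) =
      algebraMap Fq (K a) (qi C i ^ (-1 : ℤ)) ^ (k i - 1) := by
    intro r
    rw [prod_V, Finset.prod_eq_single i]
    · have : ∀ s : Fin (k i), (if (⟨i, r⟩ : V k).1 = (⟨i, s⟩ : V k).1 ∧ (⟨i, r⟩ : V k) ≠ ⟨i, s⟩ then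
          algebraMap Fq (K a) (qi C (⟨i, r⟩ : V k).1 ^ (-1 : ℤ)) else 1) =
          if r ≠ s then algebraMap Fq (K a) (qi C i ^ (-1 : ℤ)) else 1 := by
        intro s
        simp
      rw [Finset.prod_congr rfl fun s _ => this s, ← Finset.prod_filter, Finset.prod_const]
      congr 1
      have : (Finset.univ.filter fun s => r ≠ s) = Finset.univ.erase r := by
        ext s
        simp [eq_comm]
      rw [this, Finset.card_erase_of_mem (Finset.mem_univ r), Finset.card_univ, Fintype.card_fin]
    · intro j _ hj
      exact Finset.prod_eq_one fun s _ => if_neg fun h => hj h.1.symm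
    · intro h
      exact absurd (Finset.mem_univ _) h
  rw [Finset.prod_congr rfl fun r _ => h4 r, Finset.prod_const, Finset.card_univ, Fintype.card_fin,
    ← pow_mul, ← map_pow, ← zpow_natCast, ← zpow_mul]
  congr 2
  rcases Nat.eq_zero_or_pos (k i) with h0 | h0
  · simp [h0]
  · push_cast [Nat.cast_sub h0]
    ring

theorem kapE_true_self (u u' : Slot a) (h : u.1.1 = u'.1.1) :
    kapE O true u u' = zeta C u.1.1 u.1.1 (pt C true u) (pt C true u') := by
  rw [kapE, if_pos rfl, kapAt, slotCl, slotCl, ← h, kap_self]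

theorem kapE_false_self (u u' : Slot a) (h : u.1.1 = u'.1.1) :
    kapE O false u u' = zeta C u.1.1 u.1.1 (pt C false u') (pt C false u) := by
  rw [kapE, if_neg (by simp), kapAt, slotCl, slotCl, ← h, kap_self]

theorem termPlus_eq {k : I → ℕ} {F : K k} (hF : F ∈ bigComp O k) (m : Comp a k) :
    algebraMap Fq (K a) (∏ i, qi C i ^ ((k i : ℤ) - (k i : ℤ) ^ 2)) * termPlus O col z m F =
      phiC O col z true (DirectSum.of (fun k : I → ℕ => K k) k F) m.fn := by
  classical
  rw [phiC, coefE, prod_pairE, ← evalRat_specPt O true hF, ← prod_const_pairs m, termPlus]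
  have e1 : ∀ i (r : Fin (a i)) p, ptPlus C a i r p = pt C true ⟨⟨i, r⟩, p⟩ := fun _ _ _ => rfl
  have e2 : specPt m (ptPlus C a) = fun v => pt C true (slotEnum m v) := rfl
  have e3 : ∀ i r, m.1 i r = m.fn ⟨i, r⟩ := fun _ _ => rfl
  simp only [e1, e2, e3]
  have hA := prod_slots_same m.fn fun u u' => (zeta C u.1.1 u.1.1 (pt C true u) (pt C true u'))⁻¹
  have hB := prod_slots_colour m.fn fun u u' => (zeta C u.1.1 u.1.1 (pt C true u) (pt C true u'))⁻¹
  have hC := prod_slots_arr m.fn O.arr fun u u' => (zeta C u.1.1 u'.1.1 (pt C true u) (pt C true u'))⁻¹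
  have hY := prod_slots m.fn fun u => ptE O col z true u.1 (pt C true u)
  have hY' : ∀ i (r : Fin (a i)) y, ptE O col z true ⟨i, r⟩ y = Y O col z i r y := fun _ _ _ => rfl
  simp only [hY'] at hY
  have hC' : (∏ u ∈ slots m.fn, ∏ u' ∈ slots m.fn,
      if O.arr u'.1.1 u.1.1 then (zeta C u.1.1 u'.1.1 (pt C true u) (pt C true u'))⁻¹ else 1) =
      (∏ u ∈ slots m.fn, ∏ u' ∈ slots m.fn,
        if arrE O true u'.1.1 u.1.1 then (kapE O true u u')⁻¹ else 1) *
      ∏ u ∈ slots m.fn, ∏ u' ∈ slots m.fn,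
        if O.arr u'.1.1 u.1.1 then pt C true u - pt C true u' else 1 := by
    simp only [← Finset.prod_mul_distrib]
    refine Finset.prod_congr rfl fun u _ => Finset.prod_congr rfl fun u' _ => ?_
    have : arrE O true u'.1.1 u.1.1 = O.arr u'.1.1 u.1.1 := rfl
    simp only [this]
    split_ifs with h
    · rw [show kapE O true u u' = pt C true u - algebraMap Fq (K a) (qi C u.1.1 ^ (-C.c u.1.1 u'.1.1)) *
        pt C true u' from kap_of_arr_right O h _ _, zeta, inv_div, div_eq_mul_inv, mul_comm]
    · rw [mul_one]
  have hA' : (∏ u ∈ slots m.fn, ∏ u' ∈ slots m.fn, if u.1 = u'.1 then (if u.2 < u'.2 then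
      algebraMap Fq (K a) (qi C u.1.1 ^ (-(1 + sg true))) * (kapE O true u u')⁻¹ else 1) else 1) =
      (∏ u ∈ slots m.fn, ∏ u' ∈ slots m.fn, if u.1 = u'.1 then (if u.2 < u'.2 then
        algebraMap Fq (K a) (qi C u.1.1 ^ (-2 : ℤ)) else 1) else 1) *
      ∏ u ∈ slots m.fn, ∏ u' ∈ slots m.fn, if u.1 = u'.1 then (if u.2 < u'.2 then
        (zeta C u.1.1 u.1.1 (pt C true u) (pt C true u'))⁻¹ else 1) else 1 := by
    simp only [← Finset.prod_mul_distrib]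
    refine Finset.prod_congr rfl fun u _ => Finset.prod_congr rfl fun u' _ => ?_
    split_ifs with h h'
    · rw [kapE_true_self O u u' (congrArg Sigma.fst h)]
      rfl
    · rw [mul_one]
    · rw [mul_one]
  have hB' : (∏ u ∈ slots m.fn, ∏ u' ∈ slots m.fn, if u.1 ≠ u'.1 ∧ u.1.1 = u'.1.1 then
      algebraMap Fq (K a) (qi C u.1.1 ^ (-1 : ℤ)) * (kapE O true u u')⁻¹ else 1) =
      (∏ u ∈ slots m.fn, ∏ u' ∈ slots m.fn, if u.1 ≠ u'.1 ∧ u.1.1 = u'.1.1 then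
        algebraMap Fq (K a) (qi C u.1.1 ^ (-1 : ℤ)) else 1) *
      ∏ u ∈ slots m.fn, ∏ u' ∈ slots m.fn, if u.1 ≠ u'.1 ∧ u.1.1 = u'.1.1 then
        (zeta C u.1.1 u.1.1 (pt C true u) (pt C true u'))⁻¹ else 1 := by
    simp only [← Finset.prod_mul_distrib]
    refine Finset.prod_congr rfl fun u _ => Finset.prod_congr rfl fun u' _ => ?_
    split_ifs with h
    · rw [kapE_true_self O u u' h.2]
    · rw [mul_one]
  rw [← hY, ← hA, hA', hB']
  have hB2 := hB
  have hC2 := hC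
  convert_to _ * ((∏ u ∈ slots m.fn, ptE O col z true u.1 (pt C true u)) * _ *
    (∏ u ∈ slots m.fn, ∏ u' ∈ slots m.fn, if u.1 = u'.1 then (if u.2 < u'.2 then
        (zeta C u.1.1 u.1.1 (pt C true u) (pt C true u'))⁻¹ else 1) else 1) *
    (∏ u ∈ slots m.fn, ∏ u' ∈ slots m.fn, if u.1 ≠ u'.1 ∧ u.1.1 = u'.1.1 then
        (zeta C u.1.1 u.1.1 (pt C true u) (pt C true u'))⁻¹ else 1) *
    ((∏ u ∈ slots m.fn, ∏ u' ∈ slots m.fn,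
        if arrE O true u'.1.1 u.1.1 then (kapE O true u u')⁻¹ else 1) *
      ∏ u ∈ slots m.fn, ∏ u' ∈ slots m.fn,
        if O.arr u'.1.1 u.1.1 then pt C true u - pt C true u' else 1)) = _
  · rw [hB2, ← hC', hC2]
    congr!
  · ring

theorem phiPlus_eq {k : I → ℕ} {F : K k} (hF : F ∈ bigComp O k) :
    phiPlus O col z k F = phiE O col z true (a := a) k (DirectSum.of (fun k : I → ℕ => K k) k F) := by
  rw [phiPlus, phiE, sum_comps, Finset.smul_sum]
  refine Finset.sum_congr rfl fun m _ => ?_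
  rw [mulOp_mul_shiftOp, smul_single_Fq, Algebra.smul_def, termPlus_eq O col z hF]
  congr 2
  funext v
  simp only [sg, if_true, neg_one_mul, Comp.fn]

theorem termMinus_eq {k : I → ℕ} {F : K k} (hF : F ∈ bigComp O k) (m : Comp a k) :
    termMinus O m F = phiC O col z false (DirectSum.of (fun k : I → ℕ => K k) k F) m.fn := by
  classical
  rw [phiC, coefE, prod_pairE, ← evalRat_specPt O false hF, termMinus]
  have e1 : ∀ i (r : Fin (a i)) p, ptMinus C a i r p = pt C false ⟨⟨i, r⟩, p⟩ := fun _ _ _ => rfl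
  have e2 : specPt m (ptMinus C a) = fun v => pt C false (slotEnum m v) := rfl
  have e3 : ∀ i r, m.1 i r = m.fn ⟨i, r⟩ := fun _ _ => rfl
  simp only [e1, e2, e3]
  have hA := prod_slots_same m.fn fun u u' => (zeta C u.1.1 u.1.1 (pt C false u') (pt C false u))⁻¹
  have hB := prod_slots_colour m.fn fun u u' => algebraMap Fq (K a) (qi C u.1.1)⁻¹ *
    (zeta C u.1.1 u.1.1 (pt C false u') (pt C false u))⁻¹
  have hC := prod_slots_arr m.fn (fun j i => O.arr i j) fun u u' =>
    (zeta C u'.1.1 u.1.1 (pt C false u') (pt C false u))⁻¹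
  have hY := prod_slots m.fn fun u => ptE O col z false u.1 (pt C false u)
  have hY' : ∀ i (r : Fin (a i)) y, ptE O col z false ⟨i, r⟩ y = Y' O i r y := fun _ _ _ => rfl
  simp only [hY'] at hY
  have hC' : (∏ u ∈ slots m.fn, ∏ u' ∈ slots m.fn,
      if O.arr u.1.1 u'.1.1 then (zeta C u'.1.1 u.1.1 (pt C false u') (pt C false u))⁻¹ else 1) =
      (∏ u ∈ slots m.fn, ∏ u' ∈ slots m.fn,
        if arrE O false u'.1.1 u.1.1 then (kapE O false u u')⁻¹ else 1) *
      ∏ u ∈ slots m.fn, ∏ u' ∈ slots m.fn,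
        if O.arr u'.1.1 u.1.1 then pt C false u - pt C false u' else 1 := by
    rw [Finset.prod_comm (f := fun u u' => if O.arr u'.1.1 u.1.1 then pt C false u - pt C false u' else 1)]
    simp only [← Finset.prod_mul_distrib]
    refine Finset.prod_congr rfl fun u _ => Finset.prod_congr rfl fun u' _ => ?_
    have : arrE O false u'.1.1 u.1.1 = O.arr u.1.1 u'.1.1 := rfl
    simp only [this]
    split_ifs with h
    · rw [show kapE O false u u' = pt C false u' - algebraMap Fq (K a) (qi C u'.1.1 ^ (-C.c u'.1.1 u.1.1)) *
        pt C false u from kap_of_arr_right O h _ _, zeta, inv_div, div_eq_mul_inv, mul_comm]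
    · rw [mul_one]
  have hA' : (∏ u ∈ slots m.fn, ∏ u' ∈ slots m.fn, if u.1 = u'.1 then (if u.2 < u'.2 then
      algebraMap Fq (K a) (qi C u.1.1 ^ (-(1 + sg false))) * (kapE O false u u')⁻¹ else 1) else 1) =
      ∏ u ∈ slots m.fn, ∏ u' ∈ slots m.fn, if u.1 = u'.1 then (if u.2 < u'.2 then
        (zeta C u.1.1 u.1.1 (pt C false u') (pt C false u))⁻¹ else 1) else 1 := by
    refine Finset.prod_congr rfl fun u _ => Finset.prod_congr rfl fun u' _ => ?_
    split_ifs with h h'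
    · rw [kapE_false_self O u u' (congrArg Sigma.fst h), show -(1 + sg false) = 0 from rfl, zpow_zero,
        map_one, one_mul]
    · rfl
    · rfl
  have hB' : (∏ u ∈ slots m.fn, ∏ u' ∈ slots m.fn, if u.1 ≠ u'.1 ∧ u.1.1 = u'.1.1 then
      algebraMap Fq (K a) (qi C u.1.1 ^ (-1 : ℤ)) * (kapE O false u u')⁻¹ else 1) =
      ∏ u ∈ slots m.fn, ∏ u' ∈ slots m.fn, if u.1 ≠ u'.1 ∧ u.1.1 = u'.1.1 then
        algebraMap Fq (K a) (qi C u.1.1)⁻¹ *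
          (zeta C u.1.1 u.1.1 (pt C false u') (pt C false u))⁻¹ else 1 := by
    refine Finset.prod_congr rfl fun u _ => Finset.prod_congr rfl fun u' _ => ?_
    split_ifs with h
    · rw [kapE_false_self O u u' h.2, zpow_neg_one]
    · rfl
  rw [← hY, ← hA, hA', hB']
  convert_to ((∏ u ∈ slots m.fn, ptE O col z false u.1 (pt C false u)) * _ *
    (∏ u ∈ slots m.fn, ∏ u' ∈ slots m.fn, if u.1 = u'.1 then (if u.2 < u'.2 then
        (zeta C u.1.1 u.1.1 (pt C false u') (pt C false u))⁻¹ else 1) else 1) *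
    (∏ u ∈ slots m.fn, ∏ u' ∈ slots m.fn, if u.1 ≠ u'.1 ∧ u.1.1 = u'.1.1 then
        algebraMap Fq (K a) (qi C u.1.1)⁻¹ *
          (zeta C u.1.1 u.1.1 (pt C false u') (pt C false u))⁻¹ else 1) *
    ((∏ u ∈ slots m.fn, ∏ u' ∈ slots m.fn,
        if arrE O false u'.1.1 u.1.1 then (kapE O false u u')⁻¹ else 1) *
      ∏ u ∈ slots m.fn, ∏ u' ∈ slots m.fn,
        if O.arr u'.1.1 u.1.1 then pt C false u - pt C false u' else 1)) = _
  · rw [hB, ← hC', hC]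
    congr!
  · ring

theorem phiMinus_eq {k : I → ℕ} {F : K k} (hF : F ∈ bigComp O k) :
    phiMinus O k F = phiE O col z false (a := a) k (DirectSum.of (fun k : I → ℕ => K k) k F) := by
  rw [phiMinus, phiE, sum_comps]
  refine Finset.sum_congr rfl fun m _ => ?_
  rw [mulOp_mul_shiftOp, termMinus_eq O col z hF]
  congr 2
  funext v
  simp [sg, Comp.fn]

/-! ### The images of the generators -/

theorem comps_single (i : I) :
    comps a (Pi.single i 1) = Finset.univ.image fun t : Fin (a i) => Pi.single (⟨i, t⟩ : V a) 1 := by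
  ext m
  rw [mem_comps, Finset.mem_image]
  constructor
  · intro h
    have h1 : ∑ r : Fin (a i), m ⟨i, r⟩ = 1 := by simpa [slotDeg] using congrFun h i
    obtain ⟨t, -, ht⟩ := Finset.exists_ne_zero_of_sum_ne_zero (h1.trans_ne one_ne_zero)
    refine ⟨t, Finset.mem_univ t, ?_⟩
    rw [← Finset.add_sum_erase _ _ (Finset.mem_univ t)] at h1
    have h2 : m ⟨i, t⟩ = 1 := by omega
    have h3 : ∑ r ∈ Finset.univ.erase t, m ⟨i, r⟩ = 0 := by omega
    funext ⟨j, s⟩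
    by_cases hj : j = i
    · subst hj
      by_cases hs : s = t
      · subst hs
        rw [Pi.single_eq_same, h2]
      · rw [Pi.single_eq_of_ne (by simpa using hs)]
        exact ((Finset.sum_eq_zero_iff.1 h3) s (Finset.mem_erase.2 ⟨hs, Finset.mem_univ s⟩)).symm
    · rw [Pi.single_eq_of_ne (fun e => hj (congrArg Sigma.fst e))]
      have := congrFun h j
      rw [Pi.single_eq_of_ne hj, slotDeg, Finset.sum_eq_zero_iff] at this
      exact (this s (Finset.mem_univ s)).symm
  · rintro ⟨t, -, rfl⟩
    funext j
    by_cases hj : j = i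
    · subst hj
      rw [Pi.single_eq_same, slotDeg, Finset.sum_eq_single t]
      · simp
      · intro s _ hs
        exact Pi.single_eq_of_ne (by simpa using hs) _
      · simp
    · rw [Pi.single_eq_of_ne hj, slotDeg]
      exact Finset.sum_eq_zero fun s _ => Pi.single_eq_of_ne (fun e => hj (congrArg Sigma.fst e)) _

theorem slots_single (v : V a) : slots (Pi.single v 1) = {⟨v, 0⟩} := by
  ext ⟨v', p⟩
  rw [mem_slots, Finset.mem_singleton]
  by_cases h : v' = v
  · subst h
    simp
  · rw [Pi.single_eq_of_ne h]
    simp [h]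

theorem phiC_xPow (i : I) (r : ℤ) (t : Fin (a i)) :
    phiC O col z ε (xPow i r) (Pi.single ⟨i, t⟩ 1) =
      ptE O col z ε ⟨i, t⟩ (pt C ε ⟨⟨i, t⟩, 0⟩) * pt C ε ⟨⟨i, t⟩, 0⟩ ^ r := by
  have h := congrFun (evC_xPow O (cl := slotCl) (pt_ne_zero (a := a) C ε) i r) {⟨⟨i, t⟩, 0⟩}
  rw [Conv.gen_singleton, if_pos (show slotCl (⟨⟨i, t⟩, 0⟩ : Slot a) = i from rfl)] at h
  have h' : ev O slotCl (pt C ε) (xPow i r) {⟨⟨i, t⟩, 0⟩} = pt C ε ⟨⟨i, t⟩, 0⟩ ^ r := h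
  rw [phiC, coefE, slots_single, h', Finset.prod_singleton, Finset.prod_singleton,
    Finset.prod_singleton, pairE, if_pos rfl, if_neg (lt_irrefl _), mul_one]

theorem phiLin_xPow (i : I) (r : ℤ) : phiLin O col z ε (a := a) (xPow i r) = ∑ t : Fin (a i),
    mulOp C (ptE O col z ε ⟨i, t⟩ (pt C ε ⟨⟨i, t⟩, 0⟩) * pt C ε ⟨⟨i, t⟩, 0⟩ ^ r) *
      shiftOp C (Pi.single ⟨i, t⟩ (-sg ε)) := by
  have hx : x (⟨i, ⟨0, by simp⟩⟩ : V (Pi.single i 1)) ^ r ∈ bigComp O (Pi.single i 1) :=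
    (xPow_mem_wheelComp O i r).1
  rw [xPow, phiLin_of O col z ε hx, phiE, comps_single, Finset.sum_image]
  · refine Finset.sum_congr rfl fun t _ => ?_
    rw [mulOp_mul_shiftOp, ← phiC_xPow]
    congr 2
    rw [shiftE]
    congr 1
    funext v
    rw [Pi.single_apply, Pi.single_apply]
    split_ifs <;> simp
  · intro t _ t' _ h
    by_contra hne
    have := congrFun h ⟨i, t⟩
    simp only [Pi.single_eq_same] at this
    rw [Pi.single_eq_of_ne (by simpa using hne)] at this
    exact one_ne_zero this

theorem qi_sub_inv_ne_zero (i : I) : qi C i - (qi C i)⁻¹ ≠ 0 := by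
  rw [sub_ne_zero]
  intro h
  have h1 : qi C i ^ (1 : ℤ) = qi C i ^ (-1 : ℤ) := by rwa [zpow_one, zpow_neg_one]
  exact absurd (qi_zpow_injective C i h1) (by norm_num)

theorem phiLin_xPow_pos (i : I) (r : ℤ) :
    phiLin O col z true (a := a) (xPow i r) = gkloE O col z i r := by
  rw [phiLin_xPow, gkloE]
  refine Finset.sum_congr rfl fun t _ => ?_
  rw [show -sg true = -1 from rfl]
  congr 2
  have h0 : pt C true (⟨⟨i, t⟩, 0⟩ : Slot a) = w ⟨i, t⟩ := by
    rw [pt_eq]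
    simp [sg]
  have h1 : 1 / (qi C i - (qi C i)⁻¹) = -qi C i / (1 - qi C i ^ 2) := by
    have h2 := qi_sub_inv_ne_zero (C := C) i
    have h3 := qi_ne_zero C i
    have h4 : 1 - qi C i ^ 2 = -qi C i * (qi C i - (qi C i)⁻¹) := by
      field_simp
      ring
    rw [h4, div_mul_eq_div_div, div_self (neg_ne_zero.2 h3)]
  rw [h0, ptE, if_pos rfl, Y, h1]
  ring

theorem phiLin_xPow_neg (i : I) (r : ℤ) : phiLin O col z false (a := a) (xPow i r) = gkloF O i r := by
  rw [phiLin_xPow, gkloF]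
  refine Finset.sum_congr rfl fun t _ => ?_
  rw [show -sg false = 1 from rfl]
  congr 2
  have h0 : pt C false (⟨⟨i, t⟩, 0⟩ : Slot a) = algebraMap Fq (K a) (qi C i ^ 2) * w ⟨i, t⟩ := by
    rw [pt_eq]
    simp only [sg]
    norm_cast
  have h1 : algebraMap Fq (K a) (qi C i ^ 2) * w ⟨i, t⟩ * algebraMap Fq (K a) (qi C i ^ (-2 : ℤ)) =
      w ⟨i, t⟩ := by
    rw [mul_right_comm, ← map_mul, ← zpow_natCast, ← zpow_add₀ (qi_ne_zero C i)]
    simp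
  rw [h0, ptE, if_neg (by simp), Y', h1]
  ring

end Explicit

end

section

/-! ### Rings of coefficients -/

section CoefRing

variable {I : Type*} [Fintype I] {C : CartanDatum I} {a : I → ℕ}

variable (C a) in
/-- The localization of the Laurent polynomials at the `w_v - q_i^m w_u` with `P v u`. -/
def coefRing (P : V a → V a → Prop) : Subalgebra Fq (K a) :=
  Algebra.adjoin Fq ((Set.range (x (k := a)) ∪ Set.range fun v : V a => (x v)⁻¹) ∪
    {F | ∃ (v u : V a) (m : ℤ), P v u ∧ F = (wDiff C v u m)⁻¹})

variable {P : V a → V a → Prop}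

theorem laurent_le_coefRing : laurent a ≤ coefRing C a P := Algebra.adjoin_mono Set.subset_union_left

theorem diffGens_subset_Atilde : diffGens C a ⊆ Atilde C a :=
  fun _ h => Algebra.subset_adjoin (Or.inl h)

theorem diffGens_subset_AtildePrime : diffGens C a ⊆ AtildePrime C a :=
  fun _ h => Algebra.subset_adjoin (Or.inl h)

theorem mulOp_mem_of_coefRing {S : Subalgebra Fq (Diff C a)} (hS : diffGens C a ⊆ S)
    (hS' : ∀ v u m, P v u → mulOp C (wDiff C v u m)⁻¹ ∈ S) {F : K a} (hF : F ∈ coefRing C a P) :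
    mulOp C F ∈ S := by
  have : coefRing C a P ≤ S.comap (mulHom C a) := by
    refine Algebra.adjoin_le ?_
    rintro _ (h | ⟨v, u, m, h, rfl⟩)
    · exact mulOp_laurent_mem hS (Algebra.subset_adjoin h)
    · exact hS' v u m h
  exact this hF

theorem mulOp_mem_Atilde {F : K a} (hF : F ∈ coefRing C a fun v u => v ≠ u ∧ v.1 = u.1) :
    mulOp C F ∈ Atilde C a :=
  mulOp_mem_of_coefRing diffGens_subset_Atilde
    (fun v u m h => Algebra.subset_adjoin (Or.inr ⟨v, u, m, h.1, h.2, rfl⟩)) hF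

theorem mulOp_mem_AtildePrime {F : K a} (hF : F ∈ coefRing C a fun v u => v ≠ u) :
    mulOp C F ∈ AtildePrime C a :=
  mulOp_mem_of_coefRing diffGens_subset_AtildePrime
    (fun v u m h => Algebra.subset_adjoin (Or.inr ⟨v, u, m, h, rfl⟩)) hF

theorem const_mem_laurent (c : Fq) : algebraMap Fq (K a) c ∈ laurent a := Subalgebra.algebraMap_mem _ c

theorem w_mem_laurent (v : V a) : w v ∈ laurent a := pow_mem (x_mem_laurent v) 2

theorem w_inv_mem_laurent (v : V a) : (w v)⁻¹ ∈ laurent a := by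
  rw [w, ← inv_pow]
  exact pow_mem (x_inv_mem_laurent v) 2

theorem inv_w_sub_mem {v u : V a} (h : P v u) {A B : Fq} {m : ℤ}
    (hm : B = A * qi C v.1 ^ m) :
    (algebraMap Fq (K a) A * w v - algebraMap Fq (K a) B * w u)⁻¹ ∈ coefRing C a P := by
  have e : algebraMap Fq (K a) A * w v - algebraMap Fq (K a) B * w u =
      algebraMap Fq (K a) A * wDiff C v u m := by
    rw [wDiff, hm, map_mul]
    ring
  rw [e, mul_inv, ← map_inv₀]
  exact mul_mem (Subalgebra.algebraMap_mem _ _) (Algebra.subset_adjoin (Or.inr ⟨v, u, m, h, rfl⟩))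

theorem CartanDatum.exists_qi_eq_pow {i j : I} (h : i ≠ j) (hc : C.c i j ≠ 0) :
    (∃ e : ℕ, qi C j = qi C i ^ e) ∨ ∃ e : ℕ, qi C i = qi C j ^ e := by
  have h1 := C.symm i j
  rcases C.c_eq_neg_one h hc with h2 | h2
  · right
    have h3 := C.c_offDiag j i h.symm
    refine ⟨(-C.c j i).toNat, ?_⟩
    rw [qi, qi, ← pow_mul]
    congr 1
    zify
    rw [Int.toNat_of_nonneg (by omega)]
    rw [h2] at h1
    linarith
  · left
    have h3 := C.c_offDiag i j h
    refine ⟨(-C.c i j).toNat, ?_⟩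
    rw [qi, qi, ← pow_mul]
    congr 1
    zify
    rw [Int.toNat_of_nonneg (by omega)]
    rw [h2] at h1
    linarith

variable [DecidableEq I] (ε : Bool)

theorem pt_mem_laurent (u : Slot a) : pt C ε u ∈ laurent a := by
  rw [pt_eq]
  exact mul_mem (const_mem_laurent _) (w_mem_laurent _)

theorem pt_inv_mem_laurent (u : Slot a) : (pt C ε u)⁻¹ ∈ laurent a := by
  rw [pt_eq, mul_inv, ← map_inv₀]
  exact mul_mem (const_mem_laurent _) (w_inv_mem_laurent _)

theorem inv_pt_sub_mem_of_eq {u u' : Slot a} (h : u.1 = u'.1) (c : Fq) :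
    (pt C ε u - algebraMap Fq (K a) c * pt C ε u')⁻¹ ∈ laurent a := by
  rw [pt_eq, pt_eq, ← h, ← mul_assoc, ← map_mul, ← sub_mul, ← map_sub, mul_inv, ← map_inv₀]
  exact mul_mem (const_mem_laurent _) (w_inv_mem_laurent _)

theorem inv_pt_sub_mem_of_colour {u u' : Slot a} (hP : P u.1 u'.1) (h : u.1.1 = u'.1.1) (n : ℤ) :
    (pt C ε u - algebraMap Fq (K a) (qi C u.1.1 ^ n) * pt C ε u')⁻¹ ∈ coefRing C a P := by
  rw [pt_eq, pt_eq, ← h, ← mul_assoc, ← map_mul]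
  refine inv_w_sub_mem hP
    (m := n + 2 * sg ε * u.2 - 2 * sg ε * u'.2) ?_
  rw [← zpow_add₀ (qi_ne_zero C _), ← zpow_add₀ (qi_ne_zero C _)]
  congr 1
  ring

theorem inv_pt_sub_mem_of_edge {u u' : Slot a} (hP : P u.1 u'.1) (hP' : P u'.1 u.1)
    (h : u.1.1 ≠ u'.1.1) (hc : C.c u.1.1 u'.1.1 ≠ 0) (n : ℤ) :
    (pt C ε u - algebraMap Fq (K a) (qi C u'.1.1 ^ n) * pt C ε u')⁻¹ ∈ coefRing C a P := by
  rw [pt_eq, pt_eq, ← mul_assoc, ← map_mul, ← zpow_add₀ (qi_ne_zero C _)]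
  generalize 1 - sg ε - 2 * sg ε * (u.2 : ℤ) = s
  generalize n + (1 - sg ε - 2 * sg ε * (u'.2 : ℤ)) = t
  rcases C.exists_qi_eq_pow h hc with ⟨e, he⟩ | ⟨e, he⟩
  · refine inv_w_sub_mem hP (m := e * t - s) ?_
    rw [he, ← zpow_add₀ (qi_ne_zero C _), ← zpow_natCast, ← zpow_mul]
    congr 1
    ring
  · rw [← neg_sub, inv_neg]
    refine neg_mem (inv_w_sub_mem hP' (m := e * s - t) ?_)
    rw [he, ← zpow_add₀ (qi_ne_zero C _), ← zpow_natCast, ← zpow_mul]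
    congr 1
    ring

theorem evalRat_mem_of_laurent {E : Type*} [Field E] [Algebra Fq E] {k : I → ℕ}
    (S : Subalgebra Fq E) {p : V k → E} (hp : ∀ v, p v ≠ 0) (h : ∀ v, p v ∈ S)
    (h' : ∀ v, (p v)⁻¹ ∈ S) {f : K k} (hf : f ∈ laurent k) : evalRat p f ∈ S := by
  have key : ∃ y ∈ S, HasVal p f y := by
    induction hf using Algebra.adjoin_induction with
    | mem f hf =>
      rcases hf with ⟨v, rfl⟩ | ⟨v, rfl⟩
      · exact ⟨_, h v, hasVal_x p v⟩
      · exact ⟨_, h' v, (hasVal_x p v).inv (hp v)⟩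
    | algebraMap c => exact ⟨_, Subalgebra.algebraMap_mem S c, hasVal_const p c⟩
    | add f g _ _ hf hg =>
      obtain ⟨y, hy, hf⟩ := hf
      obtain ⟨y', hy', hg⟩ := hg
      exact ⟨_, add_mem hy hy', hf.add hg⟩
    | mul f g _ _ hf hg =>
      obtain ⟨y, hy, hf⟩ := hf
      obtain ⟨y', hy', hg⟩ := hg
      exact ⟨_, mul_mem hy hy', hf.mul hg⟩
  obtain ⟨y, hy, hf⟩ := key
  rwa [hf.evalRat_eq]

end CoefRing

section Membership

variable {I : Type*} [Fintype I] [DecidableEq I] {C : CartanDatum I} (O : DynOrientation C)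
  {a : I → ℕ} {N : ℕ} (col : Fin N → I) (z : Fin N → ℂ) (ε : Bool) {P : V a → V a → Prop}

theorem ev_pt_mem_laurent {F : T I} (hF : F ∈ bigS O) (A : Finset (Slot a)) :
    ev O slotCl (pt C ε) F A ∈ laurent a :=
  evalRat_mem_of_laurent (laurent a) (fun _ => pt_ne_zero C ε _) (fun _ => pt_mem_laurent ε _)
    (fun _ => pt_inv_mem_laurent ε _) (hF (cnt slotCl A)).1

theorem Z_pt_mem (i : I) (u : Slot a) : Z col z C a i (pt C ε u) ∈ laurent a := by
  refine prod_mem fun s _ => sub_mem (one_mem _) ?_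
  rw [div_eq_mul_inv]
  exact mul_mem (const_mem_laurent _) (pt_inv_mem_laurent ε u)

theorem facE_edge_mem {v t : V a} (h : t.1 ≠ v.1) (p : ℕ) : facE O ε v t (pt C ε ⟨v, p⟩) ∈ laurent a := by
  rw [facE, if_neg h]
  split_ifs
  · refine mul_mem (x_zpow_mem_laurent t _) (prod_mem fun s _ => sub_mem (one_mem _) ?_)
    rw [div_eq_mul_inv, mul_inv, ← map_inv₀]
    exact mul_mem (w_mem_laurent t) (mul_mem (const_mem_laurent _) (pt_inv_mem_laurent ε _))
  · exact one_mem _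

theorem facE_colour_mem (hP : ∀ v u : V a, v ≠ u → v.1 = u.1 → P v u) {v t : V a} (h : t.1 = v.1) (p : ℕ) :
    facE O ε v t (pt C ε ⟨v, p⟩) ∈ coefRing C a P := by
  rw [facE, if_pos h]
  refine mul_mem (laurent_le_coefRing (x_zpow_mem_laurent t _)) ?_
  split_ifs with htv
  · exact one_mem _
  · rw [one_sub_div (pt_ne_zero C ε _), inv_div, div_eq_mul_inv]
    refine mul_mem (laurent_le_coefRing (pt_mem_laurent ε _)) ?_
    have := inv_pt_sub_mem_of_colour (C := C) ε (u := ⟨v, p⟩) (u' := ⟨t, 0⟩) (hP v t (Ne.symm htv) h.symm) h.symm 0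
    rwa [zpow_zero, map_one, one_mul] at this

theorem kapE_inv_of_colour (u u' : Slot a) (h : u.1.1 = u'.1.1) : ∃ (c : Fq) (n : ℤ) , c ≠ 0 ∧
    (kapE O ε u u')⁻¹ = (pt C ε u - pt C ε u') * algebraMap Fq (K a) c *
      (pt C ε u - algebraMap Fq (K a) (qi C u.1.1 ^ n) * pt C ε u')⁻¹ := by
  cases ε
  · refine ⟨qi C u.1.1 ^ (2 : ℤ), 2, ?_⟩
    rw [kapE_false_self O u u' h, zeta, inv_div, C.c_diag]
    have e : pt C false u' - algebraMap Fq (K a) (qi C u.1.1 ^ (-2 : ℤ)) * pt C false u =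
        -(algebraMap Fq (K a) (qi C u.1.1 ^ (-2 : ℤ)) * (pt C false u -
          algebraMap Fq (K a) (qi C u.1.1 ^ (2 : ℤ)) * pt C false u')) := by
      rw [mul_sub, ← mul_assoc, ← map_mul, ← zpow_add₀ (qi_ne_zero C _)]
      simp
    rw [e, div_eq_mul_inv, inv_neg, mul_inv, ← map_inv₀, ← zpow_neg]
    refine ⟨zpow_ne_zero _ (qi_ne_zero C _), ?_⟩
    rw [neg_neg]
    ring
  · refine ⟨1, -2, one_ne_zero, ?_⟩
    rw [kapE_true_self O u u' h, zeta, inv_div, C.c_diag, map_one, mul_one, div_eq_mul_inv]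

theorem kapE_of_arrE {u u' : Slot a} (h : arrE O ε u'.1.1 u.1.1) : ∃ c : Fq, c ≠ 0 ∧
    kapE O ε u u' = algebraMap Fq (K a) c *
      (pt C ε u - qE ε C a u'.1.1 (-C.c u'.1.1 u.1.1) * pt C ε u') := by
  cases ε
  · refine ⟨-qi C u'.1.1 ^ (-C.c u'.1.1 u.1.1), neg_ne_zero.2 (zpow_ne_zero _ (qi_ne_zero C _)), ?_⟩
    rw [show kapE O false u u' = pt C false u' - algebraMap Fq (K a) (qi C u'.1.1 ^ (-C.c u'.1.1 u.1.1)) *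
        pt C false u from kap_of_arr_right O h _ _, mul_sub, ← mul_assoc, qE, ← map_mul, neg_mul,
        ← zpow_add₀ (qi_ne_zero C _)]
    simp [sg]
    ring
  · refine ⟨1, one_ne_zero, ?_⟩
    rw [show kapE O true u u' = pt C true u - algebraMap Fq (K a) (qi C u.1.1 ^ (-C.c u.1.1 u'.1.1)) *
        pt C true u' from kap_of_arr_right O h _ _, qE, qi_zpow_neg_c_symm]
    simp [sg]

theorem ne_of_arrE {i j : I} (h : arrE O ε j i) : i ≠ j := fun e => by
  cases ε
  · exact O.ne_of_arr (show O.arr i j from h) e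
  · exact O.ne_of_arr (show O.arr j i from h) e.symm

theorem c_ne_zero_of_arrE {i j : I} (h : arrE O ε j i) : C.c i j ≠ 0 := by
  refine (O.adj_iff i j (ne_of_arrE O ε h)).2 ?_
  cases ε
  · exact Or.inl h
  · exact Or.inr h

open Classical in
theorem pairE_mem_of_not_arrE (hP : ∀ v u : V a, v ≠ u → v.1 = u.1 → P v u) (u u' : Slot a) :
    (if arrE O ε u'.1.1 u.1.1 then 1 else pairE O ε u u') ∈ coefRing C a P := by
  split_ifs with h
  · exact one_mem _
  rw [pairE]
  split_ifs with h1 h2 h3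
  · refine mul_mem (Subalgebra.algebraMap_mem _ _) ?_
    obtain ⟨c, n, -, e⟩ := kapE_inv_of_colour O ε u u' (congrArg Sigma.fst h1)
    rw [e]
    exact laurent_le_coefRing (mul_mem (mul_mem (sub_mem (pt_mem_laurent ε _) (pt_mem_laurent ε _))
      (const_mem_laurent _)) (inv_pt_sub_mem_of_eq ε h1 _))
  · exact one_mem _
  · refine mul_mem (Subalgebra.algebraMap_mem _ _) ?_
    obtain ⟨c, n, -, e⟩ := kapE_inv_of_colour O ε u u' h3
    rw [e]
    exact mul_mem (laurent_le_coefRing (mul_mem (sub_mem (pt_mem_laurent ε _) (pt_mem_laurent ε _))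
      (const_mem_laurent _))) (inv_pt_sub_mem_of_colour ε (hP _ _ h1 h3) h3 _)
  · exact one_mem _

theorem pairE_of_arrE {u u' : Slot a} (h : arrE O ε u'.1.1 u.1.1) :
    pairE O ε u u' = (kapE O ε u u')⁻¹ := by
  have h1 := ne_of_arrE O ε h
  rw [pairE, if_neg (fun e => h1 (congrArg Sigma.fst e)), if_neg h1, if_pos h]

open Classical in
/-- The coefficients, up to factors in the smaller ring of coefficients. -/
theorem exists_coefE_eq (hP : ∀ v u : V a, v ≠ u → v.1 = u.1 → P v u) (m : V a → ℕ) :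
    ∃ A ∈ coefRing C a P, coefE O col z ε m = A * ∏ u ∈ slots m, ∏ t,
      if arrE O ε t.1 u.1.1 then facE O ε u.1 t (pt C ε u) *
        ∏ p ∈ Finset.range (m t), (kapE O ε u ⟨t, p⟩)⁻¹ else 1 := by
  refine ⟨(∏ u ∈ slots m, (algebraMap Fq (K a) (conE C ε u.1.1) *
      (if ε then Z col z C a u.1.1 (pt C ε u) else 1) *
      ∏ t, if arrE O ε t.1 u.1.1 then 1 else facE O ε u.1 t (pt C ε u))) *
      ∏ u ∈ slots m, ∏ u' ∈ slots m, if arrE O ε u'.1.1 u.1.1 then 1 else pairE O ε u u', ?_, ?_⟩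
  · refine mul_mem (prod_mem fun u _ => mul_mem (mul_mem (Subalgebra.algebraMap_mem _ _) ?_)
      (prod_mem fun t _ => ?_)) (prod_mem fun u _ => prod_mem fun u' _ =>
        pairE_mem_of_not_arrE O ε hP u u')
    · split_ifs
      · exact laurent_le_coefRing (Z_pt_mem col z ε _ u)
      · exact one_mem _
    · split_ifs with h
      · exact one_mem _
      · by_cases hc : t.1 = u.1.1
        · exact facE_colour_mem O ε hP hc u.2
        · exact laurent_le_coefRing (facE_edge_mem O ε hc u.2)
  · rw [coefE]
    have h1 : ∀ u : Slot a, ptE O col z ε u.1 (pt C ε u) = (algebraMap Fq (K a) (conE C ε u.1.1) *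
      (if ε then Z col z C a u.1.1 (pt C ε u) else 1) *
      ∏ t, if arrE O ε t.1 u.1.1 then 1 else facE O ε u.1 t (pt C ε u)) *
      ∏ t, if arrE O ε t.1 u.1.1 then facE O ε u.1 t (pt C ε u) else 1 := by
      intro u
      rw [ptE_eq, mul_assoc _ (∏ t, _) (∏ t, _), ← Finset.prod_mul_distrib]
      congr 1
      refine Finset.prod_congr rfl fun t _ => ?_
      split_ifs
      · rw [one_mul]
      · rw [mul_one]
    have h2 : ∀ u u' : Slot a, pairE O ε u u' = (if arrE O ε u'.1.1 u.1.1 then 1 else pairE O ε u u') *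
        if arrE O ε u'.1.1 u.1.1 then (kapE O ε u u')⁻¹ else 1 := by
      intro u u'
      split_ifs with h
      · rw [one_mul, pairE_of_arrE O ε h]
      · rw [mul_one]
    have h3 : ∀ u : Slot a, (∏ u' ∈ slots m, if arrE O ε u'.1.1 u.1.1 then (kapE O ε u u')⁻¹ else 1) =
        ∏ t, if arrE O ε t.1 u.1.1 then ∏ p ∈ Finset.range (m t), (kapE O ε u ⟨t, p⟩)⁻¹ else 1 := by
      intro u
      rw [slots, Finset.prod_sigma]
      refine Finset.prod_congr rfl fun t _ => ?_
      split_ifs <;> simp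
    rw [Finset.prod_congr rfl fun u _ => h1 u,
      Finset.prod_congr rfl fun u _ => Finset.prod_congr rfl fun u' _ => h2 u u']
    simp only [Finset.prod_mul_distrib, h3]
    have h4 : ∀ u t, (if arrE O ε t.1 u.1.1 then facE O ε u.1 t (pt C ε u) *
        ∏ p ∈ Finset.range (m t), (kapE O ε u ⟨t, p⟩)⁻¹ else 1) =
        (if arrE O ε t.1 u.1.1 then facE O ε u.1 t (pt C ε u) else 1) *
        if arrE O ε t.1 u.1.1 then ∏ p ∈ Finset.range (m t), (kapE O ε u ⟨t, p⟩)⁻¹ else 1 := by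
      intro u t
      split_ifs
      · rfl
      · rw [mul_one]
    simp only [h4, Finset.prod_mul_distrib]
    ring

theorem phiC_mem_of_ne {F : T I} (hF : F ∈ bigS O) (m : V a → ℕ) :
    phiC O col z ε F m ∈ coefRing C a fun v u => v ≠ u := by
  classical
  obtain ⟨A, hA, e⟩ := exists_coefE_eq O col z ε (P := fun v u => v ≠ u) (fun _ _ h _ => h) m
  rw [phiC, e]
  refine mul_mem (mul_mem hA (prod_mem fun u _ => prod_mem fun t _ => ?_))
    (laurent_le_coefRing (ev_pt_mem_laurent O ε hF _))
  split_ifs with h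
  · have hne := ne_of_arrE O ε h
    have hne' : u.1 ≠ t := fun e => hne (congrArg Sigma.fst e)
    refine mul_mem (laurent_le_coefRing (facE_edge_mem O ε hne.symm u.2)) (prod_mem fun p _ => ?_)
    obtain ⟨c, hc, e⟩ := kapE_of_arrE O ε (u := u) (u' := ⟨t, p⟩) h
    rw [e, mul_inv, ← map_inv₀]
    exact mul_mem (Subalgebra.algebraMap_mem _ _)
      (inv_pt_sub_mem_of_edge ε (u := u) (u' := ⟨t, p⟩) hne' hne'.symm hne (c_ne_zero_of_arrE O ε h) _)
  · exact one_mem _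

theorem phiLin_mem {B : Submodule Fq (T I)} (hB : B ≤ bigS O)
    (hB' : ∀ F ∈ B, ∀ k, DirectSum.of (fun k : I → ℕ => K k) k (F k) ∈ B)
    {S : Subalgebra Fq (Diff C a)} (hS : diffGens C a ⊆ S)
    (hc : ∀ F ∈ B, ∀ m, mulOp C (phiC O col z ε F m) ∈ S) {F : T I} (hF : F ∈ B) :
    phiLin O col z ε F ∈ S := by
  obtain ⟨s, hs⟩ := eq_sum_of F
  rw [hs, map_sum]
  refine sum_mem fun k _ => ?_
  rw [phiLin_of O col z ε (hB hF k), phiE]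
  refine sum_mem fun m _ => ?_
  rw [shiftE, ← mulOp_mul_shiftOp]
  exact mul_mem (hc _ (hB' F hF k) m) (shiftOp_mem hS _)

theorem phiLin_mem_AtildePrime {F : T I} (hF : F ∈ bigS O) :
    phiLin O col z ε F ∈ AtildePrime C a :=
  phiLin_mem O col z ε le_rfl (fun _ hF k => of_mem_bigS O (hF k)) diffGens_subset_AtildePrime
    (fun _ hF m => mulOp_mem_AtildePrime (phiC_mem_of_ne O col z ε hF m)) hF

end Membership

end

section

/-! ### Divisibility by wheel conditions -/

section Wheel

variable {I : Type*} [Fintype I] [DecidableEq I] {C : CartanDatum I} (O : DynOrientation C)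
  {a : I → ℕ} (ε : Bool)

variable (C) in
/-- The constant factor of an evaluation point. -/
def ptC (u : Slot a) : Fq := qi C u.1.1 ^ (1 - sg ε - 2 * sg ε * u.2)

theorem ptC_ne_zero (u : Slot a) : ptC C ε u ≠ 0 := zpow_ne_zero _ (qi_ne_zero C _)

theorem numerator_eq {ι : Type*} [DecidableEq ι] {cl : ι → I} {F : T I} (hF : F ∈ bigS O) {S : Finset ι}
    {n : MvPolynomial (V (cnt cl S)) Fq} {s : V (cnt cl S) →₀ ℕ}
    (hn : F (cnt cl S) * poleDen O (cnt cl S) *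
      algebraMap (MvPolynomial (V (cnt cl S)) Fq) (K (cnt cl S)) (MvPolynomial.monomial s 1) =
        algebraMap _ _ n)
    {E : Type*} [Field E] [Algebra Fq E] {p : ι → E} (hp : ∀ u, p u ≠ 0) :
    MvPolynomial.aeval (fun v => p (enum cl S v)) n = ev O cl p F S *
      MvPolynomial.aeval (fun v => p (enum cl S v)) (MvPolynomial.monomial s (1 : Fq)) := by
  have hm := aeval_monomial_ne_zero (p := fun v => p (enum cl S v)) (fun v => hp _) s
  have h := (hasVal_ev O (cl := cl) hp hF S).unique ⟨n, _, hm, hn, rfl⟩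
  rw [h, div_mul_cancel₀ _ hm]

theorem linear_dvd_of_ev_eq_zero {ι σ : Type*} [DecidableEq ι] [DecidableEq σ] {cl : ι → I} {F : T I}
    (hF : F ∈ bigS O) {S : Finset ι} {n : MvPolynomial (V (cnt cl S)) Fq} {s : V (cnt cl S) →₀ ℕ}
    (hn : F (cnt cl S) * poleDen O (cnt cl S) *
      algebraMap (MvPolynomial (V (cnt cl S)) Fq) (K (cnt cl S)) (MvPolynomial.monomial s 1) =
        algebraMap _ _ n) (P : ι → MvPolynomial σ Fq) {t t' : σ} (ht : t ≠ t') (c : Fq)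
    (hP : ∀ u, substVar t t' c (P u) ≠ 0)
    (h0 : ev O cl (fun u => algebraMap (MvPolynomial σ Fq) (Rat σ) (substVar t t' c (P u))) F S = 0) :
    MvPolynomial.X t - MvPolynomial.C c * MvPolynomial.X t' ∣
      MvPolynomial.aeval (fun v => P (enum cl S v)) n := by
  rw [linear_dvd_iff ht]
  have hinj := IsFractionRing.injective (MvPolynomial σ Fq) (Rat σ)
  apply hinj
  have h1 := numerator_eq O hF hn
    (p := fun u => algebraMap (MvPolynomial σ Fq) (Rat σ) (substVar t t' c (P u)))
    (fun u => (map_ne_zero_iff _ hinj).2 (hP u))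
  rw [h0, zero_mul] at h1
  rw [map_zero, ← h1]
  have h2 : (substVar t t' c (MvPolynomial.aeval (fun v => P (enum cl S v)) n)) =
      MvPolynomial.aeval (fun v => substVar t t' c (P (enum cl S v))) n := by
    rw [← AlgHom.comp_apply]
    congr 1
    ext v
    simp
  rw [h2]
  have h3 : ∀ (f : V (cnt cl S) → MvPolynomial σ Fq) (n : MvPolynomial (V (cnt cl S)) Fq),
      algebraMap (MvPolynomial σ Fq) (Rat σ) (MvPolynomial.aeval f n) =
      MvPolynomial.aeval (fun v => algebraMap (MvPolynomial σ Fq) (Rat σ) (f v)) n := by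
    intro f n
    change IsScalarTower.toAlgHom Fq (MvPolynomial σ Fq) (Rat σ) _ = _
    rw [← AlgHom.comp_apply]
    congr 1
    ext v
    simp
  exact h3 _ n

/-- The evaluation points, with independent variables over `v`. -/
def freePt (C : CartanDatum I) (v : V a) (u : Slot a) : MvPolynomial (Slot a) Fq :=
  if u.1 = v then MvPolynomial.X u else MvPolynomial.C (ptC C ε u) * MvPolynomial.X ⟨u.1, 0⟩

theorem ptC_shift {v : V a} {p t : ℕ} (h : t ≤ p) :
    ptC C ε ⟨v, p - t⟩ = ptC C ε ⟨v, p⟩ * qi C v.1 ^ (2 * sg ε * t) := by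
  rw [ptC, ptC, ← zpow_add₀ (qi_ne_zero C _)]
  congr 1
  push_cast [Nat.cast_sub h]
  ring

theorem ev_eq_zero_of_string {F : T I} (hF : F ∈ wheelS O) (m : V a → ℕ) {v v' : V a} (hv : v.1 ≠ v'.1)
    (hc : C.c v'.1 v.1 ≠ 0) {p p' : ℕ} (hp : p < m v) (hp' : p' < m v')
    (hn : (-C.c v'.1 v.1).toNat ≤ p') {E : Type*} [Field E] [Algebra Fq E] {y : E}
    {ρ : Slot a → E} (hρ : ∀ u, ρ u ≠ 0)
    (hρ1 : ρ ⟨v, p⟩ = algebraMap Fq E (qi C v'.1 ^ (sg ε * -C.c v'.1 v.1) * ptC C ε ⟨v', p'⟩) * y)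
    (hρ2 : ∀ p, ρ ⟨v', p⟩ = algebraMap Fq E (ptC C ε ⟨v', p⟩) * y) :
    ev O slotCl ρ F (slots m) = 0 := by
  have hneg := C.c_offDiag _ _ hv.symm
  set n := (-C.c v'.1 v.1).toNat with hndef
  have hcn : -C.c v'.1 v.1 = n := by omega
  have hq := qi_ne_zero C v'.1
  cases ε
  · refine ev_eq_zero_of_wheel O hρ hF hv.symm hc (fun t => ⟨v', p' - (n - t)⟩) ⟨v, p⟩
      (W := ρ ⟨v', p' - n⟩) ?_ (mem_slots.2 hp) rfl ?_
    · intro t ht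
      have htn : t ≤ n := by omega
      refine ⟨mem_slots.2 (lt_of_le_of_lt (Nat.sub_le _ _) hp'), rfl, ?_⟩
      rw [hρ2, hρ2, ptC_shift false (by omega), ptC_shift false hn, mul_right_comm _ y, ← map_mul,
        mul_assoc (ptC C false _), ← zpow_natCast (qi C v'.1), ← zpow_add₀ hq]
      congr 4
      simp only [sg]
      push_cast [Nat.cast_sub htn]
      ring
    · rw [hρ1, hρ2, ptC_shift false hn, mul_right_comm _ y, ← map_mul, hcn, mul_assoc (ptC _ _ _),
        ← zpow_add₀ hq, mul_comm (qi C v'.1 ^ _)]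
      congr 4
      simp only [sg, Bool.false_eq_true, if_false]
      linarith
  · refine ev_eq_zero_of_wheel O hρ hF hv.symm hc (fun t => ⟨v', p' - t⟩) ⟨v, p⟩
      (W := ρ ⟨v', p'⟩) ?_ (mem_slots.2 hp) rfl ?_
    · intro t ht
      refine ⟨mem_slots.2 (lt_of_le_of_lt (Nat.sub_le _ _) hp'), rfl, ?_⟩
      rw [hρ2, hρ2, ptC_shift true (by omega), mul_right_comm _ y, ← map_mul,
        ← zpow_natCast (qi C v'.1)]
      congr 4
    · rw [hρ1, hρ2, mul_right_comm _ y, ← map_mul, mul_comm (qi C v'.1 ^ _)]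
      congr 4
      simp [sg]

/-- The linear forms specializing to the evaluation points. -/
def linPt (C : CartanDatum I) (u : Slot a) : MvPolynomial (V a) Fq :=
  MvPolynomial.C (ptC C ε u) * MvPolynomial.X u.1

/-- The zeros of the numerators forced by the wheel conditions. -/
def wheelC (C : CartanDatum I) (v v' : V a) (p : ℕ) : Fq :=
  qi C v'.1 ^ (sg ε * -C.c v'.1 v.1) * ptC C ε ⟨v', p⟩

theorem wheelC_ne_zero (v v' : V a) (p : ℕ) : wheelC ε C v v' p ≠ 0 :=
  mul_ne_zero (zpow_ne_zero _ (qi_ne_zero C _)) (ptC_ne_zero ε _)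

theorem wheelC_injective (v v' : V a) : Function.Injective (wheelC ε C v v') := by
  intro p p' h
  have h1 := mul_left_cancel₀ (zpow_ne_zero _ (qi_ne_zero C _)) h
  have h2 := qi_zpow_injective C _ h1
  cases ε <;> simp only [sg, Bool.false_eq_true, if_false, if_true] at h2 <;> omega

variable {F : T I} (hF : F ∈ wheelS O) {m : V a → ℕ}
  {n : MvPolynomial (V (cnt slotCl (slots m))) Fq} {s : V (cnt slotCl (slots m)) →₀ ℕ}
  (hn : F (cnt slotCl (slots m)) * poleDen O (cnt slotCl (slots m)) *
      algebraMap (MvPolynomial (V (cnt slotCl (slots m))) Fq) (K (cnt slotCl (slots m)))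
        (MvPolynomial.monomial s 1) = algebraMap _ _ n)

include hF hn in
theorem prod_free_dvd {v v' : V a} (hv : v.1 ≠ v'.1) (hc : C.c v'.1 v.1 ≠ 0) :
    ∏ z ∈ Finset.range (m v) ×ˢ Finset.Ico (-C.c v'.1 v.1).toNat (m v'),
      (MvPolynomial.X (⟨v, z.1⟩ : Slot a) -
        MvPolynomial.C (wheelC ε C v v' z.2) * MvPolynomial.X (⟨v', 0⟩ : Slot a)) ∣
      MvPolynomial.aeval (fun t => freePt ε C v (enum slotCl (slots m) t)) n := by
  have hvv : v ≠ v' := fun e => hv (congrArg Sigma.fst e)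
  have hne : ∀ p, (⟨v, p⟩ : Slot a) ≠ ⟨v', 0⟩ := fun p e => hvv (congrArg Sigma.fst e)
  refine Finset.prod_dvd_of_isRelPrime ?_ ?_
  · rintro ⟨p, p'⟩ - ⟨r, r'⟩ - hz
    refine isRelPrime_linear (hne p) (hne r) (wheelC_ne_zero ε v v' p') ?_ ?_
    · rintro ⟨h1, -, h2⟩
      have e1 : r = p := by simpa using h1
      have e2 := wheelC_injective ε v v' h2
      exact hz (Prod.ext e1.symm e2.symm)
    · rintro ⟨h1, -⟩
      exact hne r h1
  · rintro ⟨p, p'⟩ hz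
    simp only [Finset.mem_product, Finset.mem_range, Finset.mem_Ico] at hz
    have hfree : ∀ u : Slot a, u.1 ≠ v → substVar (⟨v, p⟩ : Slot a) ⟨v', 0⟩ (wheelC ε C v v' p')
        (freePt ε C v u) = MvPolynomial.C (ptC C ε u) * MvPolynomial.X ⟨u.1, 0⟩ := by
      intro u hu
      rw [freePt, if_neg hu, map_mul, substVar_X, if_neg (fun e => hu (congrArg Sigma.fst e)),
        ← MvPolynomial.algebraMap_eq, AlgHom.commutes]
    have h1 : substVar (⟨v, p⟩ : Slot a) ⟨v', 0⟩ (wheelC ε C v v' p') (freePt ε C v ⟨v, p⟩) =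
        MvPolynomial.C (wheelC ε C v v' p') * MvPolynomial.X ⟨v', 0⟩ := by
      rw [freePt, if_pos rfl, substVar_X, if_pos rfl]
    have hP : ∀ u, substVar (⟨v, p⟩ : Slot a) ⟨v', 0⟩ (wheelC ε C v v' p') (freePt ε C v u) ≠ 0 := by
      intro u
      by_cases hu : u.1 = v
      · by_cases hup : u = ⟨v, p⟩
        · rw [hup, h1]
          exact mul_ne_zero (MvPolynomial.C_ne_zero.2 (wheelC_ne_zero ε v v' p')) (MvPolynomial.X_ne_zero _)
        · rw [freePt, if_pos hu, substVar_X, if_neg hup]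
          exact MvPolynomial.X_ne_zero _
      · rw [hfree u hu]
        exact mul_ne_zero (MvPolynomial.C_ne_zero.2 (ptC_ne_zero ε u)) (MvPolynomial.X_ne_zero _)
    refine linear_dvd_of_ev_eq_zero O (wheelS_le_bigS O hF) hn _ (hne p) _ hP ?_
    have hinj := IsFractionRing.injective (MvPolynomial (Slot a) Fq) (Rat (Slot a))
    refine ev_eq_zero_of_string O ε hF m hv hc hz.1 hz.2.2 hz.2.1
      (y := algebraMap (MvPolynomial (Slot a) Fq) (Rat (Slot a)) (MvPolynomial.X ⟨v', 0⟩))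
      (fun u => (map_ne_zero_iff _ hinj).2 (hP u)) ?_ ?_
    · rw [h1, map_mul]
      rfl
    · intro r
      rw [hfree ⟨v', r⟩ hvv.symm, map_mul]
      rfl

include hF hn in
theorem prod_lin_dvd {v v' : V a} (hv : v.1 ≠ v'.1) (hc : C.c v'.1 v.1 ≠ 0) :
    ∏ z ∈ Finset.range (m v) ×ˢ Finset.Ico (-C.c v'.1 v.1).toNat (m v'),
      (MvPolynomial.X v -
        MvPolynomial.C (wheelC ε C v v' z.2 / ptC C ε ⟨v, z.1⟩) * MvPolynomial.X v') ∣
      MvPolynomial.aeval (fun t => linPt ε C (enum slotCl (slots m) t)) n := by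
  have hvv : v ≠ v' := fun e => hv (congrArg Sigma.fst e)
  let φ : MvPolynomial (Slot a) Fq →ₐ[Fq] MvPolynomial (V a) Fq :=
    MvPolynomial.aeval fun u => if u.1 = v then linPt ε C u else MvPolynomial.X u.1
  have hφC : ∀ c, φ (MvPolynomial.C c) = MvPolynomial.C c := fun c => by
    rw [← MvPolynomial.algebraMap_eq, AlgHom.commutes, MvPolynomial.algebraMap_eq]
  have hφ : ∀ u, φ (freePt ε C v u) = linPt ε C u := by
    intro u
    rw [freePt]
    split_ifs with hu
    · simp only [φ, MvPolynomial.aeval_X, if_pos hu]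
    · rw [map_mul, hφC]
      simp only [φ, MvPolynomial.aeval_X, if_neg hu]
      rfl
  have h := map_dvd φ (prod_free_dvd O ε hF hn hv hc)
  have e : φ (MvPolynomial.aeval (fun t => freePt ε C v (enum slotCl (slots m) t)) n) =
      MvPolynomial.aeval (fun t => linPt ε C (enum slotCl (slots m) t)) n := by
    rw [← AlgHom.comp_apply]
    congr 1
    ext t
    simp [hφ]
  rw [e, map_prod] at h
  refine (Finset.prod_dvd_prod_of_dvd _ _ fun z _ => ?_).trans h
  have e2 : φ (MvPolynomial.X (⟨v, z.1⟩ : Slot a) -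
      MvPolynomial.C (wheelC ε C v v' z.2) * MvPolynomial.X (⟨v', 0⟩ : Slot a)) =
      (MvPolynomial.X v - MvPolynomial.C (wheelC ε C v v' z.2 / ptC C ε ⟨v, z.1⟩) * MvPolynomial.X v') *
        MvPolynomial.C (ptC C ε ⟨v, z.1⟩) := by
    rw [map_sub, map_mul, hφC, sub_mul, mul_right_comm, ← MvPolynomial.C_mul,
      div_mul_cancel₀ _ (ptC_ne_zero ε _)]
    simp only [φ, MvPolynomial.aeval_X, if_true, if_neg hvv.symm, linPt]
    rw [mul_comm]
  rw [e2]
  exact dvd_mul_right _ _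

open Classical in
include hF hn in
theorem prod_edges_dvd :
    ∏ b ∈ Finset.univ.filter (fun b : V a × V a => arrE O ε b.2.1 b.1.1),
      ∏ z ∈ Finset.range (m b.1) ×ˢ Finset.Ico (-C.c b.2.1 b.1.1).toNat (m b.2),
      (MvPolynomial.X b.1 -
        MvPolynomial.C (wheelC ε C b.1 b.2 z.2 / ptC C ε ⟨b.1, z.1⟩) * MvPolynomial.X b.2) ∣
      MvPolynomial.aeval (fun t => linPt ε C (enum slotCl (slots m) t)) n := by
  have hne : ∀ b : V a × V a, arrE O ε b.2.1 b.1.1 → b.1 ≠ b.2 :=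
    fun b hb e => ne_of_arrE O ε hb (congrArg Sigma.fst e)
  refine Finset.prod_dvd_of_isRelPrime ?_ ?_
  · rintro b hb b' hb' hbb
    have hb := (Finset.mem_filter.1 hb).2
    have hb' := (Finset.mem_filter.1 hb').2
    refine IsRelPrime.prod_left fun z _ => IsRelPrime.prod_right fun z' _ =>
      isRelPrime_linear (hne b hb) (hne b' hb')
        (div_ne_zero (wheelC_ne_zero ε _ _ _) (ptC_ne_zero ε _)) ?_ ?_
    · rintro ⟨h1, h2, -⟩
      exact hbb (Prod.ext h1.symm h2.symm)
    · rintro ⟨h1, h2⟩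
      rw [h1, h2] at hb'
      cases ε <;> exact O.asymm _ _ hb hb'
  · rintro b hb
    have hb := (Finset.mem_filter.1 hb).2
    refine prod_lin_dvd O ε hF hn (ne_of_arrE O ε hb) ?_
    have h1 := c_ne_zero_of_arrE O ε hb
    intro h0
    have := C.symm b.1.1 b.2.1
    rw [h0, mul_zero] at this
    exact h1 ((mul_eq_zero.1 this).resolve_left (by exact_mod_cast (C.d_pos _).ne'))

theorem wheel_factor_eq (v v' : V a) (p p' : ℕ) :
    pt C ε ⟨v, p⟩ - qE ε C a v'.1 (-C.c v'.1 v.1) * pt C ε ⟨v', p'⟩ =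
      algebraMap Fq (K a) (ptC C ε ⟨v, p⟩) *
        (w v - algebraMap Fq (K a) (wheelC ε C v v' p' / ptC C ε ⟨v, p⟩) * w v') := by
  rw [pt_eq, pt_eq, mul_sub, ← mul_assoc (algebraMap Fq (K a) (ptC C ε ⟨v, p⟩)), ← map_mul,
    mul_div_cancel₀ _ (ptC_ne_zero ε _), qE, ← mul_assoc, ← map_mul]
  rfl

open Classical in
/-- The wheel conditions make the evaluations divisible by all the denominators that are not
cancelled otherwise. -/
theorem exists_ev_eq {F : T I} (hF : F ∈ wheelS O) (m : V a → ℕ) :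
    ∃ G ∈ laurent a, ev O slotCl (pt C ε) F (slots m) = G * ∏ u ∈ slots m, ∏ t,
      if arrE O ε t.1 u.1.1 then ∏ p ∈ Finset.Ico (-C.c t.1 u.1.1).toNat (m t),
        (pt C ε u - qE ε C a t.1 (-C.c t.1 u.1.1) * pt C ε ⟨t, p⟩) else 1 := by
  obtain ⟨n, s, hn⟩ := exists_monomial_mul (hF (cnt slotCl (slots m))).1.1
  obtain ⟨H, hH⟩ := prod_edges_dvd O ε hF hn
  let θ : MvPolynomial (V a) Fq →ₐ[Fq] K a := MvPolynomial.aeval w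
  have hθC : ∀ c, θ (MvPolynomial.C c) = algebraMap Fq (K a) c := fun c => MvPolynomial.aeval_C _ c
  have hθX : ∀ v, θ (MvPolynomial.X v) = w v := fun v => MvPolynomial.aeval_X _ v
  have hθ : ∀ f, θ f ∈ laurent a := by
    intro f
    induction f using MvPolynomial.induction_on with
    | C c => rw [hθC]; exact const_mem_laurent c
    | add f g hf hg => rw [map_add]; exact add_mem hf hg
    | mul_X f v hf => rw [map_mul, hθX]; exact mul_mem hf (w_mem_laurent v)
  have e1 : θ (MvPolynomial.aeval (fun t => linPt ε C (enum slotCl (slots m) t)) n) =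
      MvPolynomial.aeval (fun t => pt C ε (enum slotCl (slots m) t)) n := by
    rw [← AlgHom.comp_apply]
    congr 1
    ext t
    simp only [AlgHom.comp_apply, MvPolynomial.aeval_X, linPt, map_mul, hθC, hθX]
    exact (pt_eq C ε _).symm
  have e2 := numerator_eq O (wheelS_le_bigS O hF) hn (pt_ne_zero C ε)
  set M := MvPolynomial.aeval (fun t => pt C ε (enum slotCl (slots m) t)) (MvPolynomial.monomial s (1 : Fq))
    with hM
  have hM0 : M ≠ 0 := aeval_monomial_ne_zero (fun t => pt_ne_zero C ε _) s
  have hMi : M⁻¹ ∈ laurent a := by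
    rw [hM, MvPolynomial.aeval_monomial, map_one, one_mul, Finsupp.prod, ← Finset.prod_inv_distrib]
    refine prod_mem fun t _ => ?_
    rw [← inv_pow]
    exact pow_mem (pt_inv_mem_laurent ε _) _
  have e3 := congrArg θ hH
  rw [e1, e2, map_mul, map_prod] at e3
  simp only [map_prod, map_sub, map_mul, hθC, hθX] at e3
  let B : Fq := ∏ b ∈ Finset.univ.filter (fun b : V a × V a => arrE O ε b.2.1 b.1.1),
      ∏ z ∈ Finset.range (m b.1) ×ˢ Finset.Ico (-C.c b.2.1 b.1.1).toNat (m b.2), ptC C ε ⟨b.1, z.1⟩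
  have hB : B ≠ 0 := Finset.prod_ne_zero_iff.2 fun _ _ => Finset.prod_ne_zero_iff.2 fun _ _ =>
    ptC_ne_zero ε _
  have e4 : (∏ u ∈ slots m, ∏ t, if arrE O ε t.1 u.1.1 then
      ∏ p ∈ Finset.Ico (-C.c t.1 u.1.1).toNat (m t),
        (pt C ε u - qE ε C a t.1 (-C.c t.1 u.1.1) * pt C ε ⟨t, p⟩) else 1) =
      algebraMap Fq (K a) B * ∏ b ∈ Finset.univ.filter (fun b : V a × V a => arrE O ε b.2.1 b.1.1),
      ∏ z ∈ Finset.range (m b.1) ×ˢ Finset.Ico (-C.c b.2.1 b.1.1).toNat (m b.2),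
        (w b.1 - algebraMap Fq (K a) (wheelC ε C b.1 b.2 z.2 / ptC C ε ⟨b.1, z.1⟩) * w b.2) := by
    simp only [B, map_prod, ← Finset.prod_mul_distrib, ← wheel_factor_eq]
    rw [Finset.prod_filter, Fintype.prod_prod_type, slots, Finset.prod_sigma]
    refine Finset.prod_congr rfl fun v _ => ?_
    rw [Finset.prod_comm]
    refine Finset.prod_congr rfl fun t _ => ?_
    split_ifs
    · rw [Finset.prod_product]
    · simp
  refine ⟨algebraMap Fq (K a) B⁻¹ * θ H * M⁻¹,
    mul_mem (mul_mem (const_mem_laurent _) (hθ H)) hMi, ?_⟩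
  rw [e4, map_inv₀]
  refine mul_right_cancel₀ hM0 (e3.trans ?_)
  have hB' : algebraMap Fq (K a) B ≠ 0 := (map_ne_zero _).2 hB
  field_simp

theorem facE_eq {v t : V a} (ha : arrE O ε t.1 v.1) {n : ℕ} (hn : (n : ℤ) = -C.c t.1 v.1) (p : ℕ) :
    facE O ε v t (pt C ε ⟨v, p⟩) = x t ^ C.c t.1 v.1 * ∏ r ∈ Finset.range n,
      (pt C ε ⟨v, p⟩ - qE ε C a t.1 n * pt C ε ⟨t, r⟩) / pt C ε ⟨v, p⟩ := by
  have hQ : qE ε C a t.1 1 ≠ 0 := qE_ne_zero ε _ _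
  rw [facE, if_neg (ne_of_arrE O ε ha).symm, if_pos ha, ← hn, Int.toNat_natCast, edge_prod ε,
    ← Finset.prod_range_reflect]
  congr 1
  refine Finset.prod_congr rfl fun r hr => ?_
  have hr := Finset.mem_range.1 hr
  rw [sub_div, div_self (pt_ne_zero C ε _), pt_eq_qE ε t r, qE_zpow ε t.1 n, ← mul_assoc,
    ← zpow_add₀ hQ, mul_comm (pt C ε ⟨t, 0⟩)]
  congr 4
  have : ((n - 1 - r : ℕ) : ℤ) = n - 1 - r := by omega
  rw [this]
  ring

theorem cancel_denominators {v t : V a} (ha : arrE O ε t.1 v.1) (p M : ℕ) :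
    facE O ε v t (pt C ε ⟨v, p⟩) * (∏ r ∈ Finset.range M, (kapE O ε ⟨v, p⟩ ⟨t, r⟩)⁻¹) *
      ∏ r ∈ Finset.Ico (-C.c t.1 v.1).toNat M,
        (pt C ε ⟨v, p⟩ - qE ε C a t.1 (-C.c t.1 v.1) * pt C ε ⟨t, r⟩) ∈ laurent a := by
  have hneg := C.c_offDiag _ _ (ne_of_arrE O ε ha).symm
  obtain ⟨n, hn⟩ := Int.eq_ofNat_of_zero_le (neg_nonneg.2 hneg)
  rw [facE_eq O ε ha hn.symm, hn, Int.toNat_natCast]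
  set δ : ℕ → K a := fun r => pt C ε ⟨v, p⟩ - qE ε C a t.1 n * pt C ε ⟨t, r⟩ with hδ
  have hvt : v ≠ t := fun e => ne_of_arrE O ε ha (congrArg Sigma.fst e).symm.symm
  have hδ0 : ∀ r, δ r ≠ 0 := fun r => pt_sub_ne_zero ε (u := ⟨v, p⟩) (u' := ⟨t, r⟩) hvt _
  have hδL : ∀ r, δ r ∈ laurent a := fun r =>
    sub_mem (pt_mem_laurent ε _) (mul_mem (const_mem_laurent _) (pt_mem_laurent ε _))
  choose c hc hκ using fun r => kapE_of_arrE O ε (u := ⟨v, p⟩) (u' := ⟨t, r⟩) ha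
  have hκ' : ∀ r, (kapE O ε (⟨v, p⟩ : Slot a) ⟨t, r⟩)⁻¹ = algebraMap Fq (K a) (c r)⁻¹ * (δ r)⁻¹ := by
    intro r
    rw [hκ, mul_inv, map_inv₀, hδ]
    simp only [hn]
  have hcancel : (∏ r ∈ Finset.range n, δ r) * (∏ r ∈ Finset.range M, (δ r)⁻¹) *
      (∏ r ∈ Finset.Ico n M, δ r) ∈ laurent a := by
    have h0 : ∀ s : Finset ℕ, ∏ r ∈ s, δ r ≠ 0 := fun s => Finset.prod_ne_zero_iff.2 fun r _ => hδ0 r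
    rw [Finset.prod_inv_distrib]
    rcases le_total M n with h | h
    · rw [Finset.Ico_eq_empty_of_le h, Finset.prod_empty, mul_one, ← Finset.prod_range_mul_prod_Ico δ h,
        mul_right_comm, mul_inv_cancel₀ (h0 _), one_mul]
      exact prod_mem fun r _ => hδL r
    · rw [mul_right_comm, Finset.prod_range_mul_prod_Ico δ h, mul_inv_cancel₀ (h0 _)]
      exact one_mem _
  have e : x t ^ C.c t.1 v.1 * (∏ r ∈ Finset.range n, δ r / pt C ε ⟨v, p⟩) *
      (∏ r ∈ Finset.range M, (kapE O ε ⟨v, p⟩ ⟨t, r⟩)⁻¹) * ∏ r ∈ Finset.Ico n M, δ r =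
      x t ^ C.c t.1 v.1 * (pt C ε ⟨v, p⟩)⁻¹ ^ n * algebraMap Fq (K a) (∏ r ∈ Finset.range M, (c r)⁻¹) *
      ((∏ r ∈ Finset.range n, δ r) * (∏ r ∈ Finset.range M, (δ r)⁻¹) * (∏ r ∈ Finset.Ico n M, δ r)) := by
    simp only [hκ', Finset.prod_mul_distrib, div_eq_mul_inv, map_prod, Finset.prod_const,
      Finset.card_range]
    ring
  rw [e]
  exact mul_mem (mul_mem (mul_mem (x_zpow_mem_laurent t _) (pow_mem (pt_inv_mem_laurent ε _) n))
    (const_mem_laurent _)) hcancel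

variable {N : ℕ} (col : Fin N → I) (z : Fin N → ℂ)

theorem phiC_mem_of_wheel {F : T I} (hF : F ∈ wheelS O) (m : V a → ℕ) :
    phiC O col z ε F m ∈ coefRing C a fun v u => v ≠ u ∧ v.1 = u.1 := by
  classical
  obtain ⟨A, hA, e⟩ := exists_coefE_eq O col z ε (P := fun v u => v ≠ u ∧ v.1 = u.1)
    (fun _ _ h h' => ⟨h, h'⟩) m
  obtain ⟨G, hG, e'⟩ := exists_ev_eq O ε hF m
  rw [phiC, e, e', mul_mul_mul_comm]
  refine mul_mem (mul_mem hA (laurent_le_coefRing hG)) (laurent_le_coefRing ?_)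
  simp only [← Finset.prod_mul_distrib]
  refine prod_mem fun u _ => prod_mem fun t _ => ?_
  split_ifs with h
  · exact cancel_denominators O ε h u.2 (m t)
  · rw [mul_one]
    exact one_mem _

theorem phiLin_mem_Atilde {F : T I} (hF : F ∈ wheelS O) : phiLin O col z ε F ∈ Atilde C a :=
  phiLin_mem O col z ε (wheelS_le_bigS O) (fun _ hF k => of_mem_wheelS O (hF k))
    diffGens_subset_Atilde (fun _ hF m => mulOp_mem_Atilde (phiC_mem_of_wheel O ε col z hF m)) hF

end Wheel

end

section

/-! ### Injectivity in bounded degrees -/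

section Injectivity

variable {I : Type*} [Fintype I] [DecidableEq I] {C : CartanDatum I} (O : DynOrientation C)
  {a : I → ℕ} {N : ℕ} (col : Fin N → I) (z : Fin N → ℂ) (ε : Bool)

theorem shiftE_injective : Function.Injective (shiftE C ε (a := a)) := by
  intro m n h
  have h1 : (fun v => -sg ε * (m v : ℤ)) = fun v => -sg ε * (n v : ℤ) := h
  funext v
  have h2 := congrFun h1 v
  cases ε <;> simpa [sg] using h2

theorem phiC_zero (m : V a → ℕ) : phiC O col z ε 0 m = 0 := by rw [phiC, ev_zero, mul_zero]

theorem phiC_add {F G : T I} (hF : F ∈ bigS O) (hG : G ∈ bigS O) (m : V a → ℕ) :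
    phiC O col z ε (F + G) m = phiC O col z ε F m + phiC O col z ε G m := by
  rw [phiC, phiC, phiC, ev_add O (pt_ne_zero C ε) hF hG, mul_add]

theorem coeff_phiE (k : I → ℕ) (F : T I) (m : V a → ℕ) :
    (phiE O col z ε k F).coeff (shiftE C ε m) = if slotDeg m = k then phiC O col z ε F m else 0 := by
  classical
  have h : ∀ s : Finset (V a → ℕ), (∑ m' ∈ s, (SkewMonoidAlgebra.single (shiftE C ε m')
      (phiC O col z ε F m') : Diff C a)).coeff (shiftE C ε m) = if m ∈ s then phiC O col z ε F m else 0 := by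
    intro s
    induction s using Finset.induction_on with
    | empty => simp
    | insert n s hn ih =>
      rw [Finset.sum_insert hn, SkewMonoidAlgebra.coeff_add, Finsupp.add_apply, ih,
        SkewMonoidAlgebra.coeff_single_apply]
      simp only [(shiftE_injective (C := C) ε).eq_iff, Finset.mem_insert]
      by_cases hnm : n = m
      · subst hnm
        simp [hn]
      · simp [hnm, Ne.symm hnm]
  rw [phiE, h]
  simp only [mem_comps]

theorem coeff_phiLin {F : T I} (hF : F ∈ bigS O) (m : V a → ℕ) :
    (phiLin O col z ε F).coeff (shiftE C ε m) = phiC O col z ε F m := by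
  refine bigS_induction O (P := fun F => (phiLin O col z ε F).coeff (shiftE C ε m) = phiC O col z ε F m)
    ?_ ?_ ?_ hF
  · rw [map_zero, phiC_zero]
    rfl
  · intro k F hF
    rw [phiLin_of O col z ε hF, coeff_phiE]
    split_ifs with h
    · rfl
    · rw [phiC, ev_of_ne O F (by rwa [cnt_slots]), mul_zero]
  · intro F hF G hG h h'
    rw [map_add, SkewMonoidAlgebra.coeff_add, Finsupp.add_apply, h, h', phiC_add O col z ε hF hG]

theorem pt_ne_const (u : Slot a) (c : Fq) : pt C ε u ≠ algebraMap Fq (K a) c := by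
  intro h
  have hinj := IsFractionRing.injective (MvPolynomial (V a) Fq) (K a)
  rw [pt_eq] at h
  have h' : MvPolynomial.C (ptC C ε u) * MvPolynomial.X u.1 ^ 2 = MvPolynomial.C c := by
    apply hinj
    rw [map_mul, map_pow]
    exact h
  rw [MvPolynomial.C_mul_X_pow_eq_monomial, MvPolynomial.C_apply,
    MvPolynomial.monomial_eq_monomial_iff] at h'
  rcases h' with ⟨h1, -⟩ | ⟨h1, -⟩
  · have := congrArg (fun f => f u.1) h1
    simp at this
  · exact ptC_ne_zero ε u h1

theorem ptE_ne_zero (u : Slot a) : ptE O col z ε u.1 (pt C ε u) ≠ 0 := by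
  rw [ptE_eq]
  have hpt := pt_ne_zero C ε u
  refine mul_ne_zero (mul_ne_zero ((map_ne_zero _).2 ?_) ?_) (Finset.prod_ne_zero_iff.2 fun t _ => ?_)
  · rw [conE]
    have h1 := qi_sub_inv_ne_zero (C := C) u.1.1
    split_ifs
    · exact one_div_ne_zero h1
    · refine one_div_ne_zero fun h => h1 ?_
      have h3 := qi_ne_zero C u.1.1
      field_simp
      linear_combination -h
  · split_ifs
    · refine Finset.prod_ne_zero_iff.2 fun s _ => ?_
      rw [one_sub_div hpt]
      exact div_ne_zero (sub_ne_zero.2 (pt_ne_const ε u _)) hpt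
    · exact one_ne_zero
  · rw [facE]
    split_ifs with h1 h2 h3
    · exact mul_ne_zero (zpow_ne_zero _ (x_ne_zero t)) one_ne_zero
    · refine mul_ne_zero (zpow_ne_zero _ (x_ne_zero t)) (inv_ne_zero ?_)
      rw [one_sub_div hpt]
      have := pt_sub_ne_zero (C := C) ε (u := u) (u' := ⟨t, 0⟩) (Ne.symm h2) 1
      rw [map_one, one_mul] at this
      exact div_ne_zero this hpt
    · refine mul_ne_zero (zpow_ne_zero _ (x_ne_zero t)) (Finset.prod_ne_zero_iff.2 fun p _ => ?_)
      have hq := algebraMap_qi_zpow_ne_zero (C := C) (E := K a) t.1 (-C.c t.1 u.1.1 - 2 * (p : ℤ))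
      rw [one_sub_div (mul_ne_zero hq hpt)]
      refine div_ne_zero (sub_ne_zero.2 fun e => ?_) (mul_ne_zero hq hpt)
      rw [pt_eq, ← mul_assoc, ← map_mul] at e
      have e' := e.symm
      rw [← one_mul (w t), ← map_one (algebraMap Fq (K a))] at e'
      exact h1 (congrArg Sigma.fst (mul_w_eq one_ne_zero e').1)
    · exact one_ne_zero

theorem pairE_ne_zero (u u' : Slot a) : pairE O ε u u' ≠ 0 := by
  classical
  rw [pairE]
  split_ifs with h1 h2 h3 h4
  · exact mul_ne_zero (algebraMap_qi_zpow_ne_zero _ _) (inv_ne_zero (kapE_self_ne_zero O ε h1 h2))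
  · exact one_ne_zero
  · exact mul_ne_zero (algebraMap_qi_zpow_ne_zero _ _) (inv_ne_zero (kapE_ne_zero O ε h1))
  · exact inv_ne_zero (kapE_ne_zero O ε h1)
  · exact one_ne_zero

theorem coefE_ne_zero (m : V a → ℕ) : coefE O col z ε m ≠ 0 :=
  mul_ne_zero (Finset.prod_ne_zero_iff.2 fun u _ => ptE_ne_zero O col z ε u)
    (Finset.prod_ne_zero_iff.2 fun u _ => Finset.prod_ne_zero_iff.2 fun u' _ => pairE_ne_zero O ε u u')

theorem algebraicIndependent_pt : AlgebraicIndependent Fq fun v : V a => pt C ε ⟨v, 0⟩ := by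
  have h1 : AlgebraicIndependent Fq (x : V a → K a) := by
    have hX := MvPolynomial.algebraicIndependent_X (V a) Fq
    exact hX.map' (f := IsScalarTower.toAlgHom Fq (MvPolynomial (V a) Fq) (K a))
      (IsFractionRing.injective (MvPolynomial (V a) Fq) (K a))
  have h2 := h1.polynomial_aeval_of_transcendental
    (f := fun v => Polynomial.C (ptC C ε ⟨v, 0⟩) * Polynomial.X ^ 2) fun v => by
      apply Polynomial.transcendental
      · rw [Polynomial.natDegree_C_mul_X_pow _ _ (ptC_ne_zero ε _)]
        norm_num
      · rw [Polynomial.leadingCoeff_C_mul_X_pow]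
        exact mem_nonZeroDivisors_of_ne_zero (ptC_ne_zero ε _)
  convert h2 using 2 with v
  rw [pt_eq, map_mul, map_pow, Polynomial.aeval_X, Polynomial.aeval_C]
  rfl

theorem eq_zero_of_phiLin_eq_zero {F : T I} (hF : F ∈ bigS O) (h0 : phiLin O col z ε (a := a) F = 0)
    {k : I → ℕ} (hk : k ≤ a) : F k = 0 := by
  let m : V a → ℕ := fun v => if (v.2 : ℕ) < k v.1 then 1 else 0
  have hm : cnt slotCl (slots m) = k := by
    rw [cnt_slots]
    funext i
    simp only [slotDeg, m]
    rw [Finset.sum_boole, Fin.card_filter_val_lt]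
    simpa using hk i
  have h1 : phiC O col z ε F m = 0 := by
    rw [← coeff_phiLin O col z ε hF, h0]
    rfl
  have h2 : ev O slotCl (pt C ε) F (slots m) = 0 :=
    (mul_eq_zero.1 h1).resolve_left (coefE_ne_zero O col z ε m)
  obtain ⟨n, s, hn⟩ := exists_monomial_mul (hF (cnt slotCl (slots m))).1
  have h3 := numerator_eq O hF hn (pt_ne_zero C ε)
  rw [h2, zero_mul] at h3
  have he := isEnum_enum slotCl (slots m)
  have hz : ∀ t, enum slotCl (slots m) t = ⟨(enum slotCl (slots m) t).1, 0⟩ := by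
    intro t
    have := mem_slots.1 ((he.mem _).2 ⟨t, rfl⟩)
    refine Sigma.ext rfl (heq_of_eq ?_)
    change (enum slotCl (slots m) t).2 = 0
    have h1 : m (enum slotCl (slots m) t).1 ≤ 1 := by
      simp only [m]
      split_ifs <;> omega
    omega
  have hg : Function.Injective fun t => (enum slotCl (slots m) t).1 := by
    intro t t' h
    refine he.inj ?_
    rw [hz t, hz t']
    exact congrArg (fun v => (⟨v, 0⟩ : Slot a)) h
  have h4 : n = 0 := by
    refine ((algebraicIndependent_pt (C := C) (a := a) ε).comp _ hg).eq_zero_of_aeval_eq_zero n ?_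
    rw [← h3]
    congr 2
    funext t
    rw [hz t]
    rfl
  rw [h4, map_zero] at hn
  rcases mul_eq_zero.1 hn with h5 | h5
  · rw [← hm]
    exact (mul_eq_zero.1 h5).resolve_right (poleDen_ne_zero O _)
  · rw [map_eq_zero_iff _ (IsFractionRing.injective _ _), MvPolynomial.monomial_eq_zero] at h5
    exact absurd h5 one_ne_zero

end Injectivity

end

section

/-! ### Expansions of rational functions as Laurent series -/

section Expansion

variable {k : Type*} [Field k]

theorem algebraMap_laurentSeries (c : k) : algebraMap k (LaurentSeries k) c = HahnSeries.C c := by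
  rw [HahnSeries.algebraMap_apply', PowerSeries.algebraMap_apply, HahnSeries.ofPowerSeries_C]
  rfl

theorem coeff_algebraMap_mul (c : k) (F : LaurentSeries k) (n : ℤ) :
    (algebraMap k (LaurentSeries k) c * F).coeff n = c * F.coeff n := by
  rw [algebraMap_laurentSeries, HahnSeries.C_apply, HahnSeries.coeff_single_mul, sub_zero]

theorem single_ne_zero' (n : ℤ) : (HahnSeries.single n 1 : LaurentSeries k) ≠ 0 :=
  HahnSeries.single_ne_zero one_ne_zero

theorem inv_single_one (n : ℤ) :
    (HahnSeries.single n 1 : LaurentSeries k)⁻¹ = HahnSeries.single (-n) 1 := by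
  refine inv_eq_of_mul_eq_one_right ?_
  rw [HahnSeries.single_mul_single, add_neg_cancel, one_mul]
  rfl

/-- The action of an endomorphism of the field of coefficients on Laurent series. -/
def lmap (σ : k →+* k) : LaurentSeries k →+* LaurentSeries k where
  toFun F := F.map σ
  map_one' := HahnSeries.map_one (σ.toMonoidWithZeroHom)
  map_mul' _ _ := HahnSeries.map_mul σ.toNonUnitalRingHom
  map_zero' := HahnSeries.map_zero (σ : ZeroHom k k)
  map_add' _ _ := HahnSeries.map_add (σ : k →+ k)

theorem coeff_lmap (σ : k →+* k) (F : LaurentSeries k) (n : ℤ) :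
    (lmap σ F).coeff n = σ (F.coeff n) := rfl

theorem lmap_single (σ : k →+* k) (n : ℤ) :
    lmap σ (HahnSeries.single n 1) = HahnSeries.single n 1 := by
  refine (HahnSeries.map_single (Γ := ℤ) (a := n) (r := (1 : k)) (σ : ZeroHom k k)).trans ?_
  congr 1
  exact map_one σ

theorem lmap_algebraMap (σ : k →+* k) (c : k) :
    lmap σ (algebraMap k (LaurentSeries k) c) = algebraMap k (LaurentSeries k) (σ c) := by
  rw [algebraMap_laurentSeries, algebraMap_laurentSeries]
  exact HahnSeries.map_C c σ

/-- The geometric series. -/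
def geom (b : k) : LaurentSeries k := HahnSeries.ofPowerSeries ℤ k (PowerSeries.mk fun n => b ^ n)

theorem geom_mul (b : k) :
    geom b * (1 - algebraMap k (LaurentSeries k) b * HahnSeries.single 1 1) = 1 := by
  have h : (PowerSeries.mk fun n => b ^ n) * (1 - PowerSeries.C b * PowerSeries.X) = (1 : PowerSeries k) := by
    ext n
    cases n with
    | zero => simp [mul_sub]
    | succ n =>
      rw [mul_sub, mul_one, ← mul_assoc, map_sub, PowerSeries.coeff_succ_mul_X, PowerSeries.coeff_mul_C,
        PowerSeries.coeff_mk, PowerSeries.coeff_mk, PowerSeries.coeff_one, if_neg n.succ_ne_zero, pow_succ,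
        sub_self]
  rw [geom, algebraMap_laurentSeries, ← HahnSeries.ofPowerSeries_C, ← HahnSeries.ofPowerSeries_X,
    ← map_mul, ← map_one (HahnSeries.ofPowerSeries ℤ k), ← map_sub, ← map_mul, h]

theorem coeff_ofPowerSeries (H : PowerSeries k) (n : ℤ) :
    (HahnSeries.ofPowerSeries ℤ k H).coeff n = if 0 ≤ n then PowerSeries.coeff n.toNat H else 0 := by
  split_ifs with h
  · obtain ⟨m, rfl⟩ := Int.eq_ofNat_of_zero_le h
    exact HahnSeries.ofPowerSeries_apply_coeff H m
  · rw [HahnSeries.ofPowerSeries_apply]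
    refine HahnSeries.embDomain_of_notMem_range ?_
    rintro ⟨m, hm⟩
    exact h (by rw [← hm]; exact Int.natCast_nonneg m)

theorem one_sub_single_neg {b : k} (hb : b ≠ 0) :
    (1 : LaurentSeries k) - algebraMap k (LaurentSeries k) b * HahnSeries.single (-1) 1 =
      algebraMap k (LaurentSeries k) (-b) * HahnSeries.single (-1) 1 *
        (1 - algebraMap k (LaurentSeries k) b⁻¹ * HahnSeries.single 1 1) := by
  have h : (HahnSeries.single (-1) 1 : LaurentSeries k) * HahnSeries.single 1 1 = 1 := by
    rw [HahnSeries.single_mul_single, neg_add_cancel, one_mul]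
    rfl
  have h' : algebraMap k (LaurentSeries k) b * algebraMap k (LaurentSeries k) b⁻¹ = 1 := by
    rw [← map_mul, mul_inv_cancel₀ hb, map_one]
  rw [map_neg]
  linear_combination (-1 : LaurentSeries k) * h' -
    algebraMap k (LaurentSeries k) b * algebraMap k (LaurentSeries k) b⁻¹ * h

theorem one_sub_single_ne_zero (s : Bool) {b : k} (hb : b ≠ 0) :
    (1 : LaurentSeries k) - algebraMap k (LaurentSeries k) b * HahnSeries.single (sg s) 1 ≠ 0 := by
  cases s
  · change (1 : LaurentSeries k) - algebraMap k (LaurentSeries k) b * HahnSeries.single (-1) 1 ≠ 0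
    rw [one_sub_single_neg hb]
    refine mul_ne_zero (mul_ne_zero ?_ (single_ne_zero' _)) (right_ne_zero_of_mul_eq_one (geom_mul _))
    simpa using hb
  · exact right_ne_zero_of_mul_eq_one (geom_mul _)

theorem coeff_inv_sub_coeff_inv {b : k} (hb : b ≠ 0) (t : ℤ) :
    ((1 - algebraMap k (LaurentSeries k) b * HahnSeries.single (sg true) 1)⁻¹).coeff t -
      ((1 - algebraMap k (LaurentSeries k) b * HahnSeries.single (sg false) 1)⁻¹).coeff (-t) = b ^ t := by
  have h1 : (1 - algebraMap k (LaurentSeries k) b * HahnSeries.single (sg true) 1)⁻¹ = geom b :=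
    inv_eq_of_mul_eq_one_left (geom_mul b)
  have h2 : (1 - algebraMap k (LaurentSeries k) b * HahnSeries.single (sg false) 1)⁻¹ =
      algebraMap k (LaurentSeries k) (-b)⁻¹ * (HahnSeries.single 1 1 * geom b⁻¹) := by
    change (1 - algebraMap k (LaurentSeries k) b * HahnSeries.single (-1) 1)⁻¹ = _
    rw [one_sub_single_neg hb, mul_inv, mul_inv, inv_single_one, neg_neg,
      inv_eq_of_mul_eq_one_left (geom_mul b⁻¹), mul_assoc, map_inv₀]
  rw [h1, h2, coeff_algebraMap_mul, HahnSeries.coeff_single_mul, one_mul, geom, geom, coeff_ofPowerSeries,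
    coeff_ofPowerSeries]
  by_cases ht : 0 ≤ t
  · rw [if_pos ht, if_neg (by omega), mul_zero, sub_zero, PowerSeries.coeff_mk, ← zpow_natCast,
      Int.toNat_of_nonneg ht]
  · rw [if_neg ht, if_pos (by omega), PowerSeries.coeff_mk, ← zpow_natCast,
      Int.toNat_of_nonneg (by omega), inv_zpow', inv_neg, neg_mul, zero_sub, neg_neg, ← zpow_neg_one,
      ← zpow_add₀ hb]
    congr 1
    ring

theorem coeff_aeval_single (s : Bool) (Q : Polynomial k) (t : ℤ) :
    (Polynomial.aeval (HahnSeries.single (sg s) 1 : LaurentSeries k) Q).coeff (sg s * t) =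
      if 0 ≤ t then Q.coeff t.toNat else 0 := by
  have hp (n : ℕ) : (HahnSeries.single (sg s) 1 : LaurentSeries k) ^ n = HahnSeries.single (sg s * n) 1 := by
    rw [HahnSeries.single_pow, one_pow, nsmul_eq_mul, mul_comm]
  have hs : sg s ≠ 0 := by cases s <;> simp [sg]
  induction Q using Polynomial.induction_on' with
  | add P Q hP hQ =>
    rw [map_add, HahnSeries.coeff_add, hP, hQ]
    split_ifs <;> simp
  | monomial n c =>
    rw [Polynomial.aeval_monomial, coeff_algebraMap_mul, hp]
    by_cases h : t = n
    · subst h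
      simp
    · rw [HahnSeries.coeff_single_of_ne (fun e => h (mul_left_cancel₀ hs e)), mul_zero]
      split_ifs with h0
      · rw [Polynomial.coeff_monomial, if_neg (by omega)]
      · rfl

theorem partial_fractions {ι : Type*} [Fintype ι] [DecidableEq ι] (Q : Polynomial k) {b : ι → k}
    (hb : Function.Injective b) (h0 : ∀ j, b j ≠ 0) : ∃ Q₀ : Polynomial k,
      Q = Q₀ * ∏ j, (1 - Polynomial.C (b j) * Polynomial.X) +
        ∑ j, Polynomial.C (Q.eval (b j)⁻¹ / ∏ j' ∈ Finset.univ.erase j, (1 - b j' / b j)) *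
          ∏ j' ∈ Finset.univ.erase j, (1 - Polynomial.C (b j') * Polynomial.X) := by
  have hd : ∏ j, (1 - Polynomial.C (b j) * Polynomial.X) ∣ Q -
      ∑ j, Polynomial.C (Q.eval (b j)⁻¹ / ∏ j' ∈ Finset.univ.erase j, (1 - b j' / b j)) *
          ∏ j' ∈ Finset.univ.erase j, (1 - Polynomial.C (b j') * Polynomial.X) := by
    have hfac : ∀ j, (1 : Polynomial k) - Polynomial.C (b j) * Polynomial.X =
        Polynomial.C (-b j) * (Polynomial.X - Polynomial.C (b j)⁻¹) := by
      intro j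
      rw [mul_sub, ← Polynomial.C_mul, neg_mul, mul_inv_cancel₀ (h0 j)]
      simp
      ring
    refine Finset.prod_dvd_of_coprime ?_ fun j _ => ?_
    · intro j _ j' _ hjj
      simp only [Function.onFun]
      rw [hfac, hfac]
      refine (isCoprime_mul_unit_left_left (Polynomial.isUnit_C.2 (neg_ne_zero.2 (h0 j)).isUnit) _ _).2
        ((isCoprime_mul_unit_left_right (Polynomial.isUnit_C.2 (neg_ne_zero.2 (h0 j')).isUnit) _ _).2 ?_)
      exact Polynomial.isCoprime_X_sub_C_of_isUnit_sub
        (sub_ne_zero.2 fun e => hjj (hb (inv_injective e))).isUnit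
    · rw [hfac]
      refine (Polynomial.isUnit_C.2 (neg_ne_zero.2 (h0 j)).isUnit).mul_left_dvd.2 (Polynomial.dvd_iff_isRoot.2 ?_)
      rw [Polynomial.IsRoot, Polynomial.eval_sub, Polynomial.eval_finsetSum, Finset.sum_eq_single j, sub_eq_zero]
      · have hne : ∏ j' ∈ Finset.univ.erase j, (1 - b j' / b j) ≠ 0 := by
          refine Finset.prod_ne_zero_iff.2 fun j' hj' => ?_
          rw [sub_ne_zero, ne_comm, Ne, div_eq_one_iff_eq (h0 j)]
          exact fun e => (Finset.mem_erase.1 hj').1 (hb e)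
        rw [Polynomial.eval_mul, Polynomial.eval_C, Polynomial.eval_prod]
        simp only [Polynomial.eval_sub, Polynomial.eval_one, Polynomial.eval_mul, Polynomial.eval_C,
          Polynomial.eval_X, ← div_eq_mul_inv]
        rw [div_mul_cancel₀ _ hne]
      · intro j' _ hjj
        have h : ∏ i ∈ Finset.univ.erase j', Polynomial.eval (b j)⁻¹
            (1 - Polynomial.C (b i) * Polynomial.X) = 0 :=
          Finset.prod_eq_zero (Finset.mem_erase.2 ⟨hjj.symm, Finset.mem_univ j⟩) (by simp [h0 j])
        rw [Polynomial.eval_mul, Polynomial.eval_prod, h, mul_zero]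
      · simp
  obtain ⟨Q₀, h⟩ := hd
  exact ⟨Q₀, by rw [mul_comm, ← h, sub_add_cancel]⟩

/-- The difference of the two expansions of a rational function is the sum of the delta functions
at its poles. -/
theorem coeff_expansion_sub {ι : Type*} [Fintype ι] [DecidableEq ι] (Q : Polynomial k) {b : ι → k}
    (hb : Function.Injective b) (h0 : ∀ j, b j ≠ 0) (R : Bool → LaurentSeries k)
    (hR : ∀ s, R s = Polynomial.aeval (HahnSeries.single (sg s) 1 : LaurentSeries k) Q /
      ∏ j, (1 - algebraMap k (LaurentSeries k) (b j) * HahnSeries.single (sg s) 1)) (t : ℤ) :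
    (R true).coeff t - (R false).coeff (-t) =
      ∑ j, Q.eval (b j)⁻¹ / (∏ j' ∈ Finset.univ.erase j, (1 - b j' / b j)) * b j ^ t := by
  obtain ⟨Q₀, hQ⟩ := partial_fractions Q hb h0
  set α : ι → k := fun j => Q.eval (b j)⁻¹ / ∏ j' ∈ Finset.univ.erase j, (1 - b j' / b j) with hα
  have key (s : Bool) : R s = Polynomial.aeval (HahnSeries.single (sg s) 1 : LaurentSeries k) Q₀ +
      ∑ j, algebraMap k (LaurentSeries k) (α j) *
        (1 - algebraMap k (LaurentSeries k) (b j) * HahnSeries.single (sg s) 1)⁻¹ := by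
    have hne : ∏ j, (1 - algebraMap k (LaurentSeries k) (b j) * HahnSeries.single (sg s) 1) ≠ 0 :=
      Finset.prod_ne_zero_iff.2 fun j _ => one_sub_single_ne_zero s (h0 j)
    rw [hR, div_eq_iff hne, hQ, map_add, map_mul, map_prod, map_sum, add_mul, Finset.sum_mul]
    simp only [map_sub, map_one, map_mul, map_prod, Polynomial.aeval_C, Polynomial.aeval_X]
    congr 1
    refine Finset.sum_congr rfl fun j _ => ?_
    rw [← Finset.mul_prod_erase Finset.univ _ (Finset.mem_univ j), mul_assoc,
      inv_mul_cancel_left₀ (one_sub_single_ne_zero s (h0 j))]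
  have hc (s : Bool) : (R s).coeff (sg s * t) = (if 0 ≤ t then Q₀.coeff t.toNat else 0) +
      ∑ j, α j * ((1 - algebraMap k (LaurentSeries k) (b j) * HahnSeries.single (sg s) 1)⁻¹).coeff
        (sg s * t) := by
    rw [key, HahnSeries.coeff_add, coeff_aeval_single, HahnSeries.coeff_sum]
    simp only [coeff_algebraMap_mul]
  have h1 := hc true
  have h2 := hc false
  rw [show sg true * t = t by simp [sg]] at h1
  rw [show sg false * t = -t by simp [sg]] at h2
  rw [h1, h2, add_sub_add_left_eq_sub, ← Finset.sum_sub_distrib]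
  refine Finset.sum_congr rfl fun j _ => ?_
  rw [← mul_sub, coeff_inv_sub_coeff_inv (h0 j)]

/-! ### Laurent series with leading coefficient a unit of a subring -/

variable {R : Type*} [CommRing R] [Algebra R k]

variable (R) in
/-- Laurent series with coefficients in a subring and lowest term `c u ^ n`, `c` a unit of the
subring. -/
def HasLead (F : LaurentSeries k) (n : ℤ) : Prop := ∃ (c : Rˣ) (H : PowerSeries R),
  PowerSeries.constantCoeff H = 1 ∧ F = algebraMap k (LaurentSeries k) (algebraMap R k c) *
    HahnSeries.single n 1 * HahnSeries.ofPowerSeries ℤ k (PowerSeries.map (algebraMap R k) H)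

theorem HasLead.mul {F G : LaurentSeries k} {m n : ℤ} (hF : HasLead R F m) (hG : HasLead R G n) :
    HasLead R (F * G) (m + n) := by
  obtain ⟨c, H, hH, rfl⟩ := hF
  obtain ⟨c', H', hH', rfl⟩ := hG
  refine ⟨c * c', H * H', by rw [map_mul, hH, hH', one_mul], ?_⟩
  have e : (HahnSeries.single (m + n) 1 : LaurentSeries k) = HahnSeries.single m 1 * HahnSeries.single n 1 := by
    rw [HahnSeries.single_mul_single, one_mul]
  rw [e, Units.val_mul, map_mul, map_mul, map_mul, map_mul]
  ring

theorem HasLead.inv {F : LaurentSeries k} {n : ℤ} (hF : HasLead R F n) : HasLead R F⁻¹ (-n) := by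
  obtain ⟨c, H, hH, rfl⟩ := hF
  refine ⟨c⁻¹, PowerSeries.invOfUnit H 1, by simp, ?_⟩
  have h1 : H * PowerSeries.invOfUnit H 1 = 1 := PowerSeries.mul_invOfUnit H 1 (by rw [hH]; rfl)
  have h2 : HahnSeries.ofPowerSeries ℤ k (PowerSeries.map (algebraMap R k) H) *
      HahnSeries.ofPowerSeries ℤ k (PowerSeries.map (algebraMap R k) (PowerSeries.invOfUnit H 1)) = 1 := by
    rw [← map_mul, ← map_mul, h1, map_one, map_one]
  have h3 : algebraMap k (LaurentSeries k) (algebraMap R k c) *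
      algebraMap k (LaurentSeries k) (algebraMap R k (c⁻¹ : Rˣ)) = 1 := by
    rw [← map_mul, ← map_mul, Units.mul_inv, map_one, map_one]
  rw [mul_inv, mul_inv, inv_single_one, inv_eq_of_mul_eq_one_right h2, inv_eq_of_mul_eq_one_right h3]

theorem HasLead.div {F G : LaurentSeries k} {m n : ℤ} (hF : HasLead R F m) (hG : HasLead R G n) :
    HasLead R (F / G) (m - n) := by
  rw [div_eq_mul_inv, sub_eq_add_neg]
  exact hF.mul hG.inv

theorem HasLead.of_unit (c : Rˣ) : HasLead R (algebraMap k (LaurentSeries k) (algebraMap R k c)) 0 :=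
  ⟨c, 1, map_one _, by
    rw [show (HahnSeries.single 0 1 : LaurentSeries k) = 1 from rfl, map_one, map_one, mul_one, mul_one]⟩

theorem HasLead.one : HasLead R (1 : LaurentSeries k) 0 := by
  simpa using HasLead.of_unit (k := k) (1 : Rˣ)

theorem HasLead.prod {ι : Type*} {s : Finset ι} {F : ι → LaurentSeries k} {n : ι → ℤ}
    (h : ∀ i ∈ s, HasLead R (F i) (n i)) : HasLead R (∏ i ∈ s, F i) (∑ i ∈ s, n i) := by
  classical
  induction s using Finset.induction_on with
  | empty => exact HasLead.one
  | insert i s hi ih =>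
    rw [Finset.prod_insert hi, Finset.sum_insert hi]
    exact (h i (Finset.mem_insert_self i s)).mul (ih fun j hj => h j (Finset.mem_insert_of_mem hj))

theorem HasLead.one_sub (s : Bool) {b : k} (hb : b ≠ 0) (h : ∃ c : Rˣ, algebraMap R k c = b) :
    HasLead R (1 - algebraMap k (LaurentSeries k) b * HahnSeries.single (sg s) 1) (if s then 0 else -1) := by
  have h1 : ∀ c : R, (1 : LaurentSeries k) - algebraMap k (LaurentSeries k) (algebraMap R k c) *
      HahnSeries.single 1 1 = HahnSeries.ofPowerSeries ℤ k
        (PowerSeries.map (algebraMap R k) (1 - PowerSeries.C c * PowerSeries.X)) := by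
    intro c
    rw [map_sub, map_sub, map_one (PowerSeries.map _), map_one (HahnSeries.ofPowerSeries ℤ k), map_mul,
      map_mul, PowerSeries.map_C, PowerSeries.map_X, HahnSeries.ofPowerSeries_C,
      HahnSeries.ofPowerSeries_X, algebraMap_laurentSeries]
  obtain ⟨c, rfl⟩ := h
  cases s
  · refine ⟨-c, 1 - PowerSeries.C (c⁻¹ : Rˣ).1 * PowerSeries.X, by simp, ?_⟩
    change (1 : LaurentSeries k) - _ * HahnSeries.single (-1) 1 = _ * HahnSeries.single (-1) 1 * _
    rw [one_sub_single_neg hb, ← h1]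
    have : (algebraMap R k c)⁻¹ = algebraMap R k (c⁻¹ : Rˣ) :=
      inv_eq_of_mul_eq_one_right (by rw [← map_mul, Units.mul_inv, map_one])
    rw [this, Units.val_neg, map_neg, map_neg, map_neg]
  · refine ⟨1, 1 - PowerSeries.C c.1 * PowerSeries.X, by simp, ?_⟩
    change 1 - _ = _ * HahnSeries.single 0 1 * _
    rw [show (HahnSeries.single 0 1 : LaurentSeries k) = 1 from rfl, ← h1, Units.val_one,
      map_one (algebraMap R k), map_one (algebraMap k (LaurentSeries k)), one_mul, one_mul]
    rfl

theorem HasLead.coeff {F : LaurentSeries k} {n : ℤ} (hF : HasLead R F n) (m : ℤ) :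
    ∃ c : R, F.coeff m = algebraMap R k c ∧ (m < n → F.coeff m = 0) ∧
      (m = n → IsUnit c) := by
  obtain ⟨c, H, hH, rfl⟩ := hF
  have h : (algebraMap k (LaurentSeries k) (algebraMap R k c) *
    HahnSeries.single n 1 * HahnSeries.ofPowerSeries ℤ k (PowerSeries.map (algebraMap R k) H)).coeff m =
      algebraMap R k (c * (if 0 ≤ m - n then PowerSeries.coeff (m - n).toNat H else 0)) := by
    rw [mul_assoc, coeff_algebraMap_mul, HahnSeries.coeff_single_mul, one_mul, coeff_ofPowerSeries, map_mul]
    split_ifs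
    · rw [PowerSeries.coeff_map]
    · rw [map_zero]
  refine ⟨_, h, fun hm => ?_, fun hm => ?_⟩
  · rw [h, if_neg (by omega), mul_zero, map_zero]
  · subst hm
    rw [sub_self, if_pos le_rfl, Int.toNat_zero, PowerSeries.coeff_zero_eq_constantCoeff, hH, mul_one]
    exact c.isUnit

end Expansion

end

section

/-! ### The series of Cartan currents -/

section CartanCurrents

variable {I : Type*} [Fintype I] [DecidableEq I] {C : CartanDatum I} (O : DynOrientation C)
  {a : I → ℕ} {N : ℕ} (col : Fin N → I) (z : Fin N → ℂ)

theorem pt_true_zero (v : V a) : pt C true (⟨v, 0⟩ : Slot a) = w v := by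
  rw [pt_eq]
  simp [sg]

theorem pt_false_zero (v : V a) :
    pt C false (⟨v, 0⟩ : Slot a) = algebraMap Fq (K a) (qi C v.1 ^ (2 : ℤ)) * w v := by
  rw [pt_eq]
  simp only [sg]
  norm_cast

theorem prod_colour {M : Type*} [CommMonoid M] (i : I) (f : V a → M) :
    ∏ r : Fin (a i), f ⟨i, r⟩ = ∏ u : V a, if u.1 = i then f u else 1 := by
  rw [prod_V, Finset.prod_eq_single i]
  · exact Finset.prod_congr rfl fun r _ => (if_pos rfl).symm
  · exact fun j _ hj => Finset.prod_eq_one fun r _ => if_neg hj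
  · simp

/-- The numerator of `Z_i` as a polynomial in `y⁻¹`. -/
def zPoly (C : CartanDatum I) (a : I → ℕ) (i : I) : Polynomial (K a) :=
  ∏ s ∈ Finset.univ.filter (fun s => col s = i),
    (1 - Polynomial.C (algebraMap Fq (K a) (qi C i * RatFunc.C (z s))) * Polynomial.X)

open Classical in
/-- The numerator of the factor of `ψ_i` contributed by one variable, as a polynomial in `y⁻¹`. -/
def psiNum (i : I) (u : V a) : Polynomial (K a) :=
  if u.1 = i then Polynomial.C (x u ^ 2)
  else if O.arr u.1 i ∨ O.arr i u.1 then
    Polynomial.C (x u ^ C.c u.1 i) * ∏ p ∈ Finset.Icc 1 (-C.c u.1 i).toNat,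
      (1 - Polynomial.C (w u / algebraMap Fq (K a) (qi C u.1 ^ (-C.c u.1 i - 2 * (p : ℤ)))) * Polynomial.X)
  else 1

/-- The denominator of the factor of `ψ_i` contributed by one variable. -/
def psiDen (C : CartanDatum I) {a : I → ℕ} {E : Type*} [Field E] [Algebra (K a) E] (i : I) (u : V a) (Y : E) : E :=
  if u.1 = i then ∏ s : Bool, (1 - algebraMap (K a) E (pt C s ⟨u, 0⟩) * Y) else 1

variable {E : Type*} [Field E] [Algebra (K a) E]

theorem aeval_zPoly (i : I) (y : E) : Polynomial.aeval y⁻¹ (zPoly col z C a i) = Z col z C a i y := by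
  rw [zPoly, Z, map_prod]
  refine Finset.prod_congr rfl fun s _ => ?_
  rw [map_sub, map_one, map_mul, Polynomial.aeval_C, Polynomial.aeval_X, div_eq_mul_inv]
  rfl

open Classical in
theorem prod_aeval_psiNum (i : I) (y : E) : ∏ u : V a, Polynomial.aeval y⁻¹ (psiNum O i u) =
    algebraMap (K a) E (wAll a i *
      ∏ j ∈ Finset.univ.filter (fun j => O.arr j i ∨ O.arr i j), wHalf C a i j) *
      ∏ j ∈ Finset.univ.filter (fun j => O.arr j i ∨ O.arr i j), Wprod (a := a) C i j y := by
  have hi : ¬ (O.arr i i ∨ O.arr i i) := fun h => h.elim (fun h => O.ne_of_arr h rfl) fun h => O.ne_of_arr h rfl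
  rw [map_mul, map_prod, mul_assoc, ← Finset.prod_mul_distrib, Finset.prod_filter, wAll, prod_V, map_prod]
  have h : ∀ j, (∏ r : Fin (a j), Polynomial.aeval y⁻¹ (psiNum O i ⟨j, r⟩)) =
      (if j = i then ∏ r : Fin (a i), algebraMap (K a) E (w ⟨i, r⟩) else 1) *
      if O.arr j i ∨ O.arr i j then algebraMap (K a) E (wHalf C a i j) * Wprod (a := a) C i j y else 1 := by
    intro j
    by_cases hj : j = i
    · subst hj
      rw [if_pos rfl, if_neg hi, mul_one]
      refine Finset.prod_congr rfl fun r _ => ?_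
      rw [psiNum, if_pos rfl, Polynomial.aeval_C]
      rfl
    · rw [if_neg hj, one_mul]
      split_ifs with h
      · rw [wHalf, Wprod, map_prod]
        simp only [W]
        rw [Finset.prod_comm, ← Finset.prod_mul_distrib]
        refine Finset.prod_congr rfl fun r _ => ?_
        rw [psiNum, if_neg hj, if_pos h, map_mul, Polynomial.aeval_C, map_prod]
        congr 1
        refine Finset.prod_congr rfl fun p _ => ?_
        rw [map_sub, map_one, map_mul, Polynomial.aeval_C, Polynomial.aeval_X, map_div₀, ← div_div,
          div_eq_mul_inv _ y]
        rfl
      · refine Finset.prod_eq_one fun r _ => ?_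
        rw [psiNum, if_neg hj, if_neg h, map_one]
  rw [Finset.prod_congr rfl fun j _ => h j, Finset.prod_mul_distrib, Finset.prod_ite_eq',
    if_pos (Finset.mem_univ _)]

theorem gkloPsi_eq_div (i : I) (y : E) : gkloPsi (a := a) O col z i y =
    Polynomial.aeval y⁻¹ (zPoly col z C a i * ∏ u, psiNum O i u) /
      ∏ j : Fin (a i) × Bool, (1 - algebraMap (K a) E (pt C j.2 ⟨⟨i, j.1⟩, 0⟩) * y⁻¹) := by
  classical
  rw [map_mul, map_prod, aeval_zPoly, prod_aeval_psiNum, gkloPsi, Fintype.prod_prod_type]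
  have h : ∏ r : Fin (a i), ∏ s : Bool, (1 - algebraMap (K a) E (pt C s ⟨⟨i, r⟩, 0⟩) * y⁻¹) =
      W (a := a) i y * W (a := a) i (cst a (qi C i ^ (-2 : ℤ)) * y) := by
    rw [W, W, ← Finset.prod_mul_distrib]
    refine Finset.prod_congr rfl fun r _ => ?_
    rw [Fintype.prod_bool, pt_true_zero, pt_false_zero, div_eq_mul_inv, mul_comm (cst a _) y, ← div_div,
      div_eq_mul_inv _ y, div_eq_mul_inv, cst, ← map_inv₀, ← map_inv₀, ← zpow_neg, neg_neg, map_mul]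
    ring
  rw [h]
  ring

theorem gkloPsi_eq_prod (i : I) (y : E) : gkloPsi (a := a) O col z i y =
    Polynomial.aeval y⁻¹ (zPoly col z C a i) *
      ∏ u : V a, Polynomial.aeval y⁻¹ (psiNum O i u) / psiDen C i u y⁻¹ := by
  rw [gkloPsi_eq_div, map_mul, map_prod, mul_div_assoc, Finset.prod_div_distrib, Fintype.prod_prod_type,
    prod_colour i fun u : V a => ∏ s : Bool, (1 - algebraMap (K a) E (pt C s ⟨u, 0⟩) * y⁻¹)]
  rfl

/-- The current `ψ^±_i`, expanded. -/
def psiSer (s : Bool) (i : I) : LaurentSeries (K a) :=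
  gkloPsi (a := a) O col z i (HahnSeries.single (-sg s) 1)

theorem inv_single_neg {k : Type*} [Field k] (n : ℤ) :
    (HahnSeries.single (-n) 1 : LaurentSeries k)⁻¹ = HahnSeries.single n 1 := by
  rw [inv_single_one, neg_neg]

theorem exists_unit_laurent {F : K a} (h0 : F ≠ 0) (h : F ∈ laurent a) (h' : F⁻¹ ∈ laurent a) :
    ∃ c : (laurent a)ˣ, algebraMap (laurent a) (K a) c = F :=
  ⟨⟨⟨F, h⟩, ⟨F⁻¹, h'⟩, Subtype.ext (mul_inv_cancel₀ h0), Subtype.ext (inv_mul_cancel₀ h0)⟩, rfl⟩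

theorem hasLead_zPoly (hz : ∀ s, z s ≠ 0) (s : Bool) (i : I) :
    HasLead (laurent a) (Polynomial.aeval (HahnSeries.single (sg s) 1 : LaurentSeries (K a)) (zPoly col z C a i))
      (if s then 0 else -((Finset.univ.filter (fun s => col s = i)).card : ℤ)) := by
  rw [zPoly, map_prod]
  have h : (if s then 0 else -((Finset.univ.filter (fun s => col s = i)).card : ℤ)) =
      ∑ t ∈ Finset.univ.filter (fun s => col s = i), if s then 0 else (-1 : ℤ) := by
    cases s <;> simp
  rw [h]
  refine HasLead.prod fun t _ => ?_
  rw [map_sub, map_one, map_mul, Polynomial.aeval_C, Polynomial.aeval_X]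
  have h0 : qi C i * RatFunc.C (z t) ≠ 0 := mul_ne_zero (qi_ne_zero C i) (by simpa using hz t)
  have h1 : algebraMap Fq (K a) (qi C i * RatFunc.C (z t)) ≠ 0 := by
    rw [Ne, FaithfulSMul.algebraMap_eq_zero_iff]
    exact h0
  refine HasLead.one_sub s h1 (exists_unit_laurent h1 (const_mem_laurent _) ?_)
  rw [← map_inv₀]
  exact const_mem_laurent _

theorem hasLead_psiFac (s : Bool) (i : I) (u : V a) :
    HasLead (laurent a) (Polynomial.aeval (HahnSeries.single (sg s) 1 : LaurentSeries (K a)) (psiNum O i u) /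
      psiDen C i u (HahnSeries.single (sg s) 1)) (if s then 0 else C.c u.1 i) := by
  classical
  have hlin : ∀ F : K a, F ≠ 0 → F ∈ laurent a → F⁻¹ ∈ laurent a → HasLead (laurent a)
      (1 - algebraMap (K a) (LaurentSeries (K a)) F * HahnSeries.single (sg s) 1) (if s then 0 else -1) :=
    fun F h0 h h' => HasLead.one_sub s h0 (exists_unit_laurent h0 h h')
  have hcst : ∀ n : ℤ, HasLead (laurent a) (algebraMap (K a) (LaurentSeries (K a)) (x u ^ n)) 0 := by
    intro n
    obtain ⟨c, hc⟩ := exists_unit_laurent (zpow_ne_zero n (x_ne_zero u)) (x_zpow_mem_laurent u n)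
      (by rw [← zpow_neg]; exact x_zpow_mem_laurent u (-n))
    rw [← hc]
    exact HasLead.of_unit c
  by_cases hi : u.1 = i
  · rw [psiNum, if_pos hi, psiDen, if_pos hi, Polynomial.aeval_C]
    have h1 := (hcst 2).div (HasLead.prod (s := Finset.univ) fun (t : Bool) _ =>
      hlin (pt C t ⟨u, 0⟩) (pt_ne_zero C t _) (pt_mem_laurent t _) (pt_inv_mem_laurent t _))
    convert h1 using 1
    · rfl
    · rw [← hi, C.c_diag]
      cases s <;> rfl
  · rw [psiNum, if_neg hi, psiDen, if_neg hi, div_one]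
    have hle := C.c_offDiag u.1 i hi
    by_cases h : O.arr u.1 i ∨ O.arr i u.1
    · rw [if_pos h, map_mul, Polynomial.aeval_C, map_prod]
      have h1 := (hcst (C.c u.1 i)).mul (HasLead.prod (s := Finset.Icc 1 (-C.c u.1 i).toNat) fun p _ =>
        hlin (w u / algebraMap Fq (K a) (qi C u.1 ^ (-C.c u.1 i - 2 * (p : ℤ))))
          (div_ne_zero (w_ne_zero u) (algebraMap_qi_zpow_ne_zero _ _))
          (by
            rw [div_eq_mul_inv, ← map_inv₀]
            exact mul_mem (w_mem_laurent u) (const_mem_laurent _))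
          (by
            rw [inv_div, div_eq_mul_inv]
            exact mul_mem (const_mem_laurent _) (w_inv_mem_laurent u)))
      convert h1 using 1
      · simp only [map_sub, map_one (Polynomial.aeval _), map_mul, Polynomial.aeval_C, Polynomial.aeval_X]
      · rw [Finset.sum_const, Nat.card_Icc, add_tsub_cancel_right, nsmul_eq_mul]
        cases s
        · simp only [Bool.false_eq_true, if_false]
          omega
        · simp
    · have hc : C.c u.1 i = 0 := by
        by_contra hc
        exact h ((O.adj_iff u.1 i hi).1 hc)
      rw [if_neg h, map_one (Polynomial.aeval _), hc, ite_self]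
      exact HasLead.one

theorem hasLead_psiSer (hz : ∀ s, z s ≠ 0) {μ : I → ℤ} (hμ : ∀ i,
    ((Finset.univ.filter (fun s => col s = i)).card : ℤ) - μ i = ∑ j, C.c j i * (a j : ℤ)) (s : Bool) (i : I) :
    HasLead (laurent a) (psiSer O col z (a := a) s i) (if s then 0 else -μ i) := by
  rw [psiSer, gkloPsi_eq_prod, inv_single_neg]
  have h := (hasLead_zPoly (C := C) (a := a) col z hz s i).mul (HasLead.prod (s := Finset.univ)
    fun u _ => hasLead_psiFac O s i u)
  convert h using 1
  cases s
  · have h1 : ∑ u : V a, C.c u.1 i = ∑ j, C.c j i * (a j : ℤ) := by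
      rw [Fintype.sum_sigma]
      refine Finset.sum_congr rfl fun j _ => ?_
      rw [Finset.sum_const (C.c j i), Finset.card_univ, Fintype.card_fin, nsmul_eq_mul, mul_comm]
    simp only [Bool.false_eq_true, if_false, h1, ← hμ i]
    ring
  · simp

/-! ### Shifts of the Cartan currents -/

/-- Shifting one variable. -/
def shiftOne (C : CartanDatum I) (v : V a) (n : ℤ) : K a →ₐ[Fq] K a := shiftHom (Shift.mk C (Pi.single v n))

theorem shiftOne_x (v : V a) (n : ℤ) : shiftOne C v n (x v) = algebraMap Fq (K a) (qi C v.1 ^ n) * x v := by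
  rw [shiftOne, shiftHom_x, Pi.single_eq_same]

theorem shiftOne_x_of_ne {v u : V a} (h : u ≠ v) (n : ℤ) : shiftOne C v n (x u) = x u := by
  rw [shiftOne, shiftHom_x, Pi.single_eq_of_ne h, zpow_zero, map_one, one_mul]

theorem shiftOne_w (v : V a) (n : ℤ) : shiftOne C v n (w v) = algebraMap Fq (K a) (qi C v.1 ^ (2 * n)) * w v := by
  rw [shiftOne, shiftHom_w, Pi.single_eq_same]

theorem shiftOne_w_of_ne {v u : V a} (h : u ≠ v) (n : ℤ) : shiftOne C v n (w u) = w u := by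
  rw [w, map_pow, shiftOne_x_of_ne h]

theorem pt_zero (s : Bool) (v : V a) :
    pt C s (⟨v, 0⟩ : Slot a) = algebraMap Fq (K a) (qi C v.1 ^ (1 - sg s)) * w v := by
  rw [pt_eq]
  simp

theorem shiftOne_shiftOne (v : V a) (m n : ℤ) (F : K a) :
    shiftOne C v m (shiftOne C v n F) = shiftOne C v (m + n) F := by
  rw [shiftOne, shiftOne, shiftOne, shiftHom_apply, shiftHom_apply, shiftHom_apply, ← mul_smul, Pi.single_add]
  rfl

theorem shiftOne_zero (v : V a) (F : K a) : shiftOne C v 0 F = F := by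
  rw [shiftOne, shiftHom_apply, Pi.single_zero]
  exact one_smul _ F

theorem lmap_aeval {k : Type*} [Field k] (σ : k →+* k) (n : ℤ) (p : Polynomial k) :
    lmap σ (Polynomial.aeval (HahnSeries.single n 1 : LaurentSeries k) p) =
      Polynomial.aeval (HahnSeries.single n 1 : LaurentSeries k) (p.map σ) := by
  induction p using Polynomial.induction_on' with
  | add p q hp hq => rw [map_add, map_add, hp, hq, Polynomial.map_add, map_add]
  | monomial m c =>
    rw [Polynomial.aeval_monomial, Polynomial.map_monomial, Polynomial.aeval_monomial, map_mul, map_pow,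
      lmap_single, lmap_algebraMap]

theorem map_zPoly (σ : K a →ₐ[Fq] K a) (i : I) :
    (zPoly col z C a i).map (σ : K a →+* K a) = zPoly col z C a i := by
  rw [zPoly, Polynomial.map_prod]
  refine Finset.prod_congr rfl fun s _ => ?_
  rw [Polynomial.map_sub, Polynomial.map_one, Polynomial.map_mul, Polynomial.map_C, Polynomial.map_X]
  congr 3
  exact σ.commutes _

theorem map_psiNum_of_ne {v u : V a} (h : u ≠ v) (n : ℤ) (i : I) :
    (psiNum O i u).map (shiftOne C v n : K a →+* K a) = psiNum O i u := by
  rw [psiNum]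
  split_ifs
  · rw [Polynomial.map_C, RingHom.coe_coe, map_pow, shiftOne_x_of_ne h]
  · rw [Polynomial.map_mul, Polynomial.map_C, RingHom.coe_coe, map_zpow₀, shiftOne_x_of_ne h,
      Polynomial.map_prod]
    congr 1
    refine Finset.prod_congr rfl fun p _ => ?_
    rw [Polynomial.map_sub, Polynomial.map_one, Polynomial.map_mul, Polynomial.map_C, Polynomial.map_X,
      RingHom.coe_coe, map_div₀, shiftOne_w_of_ne h, AlgHom.commutes]
  · rw [Polynomial.map_one]

theorem prod_Icc_shift {M : Type*} [CommMonoid M] (g : ℕ → M) (n : ℕ) :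
    g 0 * ∏ p ∈ Finset.Icc 1 n, g p = g n * ∏ p ∈ Finset.Icc 1 n, g (p - 1) := by
  induction n with
  | zero => simp
  | succ n ih =>
    rw [Finset.prod_Icc_succ_top (by omega), Finset.prod_Icc_succ_top (by omega), ← mul_assoc, ih,
      add_tsub_cancel_right]
    ac_rfl

theorem psiFac_shift (s : Bool) (i : I) (v : V a) :
    (1 - algebraMap (K a) (LaurentSeries (K a)) (algebraMap Fq (K a) (qi C i ^ C.c i v.1) * w v) *
        HahnSeries.single (sg s) 1) *
      (Polynomial.aeval (HahnSeries.single (sg s) 1 : LaurentSeries (K a)) (psiNum O i v) /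
        psiDen C i v (HahnSeries.single (sg s) 1)) =
    (algebraMap (K a) (LaurentSeries (K a)) (algebraMap Fq (K a) (qi C i ^ C.c i v.1)) -
        algebraMap (K a) (LaurentSeries (K a)) (w v) * HahnSeries.single (sg s) 1) *
      lmap (shiftOne C v (-1) : K a →+* K a)
        (Polynomial.aeval (HahnSeries.single (sg s) 1 : LaurentSeries (K a)) (psiNum O i v) /
        psiDen C i v (HahnSeries.single (sg s) 1)) := by
  have hlin : ∀ n : ℤ, (1 : LaurentSeries (K a)) - algebraMap (K a) (LaurentSeries (K a))
      (algebraMap Fq (K a) (qi C v.1 ^ n) * w v) * HahnSeries.single (sg s) 1 ≠ 0 := fun n =>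
    one_sub_single_ne_zero s (mul_ne_zero (algebraMap_qi_zpow_ne_zero _ _) (w_ne_zero v))
  have hq : algebraMap Fq (K a) (qi C v.1) ≠ 0 := by simpa using algebraMap_qi_zpow_ne_zero (E := K a) v.1 1
  rw [map_div₀, lmap_aeval]
  by_cases hi : v.1 = i
  · subst hi
    rw [psiNum, if_pos rfl, psiDen, if_pos rfl, Fintype.prod_bool, C.c_diag, pt_true_zero, pt_false_zero,
      Polynomial.map_C, Polynomial.aeval_C, Polynomial.aeval_C, map_mul (lmap _), map_sub (lmap _),
      map_sub (lmap _), map_one (lmap _), map_mul (lmap _), map_mul (lmap _), lmap_algebraMap, lmap_algebraMap,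
      lmap_single, RingHom.coe_coe, map_mul (shiftOne C v (-1)), AlgHom.commutes, shiftOne_w, map_pow (shiftOne C v (-1)),
      shiftOne_x]
    have h0 := hlin 0
    have h2 := hlin 2
    have h3 := hlin (-2)
    have e : (2 * -1 : ℤ) = -2 := by norm_num
    rw [e]
    have e1 : algebraMap Fq (K a) (qi C v.1 ^ (2 : ℤ)) * (algebraMap Fq (K a) (qi C v.1 ^ (-2 : ℤ)) * w v) = w v := by
      rw [← mul_assoc, ← map_mul, ← zpow_add₀ (qi_ne_zero C _)]
      simp
    rw [zpow_zero, map_one, one_mul] at h0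
    rw [e1, mul_div_assoc', mul_div_assoc', div_eq_div_iff (mul_ne_zero h0 h2) (mul_ne_zero h3 h0)]
    have e2 : algebraMap (K a) (LaurentSeries (K a)) (algebraMap Fq (K a) (qi C v.1 ^ (2 : ℤ))) *
        algebraMap (K a) (LaurentSeries (K a)) (algebraMap Fq (K a) (qi C v.1 ^ (-2 : ℤ))) = 1 := by
      rw [← map_mul, ← map_mul, ← zpow_add₀ (qi_ne_zero C _)]
      simp
    have e3 : algebraMap (K a) (LaurentSeries (K a)) ((algebraMap Fq (K a) (qi C v.1 ^ (-1 : ℤ)) * x v) ^ 2) =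
        algebraMap (K a) (LaurentSeries (K a)) (algebraMap Fq (K a) (qi C v.1 ^ (-2 : ℤ))) *
          algebraMap (K a) (LaurentSeries (K a)) (x v ^ 2) := by
      rw [mul_pow, map_mul, ← map_pow (algebraMap Fq (K a)), ← zpow_natCast, ← zpow_mul]
      norm_num
    rw [e3, map_mul (algebraMap (K a) (LaurentSeries (K a))), map_mul (algebraMap (K a) (LaurentSeries (K a)))]
    generalize algebraMap (K a) (LaurentSeries (K a)) (algebraMap Fq (K a) (qi C v.1 ^ (2 : ℤ))) = A at *
    generalize algebraMap (K a) (LaurentSeries (K a)) (algebraMap Fq (K a) (qi C v.1 ^ (-2 : ℤ))) = B at *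
    generalize algebraMap (K a) (LaurentSeries (K a)) (x v ^ 2) = X
    generalize algebraMap (K a) (LaurentSeries (K a)) (w v) = W
    generalize (HahnSeries.single (sg s) 1 : LaurentSeries (K a)) = Y
    linear_combination (- X * (1 - A * W * Y) * (1 - W * Y)) * e2
  · rw [psiDen, if_neg hi, map_one (lmap _), div_one, div_one, psiNum, if_neg hi]
    split_ifs with h
    · obtain ⟨n, hn⟩ := Int.eq_ofNat_of_zero_le (neg_nonneg.2 (C.c_offDiag v.1 i hi))
      rw [qi_zpow_c_symm C i v.1, show C.c v.1 i = -(n : ℤ) by omega]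
      have hn' : (- -(n : ℤ)).toNat = n := by omega
      rw [hn']
      set Y : LaurentSeries (K a) := HahnSeries.single (sg s) 1 with hY
      let g : ℕ → LaurentSeries (K a) := fun p =>
        1 - algebraMap (K a) (LaurentSeries (K a)) (algebraMap Fq (K a) (qi C v.1 ^ (2 * (p : ℤ) - n)) * w v) * Y
      have hx : shiftOne C v (-1) (x v ^ (-(n : ℤ))) =
          algebraMap Fq (K a) (qi C v.1 ^ (n : ℤ)) * x v ^ (-(n : ℤ)) := by
        rw [map_zpow₀, shiftOne_x, mul_zpow, ← map_zpow₀, ← zpow_mul]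
        norm_num
      have h1 : ∀ p : ℕ, Polynomial.aeval Y (1 - Polynomial.C (w v / algebraMap Fq (K a)
          (qi C v.1 ^ (- -(n : ℤ) - 2 * (p : ℤ)))) * Polynomial.X) = g p := by
        intro p
        rw [map_sub, map_one (Polynomial.aeval Y), map_mul, Polynomial.aeval_C, Polynomial.aeval_X,
          div_eq_inv_mul, ← map_inv₀, ← zpow_neg]
        simp only [g]
        congr 6
        ring
      have h2 : ∀ p ∈ Finset.Icc 1 n, Polynomial.aeval Y (Polynomial.map (shiftOne C v (-1) : K a →+* K a)
          (1 - Polynomial.C (w v / algebraMap Fq (K a)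
          (qi C v.1 ^ (- -(n : ℤ) - 2 * (p : ℤ)))) * Polynomial.X)) = g (p - 1) := by
        intro p hp
        have hp1 := (Finset.mem_Icc.1 hp).1
        rw [Polynomial.map_sub, Polynomial.map_one, Polynomial.map_mul, Polynomial.map_C, Polynomial.map_X,
          RingHom.coe_coe, div_eq_inv_mul, ← map_inv₀, ← zpow_neg, map_mul (shiftOne C v (-1)), AlgHom.commutes,
          shiftOne_w, ← mul_assoc, ← map_mul, ← zpow_add₀ (qi_ne_zero C _), map_sub,
          map_one (Polynomial.aeval Y), map_mul, Polynomial.aeval_C, Polynomial.aeval_X]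
        simp only [g]
        congr 6
        push_cast [hp1]
        ring
      rw [map_mul (Polynomial.aeval (R := K a) Y), map_prod (Polynomial.aeval (R := K a) Y), Finset.prod_congr rfl fun p _ => h1 p,
        Polynomial.map_mul, Polynomial.map_prod, map_mul (Polynomial.aeval (R := K a) Y),
        map_prod (Polynomial.aeval (R := K a) Y), Finset.prod_congr rfl h2, Polynomial.aeval_C, Polynomial.map_C, Polynomial.aeval_C,
        RingHom.coe_coe, hx]
      have h3 := prod_Icc_shift g n
      have h4 : g 0 = 1 - algebraMap (K a) (LaurentSeries (K a))
          (algebraMap Fq (K a) (qi C v.1 ^ (-(n : ℤ))) * w v) * Y := by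
        simp [g]
      have h5 : g n = algebraMap (K a) (LaurentSeries (K a)) (algebraMap Fq (K a) (qi C v.1 ^ (n : ℤ))) *
          (algebraMap (K a) (LaurentSeries (K a)) (algebraMap Fq (K a) (qi C v.1 ^ (-(n : ℤ)))) -
            algebraMap (K a) (LaurentSeries (K a)) (w v) * Y) := by
        rw [mul_sub, ← map_mul, ← map_mul, ← zpow_add₀ (qi_ne_zero C _), add_neg_cancel, zpow_zero,
          map_one (algebraMap Fq _), map_one (algebraMap (K a) _), ← mul_assoc, ← map_mul]
        simp only [g]
        congr 6
        ring
      rw [← h4, map_mul (algebraMap (K a) _) (algebraMap Fq (K a) (qi C v.1 ^ (n : ℤ)))]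
      rw [h5] at h3
      linear_combination algebraMap (K a) (LaurentSeries (K a)) (x v ^ (-(n : ℤ))) * h3
    · have hc : C.c i v.1 = 0 := by
        by_contra hc
        exact h (((O.adj_iff i v.1 (Ne.symm hi)).1 hc).symm)
      rw [hc, zpow_zero, map_one (algebraMap Fq (K a)), one_mul, map_one (algebraMap (K a) _), Polynomial.map_one]

theorem psiSer_shift (s : Bool) (i : I) (v : V a) :
    (1 - algebraMap (K a) (LaurentSeries (K a)) (algebraMap Fq (K a) (qi C i ^ C.c i v.1) * w v) *
        HahnSeries.single (sg s) 1) * psiSer O col z s i =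
    (algebraMap (K a) (LaurentSeries (K a)) (algebraMap Fq (K a) (qi C i ^ C.c i v.1)) -
        algebraMap (K a) (LaurentSeries (K a)) (w v) * HahnSeries.single (sg s) 1) *
      lmap (shiftOne C v (-1) : K a →+* K a) (psiSer O col z s i) := by
  rw [psiSer, gkloPsi_eq_prod, inv_single_neg, map_mul (lmap _), lmap_aeval, map_zPoly, map_prod,
    ← Finset.mul_prod_erase Finset.univ _ (Finset.mem_univ v),
    ← Finset.mul_prod_erase Finset.univ (fun u => lmap _ _) (Finset.mem_univ v)]
  have h : ∀ u ∈ Finset.univ.erase v, lmap (shiftOne C v (-1) : K a →+* K a)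
      (Polynomial.aeval (HahnSeries.single (sg s) 1 : LaurentSeries (K a)) (psiNum O i u) /
        psiDen C i u (HahnSeries.single (sg s) 1)) =
      Polynomial.aeval (HahnSeries.single (sg s) 1 : LaurentSeries (K a)) (psiNum O i u) /
        psiDen C i u (HahnSeries.single (sg s) 1) := by
    intro u hu
    have hu := (Finset.mem_erase.1 hu).1
    rw [map_div₀, lmap_aeval, map_psiNum_of_ne O hu, psiDen]
    congr 1
    split_ifs
    · rw [map_prod]
      refine Finset.prod_congr rfl fun t _ => ?_
      rw [map_sub, map_one, map_mul, lmap_algebraMap, lmap_single, RingHom.coe_coe, pt_zero, map_mul, AlgHom.commutes,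
        shiftOne_w_of_ne hu]
    · rw [map_one]
  rw [Finset.prod_congr rfl h]
  linear_combination (Polynomial.aeval (HahnSeries.single (sg s) 1 : LaurentSeries (K a)) (zPoly col z C a i) *
    ∏ u ∈ Finset.univ.erase v,
      (Polynomial.aeval (HahnSeries.single (sg s) 1 : LaurentSeries (K a)) (psiNum O i u) /
        psiDen C i u (HahnSeries.single (sg s) 1))) * psiFac_shift O s i v

end CartanCurrents

end

section

/-! ### Relations between difference operators -/

section DifferenceRelations

variable {I : Type*} [Fintype I] [DecidableEq I] {C : CartanDatum I} (O : DynOrientation C)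
  {a : I → ℕ} {N : ℕ} (col : Fin N → I) (z : Fin N → ℂ) (ε : Bool)

theorem mulOp_mul_single (F G : K a) (n : V a → ℤ) :
    mulOp C F * SkewMonoidAlgebra.single (Shift.mk C n) G = SkewMonoidAlgebra.single (Shift.mk C n) (F * G) := by
  rw [mulOp, SkewMonoidAlgebra.single_mul_single, one_mul, one_smul]

theorem single_mul_mulOp (F G : K a) (n : V a → ℤ) :
    SkewMonoidAlgebra.single (Shift.mk C n) F * mulOp C G =
      SkewMonoidAlgebra.single (Shift.mk C n) (F * shiftHom (Shift.mk C n) G) := by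
  rw [mulOp, SkewMonoidAlgebra.single_mul_single, mul_one]
  rfl

theorem single_sub_single (γ : Shift C a) (F G : K a) :
    (SkewMonoidAlgebra.single γ (F - G) : Diff C a) =
      SkewMonoidAlgebra.single γ F - SkewMonoidAlgebra.single γ G := by
  rw [eq_sub_iff_add_eq, ← SkewMonoidAlgebra.single_add, sub_add_cancel]

/-- The coefficient of the shift of `w_v` in the image of a generator. -/
def genC (v : V a) (r : ℤ) : K a := ptE O col z ε v (pt C ε ⟨v, 0⟩) * pt C ε ⟨v, 0⟩ ^ r

theorem gkloE_eq (i : I) (r : ℤ) : gkloE O col z i r = ∑ t : Fin (a i),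
    (SkewMonoidAlgebra.single (Shift.mk C (Pi.single ⟨i, t⟩ (-1))) (genC O col z true ⟨i, t⟩ r) : Diff C a) := by
  rw [← phiLin_xPow_pos, phiLin_xPow]
  exact Finset.sum_congr rfl fun t _ => mulOp_mul_shiftOp _ _

theorem gkloF_eq (i : I) (r : ℤ) : gkloF O i r = ∑ t : Fin (a i),
    (SkewMonoidAlgebra.single (Shift.mk C (Pi.single ⟨i, t⟩ 1)) (genC O col z false ⟨i, t⟩ r) : Diff C a) := by
  rw [← phiLin_xPow_neg O col z, phiLin_xPow]
  exact Finset.sum_congr rfl fun t _ => mulOp_mul_shiftOp _ _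

theorem genC_succ (v : V a) (r : ℤ) : genC O col z ε v (r + 1) = genC O col z ε v r * pt C ε ⟨v, 0⟩ := by
  rw [genC, genC, zpow_add_one₀ (pt_ne_zero C ε _), mul_assoc]

/-- The modes of the Cartan currents. -/
def psiCoef (s : Bool) (i : I) (t : ℤ) : K a := (psiSer O col z s i).coeff (sg s * t)

theorem psiCoef_rel (s : Bool) (i : I) (v : V a) (r : ℤ) :
    psiCoef O col z s i (r + 1) - algebraMap Fq (K a) (qi C i ^ C.c i v.1) * w v * psiCoef O col z s i r =
      algebraMap Fq (K a) (qi C i ^ C.c i v.1) * shiftOne C v (-1) (psiCoef O col z s i (r + 1)) -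
        w v * shiftOne C v (-1) (psiCoef O col z s i r) := by
  have h := congrArg (fun F => HahnSeries.coeff F (sg s * (r + 1))) (psiSer_shift O col z s i v)
  have e : sg s * (r + 1) - sg s = sg s * r := by ring
  simp only [sub_mul, one_mul, mul_assoc, HahnSeries.coeff_sub, coeff_algebraMap_mul,
    HahnSeries.coeff_single_mul, coeff_lmap, e] at h
  rw [mul_assoc]
  exact h

theorem psiCoef_rel' (s : Bool) (i : I) (v : V a) (r : ℤ) :
    shiftOne C v 1 (psiCoef O col z s i (r + 1)) -
        algebraMap Fq (K a) (qi C i ^ C.c i v.1) * pt C false ⟨v, 0⟩ * shiftOne C v 1 (psiCoef O col z s i r) =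
      algebraMap Fq (K a) (qi C i ^ C.c i v.1) * psiCoef O col z s i (r + 1) -
        pt C false ⟨v, 0⟩ * psiCoef O col z s i r := by
  have h := congrArg (shiftOne C v 1) (psiCoef_rel O col z s i v r)
  simp only [map_sub, map_mul, AlgHom.commutes, shiftOne_shiftOne, shiftOne_w, add_neg_cancel, shiftOne_zero,
    mul_one] at h
  rw [pt_false_zero]
  exact h

theorem posQuad_sum {A ι : Type*} [Ring A] [Algebra Fq A] (κ : Fq) (x : ℤ → A) (S : Finset ι) (y : ι → ℤ → A) (r s : ℤ) :
    posQuad κ x (fun t => ∑ v ∈ S, y v t) r s = ∑ v ∈ S, posQuad κ x (y v) r s := by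
  simp only [posQuad, Finset.mul_sum, Finset.sum_mul, Finset.smul_sum, ← Finset.sum_sub_distrib]

theorem negQuad_sum {A ι : Type*} [Ring A] [Algebra Fq A] (κ : Fq) (x : ℤ → A) (S : Finset ι) (y : ι → ℤ → A) (r s : ℤ) :
    negQuad κ x (fun t => ∑ v ∈ S, y v t) r s = ∑ v ∈ S, negQuad κ x (y v) r s := by
  simp only [negQuad, Finset.mul_sum, Finset.sum_mul, Finset.smul_sum, ← Finset.sum_sub_distrib]

theorem posQuad_psi_e (ε' : Bool) (i j : I) (r s : ℤ) :
    posQuad (qi C i ^ C.c i j) (fun t => mulOp C (psiCoef O col z ε' i t)) (gkloE O col z (a := a) j) r s = 0 := by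
  rw [show gkloE O col z (a := a) j = fun s => _ from funext fun s => gkloE_eq O col z j s, posQuad_sum]
  refine Finset.sum_eq_zero fun t _ => ?_
  have h := psiCoef_rel O col z ε' i ⟨j, t⟩ r
  simp only [posQuad, mulOp_mul_single, single_mul_mulOp, smul_single_Fq, ← single_sub_single,
    genC_succ, pt_true_zero]
  refine (congrArg (SkewMonoidAlgebra.single (k := K a) _) ?_).trans (SkewMonoidAlgebra.single_zero (k := K a) _)
  simp only [shiftOne] at h
  simp only [Algebra.smul_def]
  linear_combination genC O col z true ⟨j, t⟩ s * h

theorem negQuad_psi_f (ε' : Bool) (i j : I) (r s : ℤ) :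
    negQuad (qi C i ^ C.c i j) (fun t => mulOp C (psiCoef O col z ε' i t)) (gkloF O (a := a) j) r s = 0 := by
  rw [show gkloF O (a := a) j = fun s => _ from funext fun s => gkloF_eq O col z j s, negQuad_sum]
  refine Finset.sum_eq_zero fun t _ => ?_
  have h := psiCoef_rel' O col z ε' i ⟨j, t⟩ r
  simp only [negQuad, mulOp_mul_single, single_mul_mulOp, smul_single_Fq, ← single_sub_single,
    genC_succ]
  refine (congrArg (SkewMonoidAlgebra.single (k := K a) _) ?_).trans (SkewMonoidAlgebra.single_zero (k := K a) _)
  simp only [shiftOne] at h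
  simp only [Algebra.smul_def]
  linear_combination - genC O col z false ⟨j, t⟩ s * h

/-! ### Commutators of positive and negative generators -/

theorem shiftOne_pt_of_ne {v u : V a} (h : u ≠ v) (n : ℤ) :
    shiftOne C v n (pt C ε ⟨u, 0⟩) = pt C ε ⟨u, 0⟩ := by
  rw [pt_zero, map_mul, AlgHom.commutes, shiftOne_w_of_ne h]

theorem shiftOne_genC_of_ne {v u : V a} (h : u ≠ v) (r n : ℤ) :
    shiftOne C v n (genC O col z ε u r) =
      shiftOne C v n (ptE O col z ε u (pt C ε ⟨u, 0⟩)) * pt C ε ⟨u, 0⟩ ^ r := by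
  rw [genC, map_mul, map_zpow₀, shiftOne_pt_of_ne ε h]

theorem shiftE_single (v : V a) : shiftE C ε (Pi.single v 1) = Shift.mk C (Pi.single v (-sg ε)) := by
  rw [shiftE]
  congr 1
  funext u
  by_cases h : u = v
  · subst h; simp
  · simp [Pi.single_eq_of_ne h]

theorem ptE_mul_hE {v u : V a} (h : u ≠ v) :
    ptE O col z ε u (pt C ε ⟨u, 0⟩) * hE O ε ⟨v, 0⟩ ⟨u, 0⟩ =
      shiftOne C v (-sg ε) (ptE O col z ε u (pt C ε ⟨u, 0⟩)) := by
  have h1 := ptE_shift O col z ε (Pi.single v 1) ⟨u, 0⟩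
  rwa [slots_single, Finset.prod_singleton, slotShift_apply, shiftE_single, Pi.single_eq_of_ne h] at h1

theorem shiftOne_hE {v u : V a} (h : u ≠ v) :
    shiftOne C v 1 (hE O true ⟨v, 0⟩ ⟨u, 0⟩) = shiftOne C u (-1) (hE O false ⟨u, 0⟩ ⟨v, 0⟩) := by
  have hq : ∀ (i : I) (n : ℤ), algebraMap Fq (K a) (qi C i ^ n) ≠ 0 := fun i n => algebraMap_qi_zpow_ne_zero _ _
  have hne : ∀ b c : Fq, b ≠ 0 → algebraMap Fq (K a) b * w u - algebraMap Fq (K a) c * w v ≠ 0 := by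
    intro b c hb e
    exact h (mul_w_eq hb (sub_eq_zero.1 e)).1
  by_cases hc : v.1 = u.1
  · rw [hE_of_colour_eq O true (u := ⟨v, 0⟩) (u' := ⟨u, 0⟩) h.symm hc,
      hE_of_colour_eq O false (u := ⟨u, 0⟩) (u' := ⟨v, 0⟩) h hc.symm]
    simp only [pt_true_zero, pt_false_zero, qE, map_mul, map_div₀, map_sub, AlgHom.commutes, shiftOne_w,
      shiftOne_w_of_ne h, shiftOne_w_of_ne h.symm, sg, hc]
    simp only [if_true, Bool.false_eq_true, if_false, show (2 * 1 : ℤ) = 2 from rfl, show (2 * -1 : ℤ) = -2 from rfl,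
      show (1 * -2 : ℤ) = -2 from rfl, show (-1 * -2 : ℤ) = 2 from rfl, show (-(1 + 1) : ℤ) = -2 from rfl,
      show (-(1 + -1) : ℤ) = 0 from rfl, zpow_zero, map_one, one_mul]
    have hA := hq u.1 2
    have hAB : algebraMap Fq (K a) (qi C u.1 ^ (2 : ℤ)) * algebraMap Fq (K a) (qi C u.1 ^ (-2 : ℤ)) = 1 := by
      rw [← map_mul, ← zpow_add₀ (qi_ne_zero C _)]
      simp
    have h3 : w u - w v ≠ 0 := by simpa using hne 1 1 one_ne_zero
    generalize algebraMap Fq (K a) (qi C u.1 ^ (2 : ℤ)) = A at *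
    generalize algebraMap Fq (K a) (qi C u.1 ^ (-2 : ℤ)) = B at *
    rw [← mul_assoc A B, hAB, ← mul_assoc B A, mul_comm B A, hAB, one_mul, one_mul, ← mul_sub,
      mul_div_assoc', div_eq_div_iff h3 (mul_ne_zero hA (by rwa [← neg_sub, neg_ne_zero]))]
    linear_combination (w u - A * w v) * (w v - w u) * hAB
  by_cases h1 : O.arr u.1 v.1
  · rw [hE_of_arr O true (u := ⟨v, 0⟩) (u' := ⟨u, 0⟩) h1, hE_of_arr O false (u := ⟨u, 0⟩) (u' := ⟨v, 0⟩) h1, map_one, map_one]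
  by_cases h2 : O.arr v.1 u.1
  · rw [hE_of_arr' O true (u := ⟨v, 0⟩) (u' := ⟨u, 0⟩) h2, hE_of_arr' O false (u := ⟨u, 0⟩) (u' := ⟨v, 0⟩) h2]
    simp only [pt_true_zero, pt_false_zero, qE, map_mul, map_div₀, map_sub, AlgHom.commutes, shiftOne_w,
      shiftOne_w_of_ne h, shiftOne_w_of_ne h.symm, sg]
    simp only [if_true, Bool.false_eq_true, if_false, show (2 * 1 : ℤ) = 2 from rfl, show (2 * -1 : ℤ) = -2 from rfl,
      one_mul, neg_mul_neg, qi_zpow_c_symm C u.1 v.1]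
    have hAB : algebraMap Fq (K a) (qi C u.1 ^ (2 : ℤ)) * algebraMap Fq (K a) (qi C u.1 ^ (-2 : ℤ)) = 1 := by
      rw [← map_mul, ← zpow_add₀ (qi_ne_zero C _)]
      simp
    have hPQ : algebraMap Fq (K a) (qi C v.1 ^ (-C.c v.1 u.1)) * algebraMap Fq (K a) (qi C v.1 ^ C.c v.1 u.1) = 1 := by
      rw [← map_mul, ← zpow_add₀ (qi_ne_zero C _)]
      simp
    have h3 := hne 1 (qi C v.1 ^ (-C.c v.1 u.1) * qi C v.1 ^ (2 : ℤ)) one_ne_zero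
    have h4 := hne (qi C v.1 ^ C.c v.1 u.1) (qi C v.1 ^ (2 : ℤ)) (zpow_ne_zero _ (qi_ne_zero C _))
    rw [← neg_ne_zero, neg_sub] at h4
    rw [map_one, one_mul, map_mul, mul_assoc] at h3
    rw [← mul_assoc (algebraMap Fq (K a) (qi C u.1 ^ (2 : ℤ))), hAB, one_mul, div_eq_div_iff h3 h4]
    linear_combination (algebraMap Fq (K a) (qi C v.1 ^ (2 : ℤ)) ^ 2 * w v ^ 2 - w u ^ 2) * hPQ
  · rw [hE_of_not_arr O true (u := ⟨v, 0⟩) (u' := ⟨u, 0⟩) hc h1 h2,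
      hE_of_not_arr O false (u := ⟨u, 0⟩) (u' := ⟨v, 0⟩) (Ne.symm hc) h1 h2, map_one, map_one]

theorem commutator_of_ne {v u : V a} (h : u ≠ v) (r s : ℤ) :
    (SkewMonoidAlgebra.single (Shift.mk C (Pi.single u (-1))) (genC O col z true u r) : Diff C a) *
        SkewMonoidAlgebra.single (Shift.mk C (Pi.single v 1)) (genC O col z false v s) -
      SkewMonoidAlgebra.single (Shift.mk C (Pi.single v 1)) (genC O col z false v s) *
        SkewMonoidAlgebra.single (Shift.mk C (Pi.single u (-1))) (genC O col z true u r) = 0 := by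
  rw [single_mul_single', single_mul_single', add_comm, ← single_sub_single,
    ← SkewMonoidAlgebra.single_zero (Shift.mk C (Pi.single v 1 + Pi.single u (-1)))]
  congr 1
  change genC O col z true u r * shiftOne C u (-1) (genC O col z false v s) -
    genC O col z false v s * shiftOne C v 1 (genC O col z true u r) = 0
  rw [shiftOne_genC_of_ne O col z false h.symm, shiftOne_genC_of_ne O col z true h, genC, genC]
  have h1 := congrArg (shiftOne C v 1) (ptE_mul_hE O col z true h)
  have h2 := congrArg (shiftOne C u (-1)) (ptE_mul_hE O col z false h.symm)
  rw [map_mul, shiftOne_shiftOne, show (1 : ℤ) + -sg true = 0 from rfl, shiftOne_zero] at h1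
  rw [map_mul, shiftOne_shiftOne, show (-1 : ℤ) + -sg false = 0 from rfl, shiftOne_zero, ← shiftOne_hE O h] at h2
  linear_combination
    (-(shiftOne C u (-1) (ptE O col z false v (pt C false ⟨v, 0⟩))) * pt C true ⟨u, 0⟩ ^ r *
        pt C false ⟨v, 0⟩ ^ s) * h1 +
      (shiftOne C v 1 (ptE O col z true u (pt C true ⟨u, 0⟩)) * pt C true ⟨u, 0⟩ ^ r *
        pt C false ⟨v, 0⟩ ^ s) * h2

theorem facE_self (v : V a) (y : K a) : facE O ε v v y = x v ^ (1 + sg ε) := by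
  rw [facE, if_pos rfl, if_pos rfl, mul_one]

theorem shiftOne_facE {v u : V a} (h : u ≠ v) (n : ℤ) (y : K a) :
    shiftOne C v n (facE O ε v u y) = facE O ε v u (shiftOne C v n y) := by
  rw [facE, facE]
  split_ifs
  · rw [map_mul, map_zpow₀, shiftOne_x_of_ne h, map_inv₀, map_sub, map_one, map_div₀, shiftOne_pt_of_ne ε h]
  · rw [map_mul, map_zpow₀, shiftOne_x_of_ne h, map_prod]
    congr 1
    refine Finset.prod_congr rfl fun p _ => ?_
    rw [map_sub, map_one, map_div₀, shiftOne_w_of_ne h, map_mul, AlgHom.commutes]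
  · rw [map_one]

theorem shiftOne_ptE (v : V a) (n : ℤ) (y : K a) : shiftOne C v n (ptE O col z ε v y) =
    algebraMap Fq (K a) (qi C v.1 ^ (n * (1 + sg ε))) * ptE O col z ε v (shiftOne C v n y) := by
  rw [ptE_eq, ptE_eq, map_mul, map_mul, AlgHom.commutes, map_prod,
    ← Finset.mul_prod_erase Finset.univ _ (Finset.mem_univ v),
    ← Finset.mul_prod_erase Finset.univ (fun t => facE O ε v t _) (Finset.mem_univ v), facE_self, facE_self,
    map_zpow₀, shiftOne_x, mul_zpow, ← map_zpow₀, ← zpow_mul,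
    Finset.prod_congr rfl fun u hu => shiftOne_facE O ε (Finset.mem_erase.1 hu).1 n y]
  have h : shiftOne C v n (if ε then Z col z C a v.1 y else 1) =
      if ε then Z col z C a v.1 (shiftOne C v n y) else 1 := by
    split_ifs
    · rw [map_Z]
    · rw [map_one]
  rw [h]
  ring

/-- The product of the positive and negative coefficients. -/
def diagC (v : V a) (y : K a) : K a := ptE O col z true v y * ptE O col z false v y

theorem commutator_self (v : V a) (r s : ℤ) :
    (SkewMonoidAlgebra.single (Shift.mk C (Pi.single v (-1))) (genC O col z true v r) : Diff C a) *
        SkewMonoidAlgebra.single (Shift.mk C (Pi.single v 1)) (genC O col z false v s) -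
      SkewMonoidAlgebra.single (Shift.mk C (Pi.single v 1)) (genC O col z false v s) *
        SkewMonoidAlgebra.single (Shift.mk C (Pi.single v (-1))) (genC O col z true v r) =
      mulOp C (∑ t : Bool, (if t then 1 else -algebraMap Fq (K a) (qi C v.1 ^ 2)) *
        diagC O col z v (pt C t ⟨v, 0⟩) * pt C t ⟨v, 0⟩ ^ (r + s)) := by
  rw [single_mul_single', single_mul_single', add_comm, ← single_sub_single, ← Pi.single_add,
    add_neg_cancel, Pi.single_zero]
  change _ = SkewMonoidAlgebra.single (Shift.mk C 0) _
  congr 1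
  change genC O col z true v r * shiftOne C v (-1) (genC O col z false v s) -
    genC O col z false v s * shiftOne C v 1 (genC O col z true v r) = _
  have e1 : shiftOne C v (-1) (pt C false ⟨v, 0⟩) = pt C true ⟨v, 0⟩ := by
    rw [pt_true_zero, pt_false_zero, map_mul, AlgHom.commutes, shiftOne_w, ← mul_assoc, ← map_mul,
      ← zpow_add₀ (qi_ne_zero C _)]
    simp
  have e2 : shiftOne C v 1 (pt C true ⟨v, 0⟩) = pt C false ⟨v, 0⟩ := by
    rw [pt_true_zero, pt_false_zero, shiftOne_w, mul_one]
  rw [Fintype.sum_bool, genC, genC, map_mul, map_mul, map_zpow₀, map_zpow₀, shiftOne_ptE, shiftOne_ptE, e1, e2,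
    zpow_add₀ (pt_ne_zero C true _), zpow_add₀ (pt_ne_zero C false _), diagC, diagC]
  simp only [sg, if_true, Bool.false_eq_true, if_false]
  norm_num
  norm_cast
  ring

end DifferenceRelations

end

section

/-! ### The GKLO homomorphism -/

section GKLO

variable {I : Type*} [Fintype I] [DecidableEq I] {C : CartanDatum I} (O : DynOrientation C)
  {a : I → ℕ} {N : ℕ} (col : Fin N → I) (z : Fin N → ℂ)

/-- The poles of `ψ_i`. -/
def psiPole (C : CartanDatum I) (a : I → ℕ) (i : I) (p : Fin (a i) × Bool) : K a := pt C p.2 ⟨⟨i, p.1⟩, 0⟩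

theorem psiPole_injective (i : I) : Function.Injective (psiPole C a i) := by
  rintro ⟨t, s⟩ ⟨t', s'⟩ h
  simp only [psiPole, pt_zero] at h
  obtain ⟨h1, h2⟩ := mul_w_eq (zpow_ne_zero _ (qi_ne_zero C i)) h
  have h3 : t = t' := by simpa using h1
  have h4 := qi_zpow_injective C i h2
  have h5 : s = s' := by cases s <;> cases s' <;> simp_all [sg]
  rw [h3, h5]

theorem one_sub_div_ne_zero {v u : V a} (h : u ≠ v) (s s' : Bool) :
    1 - pt C s ⟨u, 0⟩ / pt C s' ⟨v, 0⟩ ≠ 0 := by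
  rw [sub_ne_zero, ne_comm, Ne, div_eq_one_iff_eq (pt_ne_zero C s' _), pt_zero, pt_zero]
  exact fun e => h (mul_w_eq (zpow_ne_zero _ (qi_ne_zero C _)) e).1

theorem eval_psiNum (i : I) {v u : V a} (hv : v.1 = i) (h : u ≠ v) {s : Bool} {y : K a}
    (hy : y = pt C s ⟨v, 0⟩) :
    (psiNum O i u).eval y⁻¹ = (facE O true v u y * facE O false v u y) *
      if u.1 = i then ∏ s : Bool, (1 - pt C s ⟨u, 0⟩ / y) else 1 := by
  subst hv
  by_cases hi : u.1 = v.1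
  · rw [psiNum, if_pos hi, if_pos hi, facE, if_pos hi, if_neg h, facE, if_pos hi, if_neg h, Fintype.prod_bool,
      Polynomial.eval_C]
    have h1 := one_sub_div_ne_zero (C := C) h true s
    have h2 := one_sub_div_ne_zero (C := C) h false s
    rw [← hy] at h1 h2
    rw [show (1 + sg true : ℤ) = (2 : ℕ) from rfl, show (1 + sg false : ℤ) = 0 from rfl, zpow_natCast, zpow_zero]
    field_simp
  · rw [psiNum, if_neg hi, if_neg hi, facE, if_neg hi, facE, if_neg hi, mul_one]
    have hE : ∀ {c : K a} {n : ℕ}, (Polynomial.C c * ∏ p ∈ Finset.Icc 1 n, (1 - Polynomial.C (w u /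
        algebraMap Fq (K a) (qi C u.1 ^ (-C.c u.1 v.1 - 2 * (p : ℤ)))) * Polynomial.X)).eval y⁻¹ =
        c * ∏ p ∈ Finset.Icc 1 n,
          (1 - w u / (algebraMap Fq (K a) (qi C u.1 ^ (-C.c u.1 v.1 - 2 * (p : ℤ))) * y)) := by
      intro c n
      simp only [Polynomial.eval_mul, Polynomial.eval_C, Polynomial.eval_prod, Polynomial.eval_sub,
        Polynomial.eval_one, Polynomial.eval_X, ← div_div, div_eq_mul_inv _ y]
    have e1 : arrE O true u.1 v.1 ↔ O.arr u.1 v.1 := Iff.rfl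
    have e2 : arrE O false u.1 v.1 ↔ O.arr v.1 u.1 := Iff.rfl
    rw [e1, e2]
    by_cases h1 : O.arr u.1 v.1
    · have h2 := O.asymm _ _ h1
      rw [if_pos (Or.inl h1), if_pos h1, if_neg h2, mul_one, hE]
    · by_cases h2 : O.arr v.1 u.1
      · rw [if_pos (Or.inr h2), if_neg h1, if_pos h2, one_mul, hE]
      · rw [if_neg (not_or.2 ⟨h1, h2⟩), if_neg h1, if_neg h2, Polynomial.eval_one, one_mul]

theorem ptE_eq_erase (ε : Bool) (v : V a) (y : K a) : ptE O col z ε v y =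
    algebraMap Fq (K a) (conE C ε v.1) * (if ε then Z col z C a v.1 y else 1) *
      (x v ^ (1 + sg ε) * ∏ u ∈ Finset.univ.erase v, facE O ε v u y) := by
  rw [ptE_eq, ← Finset.mul_prod_erase Finset.univ _ (Finset.mem_univ v), facE_self]

theorem diagC_eq (v : V a) (y : K a) : diagC O col z v y =
    algebraMap Fq (K a) (conE C true v.1 * conE C false v.1) * (Z col z C a v.1 y * x v ^ 2 *
      ∏ u ∈ Finset.univ.erase v, facE O true v u y * facE O false v u y) := by
  rw [diagC, ptE_eq_erase, ptE_eq_erase, Finset.prod_mul_distrib, map_mul, if_pos rfl, if_neg (by simp)]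
  rw [show (1 + sg true : ℤ) = (2 : ℕ) from rfl, show (1 + sg false : ℤ) = 0 from rfl, zpow_natCast, zpow_zero]
  ring

theorem residue_eq (i : I) (t : Fin (a i)) (s : Bool) :
    (zPoly col z C a i * ∏ u, psiNum O i u).eval (psiPole C a i (t, s))⁻¹ /
        ∏ p ∈ Finset.univ.erase (t, s), (1 - psiPole C a i p / psiPole C a i (t, s)) =
      algebraMap Fq (K a) (qi C i - (qi C i)⁻¹) *
        ((if s then 1 else -algebraMap Fq (K a) (qi C i ^ 2)) * diagC O col z ⟨i, t⟩ (pt C s ⟨⟨i, t⟩, 0⟩)) := by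
  set v : V a := ⟨i, t⟩ with hv
  set y : K a := pt C s ⟨v, 0⟩ with hy
  have hpole : psiPole C a i (t, s) = y := rfl
  have hnum : (zPoly col z C a i * ∏ u, psiNum O i u).eval y⁻¹ = Z col z C a i y * x v ^ 2 *
      (∏ u ∈ Finset.univ.erase v, facE O true v u y * facE O false v u y) *
      ∏ u ∈ Finset.univ.erase v, if u.1 = i then ∏ s : Bool, (1 - pt C s ⟨u, 0⟩ / y) else 1 := by
    rw [Polynomial.eval_mul, ← Polynomial.coe_aeval_eq_eval, aeval_zPoly, Polynomial.coe_aeval_eq_eval, Polynomial.eval_prod,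
      ← Finset.mul_prod_erase Finset.univ _ (Finset.mem_univ v), psiNum, if_pos rfl, Polynomial.eval_C,
      mul_assoc (_ * _), ← Finset.prod_mul_distrib, mul_assoc]
    congr 2
    exact Finset.prod_congr rfl fun u hu => eval_psiNum O i rfl (Finset.mem_erase.1 hu).1 hy
  have hden : ∏ p ∈ Finset.univ.erase (t, s), (1 - psiPole C a i p / y) =
      (1 - pt C (!s) ⟨v, 0⟩ / y) *
        ∏ u ∈ Finset.univ.erase v, if u.1 = i then ∏ s : Bool, (1 - pt C s ⟨u, 0⟩ / y) else 1 := by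
    let G : V a → Bool → K a := fun u b => if u = v ∧ b = s then 1 else 1 - pt C b ⟨u, 0⟩ / y
    have h1 : ∏ p ∈ Finset.univ.erase (t, s), (1 - psiPole C a i p / y) =
        ∏ p : Fin (a i) × Bool, G ⟨i, p.1⟩ p.2 := by
      rw [← Finset.prod_erase Finset.univ (a := (t, s)) (by simp [G, hv])]
      refine Finset.prod_congr rfl fun p hp => ?_
      have hp' : ¬ ((⟨i, p.1⟩ : V a) = v ∧ p.2 = s) := by
        rintro ⟨e1, e2⟩
        exact (Finset.mem_erase.1 hp).1 (Prod.ext (by simpa [hv] using e1) e2)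
      simp only [G, if_neg hp']
      rfl
    rw [h1, Fintype.prod_prod_type, prod_colour i fun u => ∏ b, G u b,
      ← Finset.mul_prod_erase Finset.univ _ (Finset.mem_univ v), if_pos rfl]
    congr 1
    · rw [Fintype.prod_bool]
      cases s <;> simp [G]
    · refine Finset.prod_congr rfl fun u hu => ?_
      have hu' := (Finset.mem_erase.1 hu).1
      simp [G, hu']
  have hne : (∏ u ∈ Finset.univ.erase v, if u.1 = i then ∏ s : Bool, (1 - pt C s ⟨u, 0⟩ / y) else 1) ≠ 0 := by
    refine Finset.prod_ne_zero_iff.2 fun u hu => ?_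
    split_ifs
    · exact Finset.prod_ne_zero_iff.2 fun s' _ => one_sub_div_ne_zero (Finset.mem_erase.1 hu).1 s' s
    · exact one_ne_zero
  rw [hpole, hnum, hden, mul_div_mul_right _ _ hne, diagC_eq]
  have hb : pt C (!s) ⟨v, 0⟩ / y = algebraMap Fq (K a) (qi C i ^ (2 * sg s)) := by
    rw [hy, div_eq_iff (pt_ne_zero C s _), pt_zero, pt_zero, ← mul_assoc, ← map_mul, ← zpow_add₀ (qi_ne_zero C _)]
    congr 3
    cases s <;> rfl
  have hc : (1 - qi C i ^ (2 * sg s))⁻¹ = (qi C i - (qi C i)⁻¹) * ((if s then 1 else -qi C i ^ 2) *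
      (conE C true i * conE C false i)) := by
    have h1 := qi_sub_inv_ne_zero (C := C) i
    have h2 := qi_ne_zero C i
    have h3 : 1 - qi C i ^ 2 ≠ 0 := fun e => h1 (by
      field_simp
      linear_combination -e)
    simp only [conE, if_true, Bool.false_eq_true, if_false]
    rw [mul_left_comm, ← mul_assoc (qi C i - _), mul_one_div_cancel h1, one_mul]
    cases s
    · have h4 : 1 - (qi C i ^ 2)⁻¹ ≠ 0 := by
        intro e
        apply h3
        field_simp at e
        linear_combination -e
      rw [show 2 * sg false = -(2 : ℕ) from rfl, zpow_neg, zpow_natCast, inv_eq_iff_eq_inv]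
      simp only [Bool.false_eq_true, if_false]
      field_simp
      ring
    · rw [show 2 * sg true = (2 : ℕ) from rfl, zpow_natCast]
      simp
  have hs : (if s then 1 else -algebraMap Fq (K a) (qi C i ^ 2)) =
      algebraMap Fq (K a) (if s then 1 else -qi C i ^ 2) := by
    split_ifs <;> simp
  rw [hs, hb, div_eq_mul_inv, ← map_one (algebraMap Fq (K a)), ← map_sub, ← map_inv₀, hc, map_mul, map_mul]
  ring

theorem psiCoef_sub (i : I) (t : ℤ) : psiCoef O col z true i t - psiCoef O col z false i t =
    ∑ r : Fin (a i), ∑ s : Bool, algebraMap Fq (K a) (qi C i - (qi C i)⁻¹) *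
        ((if s then 1 else -algebraMap Fq (K a) (qi C i ^ 2)) * diagC O col z ⟨i, r⟩ (pt C s ⟨⟨i, r⟩, 0⟩)) *
          pt C s ⟨⟨i, r⟩, 0⟩ ^ t := by
  have h := coeff_expansion_sub (zPoly col z C a i * ∏ u, psiNum O i u) (psiPole_injective (C := C) (a := a) i)
    (fun p => pt_ne_zero C p.2 _) (fun s => psiSer O col z s i)
    (fun s => by rw [psiSer, gkloPsi_eq_div, inv_single_neg]; rfl) t
  rw [psiCoef, psiCoef, show sg true * t = t by simp [sg], show sg false * t = -t by simp [sg], h,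
    Fintype.sum_prod_type]
  refine Finset.sum_congr rfl fun r _ => Finset.sum_congr rfl fun s _ => ?_
  rw [residue_eq]
  rfl

theorem gklo_ef_of_ne {i j : I} (h : i ≠ j) (r s : ℤ) :
    gkloE O col z (a := a) i r * gkloF O j s - gkloF O j s * gkloE O col z i r = 0 := by
  rw [gkloE_eq, gkloF_eq O col z, Finset.sum_mul_sum, Finset.sum_mul_sum, Finset.sum_comm, ← Finset.sum_sub_distrib]
  refine Finset.sum_eq_zero fun t _ => ?_
  rw [← Finset.sum_sub_distrib]
  exact Finset.sum_eq_zero fun t' _ => commutator_of_ne O col z (fun e => h (congrArg Sigma.fst e)) r s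

theorem gklo_ef_same (i : I) (r s : ℤ) :
    gkloE O col z (a := a) i r * gkloF O i s - gkloF O i s * gkloE O col z i r =
      (qi C i - (qi C i)⁻¹)⁻¹ • (mulOp C (psiCoef O col z true i (r + s)) -
        mulOp C (psiCoef O col z false i (r + s))) := by
  rw [gkloE_eq, gkloF_eq O col z, Finset.sum_mul_sum, Finset.sum_mul_sum, Finset.sum_comm (s := Finset.univ) (t := Finset.univ)
      (f := fun t t' => SkewMonoidAlgebra.single (Shift.mk C (Pi.single ⟨i, t⟩ 1)) (genC O col z false ⟨i, t⟩ s) * _),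
    ← Finset.sum_sub_distrib]
  have h1 : ∀ t : Fin (a i), (∑ t' : Fin (a i),
      (SkewMonoidAlgebra.single (Shift.mk C (Pi.single ⟨i, t⟩ (-1))) (genC O col z true ⟨i, t⟩ r) : Diff C a) *
        SkewMonoidAlgebra.single (Shift.mk C (Pi.single ⟨i, t'⟩ 1)) (genC O col z false ⟨i, t'⟩ s)) -
      ∑ t' : Fin (a i), SkewMonoidAlgebra.single (Shift.mk C (Pi.single ⟨i, t'⟩ 1)) (genC O col z false ⟨i, t'⟩ s) *
        SkewMonoidAlgebra.single (Shift.mk C (Pi.single ⟨i, t⟩ (-1))) (genC O col z true ⟨i, t⟩ r) =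
      mulOp C (∑ b : Bool, (if b then 1 else -algebraMap Fq (K a) (qi C i ^ 2)) *
        diagC O col z ⟨i, t⟩ (pt C b ⟨⟨i, t⟩, 0⟩) * pt C b ⟨⟨i, t⟩, 0⟩ ^ (r + s)) := by
    intro t
    rw [← Finset.sum_sub_distrib, Finset.sum_eq_single t, commutator_self]
    · intro t' _ h
      exact commutator_of_ne O col z (fun e => h (by simpa using e.symm)) r s
    · simp
  rw [Finset.sum_congr rfl fun t _ => h1 t]
  simp only [← mulHom_apply, ← map_sum, ← map_sub, ← map_smul]
  congr 1
  rw [psiCoef_sub, Finset.smul_sum]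
  refine Finset.sum_congr rfl fun t _ => ?_
  rw [Finset.smul_sum]
  refine Finset.sum_congr rfl fun b _ => ?_
  rw [Algebra.smul_def, ← mul_assoc, ← mul_assoc, ← map_mul, inv_mul_cancel₀ (qi_sub_inv_ne_zero i), map_one, one_mul]

end GKLO

end

section

section Homomorphism

variable {I : Type*} [Fintype I] [DecidableEq I] {C : CartanDatum I} (O : DynOrientation C)
  {a : I → ℕ} {N : ℕ} (col : Fin N → I) (z : Fin N → ℂ) (μ : I → ℤ)

/-- The degree of the `n`-th mode of `ψ^s_i`, counted from the leading one. -/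
def psiIndex (s : Bool) (i : I) (n : ℕ) : ℤ := if s then n else μ i - n

/-- The images of the generators under the GKLO homomorphism. -/
def gkloGen : UGen I → Diff C a
  | .e i r => gkloE O col z i r
  | .f i r => gkloF O i r
  | .psi s i n => mulOp C (psiCoef O col z s i (psiIndex μ s i n))
  | .psiInv s i => mulOp C (psiCoef O col z s i (psiIndex μ s i 0))⁻¹

/-- The extension of the GKLO homomorphism to the free algebra. -/
def gkloFree : FreeAlgebra Fq (UGen I) →ₐ[Fq] Diff C a := FreeAlgebra.lift Fq (gkloGen O col z μ)

theorem gkloFree_fe (i : I) (r : ℤ) : gkloFree O col z (a := a) μ (fe i r) = gkloE O col z i r :=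
  FreeAlgebra.lift_ι_apply _ _

theorem gkloFree_ff (i : I) (r : ℤ) : gkloFree O col z (a := a) μ (ff i r) = gkloF O i r :=
  FreeAlgebra.lift_ι_apply _ _

theorem gkloFree_fpsi (s : Bool) (i : I) (n : ℕ) : gkloFree O col z (a := a) μ (fpsi s i n) =
    mulOp C (psiCoef O col z s i (psiIndex μ s i n)) := FreeAlgebra.lift_ι_apply _ _

theorem gkloFree_fpsiInv (s : Bool) (i : I) : gkloFree O col z (a := a) μ (fpsiInv s i) =
    mulOp C (psiCoef O col z s i (psiIndex μ s i 0))⁻¹ := FreeAlgebra.lift_ι_apply _ _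

variable {z μ} (hz : ∀ s, z s ≠ 0) (hμ : ∀ i,
    ((Finset.univ.filter (fun s => col s = i)).card : ℤ) - μ i = ∑ j, C.c j i * (a j : ℤ))

include hz hμ

theorem psiCoef_mem_laurent (s : Bool) (i : I) (t : ℤ) : psiCoef O col z (a := a) s i t ∈ laurent a := by
  obtain ⟨c, hc, -⟩ := (hasLead_psiSer O col z hz hμ s i).coeff (sg s * t)
  rw [psiCoef, hc]
  exact c.2

theorem psiCoef_lead (s : Bool) (i : I) : psiCoef O col z (a := a) s i (psiIndex μ s i 0) ≠ 0 ∧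
    (psiCoef O col z (a := a) s i (psiIndex μ s i 0))⁻¹ ∈ laurent a := by
  obtain ⟨c, hc, -, hu⟩ := (hasLead_psiSer O col z hz hμ s i).coeff (sg s * psiIndex μ s i 0)
  obtain ⟨u, rfl⟩ := hu (by cases s <;> simp [sg, psiIndex])
  have h : algebraMap (laurent a) (K a) u * algebraMap (laurent a) (K a) (u⁻¹ : (laurent a)ˣ) = 1 := by
    rw [← map_mul, Units.mul_inv, map_one]
  rw [psiCoef, hc]
  refine ⟨left_ne_zero_of_mul_eq_one h, ?_⟩
  rw [inv_eq_of_mul_eq_one_right h]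
  exact (u⁻¹ : (laurent a)ˣ).1.2

theorem psiCoef_eq_zero (s : Bool) (i : I) {t : ℤ} (ht : if s then t < 0 else μ i < t) :
    psiCoef O col z (a := a) s i t = 0 := by
  obtain ⟨c, hc, h0, -⟩ := (hasLead_psiSer O col z hz hμ s i).coeff (sg s * t)
  exact h0 (by cases s <;> simp [sg] at ht ⊢ <;> omega)

theorem gkloFree_psiMode (s : Bool) (i : I) (t : ℤ) : gkloFree O col z (a := a) μ (psiMode μ fpsi s i t) =
    mulOp C (psiCoef O col z s i t) := by
  have h0 : mulOp C (0 : K a) = 0 := map_zero (mulHom C a)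
  cases s
  · rw [psiMode]
    split_ifs with h
    · rw [gkloFree_fpsi]
      congr 2
      simp only [psiIndex, Bool.false_eq_true, if_false]
      omega
    · rw [map_zero, psiCoef_eq_zero O col hz hμ false i (by simpa using h), h0]
  · rw [psiMode]
    split_ifs with h
    · rw [gkloFree_fpsi]
      congr 2
      simp only [psiIndex, if_true]
      omega
    · rw [map_zero, psiCoef_eq_zero O col hz hμ true i (by simpa using h), h0]

theorem gkloFree_rel {P Q : FreeAlgebra Fq (UGen I)} (h : URel C μ P Q) :
    gkloFree O col z (a := a) μ P = gkloFree O col z μ Q := by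
  have hpos : ∀ i, (fun r => gkloE O col z (a := a) i r) = fun r =>
      (phiPos O col z (isShuffleAlgebra_bigS O)).comp
        (ShAlg.incl (isShuffleAlgebra_wheelS O) (isShuffleAlgebra_bigS O) (wheelS_le_bigS O))
        (shGen O (isShuffleAlgebra_wheelS O) i r) :=
    fun i => funext fun r => (phiLin_xPow_pos O col z i r).symm
  have hneg : ∀ i, (fun r => gkloF O (a := a) i r) = fun r =>
      (phiNeg O col z (isShuffleAlgebra_bigS O)).comp
        (ShAlg.incl (isShuffleAlgebra_wheelS O) (isShuffleAlgebra_bigS O) (wheelS_le_bigS O)).op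
        (upsNeg O (isShuffleAlgebra_wheelS O) (nf C i r)) :=
    fun i => funext fun r => by
      rw [upsNeg_nf]
      exact (phiLin_xPow_neg O col z i r).symm
  cases h with
  | psi_comm s s' i j m n =>
    rw [map_mul, map_mul, gkloFree_fpsi, gkloFree_fpsi, ← mulHom_apply, ← mulHom_apply, ← map_mul, ← map_mul,
      mul_comm]
  | psi_mul_inv s i =>
    rw [map_mul, map_one, gkloFree_fpsi, gkloFree_fpsiInv, ← mulHom_apply, ← mulHom_apply, ← map_mul,
      mul_inv_cancel₀ (psiCoef_lead O col hz hμ s i).1, map_one]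
  | inv_mul_psi s i =>
    rw [map_mul, map_one, gkloFree_fpsi, gkloFree_fpsiInv, ← mulHom_apply, ← mulHom_apply, ← map_mul,
      inv_mul_cancel₀ (psiCoef_lead O col hz hμ s i).1, map_one]
  | ee i j r s =>
    rw [map_posQuad, map_zero]
    simp only [gkloFree_fe]
    rw [hpos i, hpos j, ← map_posQuad, posQuad_shGen, map_zero]
  | ff i j r s =>
    rw [map_negQuad, map_zero]
    simp only [gkloFree_ff]
    have h1 := RingQuot.mkAlgHom_rel Fq (NegRel.ff (C := C) i j r s)
    rw [map_negQuad, map_zero] at h1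
    rw [hneg i, hneg j, ← map_negQuad, ← map_negQuad, show negQuad _ (nf C i) (nf C j) r s = 0 from h1, map_zero,
      map_zero]
  | psi_e s i j r t =>
    rw [map_posQuad, map_zero]
    simp only [gkloFree_fe, gkloFree_psiMode O col hz hμ]
    exact posQuad_psi_e O col z s i j r t
  | psi_f s i j r t =>
    rw [map_negQuad, map_zero]
    simp only [gkloFree_ff, gkloFree_psiMode O col hz hμ]
    exact negQuad_psi_f O col z s i j r t
  | ef_same i r s =>
    rw [map_sub, map_mul, map_mul, map_smul, map_sub, gkloFree_fe, gkloFree_ff, gkloFree_psiMode O col hz hμ,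
      gkloFree_psiMode O col hz hμ, gklo_ef_same]
  | ef_diff i j h r s =>
    rw [map_sub, map_mul, map_mul, map_zero, gkloFree_fe, gkloFree_ff, gklo_ef_of_ne O col z h]
  | serre_e i j h r s =>
    rw [map_serre, map_zero]
    simp only [gkloFree_fe]
    rw [hpos i, hpos j, ← map_serre, serre_shGen O _ h, map_zero]
  | serre_f i j h r s =>
    rw [map_serre, map_zero]
    simp only [gkloFree_ff]
    have h1 := RingQuot.mkAlgHom_rel Fq (NegRel.serre_f (C := C) i j h r s)
    rw [map_serre, map_zero] at h1
    rw [hneg i, hneg j, ← map_serre, ← map_serre, show serre _ _ (nf C i) (nf C j) r s = 0 from h1, map_zero,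
      map_zero]

theorem gkloFree_mem (P : FreeAlgebra Fq (UGen I)) : gkloFree O col z (a := a) μ P ∈ Atilde C a := by
  induction P using FreeAlgebra.induction with
  | grade0 c => rw [AlgHom.commutes]; exact Subalgebra.algebraMap_mem _ c
  | mul P Q hP hQ => rw [map_mul]; exact mul_mem hP hQ
  | add P Q hP hQ => rw [map_add]; exact add_mem hP hQ
  | grade1 g =>
    rw [gkloFree, FreeAlgebra.lift_ι_apply]
    cases g with
    | e i r =>
      rw [gkloGen, ← phiLin_xPow_pos]
      exact phiLin_mem_Atilde O true col z (xPow_mem_wheelS O i r)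
    | f i r =>
      rw [gkloGen, ← phiLin_xPow_neg O col z]
      exact phiLin_mem_Atilde O false col z (xPow_mem_wheelS O i r)
    | psi s i n =>
      exact mulOp_mem_Atilde (laurent_le_coefRing (psiCoef_mem_laurent O col hz hμ s i _))
    | psiInv s i =>
      exact mulOp_mem_Atilde (laurent_le_coefRing (psiCoef_lead O col hz hμ s i).2)

theorem exists_gklo : ∃ Φ : U C μ →ₐ[Fq] Atilde C a, IsGKLO O col z Φ := by
  let Ψ : U C μ →ₐ[Fq] Diff C a :=
    RingQuot.liftAlgHom Fq ⟨gkloFree O col z μ, fun _ _ h => gkloFree_rel O col hz hμ h⟩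
  have hΨ : ∀ P, Ψ (toU C μ P) = gkloFree O col z μ P := fun P => RingQuot.liftAlgHom_mkAlgHom_apply _ _ _ _
  have hmem : ∀ u, Ψ u ∈ Atilde C a := by
    intro u
    obtain ⟨P, rfl⟩ := RingQuot.mkAlgHom_surjective Fq (URel C μ) u
    rw [hΨ]
    exact gkloFree_mem O col hz hμ P
  refine ⟨Ψ.codRestrict (Atilde C a) hmem, fun i r => ?_, fun i r => ?_, fun i t => ?_, fun i t => ?_⟩
  · exact (hΨ _).trans (gkloFree_fe O col z μ i r)
  · exact (hΨ _).trans (gkloFree_ff O col z μ i r)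
  · refine (hΨ _).trans ((gkloFree_psiMode O col hz hμ true i t).trans ?_)
    rw [psiCoef, show sg true * t = t by simp [sg]]
    rfl
  · refine (hΨ _).trans ((gkloFree_psiMode O col hz hμ false i t).trans ?_)
    rw [psiCoef, show sg false * t = -t by simp [sg]]
    rfl

end Homomorphism

end

section

/-! ### Dominant coweights -/

section Dominant

variable {I : Type*} [Fintype I] [DecidableEq I] (C : CartanDatum I)

theorem CartanDatum.det_ne_zero : (Matrix.of fun i j => (C.d i : ℤ) * C.c i j).det ≠ 0 := by
  intro h
  obtain ⟨v, hv, h0⟩ := Matrix.exists_mulVec_eq_zero_iff.2 h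
  have h1 := C.posDef (fun i => (v i : ℝ)) fun e => hv (funext fun i =>
    Int.cast_eq_zero.1 (congrFun e i))
  have h2 : ∀ i, ∑ j, (C.d i : ℝ) * (C.c i j : ℝ) * v i * v j = 0 := by
    intro i
    have h3 : ∑ j, (C.d i : ℤ) * C.c i j * v j = 0 := congrFun h0 i
    have h4 : ∑ j, (C.d i : ℝ) * (C.c i j : ℝ) * v j = 0 := by exact_mod_cast h3
    rw [← mul_zero (v i : ℝ), ← h4, Finset.mul_sum]
    exact Finset.sum_congr rfl fun j _ => by ring
  simp only [h2, Finset.sum_const_zero, lt_self_iff_false] at h1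

theorem CartanDatum.pos_of_mulVec_pos {u : I → ℝ} (hu : ∀ i, 0 < ∑ j, (C.d i : ℝ) * (C.c i j : ℝ) * u j) (i : I) :
    0 < u i := by
  have hoff : ∀ i j, i ≠ j → (C.d i : ℝ) * (C.c i j : ℝ) ≤ 0 := fun i j h =>
    mul_nonpos_of_nonneg_of_nonpos (Nat.cast_nonneg _) (by exact_mod_cast C.c_offDiag i j h)
  have h0 : ∀ i, 0 ≤ u i := by
    by_contra! hc
    obtain ⟨i₀, hi₀⟩ := hc
    have h1 := C.posDef (fun i => max (-u i) 0) fun e => by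
      have := congrFun e i₀
      simp only [Pi.zero_apply] at this
      have h2 := le_max_left (-u i₀) 0
      linarith
    have h2 : ∀ i, ∑ j, (C.d i : ℝ) * (C.c i j : ℝ) * max (-u i) 0 * max (-u j) 0 ≤ 0 := by
      intro i
      have h3 : ∑ j, (C.d i : ℝ) * (C.c i j : ℝ) * max (-u i) 0 * max (-u j) 0 ≤
          -(max (-u i) 0 * ∑ j, (C.d i : ℝ) * (C.c i j : ℝ) * u j) := by
        rw [Finset.mul_sum, ← Finset.sum_neg_distrib]
        refine Finset.sum_le_sum fun j _ => ?_
        by_cases h : i = j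
        · subst h
          rcases le_total (-u i) 0 with h | h
          · rw [max_eq_right h]; simp
          · rw [max_eq_left h]; exact le_of_eq (by ring)
        · have h4 := mul_le_mul_of_nonpos_left (le_max_left (-u j) 0)
            (mul_nonpos_of_nonpos_of_nonneg (hoff i j h) (le_max_right (-u i) 0))
          linarith
      have h5 := mul_nonneg (le_max_right (-u i) 0) (hu i).le
      linarith
    exact absurd h1 (not_lt.2 (Finset.sum_nonpos fun i _ => h2 i))
  refine lt_of_le_of_ne (h0 i) fun e => absurd (hu i) (not_lt.2 (Finset.sum_nonpos fun j _ => ?_))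
  by_cases h : i = j
  · subst h; rw [← e, mul_zero]
  · exact mul_nonpos_of_nonpos_of_nonneg (hoff i j h) (h0 j)

theorem CartanDatum.exists_dominant : ∃ v : I → ℕ, ∀ i, 1 ≤ v i ∧ 1 ≤ ∑ j, C.c j i * (v j : ℤ) := by
  set B : Matrix I I ℤ := Matrix.of fun i j => (C.d i : ℤ) * C.c i j with hB
  set u : I → ℤ := B.det • B.adjugate.mulVec 1 with hu
  have h1 : ∀ i, ∑ j, (C.d i : ℤ) * C.c i j * u j = B.det ^ 2 := by
    intro i
    have h2 : B.mulVec u = B.det • B.det • 1 := by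
      rw [hu, Matrix.mulVec_smul, Matrix.mulVec_mulVec, Matrix.mul_adjugate, Matrix.smul_mulVec, Matrix.one_mulVec]
    have h3 := congrFun h2 i
    simp only [Pi.smul_apply, Pi.one_apply, smul_eq_mul, mul_one, ← pow_two] at h3
    exact h3
  have hd : 0 < B.det ^ 2 := by
    have := C.det_ne_zero
    positivity
  have hpos : ∀ i, 0 < u i := by
    intro i
    have := C.pos_of_mulVec_pos (u := fun j => (u j : ℝ)) (fun i => by
      have h2 := h1 i
      have h3 : ∑ j, (C.d i : ℝ) * (C.c i j : ℝ) * (u j : ℝ) = ((B.det ^ 2 : ℤ) : ℝ) := by exact_mod_cast h2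
      rw [h3]
      exact_mod_cast hd) i
    exact_mod_cast this
  refine ⟨fun j => C.d j * (u j).toNat, fun i => ⟨?_, ?_⟩⟩
  · have := hpos i
    exact Nat.one_le_iff_ne_zero.2 (mul_ne_zero (C.d_pos i).ne' (by omega))
  · have h2 : ∑ j, C.c j i * ((C.d j * (u j).toNat : ℕ) : ℤ) = B.det ^ 2 := by
      rw [← h1 i]
      refine Finset.sum_congr rfl fun j _ => ?_
      rw [Nat.cast_mul, Int.toNat_of_nonneg (hpos j).le, C.symm i j]
      ring
    rw [h2]
    exact hd

theorem CartanDatum.exists_large (μ : I → ℤ) (n : I → ℕ) : ∃ (a : I → ℕ) (N : ℕ) (col : Fin N → I), n ≤ a ∧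
    ∀ i, ((Finset.univ.filter (fun s => col s = i)).card : ℤ) - μ i = ∑ j, C.c j i * (a j : ℤ) := by
  obtain ⟨v, hv⟩ := C.exists_dominant
  set t : ℕ := ∑ i, n i + ∑ i, (μ i).natAbs with ht
  have hn : ∀ i, n i ≤ t := fun i =>
    (Finset.single_le_sum (fun _ _ => Nat.zero_le _) (Finset.mem_univ i)).trans (Nat.le_add_right _ _)
  have hm : ∀ i, (μ i).natAbs ≤ t := fun i =>
    (Finset.single_le_sum (f := fun i => (μ i).natAbs) (fun _ _ => Nat.zero_le _) (Finset.mem_univ i)).trans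
      (Nat.le_add_left _ _)
  have hs : ∀ i, ∑ j, C.c j i * ((t * v j : ℕ) : ℤ) = t * ∑ j, C.c j i * (v j : ℤ) := by
    intro i
    rw [Finset.mul_sum]
    refine Finset.sum_congr rfl fun j _ => ?_
    push_cast
    ring
  set c : I → ℕ := fun i => (μ i + ∑ j, C.c j i * ((t * v j : ℕ) : ℤ)).toNat with hc
  have hc' : ∀ i, (c i : ℤ) = μ i + ∑ j, C.c j i * ((t * v j : ℕ) : ℤ) := by
    intro i
    rw [hc, Int.toNat_of_nonneg]
    rw [hs]
    have h1 := (hv i).2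
    have h2 : (t : ℤ) ≤ t * ∑ j, C.c j i * (v j : ℤ) := le_mul_of_one_le_right (Int.natCast_nonneg _) h1
    have h3 := hm i
    omega
  let e : V c ≃ Fin (Fintype.card (V c)) := Fintype.equivFin _
  refine ⟨fun i => t * v i, Fintype.card (V c), fun s => (e.symm s).1, fun i => ?_, fun i => ?_⟩
  · exact (hn i).trans (Nat.le_mul_of_pos_right _ (hv i).1)
  · have h1 : (Finset.univ.filter fun s => (e.symm s).1 = i).card = c i := by
      have h2 : (Finset.univ.filter fun s => (e.symm s).1 = i).map e.symm.toEmbedding =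
          (Finset.univ : Finset (Fin (c i))).map (Function.Embedding.sigmaMk (β := fun i => Fin (c i)) i) := by
        ext ⟨j, r⟩
        rw [Finset.mem_map_equiv, Finset.mem_filter, Equiv.symm_symm, Equiv.symm_apply_apply, Finset.mem_map]
        constructor
        · rintro ⟨-, rfl⟩
          exact ⟨r, Finset.mem_univ r, rfl⟩
        · rintro ⟨r', -, h⟩
          exact ⟨Finset.mem_univ _, (congrArg Sigma.fst h).symm⟩
      rw [← Finset.card_map e.symm.toEmbedding, h2, Finset.card_map, Finset.card_univ, Fintype.card_fin]
    rw [h1, hc']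
    ring

end Dominant

/-! ### Factorization through the shifted quantum affine algebra -/

section Factorization

theorem exists_comp_eq {A B D : Type*} [Semiring A] [Semiring B] [Semiring D] [Algebra Fq A] [Algebra Fq B]
    [Algebra Fq D] {f : A →ₐ[Fq] B} (hf : Function.Surjective f) {g : A →ₐ[Fq] D}
    (key : ∀ u u', f u = f u' → g u = g u') :
    ∃ Θ : B →ₐ[Fq] D, Θ.comp f = g := by
  have hs : ∀ b, f (Function.surjInv hf b) = b := Function.surjInv_eq hf
  refine ⟨{
    toFun := fun b => g (Function.surjInv hf b)
    map_one' := ?_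
    map_mul' := ?_
    map_zero' := ?_
    map_add' := ?_
    commutes' := ?_ }, AlgHom.ext fun u => key _ _ (hs _)⟩
  · rw [key _ 1 (by rw [hs, map_one]), map_one]
  · intro b b'
    rw [key _ (Function.surjInv hf b * Function.surjInv hf b') (by rw [hs, map_mul, hs, hs]), map_mul]
  · rw [key _ 0 (by rw [hs, map_zero]), map_zero]
  · intro b b'
    rw [key _ (Function.surjInv hf b + Function.surjInv hf b') (by rw [hs, map_add, hs, hs]), map_add]
  · intro c
    rw [key _ (algebraMap Fq A c) (by rw [hs, AlgHom.commutes]), AlgHom.commutes]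

variable {I : Type*} [Fintype I] [DecidableEq I] {C : CartanDatum I} (O : DynOrientation C)
  {a : I → ℕ} {N : ℕ} (col : Fin N → I) (z : Fin N → ℂ) (μ : I → ℤ)

theorem posToU_pe (i : I) (r : ℤ) : posToU C μ (pe C i r) = UposSub.gen C μ i r := by
  simp [posToU, pe, hgen]

theorem negToU_nf (i : I) (r : ℤ) : negToU C μ (nf C i r) = UnegSub.gen C μ i r := by
  simp [negToU, nf, hgen]

theorem posToU_surjective : Function.Surjective (posToU C μ) := by
  have h : UposSub C μ ≤ ((UposSub C μ).val.comp (posToU C μ)).range := by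
    refine Algebra.adjoin_le ?_
    rintro _ ⟨⟨i, r⟩, rfl⟩
    exact ⟨pe C i r, congrArg Subtype.val (posToU_pe μ i r)⟩
  intro u
  obtain ⟨v, hv⟩ := h u.2
  exact ⟨v, Subtype.ext hv⟩

theorem negToU_surjective : Function.Surjective (negToU C μ) := by
  have h : UnegSub C μ ≤ ((UnegSub C μ).val.comp (negToU C μ)).range := by
    refine Algebra.adjoin_le ?_
    rintro _ ⟨⟨i, r⟩, rfl⟩
    exact ⟨nf C i r, congrArg Subtype.val (negToU_nf μ i r)⟩
  intro u
  obtain ⟨v, hv⟩ := h u.2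
  exact ⟨v, Subtype.ext hv⟩

variable {col z μ} (hS : IsShuffleAlgebra C (wheelS O))

theorem gklo_posToU {Φ : U C μ →ₐ[Fq] Atilde C a} (hΦ : IsGKLO O col z Φ) (u : Upos C) :
    (Φ (posToU C μ u : U C μ) : Diff C a) = phiLin O col z true (upsPos O hS u).val := by
  have h : ((Atilde C a).val.comp Φ).comp ((UposSub C μ).val.comp (posToU C μ)) =
      (phiPos O col z (isShuffleAlgebra_bigS O)).comp
        ((ShAlg.incl hS (isShuffleAlgebra_bigS O) (wheelS_le_bigS O)).comp (upsPos O hS)) := by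
    apply RingQuot.ringQuot_ext'
    apply FreeAlgebra.hom_ext
    funext ⟨i, r⟩
    change (Φ (posToU C μ (pe C i r) : U C μ) : Diff C a) = phiLin O col z true (upsPos O hS (pe C i r)).val
    rw [posToU_pe, upsPos_pe]
    exact (hΦ.1 i r).trans (phiLin_xPow_pos O col z i r).symm
  exact AlgHom.congr_fun h u

theorem gklo_negToU {Φ : U C μ →ₐ[Fq] Atilde C a} (hΦ : IsGKLO O col z Φ) (u : Uneg C) :
    (Φ (negToU C μ u : U C μ) : Diff C a) = phiLin O col z false (upsNeg O hS u).unop.val := by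
  have h : ((Atilde C a).val.comp Φ).comp ((UnegSub C μ).val.comp (negToU C μ)) =
      (phiNeg O col z (isShuffleAlgebra_bigS O)).comp
        ((ShAlg.incl hS (isShuffleAlgebra_bigS O) (wheelS_le_bigS O)).op.comp (upsNeg O hS)) := by
    apply RingQuot.ringQuot_ext'
    apply FreeAlgebra.hom_ext
    funext ⟨i, r⟩
    change (Φ (negToU C μ (nf C i r) : U C μ) : Diff C a) = phiLin O col z false (upsNeg O hS (nf C i r)).unop.val
    rw [negToU_nf, upsNeg_nf]
    exact (hΦ.2.1 i r).trans (phiLin_xPow_neg O col z i r).symm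
  exact AlgHom.congr_fun h u

/-- An element of the shuffle algebra is determined by its images under the homomorphisms for all
numbers of variables compatible with `μ`. -/
theorem eq_zero_of_forall_phiLin (ε : Bool) {F : T I} (hF : F ∈ bigS O)
    (h : ∀ (a : I → ℕ) (N : ℕ) (col : Fin N → I),
      (∀ i, ((Finset.univ.filter (fun s => col s = i)).card : ℤ) - μ i = ∑ j, C.c j i * (a j : ℤ)) →
        phiLin O col 1 ε (a := a) F = 0) : F = 0 := by
  refine DFinsupp.ext fun k => ?_
  obtain ⟨a, N, col, hk, hμ⟩ := C.exists_large μ k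
  exact eq_zero_of_phiLin_eq_zero O col 1 ε hF (h a N col hμ) hk

theorem exists_posToU_factor : ∃ Θ : UposSub C μ →ₐ[Fq] ShAlg hS, Θ.comp (posToU C μ) = upsPos O hS := by
  have h0 : ∀ u, posToU C μ u = 0 → upsPos O hS u = 0 := fun u hu => by
    apply Subtype.ext
    refine eq_zero_of_forall_phiLin (μ := μ) O true (wheelS_le_bigS O (upsPos O hS u).2) fun a N col hμ => ?_
    obtain ⟨Φ, hΦ⟩ := exists_gklo O col (z := 1) (fun _ => one_ne_zero) hμ
    have h := gklo_posToU O hS hΦ u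
    rw [hu, ZeroMemClass.coe_zero, map_zero] at h
    exact h.symm
  refine exists_comp_eq (posToU_surjective μ) fun u u' e => ?_
  rw [← sub_eq_zero, ← map_sub]
  exact h0 _ (by rw [map_sub, e, sub_self])

theorem exists_negToU_factor : ∃ Θ : UnegSub C μ →ₐ[Fq] (ShAlg hS)ᵐᵒᵖ, Θ.comp (negToU C μ) = upsNeg O hS := by
  have h0 : ∀ u, negToU C μ u = 0 → upsNeg O hS u = 0 := fun u hu => by
    apply MulOpposite.unop_injective
    apply Subtype.ext
    refine eq_zero_of_forall_phiLin (μ := μ) O false (wheelS_le_bigS O (upsNeg O hS u).unop.2) fun a N col hμ => ?_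
    obtain ⟨Φ, hΦ⟩ := exists_gklo O col (z := 1) (fun _ => one_ne_zero) hμ
    have h := gklo_negToU O hS hΦ u
    rw [hu, ZeroMemClass.coe_zero, map_zero] at h
    exact h.symm
  refine exists_comp_eq (negToU_surjective μ) fun u u' e => ?_
  rw [← sub_eq_zero, ← map_sub]
  exact h0 _ (by rw [map_sub, e, sub_self])

end Factorization

end

end

end ShuffleGKLO

open ShuffleGKLO

theorem theorem2p6 {I : Type*} [Fintype I] [DecidableEq I] (C : CartanDatum I) (O : DynOrientation C)
    (a : I → ℕ) {N : ℕ} (col : Fin N → I) (z : Fin N → ℂ) (hz : ∀ s, z s ≠ 0) (μ : I → ℤ)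
    (hμ : ∀ i, ((Finset.univ.filter (fun s => col s = i)).card : ℤ) - μ i
      = ∑ j, C.c j i * (a j : ℤ)) :
    -- the shuffle product makes both shuffle spaces into algebras, and the GKLO homomorphism exists
    ∃ (hB : IsShuffleAlgebra C (bigS O)) (hS : IsShuffleAlgebra C (wheelS O))
      (Φt : U C μ →ₐ[Fq] Atilde C a), IsGKLO O col z Φt ∧
      -- part (a)
      (∃ Φ : ShAlg hB →ₐ[Fq] AtildePrime C a,
        (∀ (k : I → ℕ) (E : K k) (hE : E ∈ bigComp O k),
          (Φ (ShAlg.mk hB _ (of_mem_bigS O hE)) : Diff C a) = phiPlus O col z k E) ∧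
        (∀ E : ShAlg hS, (Φ (ShAlg.incl hS hB (wheelS_le_bigS O) E) : Diff C a) ∈ Atilde C a) ∧
        ∃ (Υ : Upos C →ₐ[Fq] ShAlg hS) (Θ : UposSub C μ →ₐ[Fq] ShAlg hS),
          (∀ i r, (Υ (pe C i r)).val = xPow i r) ∧
          Θ.comp (posToU C μ) = Υ ∧
          ∀ u : UposSub C μ,
            (Φ (ShAlg.incl hS hB (wheelS_le_bigS O) (Θ u)) : Diff C a) = Φt (u : U C μ)) ∧
      -- part (b)
      (∃ Φ : (ShAlg hB)ᵐᵒᵖ →ₐ[Fq] AtildePrime C a,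
        (∀ (k : I → ℕ) (F : K k) (hF : F ∈ bigComp O k),
          (Φ (MulOpposite.op (ShAlg.mk hB _ (of_mem_bigS O hF))) : Diff C a) = phiMinus O k F) ∧
        (∀ F : (ShAlg hS)ᵐᵒᵖ,
          (Φ ((ShAlg.incl hS hB (wheelS_le_bigS O)).op F) : Diff C a) ∈ Atilde C a) ∧
        ∃ (Υ : Uneg C →ₐ[Fq] (ShAlg hS)ᵐᵒᵖ) (Θ : UnegSub C μ →ₐ[Fq] (ShAlg hS)ᵐᵒᵖ),
          (∀ i r, (Υ (nf C i r)).unop.val = xPow i r) ∧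
          Θ.comp (negToU C μ) = Υ ∧
          ∀ u : UnegSub C μ,
            (Φ ((ShAlg.incl hS hB (wheelS_le_bigS O)).op (Θ u)) : Diff C a)
              = Φt (u : U C μ)) := by
  obtain ⟨Φt, hΦt⟩ := exists_gklo O col hz hμ
  have hB := isShuffleAlgebra_bigS O
  have hS := isShuffleAlgebra_wheelS O
  obtain ⟨Θ, hΘ⟩ := exists_posToU_factor (μ := μ) O hS
  obtain ⟨Θ', hΘ'⟩ := exists_negToU_factor (μ := μ) O hS
  refine ⟨hB, hS, Φt, hΦt, ⟨(phiPos O col z hB).codRestrict (AtildePrime C a) fun F =>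
      phiLin_mem_AtildePrime O col z true F.2, fun k E hE => ?_, fun E => phiLin_mem_Atilde O true col z E.2,
      upsPos O hS, Θ, fun i r => ?_, hΘ, fun u => ?_⟩,
    ⟨(phiNeg O col z hB).codRestrict (AtildePrime C a) fun F =>
      phiLin_mem_AtildePrime O col z false F.unop.2, fun k F hF => ?_,
      fun F => phiLin_mem_Atilde O false col z F.unop.2, upsNeg O hS, Θ', fun i r => ?_, hΘ', fun u => ?_⟩⟩
  · exact (phiLin_of O col z true hE).trans (phiPlus_eq O col z hE).symm
  · rw [upsPos_pe]
    rfl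
  · obtain ⟨v, rfl⟩ := posToU_surjective μ u
    rw [gklo_posToU O hS hΦt v, ← hΘ]
    rfl
  · exact (phiLin_of O col z false hF).trans (phiMinus_eq O col z hF).symm
  · rw [upsNeg_nf]
    rfl
  · obtain ⟨v, rfl⟩ := negToU_surjective μ u
    rw [gklo_negToU O hS hΦt v, ← hΘ']
    rfl
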